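/- **Setting.** Let $k$ be an algebraically closed field of characteristic $0$, $N$ a free abelian group of rank $n\ge 2$, $M=\mathrm{Hom}(N,\mathbb Z)$, $N_{\mathbb Q}=N\otimes\mathbb Q$, and $\mathbb G(N)=\mathrm{Spec}\,k[M]$. A *tropical curve* $h:\Gamma\to N_{\mathbb R}$ consists of a connected finite graph $\Gamma$ with vertex set $\Gamma^{[0]}\ne\emptyset$, edge set $\Gamma^{[1]}$, positive integral edge weights $w(E)$, some edges being unbounded (with one vertex only), no vertex of valency $1$ or $2$, and a map $h$ that embeds each bounded edge as a segment and each unbounded edge as a ray, of rational slope, maps vertices to $N_{\mathbb Q}$, and is balanced: $\sum_{E\ni V} w(E)u_{(V,E)}=0$ for all vertices $V$, where $u_{(V,E)}\in N$ is the primitive vector pointing from $h(V)$ into $h(E)$. It is *rational* if $\Gamma$ is a tree. Its *degree* $\Delta: N\setminus\{0\}\to\mathbb N$ counts the unbounded edges with $w(E)u_{(V,E)}=v$, and $|\Delta|=\sum_v\Delta(v)$. An $l$-marking is a tuple $\mathbf E=(E_1,\dots,E_l)$ of (not necessarily distinct) edges. An *affine constraint* of codimension $\mathbf d\in\mathbb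 N^l$ is a tuple $\mathbf A=(A_1,\dots,A_l)$ of affine subspaces of $N_{\mathbb Q}$ with $\dim A_i=n-d_i-1$; $L(A_i)$ is the linear space parallel to $A_i$. The marked curve *matches* $\mathbf A$ if $h(E_i)\cap A_i\ne\emptyset$ for all $i$. The constraint is *general* for $\Delta$ if $\sum_i d_i=|\Delta|+n-3$ and every rational $l$-marked tropical curve of degree $\Delta$ matching $\mathbf A$ satisfies: $\Gamma$ is trivalent; $h(\Gamma^{[0]})\cap\bigcup_iA_i=\emptyset$; $h$ is injective if $n>2$, and injective on vertices with finite fibers if $n=2$. A *polyhedral decomposition* $\mathscr P$ of $N_{\mathbb Q}$ is a finite covering by rational polyhedra having at least one vertex, closed under taking faces and such that non-empty intersections of two cells are faces of both; $\mathscr P^{[\mu]}$ is the set of $\mu$-dimensional cells. It is *integral* if all its vertices lie in $N$. For $\Xi\in\mathscr P$ let $C(\Xi)\subset N_{\mathbb Q}\times\mathbb Q$ be the closed cone over $\Xi\times\{1\}$. The faces of these cones form a fan; let $X$ be its toric variety, with big torus $\mathbb G(N\times\mathbb Z)$, and $X_0$ the zero locus of $\chi^{(0,1)}:X\to\mathbb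 A^1$. Then $X_0=\bigcup_{v\in\mathscr P^{[0]}}X_v$ with $X_v$ the toric divisor of the ray $C(v)$, a complete toric variety whose strata are given by the cells containing $v$. A *line* on $X_v$ is a non-constant morphism $\mathbb P^1\to X_v$ whose image is disjoint from the strata of codimension $\ge2$ and not contained in the toric boundary, with at most $3$ points mapped to the toric boundary; it is *divalent* if there are exactly $2$ such points. A *maximally degenerate curve* is (up to isomorphism of the domain over $X_0$) a stable map $\varphi:C\to X_0$ from a connected nodal curve such that for each $v\in\mathscr P^{[0]}$ the part $\varphi^{-1}(X_v)_{\mathrm{red}}\to X_v$ is empty, a line or, for $n=2$, a disjoint union of two divalent lines meeting no common toric prime divisor of $X_v$, and such that each point of $C$ mapped to some $X_v\cap X_{v'}$, $v\neq v'$, is a node of $C$, with branches mapped to two different components of $X_0$ and having equal intersection indices with the toric boundaries there. Its *associated tropical curve* is obtained from the dual intersection graph (a vertex mapped to $v$ for each component mapped to $X_v$; a bounded edge for each node and an unbounded edge for each other point of a component mapped to the toric boundary of $X_v$, mapped onto the one-dimensional cell $\Xi$ whose stratum contains the image point; weights the intersection indices) by merging the two edges at each divalent vertex. **Proposition.** Let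 $\mathbf A$ be an affine constraint of codimension $\mathbf d$ that is general for $\Delta$ and satisfies $\bigcap_iL(A_i)=0$. Let $(\Gamma,\mathbf E,h)$ be a rational $l$-marked tropical curve of degree $\Delta$ matching $\mathbf A$. Choose an orientation of the bounded edges, with $E$ going from $\partial^-E$ to $\partial^+E$; for unbounded $E$ let $\partial^-E$ be its vertex. Write $u_E=u_{(\partial^-E,E)}$. (1) The map $$\mathrm{Map}(\Gamma^{[0]},N)\to\prod_{E\ \mathrm{bounded}}N/\mathbb Zu_E\times\prod_{i=1}^lN/\big((\mathbb Qu_{E_i}+L(A_i))\cap N\big),\quad g\mapsto\big((g(\partial^+E)-g(\partial^-E))_E,(g(\partial^-E_i))_i\big)$$ is an inclusion of lattices of finite index; let $\mathfrak D$ be this index. (2) Let $\mathscr P$ be an integral polyhedral decomposition of $N_{\mathbb Q}$ with $h(\Gamma^{[0]})\subset\mathscr P^{[0]}$, $h(E)\subset\bigcup_{\Xi\in\mathscr P^{[1]}}\Xi$ for all edges $E$, and $h(\Gamma)\cap A_j\subset\mathscr P^{[0]}$ for all $j$. Assume that for every $i$ with $d_i\ge1$ the edge $E_i$ is the only edge of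 $\Gamma$ whose image meets $A_i$, and, if $n=2$, that images of distinct edges meet in finitely many points, no point has more than two preimages under $h$, and $h(V)$ has only the preimage $V$ for each vertex $V$. Let $P_1,\dots,P_l$ be arbitrary closed points of the big torus of $X$, let $LC(A_i)\subset N_{\mathbb Q}\times\mathbb Q$ be the linear span of $A_i\times\{1\}$, and let $Z_i=\overline{\mathbb G(LC(A_i)\cap(N\times\mathbb Z)).P_i}\subset X$. Then the number of isomorphism classes of maximally degenerate curves in $X_0$ with associated tropical curve $(\Gamma,h)$ whose image meets $Z_1,\dots,Z_l$ is $\mathfrak D$. -/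

import Mathlib

open scoped LinearAlgebra.Projectivization

noncomputable section

namespace ToricTropical

/-! ### Tropical curves

Throughout, `V` is a finite-dimensional rational vector space and `N` a lattice in it, that is, `N`
is a free abelian group of rank `dim V` and `V` is `N ⊗ ℚ`. -/

section Tropical

variable {V : Type*} [AddCommGroup V] [Module ℚ V]

/-- Primitive vectors of the lattice `N`; the zero vector is not primitive. -/
def IsPrimitive {N : Submodule ℤ V} (u : N) : Prop :=
  ∀ (a : ℤ) (y : N), u = a • y → IsUnit a

/-- A parameterized tropical curve `h : Γ → N_ℝ`. As every edge is embedded into a line of rational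
slope, it is given by the weighted open graph `Γ`, the images of the vertices and the primitive
direction vectors of the edges. The bounded edges come with an orientation `src → tgt`, which is an
arbitrary auxiliary choice. The one-valent vertices of the compactified graph have been removed, so
no vertex has valency one or two. -/
structure TropicalCurve (N : Submodule ℤ V) where
  /-- vertices -/
  Vert : Type
  /-- bounded edges -/
  BEdge : Type
  /-- unbounded edges -/
  UEdge : Type
  [fintypeVert : Fintype Vert]
  [fintypeBEdge : Fintype BEdge]
  [fintypeUEdge : Fintype UEdge]
  [decEqVert : DecidableEq Vert]
  src : BEdge → Vert
  tgt : BEdge → Vert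
  /-- the unique vertex of an unbounded edge -/
  base : UEdge → Vert
  bweight : BEdge → ℕ
  uweight : UEdge → ℕ
  /-- the images of the vertices -/
  pos : Vert → V
  /-- the primitive vector from the source towards the target -/
  bdir : BEdge → N
  /-- the primitive vector in the direction of an unbounded edge -/
  udir : UEdge → N
  bweight_pos : ∀ b, 0 < bweight b
  uweight_pos : ∀ e, 0 < uweight e
  bdir_primitive : ∀ b, IsPrimitive (bdir b)
  udir_primitive : ∀ e, IsPrimitive (udir e)
  /-- a bounded edge is embedded as the segment between the images of its vertices -/
  length : ∀ b, ∃ t : ℚ, 0 < t ∧ pos (tgt b) - pos (src b) = t • (bdir b : V)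
  nonempty : Nonempty Vert
  connected : ∀ x y : Vert, Relation.EqvGen (fun a c => ∃ b, src b = a ∧ tgt b = c) x y
  valency : ∀ x : Vert,
    (Finset.univ.filter fun b => src b = x).card + (Finset.univ.filter fun b => tgt b = x).card
      + (Finset.univ.filter fun e => base e = x).card ∉ ({1, 2} : Set ℕ)
  balanced : ∀ x : Vert,
    (∑ b ∈ Finset.univ.filter fun b => src b = x, bweight b • bdir b)
      - (∑ b ∈ Finset.univ.filter fun b => tgt b = x, bweight b • bdir b)
      + (∑ e ∈ Finset.univ.filter fun e => base e = x, uweight e • udir e) = 0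

namespace TropicalCurve

attribute [instance] fintypeVert fintypeBEdge fintypeUEdge decEqVert

variable {N : Submodule ℤ V} (Γ : TropicalCurve N)

/-- The edges, bounded or unbounded. -/
abbrev Edge : Type := Γ.BEdge ⊕ Γ.UEdge

/-- The vertex `∂⁻E`: the source of a bounded edge, the only vertex of an unbounded one. -/
def tail : Γ.Edge → Γ.Vert
  | .inl b => Γ.src b
  | .inr e => Γ.base e

/-- The primitive direction vector of an edge, emanating from its tail. -/
def dir : Γ.Edge → N
  | .inl b => Γ.bdir b
  | .inr e => Γ.udir e

def weight : Γ.Edge → ℕ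
  | .inl b => Γ.bweight b
  | .inr e => Γ.uweight e

/-- `x` is a vertex of the edge. -/
def Incident (x : Γ.Vert) : Γ.Edge → Prop
  | .inl b => Γ.src b = x ∨ Γ.tgt b = x
  | .inr e => Γ.base e = x

/-- The set of rational points of the image `h(E)` of a closed edge. -/
def edgeImage : Γ.Edge → Set V
  | .inl b => segment ℚ (Γ.pos (Γ.src b)) (Γ.pos (Γ.tgt b))
  | .inr e => {x | ∃ t : ℚ, 0 ≤ t ∧ x = Γ.pos (Γ.base e) + t • (Γ.udir e : V)}

/-- The image of an open cell of `Γ`: a vertex or the interior of an edge. -/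
def openCell : Γ.Vert ⊕ Γ.Edge → Set V
  | .inl x => {Γ.pos x}
  | .inr (.inl b) => openSegment ℚ (Γ.pos (Γ.src b)) (Γ.pos (Γ.tgt b))
  | .inr (.inr e) => {x | ∃ t : ℚ, 0 < t ∧ x = Γ.pos (Γ.base e) + t • (Γ.udir e : V)}

/-- The fiber `h⁻¹(x)`. As `h` is injective on every open cell, a point of the fiber is given by the
open cell that contains it. (If `h` identifies two points at all, it does so over a rational point,
so it suffices to look at `x` in `N ⊗ ℚ`.) -/
def fiber (x : V) : Set (Γ.Vert ⊕ Γ.Edge) := {c | x ∈ Γ.openCell c}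

/-- Genus zero: the connected graph `Γ` has vanishing first Betti number. -/
def IsRational : Prop := Fintype.card Γ.BEdge + 1 = Fintype.card Γ.Vert

def IsTrivalent : Prop :=
  ∀ x : Γ.Vert,
    (Finset.univ.filter fun b => Γ.src b = x).card
      + (Finset.univ.filter fun b => Γ.tgt b = x).card
      + (Finset.univ.filter fun e => Γ.base e = x).card = 3

/-- `Δ(v)` is the number of unbounded edges whose weighted direction vector is `v`. -/
def HasDegree (Δ : N →₀ ℕ) : Prop :=
  ∀ v : N, Nat.card {e : Γ.UEdge // Γ.uweight e • Γ.udir e = v} = Δ v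

/-- The `l`-marked curve `(Γ, E, h)` matches the affine constraint `A`. -/
def Matches {l : ℕ} (E : Fin l → Γ.Edge) (A : Fin l → AffineSubspace ℚ V) : Prop :=
  ∀ i, (Γ.edgeImage (E i) ∩ A i).Nonempty

/-- `h` has at worst transverse double points: distinct edges do not overlap, no point has more than
two preimages, and the image of a vertex has only one. -/
def IsSimple : Prop :=
  (∀ E E' : Γ.Edge, E ≠ E' → (Γ.edgeImage E ∩ Γ.edgeImage E').Finite) ∧
  (∀ x, (Γ.fiber x).encard ≤ 2) ∧
  (∀ x : Γ.Vert, Γ.fiber (Γ.pos x) = {Sum.inl x})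

end TropicalCurve

/-- An affine constraint of codimension `d`: affine subspaces with `dim A i = n - d i - 1`. -/
def IsAffineConstraint {l : ℕ} (d : Fin l → ℕ) (A : Fin l → AffineSubspace ℚ V) : Prop :=
  ∀ i, (A i : Set V).Nonempty ∧
    Module.finrank ℚ (A i).direction + d i + 1 = Module.finrank ℚ V

/-- The affine constraint `A` of codimension `d` is general for the degree `Δ`. -/
def IsGeneral (N : Submodule ℤ V) (Δ : N →₀ ℕ) {l : ℕ} (d : Fin l → ℕ)
    (A : Fin l → AffineSubspace ℚ V) : Prop :=
  ((∑ i, d i) + 3 = (Δ.sum fun _ c => c) + Module.finrank ℚ V) ∧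
  ∀ (Γ : TropicalCurve N) (E : Fin l → Γ.Edge),
    Γ.IsRational → Γ.HasDegree Δ → Γ.Matches E A →
      Γ.IsTrivalent ∧
      (∀ (x : Γ.Vert) (i : Fin l), Γ.pos x ∉ A i) ∧
      (2 < Module.finrank ℚ V → ∀ x, (Γ.fiber x).Subsingleton) ∧
      (Module.finrank ℚ V = 2 → Function.Injective Γ.pos ∧ ∀ x, (Γ.fiber x).Finite)

namespace TropicalCurve

variable {N : Submodule ℤ V} (Γ : TropicalCurve N)

/-- The sublattice `(ℚ u + L(A)) ∩ N` of `N`. -/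
def incidenceLattice (u : N) (A : AffineSubspace ℚ V) : Submodule ℤ N :=
  ((Submodule.span ℚ {(u : V)} ⊔ A.direction).restrictScalars ℤ).comap N.subtype

/-- The right-hand side of the lattice map: the product of the `N / ℤ u_E` over the bounded edges
and of the `N / ((ℚ u_{E i} + L(A i)) ∩ N)` over the markings. -/
abbrev LatticeTarget {l : ℕ} (E : Fin l → Γ.Edge) (A : Fin l → AffineSubspace ℚ V) : Type _ :=
  (∀ b : Γ.BEdge, N ⧸ Submodule.span ℤ {Γ.bdir b}) ×
    (∀ i : Fin l, N ⧸ incidenceLattice (Γ.dir (E i)) (A i))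

/-- The lattice map `h ↦ ((h(∂⁺E) - h(∂⁻E))_E, (h(∂⁻E i))_i)`. -/
def latticeMap {l : ℕ} (E : Fin l → Γ.Edge) (A : Fin l → AffineSubspace ℚ V) :
    (Γ.Vert → N) →ₗ[ℤ] Γ.LatticeTarget E A :=
  LinearMap.prod
    (LinearMap.pi fun b => (Submodule.span ℤ {Γ.bdir b}).mkQ ∘ₗ
      ((LinearMap.proj (Γ.tgt b) : (Γ.Vert → N) →ₗ[ℤ] N) - LinearMap.proj (Γ.src b)))
    (LinearMap.pi fun i => (incidenceLattice (Γ.dir (E i)) (A i)).mkQ ∘ₗ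
      LinearMap.proj (Γ.tail (E i)))

/-- The index `𝔇` of the image of the lattice map (zero if infinite). -/
def latticeIndex {l : ℕ} (E : Fin l → Γ.Edge) (A : Fin l → AffineSubspace ℚ V) : ℕ :=
  (LinearMap.range (Γ.latticeMap E A)).toAddSubgroup.index

end TropicalCurve

/-! ### Polyhedral decompositions -/

/-- Rational polyhedra: solution sets of finitely many inequalities `⟨m, x⟩ ≥ c`. -/
def IsPolyhedron (S : Set V) : Prop :=
  ∃ T : Finset (Module.Dual ℚ V × ℚ), S = {x | ∀ t ∈ T, t.2 ≤ t.1 x}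

/-- Nonempty faces of a polyhedron (or polyhedral cone): the loci where a linear form that is
bounded below attains its minimum. -/
def IsFace (F S : Set V) : Prop :=
  F.Nonempty ∧ ∃ (m : Module.Dual ℚ V) (c : ℚ), (∀ x ∈ S, c ≤ m x) ∧ F = {x ∈ S | m x = c}

/-- The dimension of a polyhedron, the dimension of the span `L(S)` of differences. -/
def dimension (S : Set V) : ℕ := Module.finrank ℚ (vectorSpan ℚ S)

/-- (Semi-infinite) polyhedral decompositions of `V`. -/
structure IsPolyhedralDecomposition (P : Set (Set V)) : Prop where
  finite : P.Finite
  polyhedron : ∀ S ∈ P, IsPolyhedron S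
  strongly_convex : ∀ S ∈ P, ∃ v, IsFace {v} S
  cover : ⋃₀ P = Set.univ
  face_mem : ∀ S ∈ P, ∀ F, IsFace F S → F ∈ P
  inter_face : ∀ S ∈ P, ∀ T ∈ P, (S ∩ T).Nonempty → IsFace (S ∩ T) S ∧ IsFace (S ∩ T) T

/-- Integrality: all vertices are lattice points. -/
def IsIntegral (N : Submodule ℤ V) (P : Set (Set V)) : Prop := ∀ v, {v} ∈ P → v ∈ N

/-- The decomposition `P` is adapted to the curve `Γ` and to the constraint `A`: vertices are mapped
to vertices of `P`, edges into the union of the one-dimensional cells, and all points of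
`h(Γ) ∩ A j` are vertices of `P`. -/
structure IsAdapted {N : Submodule ℤ V} (P : Set (Set V)) (Γ : TropicalCurve N) {l : ℕ}
    (A : Fin l → AffineSubspace ℚ V) : Prop where
  vert : ∀ x : Γ.Vert, {Γ.pos x} ∈ P
  edge : ∀ E : Γ.Edge, Γ.edgeImage E ⊆ ⋃₀ {S ∈ P | dimension S = 1}
  constraint : ∀ (E : Γ.Edge) (j : Fin l), ∀ x ∈ Γ.edgeImage E, x ∈ A j → {x} ∈ P

/-- The closed cone `C(S)` over `S × {1}`, as the set of all points on which every linear form that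
is nonnegative on `S × {1}` is nonnegative. -/
def coneOver (S : Set V) : Set (V × ℚ) :=
  {y | ∀ f : Module.Dual ℚ (V × ℚ), (∀ x ∈ S, 0 ≤ f (x, 1)) → 0 ≤ f y}

/-- The fan of all faces of the cones over the cells of `P`. -/
def fanOver (P : Set (Set V)) : Set (Set (V × ℚ)) := {σ | ∃ S ∈ P, IsFace σ (coneOver S)}

/-- The lattice `N × ℤ` in `V × ℚ`. -/
def extLattice (N : Submodule ℤ V) : Submodule ℤ (V × ℚ) := N.prod (Submodule.span ℤ {1})

/-- The linear span `LC(A)` of `A × {1}`. -/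
def linCone (A : AffineSubspace ℚ V) : Submodule ℚ (V × ℚ) :=
  Submodule.span ℚ {y | y.1 ∈ A ∧ y.2 = 1}

end Tropical

/-! ### Toric varieties

All schemes that occur are reduced and of finite type over the algebraically closed field `k`, so
they are described by their closed points together with the regular functions on affine charts. -/

section Toric

variable {W : Type*} [AddCommGroup W] [Module ℚ W]

/-- The dual lattice `M` of `Λ`: the linear forms with integral values on `Λ`. -/
def dualLattice (Λ : Submodule ℤ W) : AddSubgroup (Module.Dual ℚ W) where
  carrier := {m | ∀ x ∈ Λ, ∃ z : ℤ, m x = z}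
  zero_mem' := fun _ _ => ⟨0, by simp⟩
  add_mem' := fun {a b} ha hb x hx => by
    obtain ⟨z, hz⟩ := ha x hx
    obtain ⟨z', hz'⟩ := hb x hx
    exact ⟨z + z', by simp [hz, hz']⟩
  neg_mem' := fun {a} ha x hx => by
    obtain ⟨z, hz⟩ := ha x hx
    exact ⟨-z, by simp [hz]⟩

/-- A closed point of the toric variety of the fan `F` with respect to the lattice `Λ`. This variety
is glued from the charts `U_τ = Spec k[τ^∨ ∩ M]`, `τ ∈ F`, and a closed point of `U_τ` is a
homomorphism of monoids from `τ^∨ ∩ M` to `(k, ·)`. Every closed point lies in a smallest chart, that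
of the cone `σ = cone` whose torus orbit contains the point; a homomorphism on `σ^∨ ∩ M` belongs to
this orbit if and only if the monomials that do not vanish at the point are those in `σ^⊥`. Thus
`val m` is the value at the point of the monomial `χ^m` if `m ∈ σ^∨`; for all other `m` it is put to
zero. -/
@[ext]
structure ToricPoint (k : Type*) [Field k] (Λ : Submodule ℤ W) (F : Set (Set W)) where
  cone : Set W
  cone_mem : cone ∈ F
  val : dualLattice Λ → k
  val_zero : val 0 = 1
  val_add : ∀ m m' : dualLattice Λ, (∀ y ∈ cone, 0 ≤ m.1 y) → (∀ y ∈ cone, 0 ≤ m'.1 y) →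
    val (m + m') = val m * val m'
  val_ne_zero : ∀ m : dualLattice Λ, val m ≠ 0 ↔ ∀ y ∈ cone, m.1 y = 0

variable {k : Type*} [Field k] {Λ : Submodule ℤ W} {F : Set (Set W)}

/-- The affine chart `U_τ`. -/
def chart (k : Type*) [Field k] (Λ : Submodule ℤ W) (F : Set (Set W)) (τ : Set W) :
    Set (ToricPoint k Λ F) := {x | IsFace x.cone τ}

/-- The torus orbit of the cone `σ`, that is, the big torus of the toric stratum `X_σ`. -/
def orbit (k : Type*) [Field k] (Λ : Submodule ℤ W) (F : Set (Set W)) (σ : Set W) :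
    Set (ToricPoint k Λ F) := {x | x.cone = σ}

/-- The closed toric stratum `X_σ`: the union of the orbits of all cones having `σ` as a face. -/
def stratum (k : Type*) [Field k] (Λ : Submodule ℤ W) (F : Set (Set W)) (σ : Set W) :
    Set (ToricPoint k Λ F) := {x | IsFace σ x.cone}

/-- The value at a point of a Laurent polynomial, a linear combination of monomials. -/
def evalPoly (f : dualLattice Λ →₀ k) (x : ToricPoint k Λ F) : k := f.sum fun m a => a * x.val m

/-- The Zariski closure of a set of closed points: a point `x` belongs to it if in every chart `U_τ`
around `x` all regular functions vanishing on the part of the set in `U_τ` vanish at `x`. -/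
def zariskiClosure (S : Set (ToricPoint k Λ F)) : Set (ToricPoint k Λ F) :=
  {x | ∀ τ ∈ F, x ∈ chart k Λ F τ → ∀ f : dualLattice Λ →₀ k,
    (∀ m ∈ f.support, ∀ y ∈ τ, 0 ≤ m.1 y) →
    (∀ s ∈ S, s ∈ chart k Λ F τ → evalPoly f s = 0) → evalPoly f x = 0}

/-- The closed points of the torus `𝔾(Λ) = Spec k[M]`. -/
abbrev Torus (k : Type*) [Field k] (Λ : Submodule ℤ W) : Type _ :=
  Multiplicative (dualLattice Λ) →* kˣ

/-- The action of the torus on the toric variety. -/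
def translate (t : Torus k Λ) (x : ToricPoint k Λ F) : ToricPoint k Λ F where
  cone := x.cone
  cone_mem := x.cone_mem
  val m := t (Multiplicative.ofAdd m) * x.val m
  val_zero := by simp [x.val_zero]
  val_add m m' hm hm' := by
    rw [x.val_add m m' hm hm', ofAdd_add, map_mul, Units.val_mul]
    ring
  val_ne_zero m := by
    rw [← x.val_ne_zero m]
    simp

/-- The subtorus `𝔾(L ∩ Λ)` of `𝔾(Λ)` for a linear subspace `L`: the common kernel of all
characters that vanish on `L`. -/
def subtorus (k : Type*) [Field k] (Λ : Submodule ℤ W) (L : Submodule ℚ W) :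
    Subgroup (Torus k Λ) where
  carrier := {t | ∀ m : dualLattice Λ, (∀ y ∈ L, m.1 y = 0) → t (Multiplicative.ofAdd m) = 1}
  one_mem' := fun _ _ => rfl
  mul_mem' := fun {a b} ha hb m hm => by
    rw [MonoidHom.mul_apply, ha m hm, hb m hm, one_mul]
  inv_mem' := fun {a} ha m hm => by
    rw [MonoidHom.inv_apply, ha m hm, inv_one]

/-- The closure of the orbit of the point `x` under the subtorus `𝔾(L ∩ Λ)`. -/
def orbitClosure (L : Submodule ℚ W) (x : ToricPoint k Λ F) : Set (ToricPoint k Λ F) :=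
  zariskiClosure {y | ∃ t ∈ subtorus k Λ L, y = translate t x}

/-! ### Maps from the projective line -/

/-- The closed points of the projective line. -/
abbrev P1 (k : Type*) [Field k] : Type _ := ℙ k (Fin 2 → k)

/-- A homogeneous form evaluated at a representative of the point `q`. Only its vanishing and
quotients of values of forms of the same degree are meaningful, and only these are used. -/
def evalForm (G : MvPolynomial (Fin 2) k) (q : P1 k) : k := MvPolynomial.eval q.rep G

/-- A morphism from the projective line to a toric variety: locally, on some principal open set
`D₊(G)`, it maps to a chart `U_τ` and pulls back the monomials `χ^m`, `m ∈ τ^∨ ∩ M`, to regular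
functions, which on `D₊(G)` are the quotients `H / G ^ r` of degree zero. -/
def IsMorphism (f : P1 k → ToricPoint k Λ F) : Prop :=
  ∀ p, ∃ τ ∈ F, ∃ (e : ℕ) (G : MvPolynomial (Fin 2) k),
    G.IsHomogeneous e ∧ evalForm G p ≠ 0 ∧
    (∀ q, evalForm G q ≠ 0 → f q ∈ chart k Λ F τ) ∧
    ∀ m : dualLattice Λ, (∀ y ∈ τ, 0 ≤ m.1 y) →
      ∃ (r : ℕ) (H : MvPolynomial (Fin 2) k), H.IsHomogeneous (r * e) ∧
        ∀ q, evalForm G q ≠ 0 → (f q).val m = evalForm H q / evalForm G q ^ r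

/-- The function `g`, regular in a neighborhood of `p`, has a zero of order exactly `w` at `p`: near
`p` it is the `w`-th power of the linear form defining `p` times a quotient of two forms without
zero at `p`. -/
def HasOrder (g : P1 k → k) (p : P1 k) (w : ℕ) : Prop :=
  ∃ (e : ℕ) (G H : MvPolynomial (Fin 2) k),
    G.IsHomogeneous e ∧ H.IsHomogeneous (e + w) ∧ evalForm G p ≠ 0 ∧ evalForm H p ≠ 0 ∧
    ∀ q, evalForm G q ≠ 0 → evalForm H q ≠ 0 →
      g q = (p.rep 0 * q.rep 1 - p.rep 1 * q.rep 0) ^ w * evalForm G q / evalForm H q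

/-- Stable maps from connected nodal curves all of whose components are projective lines to a toric
variety. The domain is given by its normalization, which is the disjoint union of copies of the
projective line indexed by `Comp`, and by the finite set of pairs of points of the normalization that
are identified to nodes. A map from the nodal curve is a map from its normalization that takes the
same value at the two points over each node. -/
structure StableMap (k : Type*) [Field k] (Λ : Submodule ℤ W) (F : Set (Set W)) where
  Comp : Type
  finite_comp : Finite Comp
  nodes : Set (Sym2 (Comp × P1 k))
  finite_nodes : nodes.Finite
  not_diag : ∀ s ∈ nodes, ¬ s.IsDiag
  disjoint : ∀ s ∈ nodes, ∀ t ∈ nodes, ∀ x, x ∈ s → x ∈ t → s = t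
  map : Comp → P1 k → ToricPoint k Λ F
  isMorphism : ∀ c, IsMorphism (map c)
  glue : ∀ x y : Comp × P1 k, s(x, y) ∈ nodes → map x.1 x.2 = map y.1 y.2
  nonempty : Nonempty Comp
  connected : ∀ c c' : Comp,
    Relation.EqvGen (fun a b => ∃ p q, s((a, p), (b, q)) ∈ nodes) c c'
  /-- a contracted component has at least three special points -/
  stable : ∀ c, (∃ p q, map c p ≠ map c q) ∨ 3 ≤ {p | ∃ y, s((c, p), y) ∈ nodes}.ncard

/-- Isomorphisms of stable maps: isomorphisms of the domains commuting with the maps. An isomorphism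
of nodal curves is an isomorphism of the normalizations that respects the pairs of points over the
nodes, and the isomorphisms of the projective line are the projective linear maps. -/
def StableMap.Iso (C C' : StableMap k Λ F) : Prop :=
  ∃ (e : C.Comp ≃ C'.Comp) (g : C.Comp → ((Fin 2 → k) ≃ₗ[k] (Fin 2 → k))),
    (∀ c p, C'.map (e c) (g c • p) = C.map c p) ∧
    Sym2.map (fun x : C.Comp × P1 k => (e x.1, g x.1 • x.2)) '' C.nodes = C'.nodes

/-- The image of the stable map meets `Z`. -/
def StableMap.Meets (C : StableMap k Λ F) (Z : Set (ToricPoint k Λ F)) : Prop :=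
  ∃ c p, C.map c p ∈ Z

end Toric

/-! ### Curves in the central fiber of a toric degeneration -/

section Degeneration

variable {V : Type*} [AddCommGroup V] [Module ℚ V]

/-- The total space `X` of the toric degeneration defined by `P`. -/
abbrev Degeneration (k : Type*) [Field k] (N : Submodule ℤ V) (P : Set (Set V)) : Type _ :=
  ToricPoint k (extLattice N) (fanOver P)

/-- The monomial `(0, 1)`, which is the projection of the degeneration to the affine line. -/
def projMonomial (N : Submodule ℤ V) : dualLattice (extLattice N) :=
  ⟨LinearMap.snd ℚ V ℚ, fun x hx => by
    obtain ⟨z, hz⟩ := Submodule.mem_span_singleton.1 hx.2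
    exact ⟨z, by rw [LinearMap.snd_apply, ← hz]; simp⟩⟩

variable {k : Type*} [Field k] {N : Submodule ℤ V} {P : Set (Set V)}

/-- The central fiber `X_0`. It is reduced for integral `P`. -/
def centralFiber (k : Type*) [Field k] (N : Submodule ℤ V) (P : Set (Set V)) :
    Set (Degeneration k N P) := {x | x.val (projMonomial N) = 0}

/-- The component `X_v` of the central fiber, for a vertex `v` of `P`. -/
def component (k : Type*) [Field k] (N : Submodule ℤ V) (P : Set (Set V)) (v : V) :
    Set (Degeneration k N P) := stratum k (extLattice N) (fanOver P) (coneOver {v})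

/-- The big torus `Int X_v` of the component `X_v`. -/
def componentTorus (k : Type*) [Field k] (N : Submodule ℤ V) (P : Set (Set V)) (v : V) :
    Set (Degeneration k N P) := orbit k (extLattice N) (fanOver P) (coneOver {v})

/-- The cell `S` of `P` such that the point lies in the torus orbit of the cone over `S`. -/
def cell (x : Degeneration k N P) : Set V := {y | (y, 1) ∈ x.cone}

/-- The points mapped to the toric boundary of `X_v`. -/
def boundaryPoints (f : P1 k → Degeneration k N P) (v : V) : Set (P1 k) :=
  {p | f p ∉ componentTorus k N P v}

/-- `f` is a torically transverse map from the projective line to `X_v`: the preimage of the big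
torus of `X_v` is dense, and the image is disjoint from the toric strata of codimension at least two
in `X_v`, which are given by the cones of dimension at least three. -/
def IsTransverse (f : P1 k → Degeneration k N P) (v : V) : Prop :=
  (∀ p, f p ∈ component k N P v) ∧ (boundaryPoints f v).Finite ∧
  ∀ p, Module.finrank ℚ (Submodule.span ℚ (f p).cone) ≤ 2

/-- The intersection index at `p` of `f`, a torically transverse map to `X_v`, with the toric
boundary of `X_v` is `w`. Here `f p` lies in the big torus of the toric divisor of `X_v` given by the
ray spanned by the primitive vector `u`, along which the monomial `χ^m` vanishes to order
`⟨m, u⟩`. -/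
def HasIndex (f : P1 k → Degeneration k N P) (v : V) (p : P1 k) (w : ℕ) : Prop :=
  ∃ u : N, IsPrimitive u ∧ (cell (f p) ⊆ {x | ∃ a : ℚ, 0 ≤ a ∧ x = v + a • (u : V)}) ∧
    ∀ m : dualLattice (extLattice N), (∀ y ∈ (f p).cone, 0 ≤ m.1 y) → m.1 (v, 1) = 0 →
      ∃ j : ℕ, m.1 ((u : V), 0) = j ∧ HasOrder (fun q => (f q).val m) p (w * j)

/-- A line on `X_v`: a non-constant torically transverse map from the projective line with at most
three points mapped to the toric boundary. -/
def IsLine (f : P1 k → Degeneration k N P) (v : V) : Prop :=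
  IsTransverse f v ∧ (∃ p q, f p ≠ f q) ∧ (boundaryPoints f v).ncard ≤ 3

def IsDivalentLine (f : P1 k → Degeneration k N P) (v : V) : Prop :=
  IsLine f v ∧ (boundaryPoints f v).ncard = 2

/-- Pre-log curves: stable maps to the central fiber, torically transverse on each component, such
that a point mapping to the singular locus of the central fiber, where two components `X_v` meet, is
a node whose branches go to different components with the same intersection index. -/
structure IsPreLog (C : StableMap k (extLattice N) (fanOver P)) : Prop where
  mem_fiber : ∀ c p, C.map c p ∈ centralFiber k N P
  transverse : ∀ c, ∃ v, {v} ∈ P ∧ IsTransverse (C.map c) v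
  singular : ∀ c p,
    (∃ v v', v ≠ v' ∧ C.map c p ∈ component k N P v ∧ C.map c p ∈ component k N P v') →
    ∃ (c' : C.Comp) (p' : P1 k) (v v' : V) (w : ℕ), s((c, p), (c', p')) ∈ C.nodes ∧ v ≠ v' ∧
      IsTransverse (C.map c) v ∧ IsTransverse (C.map c') v' ∧
      HasIndex (C.map c) v p w ∧ HasIndex (C.map c') v' p' w

/-- Maximally degenerate curves: pre-log curves whose part over every `X_v` is empty, a line or, in
dimension two, a disjoint union of two divalent lines that do not meet a common toric divisor. In
particular no node joins two branches over the same `X_v`. -/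
structure IsMaximallyDegenerate (C : StableMap k (extLattice N) (fanOver P)) : Prop where
  preLog : IsPreLog C
  disjoint : ∀ x y, s(x, y) ∈ C.nodes → ∀ v,
    ¬ (IsTransverse (C.map x.1) v ∧ IsTransverse (C.map y.1) v)
  line : ∀ v, {v} ∈ P →
    ({c | ∀ p, C.map c p ∈ component k N P v} = ∅) ∨
    (∃ c, {c | ∀ p, C.map c p ∈ component k N P v} = {c} ∧ IsLine (C.map c) v) ∨
    (Module.finrank ℚ V = 2 ∧ ∃ c c', c ≠ c' ∧
      {c | ∀ p, C.map c p ∈ component k N P v} = {c, c'} ∧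
      IsDivalentLine (C.map c) v ∧ IsDivalentLine (C.map c') v ∧
      ∀ p ∈ boundaryPoints (C.map c) v, ∀ p' ∈ boundaryPoints (C.map c') v,
        (C.map c p).cone ≠ (C.map c' p').cone)

/-- `Γ` is the tropical curve associated to the maximally degenerate curve `C`.

The dual intersection graph of `C` has the components `c` of `C` as vertices, mapped to the vertex
`pos' c` of `P` with `C.map c` going to `X_{pos' c}`. Its flags are the pairs `(c, p)` of a component
and a point of it mapped to the toric boundary of `X_{pos' c}`; two flags form a bounded edge if they
are the branches at a node, the others are unbounded edges. The edge is mapped to the cell of `P`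
given by the stratum that contains the image of `p`, and its weight is the intersection index. The
associated tropical curve arises by merging edges at divalent vertices. So the condition is that the
dual intersection graph is a subdivision of `Γ`: `ι` is the inclusion of the vertices of `Γ`, and `ε`
sends an edge of the dual intersection graph, given by any of its flags, to the edge of `Γ` containing
it. -/
def HasTropicalCurve (C : StableMap k (extLattice N) (fanOver P)) (Γ : TropicalCurve N) : Prop :=
  ∃ (pos' : C.Comp → V) (ι : Γ.Vert → C.Comp) (ε : C.Comp → P1 k → Γ.Edge),
    (∀ c, {pos' c} ∈ P ∧ IsTransverse (C.map c) (pos' c)) ∧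
    Function.Injective ι ∧
    (∀ x, pos' (ι x) = Γ.pos x) ∧
    (∀ x y, s(x, y) ∈ C.nodes → ε x.1 x.2 = ε y.1 y.2) ∧
    (∀ c, ∀ p ∈ boundaryPoints (C.map c) (pos' c),
      HasIndex (C.map c) (pos' c) p (Γ.weight (ε c p))) ∧
    (∀ x, Set.BijOn (ε (ι x)) (boundaryPoints (C.map (ι x)) (pos' (ι x))) {E | Γ.Incident x E}) ∧
    (∀ c, c ∉ Set.range ι → (boundaryPoints (C.map c) (pos' c)).ncard = 2 ∧
      ∀ p ∈ boundaryPoints (C.map c) (pos' c), ∀ p' ∈ boundaryPoints (C.map c) (pos' c),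
        ε c p = ε c p') ∧
    (∀ E, Γ.edgeImage E =
      {x | ∃ c, ∃ p ∈ boundaryPoints (C.map c) (pos' c), ε c p = E ∧ x ∈ cell (C.map c p)})

/-- The maximally degenerate curves in the central fiber with associated tropical curve `Γ` that meet
all of the given subsets `Z i`. -/
def DegenerateCurve {l : ℕ} (Γ : TropicalCurve N) (Z : Fin l → Set (Degeneration k N P)) : Type _ :=
  {C : StableMap k (extLattice N) (fanOver P) //
    IsMaximallyDegenerate C ∧ HasTropicalCurve C Γ ∧ ∀ i, C.Meets (Z i)}

end Degeneration

end ToricTropical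

end

/-! Finite index. An element `g` of the kernel of the lattice map is a deformation of `Γ`: moving
every vertex `x` to `pos x + t • g x` keeps the edge directions and keeps the marked edges in
contact with the `A i`. Edge lengths and the distances of the marked points from the ends of their
edges are positive affine functions of `t`. If one of them is not constant, `t` can be moved until
the first of them vanishes. Contracting the edges of length zero gives a rational curve of degree
`Δ` matching `A` which fails to be trivalent or has a vertex in some `A i`, against generality. If
all are constant, `g` is a translation by a vector of `⋂ L(A i) = 0`. This is
`latticeMap_injective`. Trivalence gives `|Δ| - 2` vertices and `|Δ| - 3` bounded edges; with `∑ d i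
= |Δ| + n - 3` the rank of the target is at most that of the source (`finrank_latticeTarget_le`), so
the cokernel is finite.

The count. Let `f` be a map to a component `X_v` with prescribed boundary points `p j`, directions
`u j` and indices `w j`. Dividing `χ^m ∘ f` by the product of the powers `⟨p j, x⟩ ^ (w j * m(u j))`
leaves a function without zeros or poles, hence a constant `c(m)`
(`eq_const_of_local_quotient_forms`, `exists_eq_lineMap`). So `f` is determined by a character `c`
of the dual of `N`, that is, a point of the torus `𝔾(N)`, and the degree of the quotient being zero
is the balancing condition. Up to coordinate changes on the projective line two or three boundary
points can be put into standard position. For three points `c` is then an invariant (`char_unique`);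
for two points it matters only on the monomials orthogonal to the edge (`exists_smul_compMap_div`).

The vertices of `P` on `h(Γ)` cut the edges of `Γ` into one-dimensional cells. A maximally
degenerate curve with tropical curve `Γ` has one trivalent component for each vertex of `Γ` and one
divalent component for each further point of this subdivision, and its nodes are exactly the pairs
of boundary points over the same cell (`exists_iso_stdCurve`). Monomials orthogonal to an edge are
constant on the divalent components, so gluing propagates along the edge. Isomorphism classes
therefore correspond to families of characters `c x`, `x` a vertex of `Γ`, such that the quotient of
the characters at the two ends of a bounded edge is prescribed on the forms orthogonal to that edge.

Incidence. The closure `Z i` meets the curve only over the point of `h(E i) ∩ A i`, which is a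
vertex of `P` in the interior of `E i`. There, meeting `Z i` prescribes the character on the forms
that vanish on `ℚ u + L(A i)` (`char_eq_of_meets`, `meets_of_char_eq`). For `d i = 0` there are no
such forms besides zero, and the condition is empty.

So the curves are counted by the characters of the dual of `Map(Vert, N)` whose pullback along the
transpose of the lattice map is given. As `kˣ` is divisible and has enough roots of unity, their
number is the index of the transpose (`card_character_extensions`), which equals the index of the
lattice map (`card_quotient_dualMap`). -/

open scoped LinearAlgebra.Projectivization

noncomputable section

namespace ToricTropical

set_option linter.unusedSectionVars false

/-! ### Binary forms and functions without zeros or poles on the projective line -/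

section BinaryForms

variable {k : Type*} [Field k]

/-- The determinant of a pair of vectors of the plane. -/
def cross (p q : Fin 2 → k) : k := p 0 * q 1 - p 1 * q 0

theorem cross_smul_left (a : k) (p q : Fin 2 → k) : cross (a • p) q = a * cross p q := by
  simp [cross]; ring

theorem cross_smul_right (a : k) (p q : Fin 2 → k) : cross p (a • q) = a * cross p q := by
  simp [cross]; ring

theorem cross_self (p : Fin 2 → k) : cross p p = 0 := by
  simp [cross]; ring

theorem cross_comm (p q : Fin 2 → k) : cross p q = - cross q p := by
  simp [cross]; ring

theorem cross_eq_zero_iff {p q : Fin 2 → k} (hp : p ≠ 0) (hq : q ≠ 0) :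
    cross p q = 0 ↔ Projectivization.mk k p hp = Projectivization.mk k q hq := by
  rw [Projectivization.mk_eq_mk_iff']
  constructor
  · intro h
    have h' : p 0 * q 1 = p 1 * q 0 := sub_eq_zero.1 h
    by_cases h0 : q 0 = 0
    · have h1 : q 1 ≠ 0 := fun h1 => hq (by ext i; fin_cases i <;> simp [h0, h1])
      refine ⟨p 1 / q 1, ?_⟩
      have hp0 : p 0 = 0 := by
        rw [h0, mul_zero] at h'
        exact (mul_eq_zero.1 h').resolve_right h1
      ext i
      fin_cases i
      · simp [h0, hp0]
      · simp [h1]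
    · refine ⟨p 0 / q 0, ?_⟩
      ext i
      fin_cases i
      · simp [h0]
      · simp only [Fin.mk_one, Pi.smul_apply, smul_eq_mul]
        field_simp
        linear_combination h'
  · rintro ⟨a, rfl⟩
    rw [cross_smul_left, cross_self, mul_zero]

theorem cross_rep_eq_zero_iff {p q : P1 k} : cross p.rep q.rep = 0 ↔ p = q := by
  rw [cross_eq_zero_iff p.rep_nonzero q.rep_nonzero, Projectivization.mk_rep,
    Projectivization.mk_rep]

theorem cross_mk_rep_eq_zero_iff {x : Fin 2 → k} (hx : x ≠ 0) {q : P1 k} :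
    cross x q.rep = 0 ↔ q = Projectivization.mk k x hx := by
  rw [cross_eq_zero_iff hx q.rep_nonzero, Projectivization.mk_rep]
  exact eq_comm

/-- The linear form vanishing at the vector `p`. -/
def crossForm (p : Fin 2 → k) : MvPolynomial (Fin 2) k :=
  MvPolynomial.C (p 0) * MvPolynomial.X 1 - MvPolynomial.C (p 1) * MvPolynomial.X 0

@[simp]
theorem eval_crossForm (p q : Fin 2 → k) : MvPolynomial.eval q (crossForm p) = cross p q := by
  simp [crossForm, cross]

theorem isHomogeneous_crossForm (p : Fin 2 → k) : (crossForm p).IsHomogeneous 1 := by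
  refine MvPolynomial.IsHomogeneous.sub ?_ ?_
  · simpa using (MvPolynomial.isHomogeneous_C (Fin 2) (p 0)).mul
      (MvPolynomial.isHomogeneous_X k (1 : Fin 2))
  · simpa using (MvPolynomial.isHomogeneous_C (Fin 2) (p 1)).mul
      (MvPolynomial.isHomogeneous_X k (0 : Fin 2))

theorem eval_smul_of_isHomogeneous {G : MvPolynomial (Fin 2) k} {e : ℕ} (hG : G.IsHomogeneous e)
    (a : k) (x : Fin 2 → k) :
    MvPolynomial.eval (a • x) G = a ^ e * MvPolynomial.eval x G := by
  rw [MvPolynomial.eval_eq, MvPolynomial.eval_eq, Finset.mul_sum]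
  refine Finset.sum_congr rfl fun d hd => ?_
  have := hG (MvPolynomial.mem_support_iff.1 hd)
  rw [Finsupp.weight_apply, Finsupp.sum_fintype _ _ (by simp)] at this
  simp only [Pi.smul_apply, smul_eq_mul, mul_pow, Finset.prod_mul_distrib]
  rw [Finset.prod_pow_eq_pow_sum]
  have h2 : ∑ i ∈ d.support, d i = e := by
    rw [← this, Finset.sum_subset (Finset.subset_univ _) (by simp)]
    simp
  rw [h2]; ring

/-- The restriction of a polynomial in two variables to the affine line `x + t y`. -/
def lineRestrict (x y : Fin 2 → k) (G : MvPolynomial (Fin 2) k) : Polynomial k :=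
  MvPolynomial.aeval (fun i => Polynomial.C (x i) + Polynomial.X * Polynomial.C (y i)) G

theorem eval_lineRestrict (x y : Fin 2 → k) (G : MvPolynomial (Fin 2) k) (t : k) :
    (lineRestrict x y G).eval t = MvPolynomial.eval (x + t • y) G := by
  have : (lineRestrict x y G).eval t = (Polynomial.evalRingHom t) (lineRestrict x y G) := rfl
  rw [this, lineRestrict, MvPolynomial.aeval_def, MvPolynomial.hom_eval₂]
  rw [MvPolynomial.eval, MvPolynomial.coe_eval₂Hom]
  congr 1
  · ext a; simp
  · ext i; simp; ring

theorem add_smul_ne_zero {x y : Fin 2 → k} (h : cross x y ≠ 0) (t : k) : x + t • y ≠ 0 := by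
  intro h0
  apply h
  have : x = (-t) • y := by
    rw [neg_smul]; exact eq_neg_of_add_eq_zero_left h0
  rw [this, cross_smul_left, cross_self, mul_zero]

theorem cross_add_smul (x y : Fin 2 → k) (s t : k) :
    cross (x + s • y) (x + t • y) = (t - s) * cross x y := by
  simp [cross]; ring

theorem finite_line_preimage {x y : Fin 2 → k} (h : cross x y ≠ 0) {B : Set (P1 k)}
    (hB : B.Finite) : {t : k | Projectivization.mk k (x + t • y) (add_smul_ne_zero h t) ∈ B}.Finite := by
  refine Set.Finite.preimage ?_ hB
  intro s _ t _ hst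
  rw [← cross_eq_zero_iff, cross_add_smul] at hst
  rcases mul_eq_zero.1 hst with h1 | h1
  · exact (sub_eq_zero.1 h1).symm
  · exact absurd h1 h

theorem exists_cross_ne_zero {x : Fin 2 → k} (hx : x ≠ 0) : ∃ y : Fin 2 → k, cross x y ≠ 0 := by
  by_contra! hcon
  apply hx
  ext i
  fin_cases i
  · simpa [cross] using hcon ![0, 1]
  · simpa [cross] using hcon ![1, 0]

/-- Restrict to an affine line through `x` in an independent direction. Its points represent
pairwise distinct points of the projective line, so almost all of them avoid `B`, and a polynomial
in one variable with infinitely many roots is zero. This is the substitute for continuity by which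
identities are extended over the boundary points. -/
theorem eval_eq_zero_of_finite_compl [Infinite k] {B : Set (P1 k)} (hB : B.Finite)
    {F : MvPolynomial (Fin 2) k}
    (hF : ∀ x (hx : x ≠ 0), Projectivization.mk k x hx ∉ B → MvPolynomial.eval x F = 0)
    {x : Fin 2 → k} (hx : x ≠ 0) : MvPolynomial.eval x F = 0 := by
  obtain ⟨y, hy⟩ := exists_cross_ne_zero hx
  have h0 : lineRestrict x y F = 0 := by
    refine Polynomial.eq_zero_of_infinite_isRoot _ ?_
    refine ((finite_line_preimage hy hB).infinite_compl).mono fun t ht => ?_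
    change (lineRestrict x y F).eval t = 0
    rw [eval_lineRestrict]
    exact hF _ _ ht
  have := eval_lineRestrict x y F 0
  rw [h0] at this
  simpa using this.symm

/-- Such a function has neither zeros nor poles on the affine line. Every local expression agrees
with one fixed expression in lowest terms, whose numerator and denominator therefore have no roots
and are constants. The values on the finite set `S` play no role. -/
theorem eq_const_of_local_quotient [IsAlgClosed k] {S : Set k} (hS : S.Finite) (r : k → k)
    (hr : ∀ t₀, ∃ a b : Polynomial k, a.eval t₀ ≠ 0 ∧ b.eval t₀ ≠ 0 ∧
      ∀ t ∉ S, a.eval t ≠ 0 → b.eval t ≠ 0 → r t = a.eval t / b.eval t) :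
    ∃ c, c ≠ 0 ∧ ∀ t ∉ S, r t = c := by
  classical
  obtain ⟨a, b, ha, hb, hab⟩ := hr 0
  have ha0 : a ≠ 0 := by rintro rfl; simp at ha
  have hb0 : b ≠ 0 := by rintro rfl; simp at hb
  obtain ⟨g, a', b', hco, rfl, rfl⟩ : ∃ g a' b' : Polynomial k, IsCoprime a' b' ∧ a = g * a' ∧
      b = g * b' := by
    obtain ⟨a', ha'⟩ := EuclideanDomain.gcd_dvd_left a b
    obtain ⟨b', hb'⟩ := EuclideanDomain.gcd_dvd_right a b
    have hg0 : EuclideanDomain.gcd a b ≠ 0 := fun h => ha0 (by rw [ha', h, zero_mul])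
    refine ⟨_, a', b', ?_, ha', hb'⟩
    have := EuclideanDomain.gcd_eq_gcd_ab a b
    refine ⟨EuclideanDomain.gcdA a b, EuclideanDomain.gcdB a b, ?_⟩
    apply mul_left_cancel₀ hg0
    calc _ = (EuclideanDomain.gcd a b * a') * EuclideanDomain.gcdA a b
          + (EuclideanDomain.gcd a b * b') * EuclideanDomain.gcdB a b := by ring
      _ = _ := by rw [← ha', ← hb', ← this, mul_one]
  have hg0 := left_ne_zero_of_mul ha0
  have ha0' := right_ne_zero_of_mul ha0
  have hb0' := right_ne_zero_of_mul hb0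
  have key : ∀ t₁, ∃ a₁ b₁ : Polynomial k, a₁.eval t₁ ≠ 0 ∧ b₁.eval t₁ ≠ 0 ∧
      (∀ t ∉ S, a₁.eval t ≠ 0 → b₁.eval t ≠ 0 → r t = a₁.eval t / b₁.eval t) ∧
      a' * b₁ = a₁ * b' := by
    intro t₁
    obtain ⟨a₁, b₁, ha₁, hb₁, hab₁⟩ := hr t₁
    have ha₁0 : a₁ ≠ 0 := by rintro rfl; simp at ha₁
    have hb₁0 : b₁ ≠ 0 := by rintro rfl; simp at hb₁
    refine ⟨a₁, b₁, ha₁, hb₁, hab₁, ?_⟩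
    rw [← sub_eq_zero]
    refine Polynomial.eq_zero_of_infinite_isRoot _ ?_
    have hfin : (S ∪ {t | ((g * a') * (g * b') * (a₁ * b₁)).IsRoot t}).Finite := by
      refine hS.union ?_
      refine Polynomial.finite_setOfPred_isRoot ?_
      exact mul_ne_zero (mul_ne_zero ha0 hb0) (mul_ne_zero ha₁0 hb₁0)
    refine hfin.infinite_compl.mono fun t ht => ?_
    simp only [Set.mem_compl_iff, Set.mem_union, Set.mem_ofPred_eq, Polynomial.IsRoot.def,
      Polynomial.eval_mul, not_or, mul_eq_zero] at ht
    obtain ⟨htS, ⟨⟨hg, hA⟩, ⟨-, hB⟩⟩, hA₁, hB₁⟩ := ht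
    have h1 := hab t htS (by simp [hg, hA]) (by simp [hg, hB])
    have h2 := hab₁ t htS hA₁ hB₁
    rw [h1] at h2
    simp only [Polynomial.eval_mul] at h2
    change Polynomial.eval t (a' * b₁ - a₁ * b') = 0
    simp only [Polynomial.eval_sub, Polynomial.eval_mul]
    field_simp at h2
    linear_combination h2
  -- At a root of `a'` the identity `a' * b₁ = a₁ * b'` would force `b'` to vanish as well, which
  -- coprimality excludes.
  have hna : ∀ t, a'.eval t ≠ 0 := by
    intro t ht
    obtain ⟨a₁, b₁, ha₁, hb₁, -, he⟩ := key t
    have := congrArg (Polynomial.eval t) he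
    simp only [Polynomial.eval_mul, ht, zero_mul] at this
    have hb't : b'.eval t = 0 := (mul_eq_zero.1 this.symm).resolve_left ha₁
    obtain ⟨x, y, hxy⟩ := hco
    have := congrArg (Polynomial.eval t) hxy
    simp [ht, hb't] at this
  have hnb : ∀ t, b'.eval t ≠ 0 := by
    intro t ht
    obtain ⟨a₁, b₁, ha₁, hb₁, -, he⟩ := key t
    have := congrArg (Polynomial.eval t) he
    simp only [Polynomial.eval_mul, ht, mul_zero] at this
    exact mul_ne_zero (hna t) hb₁ this
  have hconst : ∀ f : Polynomial k, (∀ t, f.eval t ≠ 0) → ∃ c, c ≠ 0 ∧ f = Polynomial.C c := by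
    intro f hf
    have hdeg : f.degree = 0 := by
      by_contra hd
      obtain ⟨t, ht⟩ := IsAlgClosed.exists_root f hd
      exact hf t ht
    refine ⟨f.coeff 0, ?_, Polynomial.eq_C_of_degree_eq_zero hdeg⟩
    have := hf 0
    rwa [← Polynomial.coeff_zero_eq_eval_zero] at this
  obtain ⟨ca, hca, rfl⟩ := hconst a' hna
  obtain ⟨cb, hcb, rfl⟩ := hconst b' hnb
  refine ⟨ca / cb, div_ne_zero hca hcb, fun t ht => ?_⟩
  obtain ⟨a₁, b₁, ha₁, hb₁, h₁, he⟩ := key t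
  rw [h₁ t ht ha₁ hb₁]
  have := congrArg (Polynomial.eval t) he
  simp only [Polynomial.eval_mul, Polynomial.eval_C] at this
  field_simp
  linear_combination -this

/-- A function on the punctured plane that is locally on the projective line a quotient of
nonvanishing forms of degree difference `δ` is constant, and `δ = 0`. -/
theorem eq_const_of_local_quotient_forms [IsAlgClosed k] {B : Set (P1 k)} (hB : B.Finite)
    (R : (Fin 2 → k) → k) (δ : ℤ)
    (hR : ∀ x : Fin 2 → k, x ≠ 0 → ∃ (e e' : ℕ) (G H : MvPolynomial (Fin 2) k),
      G.IsHomogeneous e ∧ H.IsHomogeneous e' ∧ (e : ℤ) - e' = δ ∧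
      MvPolynomial.eval x G ≠ 0 ∧ MvPolynomial.eval x H ≠ 0 ∧
      ∀ y (hy : y ≠ 0), Projectivization.mk k y hy ∉ B →
        MvPolynomial.eval y G ≠ 0 → MvPolynomial.eval y H ≠ 0 →
        R y = MvPolynomial.eval y G / MvPolynomial.eval y H) :
    δ = 0 ∧ ∃ c, c ≠ 0 ∧ ∀ y (hy : y ≠ 0), Projectivization.mk k y hy ∉ B → R y = c := by
  have hinf : Infinite k := IsAlgClosed.instInfinite
  set e₁ : Fin 2 → k := ![1, 0] with he₁
  set e₂ : Fin 2 → k := ![0, 1] with he₂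
  have hc : cross e₁ e₂ ≠ 0 := by simp [he₁, he₂, cross]
  obtain ⟨c, hc0, hcc⟩ := eq_const_of_local_quotient (finite_line_preimage hc hB)
    (fun t => R (e₁ + t • e₂)) (by
      intro t₀
      obtain ⟨e, e', G, H, -, -, -, hG, hH, hGH⟩ := hR (e₁ + t₀ • e₂) (add_smul_ne_zero hc t₀)
      refine ⟨lineRestrict e₁ e₂ G, lineRestrict e₁ e₂ H, ?_, ?_, ?_⟩
      · rwa [eval_lineRestrict]
      · rwa [eval_lineRestrict]
      · intro t ht h1 h2
        rw [eval_lineRestrict] at h1 h2 ⊢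
        rw [eval_lineRestrict]
        exact hGH _ _ ht h1 h2)
  have hhom : ∀ y (hy : y ≠ 0), Projectivization.mk k y hy ∉ B → ∀ a : k, a ≠ 0 →
      R (a • y) = a ^ δ * R y := by
    intro y hy hyB a ha
    obtain ⟨e, e', G, H, hGe, hHe, hδ, hG, hH, hGH⟩ := hR y hy
    have hay : a • y ≠ 0 := smul_ne_zero ha hy
    have hmk : Projectivization.mk k (a • y) hay = Projectivization.mk k y hy := by
      rw [Projectivization.mk_eq_mk_iff']; exact ⟨a, rfl⟩
    rw [hGH y hy hyB hG hH, hGH (a • y) hay (hmk ▸ hyB)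
      (by rw [eval_smul_of_isHomogeneous hGe]; exact mul_ne_zero (pow_ne_zero _ ha) hG)
      (by rw [eval_smul_of_isHomogeneous hHe]; exact mul_ne_zero (pow_ne_zero _ ha) hH),
      eval_smul_of_isHomogeneous hGe, eval_smul_of_isHomogeneous hHe, ← hδ, zpow_sub₀ ha,
      zpow_natCast, zpow_natCast]
    field_simp
  have haff : ∀ y (hy : y ≠ 0), Projectivization.mk k y hy ∉ B → y 0 ≠ 0 →
      R y = y 0 ^ δ * c := by
    intro y hy hyB h0
    have hy' : y = y 0 • (e₁ + (y 1 / y 0) • e₂) := by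
      ext i
      fin_cases i
      · simp [he₁, he₂]
      · simp [he₁, he₂]; field_simp
    have hmk : Projectivization.mk k (e₁ + (y 1 / y 0) • e₂) (add_smul_ne_zero hc _)
        = Projectivization.mk k y hy := by
      rw [Projectivization.mk_eq_mk_iff']
      refine ⟨(y 0)⁻¹, ?_⟩
      rw [inv_smul_eq_iff₀ h0]
      exact hy'
    conv_lhs => rw [hy']
    rw [hhom _ (add_smul_ne_zero hc _) (hmk ▸ hyB) _ h0, hcc _ (by
      simpa only [Set.mem_ofPred_eq, hmk] using hyB)]
  have he₂0 : e₂ ≠ 0 := fun h => by simpa [he₂] using congrFun h 1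
  obtain ⟨e, e', G, H, hGe, hHe, hδ, hG, hH, hGH⟩ := hR e₂ he₂0
  set B' : Set (P1 k) := insert (Projectivization.mk k e₂ he₂0) B with hB'
  have hB'f : B'.Finite := hB.insert _
  have hzero : ∀ y (hy : y ≠ 0), Projectivization.mk k y hy ∉ B' → y 0 ≠ 0 := by
    intro y hy hyB h0
    apply hyB
    left
    rw [← cross_eq_zero_iff]
    simp [cross, he₂, h0]
  -- the local quotient at `e₂` agrees with the monomial expression wherever it is defined
  have hcmp : ∀ y (hy : y ≠ 0), Projectivization.mk k y hy ∉ B' → MvPolynomial.eval y G ≠ 0 →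
      MvPolynomial.eval y H ≠ 0 →
      MvPolynomial.eval y G = y 0 ^ δ * c * MvPolynomial.eval y H := by
    intro y hy hyB h1 h2
    have hyB2 : Projectivization.mk k y hy ∉ B := fun h => hyB (Or.inr h)
    have h3 := hGH y hy hyB2 h1 h2
    rw [haff y hy hyB2 (hzero y hy hyB)] at h3
    rw [h3]; field_simp
  -- Away from the point at infinity the function is `c` times the `δ`-th power of the first
  -- coordinate. This coordinate vanishes at `e₂`, while the local numerator `G` and denominator `H`
  -- do not, so neither a positive nor a negative exponent is possible.
  have hδ0 : δ = 0 := by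
    rcases lt_trichotomy δ 0 with hlt | h | hgt
    · exfalso
      obtain ⟨d, hd⟩ := Int.eq_ofNat_of_zero_le (by omega : (0 : ℤ) ≤ -δ)
      -- The factor `G * H` makes the identity hold trivially where the local expression is not
      -- available; it is nonzero at `e₂` and can be cancelled there.
      have hz : MvPolynomial.eval e₂ ((G * MvPolynomial.X 0 ^ d - MvPolynomial.C c * H) * (G * H))
          = 0 := by
        refine eval_eq_zero_of_finite_compl hB'f (fun y hy hyB => ?_) he₂0
        by_cases h1 : MvPolynomial.eval y G = 0
        · simp [h1]
        by_cases h2 : MvPolynomial.eval y H = 0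
        · simp [h2]
        have h3 := hcmp y hy hyB h1 h2
        have h0 := hzero y hy hyB
        have hδd : δ = -(d : ℤ) := by omega
        rw [hδd, zpow_neg, zpow_natCast] at h3
        field_simp at h3
        have : MvPolynomial.eval y (G * MvPolynomial.X 0 ^ d - MvPolynomial.C c * H) = 0 := by
          simp only [map_sub, map_mul, map_pow, MvPolynomial.eval_X, MvPolynomial.eval_C]
          linear_combination h3
        rw [map_mul, this, zero_mul]
      have hd0 : d ≠ 0 := by omega
      have hX : MvPolynomial.eval e₂ (MvPolynomial.X 0 ^ d) = 0 := by simp [he₂, hd0]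
      rw [map_mul, map_sub, map_mul, hX, mul_zero, zero_sub, map_mul, map_mul,
        MvPolynomial.eval_C] at hz
      exact mul_ne_zero (neg_ne_zero.2 (mul_ne_zero hc0 hH)) (mul_ne_zero hG hH) hz
    · exact h
    · exfalso
      obtain ⟨d, hd⟩ := Int.eq_ofNat_of_zero_le hgt.le
      have hz : MvPolynomial.eval e₂ ((G - MvPolynomial.X 0 ^ d * MvPolynomial.C c * H) * (G * H))
          = 0 := by
        refine eval_eq_zero_of_finite_compl hB'f (fun y hy hyB => ?_) he₂0
        by_cases h1 : MvPolynomial.eval y G = 0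
        · simp [h1]
        by_cases h2 : MvPolynomial.eval y H = 0
        · simp [h2]
        have h3 := hcmp y hy hyB h1 h2
        rw [hd, zpow_natCast] at h3
        have : MvPolynomial.eval y (G - MvPolynomial.X 0 ^ d * MvPolynomial.C c * H) = 0 := by
          simp only [map_sub, map_mul, map_pow, MvPolynomial.eval_X, MvPolynomial.eval_C]
          linear_combination h3
        rw [map_mul, this, zero_mul]
      have hd0 : d ≠ 0 := by omega
      have hX : MvPolynomial.eval e₂ (MvPolynomial.X 0 ^ d) = 0 := by simp [he₂, hd0]
      rw [map_mul, map_sub, map_mul, map_mul, hX, zero_mul, zero_mul, sub_zero, map_mul] at hz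
      exact mul_ne_zero hG (mul_ne_zero hG hH) hz
  refine ⟨hδ0, c, hc0, fun y hy hyB => ?_⟩
  subst hδ0
  -- The affine chart misses one point of the projective line. There the constant is found by
  -- comparing with a local expression off a finite set.
  by_cases h0 : y 0 = 0
  · obtain ⟨f, f', G', H', hGe', hHe', hδ', hG', hH', hGH'⟩ := hR y hy
    have hz : MvPolynomial.eval y ((G' - MvPolynomial.C c * H') * (G' * H')) = 0 := by
      refine eval_eq_zero_of_finite_compl hB'f (fun z hz hzB => ?_) hy
      by_cases h1 : MvPolynomial.eval z G' = 0
      · simp [h1]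
      by_cases h2 : MvPolynomial.eval z H' = 0
      · simp [h2]
      have hzB2 : Projectivization.mk k z hz ∉ B := fun h => hzB (Or.inr h)
      have h3 := hGH' z hz hzB2 h1 h2
      rw [haff z hz hzB2 (hzero z hz hzB)] at h3
      field_simp at h3
      have : MvPolynomial.eval z (G' - MvPolynomial.C c * H') = 0 := by
        simp only [map_sub, map_mul, MvPolynomial.eval_C]
        linear_combination -h3
      rw [map_mul, this, zero_mul]
    rw [map_mul, map_mul] at hz
    have hz' := (mul_eq_zero.1 hz).resolve_right (mul_ne_zero hG' hH')
    simp only [map_sub, map_mul, MvPolynomial.eval_C] at hz'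
    rw [hGH' y hy hyB hG' hH']
    field_simp
    linear_combination hz'
  · rw [haff y hy hyB h0]; simp

end BinaryForms

/-! ### Lattices, primitive vectors, and monomials of order zero along a component -/

section Lattice

variable {V : Type*} [AddCommGroup V] [Module ℚ V] {N : Submodule ℤ V}

/-- The product of the denominators of the values on a finite set of generators works. This allows
rational linear forms to be used as monomials. -/
theorem exists_pos_smul_integral {W : Type*} [AddCommGroup W] [Module ℚ W] {Λ : Submodule ℤ W}
    (hΛ : Λ.FG) (f : Module.Dual ℚ W) :
    ∃ K : ℕ, 0 < K ∧ (K : ℚ) • f ∈ dualLattice Λ := by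
  obtain ⟨S, hS⟩ := hΛ
  refine ⟨∏ s ∈ S, (f s).den, Finset.prod_pos fun s _ => (f s).den_pos, ?_⟩
  intro x hx
  rw [← hS] at hx
  induction hx using Submodule.span_induction with
  | mem x h =>
    obtain ⟨c, hc⟩ := Finset.dvd_prod_of_mem (fun s => (f s).den) h
    refine ⟨c * (f x).num, ?_⟩
    simp only [LinearMap.smul_apply, smul_eq_mul]
    rw [hc]
    push_cast
    have : ((f x).den : ℚ) * f x = (f x).num := by rw [mul_comm]; exact Rat.mul_den_eq_num _
    linear_combination (c : ℚ) * this
  | zero => exact ⟨0, by simp⟩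
  | add x y _ _ hx hy =>
    obtain ⟨a, ha⟩ := hx
    obtain ⟨b, hb⟩ := hy
    exact ⟨a + b, by rw [map_add, ha, hb]; push_cast; ring⟩
  | smul a x _ hx =>
    obtain ⟨b, hb⟩ := hx
    refine ⟨a * b, ?_⟩
    have : (a • x : W) = (a : ℚ) • x := (Int.cast_smul_eq_zsmul ℚ a x).symm
    rw [this, map_smul, hb]; push_cast; simp

theorem dual_ext_lattice [N.IsLattice ℚ] {W : Type*} [AddCommGroup W] [Module ℚ W]
    {f g : V →ₗ[ℚ] W} (h : ∀ x : N, f x = g x) : f = g :=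
  LinearMap.ext_on (Submodule.IsLattice.span_eq_top (M := N)) fun x hx => h ⟨x, hx⟩

variable (N) in
theorem extLattice_fg [N.IsLattice ℚ] : (extLattice N).FG :=
  Submodule.FG.prod Submodule.IsLattice.fg (Submodule.fg_span_singleton 1)

variable (N) in
theorem finiteDimensional_of_lattice [N.IsLattice ℚ] : FiniteDimensional ℚ V := by
  have b := (Module.Free.chooseBasis ℤ N).extendOfIsLattice ℚ
  exact Module.Finite.of_basis b

/-- The `ℚ`-linear extension of an integral linear form. -/
def extendQ [N.IsLattice ℚ] (m : Module.Dual ℤ N) : Module.Dual ℚ V :=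
  ((Module.Free.chooseBasis ℤ N).extendOfIsLattice ℚ).constr ℚ
    fun i => (m (Module.Free.chooseBasis ℤ N i) : ℚ)

@[simp]
theorem extendQ_apply [N.IsLattice ℚ] (m : Module.Dual ℤ N) (x : N) :
    extendQ m (x : V) = m x := by
  let b := Module.Free.chooseBasis ℤ N
  have : ((extendQ m).restrictScalars ℤ ∘ₗ N.subtype)
      = (Int.castAddHom ℚ).toIntLinearMap ∘ₗ m := by
    refine b.ext fun i => ?_
    simp only [LinearMap.comp_apply, LinearMap.restrictScalars_apply, Submodule.subtype_apply,
      AddMonoidHom.coe_toIntLinearMap, Int.coe_castAddHom]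
    rw [← Module.Basis.extendOfIsLattice_apply (K := ℚ) b i, extendQ, Module.Basis.constr_basis]
  exact LinearMap.congr_fun this x

theorem extendQ_add [N.IsLattice ℚ] (m m' : Module.Dual ℤ N) :
    extendQ (m + m') = extendQ m + extendQ m' :=
  dual_ext_lattice (N := N) fun x => by simp

theorem mem_extLattice {x : V} {z : ℤ} (hx : x ∈ N) : (x, (z : ℚ)) ∈ extLattice N :=
  ⟨hx, Submodule.mem_span_singleton.2 ⟨z, by simp⟩⟩

theorem exists_of_mem_extLattice {y : V × ℚ} (hy : y ∈ extLattice N) :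
    y.1 ∈ N ∧ ∃ z : ℤ, y.2 = z := by
  refine ⟨hy.1, ?_⟩
  obtain ⟨z, hz⟩ := Submodule.mem_span_singleton.1 hy.2
  exact ⟨z, by rw [← hz]; simp⟩

/-- The monomial `(x, h) ↦ m x - h * m v`, which is trivial on `(v, 1)`. -/
def monomial [N.IsLattice ℚ] (v : N) : Module.Dual ℤ N →+ dualLattice (extLattice N) where
  toFun m := ⟨extendQ m ∘ₗ LinearMap.fst ℚ V ℚ - (m v : ℚ) • LinearMap.snd ℚ V ℚ, fun y hy => by
    obtain ⟨h1, z, hz⟩ := exists_of_mem_extLattice hy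
    refine ⟨m ⟨y.1, h1⟩ - m v * z, ?_⟩
    have := extendQ_apply m ⟨y.1, h1⟩
    simp only [LinearMap.sub_apply, LinearMap.comp_apply, LinearMap.fst_apply,
      LinearMap.smul_apply, LinearMap.snd_apply, hz, smul_eq_mul]
    rw [this]; push_cast; ring⟩
  map_zero' := Subtype.ext <| by
    have : extendQ (0 : Module.Dual ℤ N) = 0 := dual_ext_lattice (N := N) fun x => by simp
    simp [this]
  map_add' m m' := Subtype.ext <| by
    refine LinearMap.ext fun y => ?_
    simp [extendQ_add]; ring

theorem monomial_apply [N.IsLattice ℚ] (v : N) (m : Module.Dual ℤ N) (x : V) (h : ℚ) :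
    (monomial v m).1 (x, h) = extendQ m x - m v * h := by
  simp [monomial]

/-- The restriction of a character of `N × ℤ` to `N`. -/
def restr : dualLattice (extLattice N) →+ Module.Dual ℤ N where
  toFun m := AddMonoidHom.toIntLinearMap
    -- The value is an integer, so its numerator is this integer.
    { toFun := fun x => (m.1 ((x : V), 0)).num
      map_zero' := by
        have : (((0 : N) : V), (0 : ℚ)) = 0 := rfl
        rw [this, map_zero, Rat.num_zero]
      map_add' := fun x y => by
        obtain ⟨a, ha⟩ := m.2 ((x : V), ((0 : ℤ) : ℚ)) (mem_extLattice x.2)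
        obtain ⟨b, hb⟩ := m.2 ((y : V), ((0 : ℤ) : ℚ)) (mem_extLattice y.2)
        have : (((x + y : N) : V), (0 : ℚ)) = ((x : V), 0) + ((y : V), 0) := by simp
        rw [Int.cast_zero] at ha hb
        rw [this, map_add, ha, hb, ← Int.cast_add]
        simp only [Rat.num_intCast] }
  map_zero' := by ext; simp
  map_add' m m' := by
    ext x
    obtain ⟨a, ha⟩ := m.2 ((x : V), ((0 : ℤ) : ℚ)) (mem_extLattice x.2)
    obtain ⟨b, hb⟩ := m'.2 ((x : V), ((0 : ℤ) : ℚ)) (mem_extLattice x.2)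
    rw [Int.cast_zero] at ha hb
    simp only [AddSubgroup.coe_add, LinearMap.add_apply, AddMonoidHom.coe_toIntLinearMap,
      AddMonoidHom.coe_mk, ZeroHom.coe_mk]
    rw [ha, hb, ← Int.cast_add]
    simp only [Rat.num_intCast]

theorem restr_apply (m : dualLattice (extLattice N)) (x : N) :
    (restr m x : ℚ) = m.1 ((x : V), 0) := by
  obtain ⟨a, ha⟩ := m.2 ((x : V), ((0 : ℤ) : ℚ)) (mem_extLattice x.2)
  rw [Int.cast_zero] at ha
  change ((m.1 ((x : V), 0)).num : ℚ) = _
  rw [ha]; simp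

theorem restr_monomial [N.IsLattice ℚ] (v : N) (m : Module.Dual ℤ N) :
    restr (monomial v m) = m := by
  ext x
  have := restr_apply (monomial v m) x
  rw [monomial_apply] at this
  simp at this
  exact this

theorem apply_eq_of_apply_one (m : dualLattice (extLattice N)) {v : V}
    (hm : m.1 (v, 1) = 0) (x : V) : m.1 (x, 1) = m.1 (x - v, 0) := by
  have : ((x, 1) : V × ℚ) = (v, 1) + (x - v, 0) := by simp
  rw [this, map_add, hm, zero_add]

theorem apply_add_smul (m : dualLattice (extLattice N)) {v : V} (hm : m.1 (v, 1) = 0) (a : ℚ)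
    (u : N) : m.1 (v + a • (u : V), 1) = a * restr m u := by
  rw [apply_eq_of_apply_one m hm, add_sub_cancel_left, restr_apply]
  have : ((a • (u : V), 0) : V × ℚ) = a • ((u : V), (0 : ℚ)) := by simp
  rw [this, map_smul, smul_eq_mul]

theorem monomial_apply_self [N.IsLattice ℚ] (v : N) (m : Module.Dual ℤ N) :
    (monomial v m).1 ((v : V), 1) = 0 := by
  simp [monomial_apply]

/-- A form that vanishes on `(v, 1)` is determined by its restriction to `N`. Together with
`restr_monomial` this identifies the characters of the big torus of `X_v` with the dual of `N`,
independently of `v`. -/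
theorem monomial_restr [N.IsLattice ℚ] (v : N) {m : dualLattice (extLattice N)}
    (hm : m.1 ((v : V), 1) = 0) : monomial v (restr m) = m := by
  refine Subtype.ext (LinearMap.ext fun y => ?_)
  obtain ⟨x, h⟩ := y
  rw [monomial_apply]
  have h1 : extendQ (restr m) = m.1 ∘ₗ LinearMap.inl ℚ V ℚ :=
    dual_ext_lattice (N := N) fun x => by simp [restr_apply]
  have h2 : ((x, h) : V × ℚ) = (x, 0) + h • (((v : V), 1) - ((v : V), 0)) := by simp
  rw [h1, h2, map_add, map_smul, map_sub, hm, restr_apply]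
  simp
  ring

/-- The values of the integral forms on `u` are an ideal of `ℤ`. A generator divides all coordinates
of `u`, hence `u` itself, so it is a unit. -/
theorem IsPrimitive.exists_dual_eq_one [N.IsLattice ℚ] {u : N} (hu : IsPrimitive u) :
    ∃ m : Module.Dual ℤ N, m u = 1 := by
  let b := Module.Free.chooseBasis ℤ N
  let ev : Module.Dual ℤ N →ₗ[ℤ] ℤ := Module.Dual.eval ℤ N u
  obtain ⟨d, hd⟩ : ∃ d, LinearMap.range ev = Ideal.span {d} :=
    (IsPrincipalIdealRing.principal (LinearMap.range ev)).principal
  have hdvd : ∀ i, d ∣ b.repr u i := fun i => by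
    have : b.repr u i ∈ LinearMap.range ev := ⟨b.coord i, rfl⟩
    rw [hd] at this
    exact Ideal.mem_span_singleton.1 this
  choose y hy using hdvd
  have hu' : u = d • ∑ i, y i • b i := by
    conv_lhs => rw [← b.sum_repr u]
    rw [Finset.smul_sum]
    refine Finset.sum_congr rfl fun i _ => ?_
    rw [smul_smul, hy]
  have hunit := hu d _ hu'
  have : (1 : ℤ) ∈ LinearMap.range ev := by
    rw [hd, Ideal.span_singleton_eq_top.2 hunit]; trivial
  exact this

theorem IsPrimitive.ne_zero {u : N} (hu : IsPrimitive u) : u ≠ 0 := by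
  rintro rfl
  have := hu 2 0 (by simp)
  rw [Int.isUnit_iff] at this
  omega

theorem IsPrimitive.coe_ne_zero {u : N} (hu : IsPrimitive u) : (u : V) ≠ 0 := by
  intro h
  exact hu.ne_zero (Subtype.ext h)

theorem IsPrimitive.neg {u : N} (hu : IsPrimitive u) : IsPrimitive (-u) := by
  intro a y h
  have := hu (-a) y (by rw [neg_smul, ← h, neg_neg])
  simpa using this

/-- Primitive vectors on the same ray are equal. -/
theorem IsPrimitive.eq_of_smul [N.IsLattice ℚ] {u u' : N} (hu : IsPrimitive u)
    (hu' : IsPrimitive u') {a : ℚ} (ha : 0 < a) (h : (u' : V) = a • (u : V)) : u' = u := by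
  obtain ⟨m, hm⟩ := hu.exists_dual_eq_one
  obtain ⟨m', hm'⟩ := hu'.exists_dual_eq_one
  have h1 : (m u' : ℚ) = a := by
    rw [← extendQ_apply m u', h, map_smul, extendQ_apply, hm]; simp
  have h2 : a * (m' u : ℚ) = 1 := by
    have := extendQ_apply m' u'
    rw [h, map_smul, extendQ_apply, hm'] at this
    simpa using this
  have h3 : m u' * m' u = 1 := by
    have : (m u' : ℚ) * m' u = 1 := by rw [h1, h2]
    exact_mod_cast this
  have h4 : m u' = 1 := by
    have h5 : 0 ≤ m u' := by
      have : (0 : ℚ) ≤ m u' := by rw [h1]; exact ha.le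
      exact_mod_cast this
    exact Int.eq_one_of_mul_eq_one_right h5 h3
  have ha1 : a = 1 := by rw [← h1, h4]; simp
  rw [ha1, one_smul] at h
  exact Subtype.ext h

end Lattice

/-! ### Characters and one-parameter subgroups -/

section Characters

variable {k : Type*} [Field k] {V : Type*} [AddCommGroup V] [Module ℚ V] {N : Submodule ℤ V}

/-- The closed points of the torus `𝔾(N)`, as characters of the integral dual of `N`. -/
abbrev CharTorus (k : Type*) [Field k] (N : Submodule ℤ V) : Type _ :=
  Multiplicative (Module.Dual ℤ N) →* kˣ

/-- The one-parameter subgroup of `u`. -/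
def oneParam (u : N) (s : kˣ) : CharTorus k N where
  toFun m := s ^ (Multiplicative.toAdd m u)
  map_one' := by simp
  map_mul' m m' := by simp [zpow_add]

@[simp]
theorem oneParam_apply (u : N) (s : kˣ) (m : Module.Dual ℤ N) :
    oneParam u s (Multiplicative.ofAdd m) = s ^ (m u) := rfl

/-- A form `m₁` with `m₁ u = 1` splits the dual into the annihilator of `u` and the multiples of
`m₁`, so `χ` depends only on its value at `m₁`. -/
theorem IsPrimitive.exists_zpow [N.IsLattice ℚ] {u : N} (hu : IsPrimitive u) (χ : CharTorus k N)
    (hχ : ∀ m : Module.Dual ℤ N, m u = 0 → χ (Multiplicative.ofAdd m) = 1) :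
    ∃ s : kˣ, χ = oneParam u s := by
  obtain ⟨m₁, hm₁⟩ := hu.exists_dual_eq_one
  refine ⟨χ (Multiplicative.ofAdd m₁), MonoidHom.ext fun m => ?_⟩
  obtain ⟨m, rfl⟩ := Multiplicative.ofAdd.surjective m
  have h := hχ (m - m u • m₁) (by simp [hm₁])
  rw [sub_eq_add_neg, ofAdd_add, ofAdd_neg, ofAdd_zsmul, map_mul, map_inv, map_zpow,
    mul_inv_eq_one] at h
  rw [oneParam_apply, h]

theorem exists_pow_eq_unit [IsAlgClosed k] (s : kˣ) {w : ℕ} (hw : 0 < w) : ∃ t : kˣ, t ^ w = s := by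
  obtain ⟨z, hz⟩ := IsAlgClosed.exists_pow_nat_eq (s : k) hw
  have hz0 : z ≠ 0 := by
    rintro rfl
    rw [zero_pow hw.ne'] at hz
    exact s.ne_zero hz.symm
  exact ⟨Units.mk0 z hz0, Units.ext (by simpa using hz)⟩

/-- A character of a group `K` of linear forms that is trivial on the forms vanishing on `u` is given
by a one-parameter subgroup, with a parameter that is a `w`-th power. -/
theorem exists_zpow_of_trivial [IsAlgClosed k] (K : AddSubgroup (Module.Dual ℤ N)) (u : N)
    {w : ℕ} (hw : 0 < w) (χ : Multiplicative K →* kˣ)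
    (hχ : ∀ m : K, m.1 u = 0 → χ (Multiplicative.ofAdd m) = 1) :
    ∃ t : kˣ, ∀ m : K, χ (Multiplicative.ofAdd m) = t ^ ((w : ℤ) * m.1 u) := by
  let ev : K →+ ℤ := (Module.Dual.eval ℤ N u).toAddMonoidHom.comp K.subtype
  obtain ⟨g, hg⟩ := (Int.subgroup_cyclic (AddMonoidHom.range ev))
  obtain ⟨m₁, hm₁⟩ : g ∈ AddMonoidHom.range ev := by rw [hg]; exact AddSubgroup.subset_closure rfl
  have hm₁' : m₁.1 u = g := hm₁
  by_cases hg0 : g = 0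
  · refine ⟨1, fun m => ?_⟩
    rw [one_zpow]
    apply hχ
    have : ev m ∈ AddMonoidHom.range ev := ⟨m, rfl⟩
    rw [hg, hg0, AddSubgroup.mem_closure_singleton] at this
    obtain ⟨n, hn⟩ := this
    rw [smul_zero] at hn
    exact hn.symm
  -- The values of `K` on `u` are the multiples of `g = m₁ u`, so what is needed is a root of order
  -- `w * g` of the value of `χ` at `m₁`. It is extracted in two steps, and a negative `g` is
  -- handled by inversion.
  · obtain ⟨t₀, ht₀⟩ := exists_pow_eq_unit (χ (Multiplicative.ofAdd m₁)) hw
    obtain ⟨t, ht⟩ := exists_pow_eq_unit t₀ (Int.natAbs_pos.2 hg0)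
    obtain ⟨t', ht'⟩ : ∃ t' : kˣ, t' ^ g = t₀ := by
      rcases Int.natAbs_eq g with h | h
      · exact ⟨t, by rw [h, zpow_natCast, ht]⟩
      · exact ⟨t⁻¹, by rw [h, inv_zpow, zpow_neg, inv_inv, zpow_natCast, ht]⟩
    refine ⟨t', fun m => ?_⟩
    have : ev m ∈ AddMonoidHom.range ev := ⟨m, rfl⟩
    rw [hg, AddSubgroup.mem_closure_singleton] at this
    obtain ⟨n, hn⟩ := this
    have hn' : m.1 u = n * g := by
      have : ev m = m.1 u := rfl
      rw [← this, ← hn]; simp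
    have h := hχ (m - n • m₁) (by
      simp only [AddSubgroup.coe_sub, AddSubgroup.coe_zsmul, LinearMap.sub_apply,
        LinearMap.smul_apply, hm₁', hn']
      simp)
    rw [sub_eq_add_neg, ofAdd_add, ofAdd_neg, ofAdd_zsmul, map_mul, map_inv, map_zpow,
      mul_inv_eq_one] at h
    rw [h, hn', ← ht₀, ← ht', ← zpow_natCast, ← zpow_mul, ← zpow_mul]
    congr 1; ring

end Characters

/-! ### Polyhedra, the cones over them, and the fan -/

section Cones

variable {V : Type*} [AddCommGroup V] [Module ℚ V] {N : Submodule ℤ V} {P : Set (Set V)}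

theorem mem_coneOver {S : Set V} {x : V} (hx : x ∈ S) : (x, (1 : ℚ)) ∈ coneOver S :=
  fun _ hf => hf x hx

theorem nonneg_coneOver_iff {S : Set V} {f : Module.Dual ℚ (V × ℚ)} :
    (∀ y ∈ coneOver S, 0 ≤ f y) ↔ ∀ x ∈ S, 0 ≤ f (x, 1) :=
  ⟨fun h _ hx => h _ (mem_coneOver hx), fun h _ hy => hy f h⟩

theorem eq_zero_coneOver_iff {S : Set V} {f : Module.Dual ℚ (V × ℚ)} :
    (∀ y ∈ coneOver S, f y = 0) ↔ ∀ x ∈ S, f (x, 1) = 0 := by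
  refine ⟨fun h _ hx => h _ (mem_coneOver hx), fun h y hy => ?_⟩
  have h1 := hy f fun x hx => (h x hx).ge
  have h2 := hy (-f) fun x hx => by simp [h x hx]
  simp at h2
  exact le_antisymm h2 h1

theorem coneOver_add {S : Set V} {y z : V × ℚ} (hy : y ∈ coneOver S) (hz : z ∈ coneOver S) :
    y + z ∈ coneOver S := fun f hf => by
  rw [map_add]; exact add_nonneg (hy f hf) (hz f hf)

theorem coneOver_smul {S : Set V} {y : V × ℚ} (hy : y ∈ coneOver S) {a : ℚ} (ha : 0 ≤ a) :
    a • y ∈ coneOver S := fun f hf => by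
  rw [map_smul]; exact mul_nonneg ha (hy f hf)

theorem coneOver_mono {S T : Set V} (h : S ⊆ T) : coneOver S ⊆ coneOver T :=
  fun _ hy f hf => hy f fun x hx => hf x (h hx)

theorem snd_nonneg_of_mem_coneOver {S : Set V} {y : V × ℚ} (hy : y ∈ coneOver S) : 0 ≤ y.2 :=
  hy (LinearMap.snd ℚ V ℚ) fun _ _ => by simp

/-- Each inequality `⟨m, x⟩ ≥ c` homogenizes to a form on `V × ℚ` that is nonnegative on the cone.
So closing the cone adds no points at height one, and a polyhedron can be recovered from its cone.
-/
theorem IsPolyhedron.mem_of_mem_coneOver {S : Set V} (hS : IsPolyhedron S) {x : V}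
    (hx : (x, (1 : ℚ)) ∈ coneOver S) : x ∈ S := by
  obtain ⟨T, rfl⟩ := hS
  intro t ht
  have := hx (t.1 ∘ₗ LinearMap.fst ℚ V ℚ - t.2 • LinearMap.snd ℚ V ℚ) fun y hy => by
    simpa using hy t ht
  simpa using this

theorem IsPolyhedron.coneOver_inj {S T : Set V} (hS : IsPolyhedron S) (hT : IsPolyhedron T)
    (h : coneOver S = coneOver T) : S = T :=
  Set.Subset.antisymm (fun _ hx => hT.mem_of_mem_coneOver (h ▸ mem_coneOver hx))
    fun _ hx => hS.mem_of_mem_coneOver (h ▸ mem_coneOver hx)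

theorem isFace_refl {W : Type*} [AddCommGroup W] [Module ℚ W] {S : Set W} (h : S.Nonempty) :
    IsFace S S :=
  ⟨h, 0, 0, fun _ _ => by simp, by simp⟩

theorem IsFace.subset {W : Type*} [AddCommGroup W] [Module ℚ W] {F S : Set W} (h : IsFace F S) :
    F ⊆ S := by
  obtain ⟨-, m, c, -, rfl⟩ := h
  exact fun _ hx => hx.1

/-- By scaling, a linear form bounded below on a cone is nonnegative there, and a minimum that is
attained is zero. -/
theorem IsFace.exists_form {σ : Set (V × ℚ)} {S : Set V} (h : IsFace σ (coneOver S)) :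
    ∃ m : Module.Dual ℚ (V × ℚ), (∀ y ∈ coneOver S, 0 ≤ m y) ∧
      σ = {y ∈ coneOver S | m y = 0} := by
  obtain ⟨⟨y₀, hy₀⟩, m, c, hm, rfl⟩ := h
  have hc : c ≤ 0 := by
    have := hm ((0 : ℚ) • y₀) (coneOver_smul hy₀.1 le_rfl)
    simpa using this
  have hnn : ∀ y ∈ coneOver S, 0 ≤ m y := by
    intro y hy
    by_contra! hlt
    have := hm (((c - 1) / m y) • y)
      (coneOver_smul hy (div_nonneg_of_nonpos (by linarith) hlt.le))
    rw [map_smul, smul_eq_mul, div_mul_cancel₀ _ hlt.ne] at this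
    linarith
  have hc0 : c = 0 := le_antisymm hc (by rw [← hy₀.2]; exact hnn _ hy₀.1)
  exact ⟨m, hnn, by rw [hc0]⟩

theorem IsPolyhedralDecomposition.cone_mem_fan (hP : IsPolyhedralDecomposition P) {S : Set V}
    (hS : S ∈ P) : coneOver S ∈ fanOver P := by
  obtain ⟨v, hv⟩ := hP.strongly_convex S hS
  exact ⟨S, hS, isFace_refl ⟨_, mem_coneOver (hv.subset rfl)⟩⟩

/-- A cone of the fan that contains a point of height one is the cone over a cell. -/
theorem IsPolyhedralDecomposition.exists_cell (hP : IsPolyhedralDecomposition P)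
    {σ : Set (V × ℚ)} (hσ : σ ∈ fanOver P) {v : V} (hv : (v, (1 : ℚ)) ∈ σ) :
    ∃ T ∈ P, v ∈ T ∧ σ = coneOver T := by
  obtain ⟨S, hS, hface⟩ := hσ
  obtain ⟨m, hm, rfl⟩ := hface.exists_form
  have hSp := hP.polyhedron S hS
  have hvS : v ∈ S := hSp.mem_of_mem_coneOver hv.1
  set T : Set V := {x ∈ S | m (x, 1) = 0} with hT
  have hvT : v ∈ T := ⟨hvS, hv.2⟩
  have hTP : T ∈ P := by
    refine hP.face_mem S hS T ⟨⟨v, hvT⟩, m ∘ₗ LinearMap.inl ℚ V ℚ, - m (0, 1), ?_, ?_⟩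
    · intro x hx
      have h1 := hm _ (mem_coneOver hx)
      have h2 : ((x, 1) : V × ℚ) = (x, 0) + (0, 1) := by simp
      rw [h2, map_add] at h1
      simp; linarith
    · ext x
      simp only [hT, Set.mem_sep_iff, LinearMap.comp_apply, LinearMap.inl_apply]
      refine and_congr_right fun _ => ?_
      have h2 : ((x, 1) : V × ℚ) = (x, 0) + (0, 1) := by simp
      rw [h2, map_add]
      exact eq_neg_iff_add_eq_zero.symm
  refine ⟨T, hTP, hvT, Set.Subset.antisymm ?_ ?_⟩
  · rintro ⟨x, h⟩ ⟨hy, hy0⟩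
    have hh : 0 ≤ h := snd_nonneg_of_mem_coneOver hy
    rcases hh.eq_or_lt with rfl | hpos
    -- A point of height zero is a recession direction: the ray from `v` in direction `x` stays in
    -- `T`. A form that is nonnegative on `T` at height one cannot decrease along this ray.
    · intro f hf
      have hray : ∀ a : ℚ, 0 ≤ a → v + a • x ∈ T := by
        intro a ha
        have hmem : ((v + a • x, 1) : V × ℚ) = (v, 1) + a • (x, 0) := by simp
        refine ⟨hSp.mem_of_mem_coneOver ?_, ?_⟩
        · rw [hmem]; exact coneOver_add hv.1 (coneOver_smul hy ha)
        · rw [hmem, map_add, map_smul, hv.2, hy0]; simp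
      by_contra! hlt
      have hv0 := hf v hvT
      have := hf _ (hray ((f (v, 1) + 1) / (- f (x, 0))) (by
        apply div_nonneg <;> linarith))
      have hmem : ∀ a : ℚ, ((v + a • x, 1) : V × ℚ) = (v, 1) + a • (x, 0) := by intro a; simp
      rw [hmem, map_add, map_smul, smul_eq_mul, div_neg, neg_mul, div_mul_cancel₀ _ hlt.ne] at this
      linarith
    · have hxT : h⁻¹ • x ∈ T := by
        have hmem : ((h⁻¹ • x, 1) : V × ℚ) = h⁻¹ • (x, h) := by
          simp [inv_mul_cancel₀ hpos.ne']
        refine ⟨hSp.mem_of_mem_coneOver ?_, ?_⟩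
        · rw [hmem]; exact coneOver_smul hy (inv_nonneg.2 hh)
        · rw [hmem, map_smul, hy0, smul_zero]
      have : ((x, h) : V × ℚ) = h • (h⁻¹ • x, 1) := by
        simp [smul_smul, mul_inv_cancel₀ hpos.ne']
      rw [this]
      exact coneOver_smul (mem_coneOver hxT) hh
  · intro y hy
    exact ⟨coneOver_mono (fun x hx => hx.1) hy, (eq_zero_coneOver_iff.2 fun x hx => hx.2) y hy⟩

theorem IsPolyhedralDecomposition.singleton_isFace (hP : IsPolyhedralDecomposition P) {T : Set V}
    (hT : T ∈ P) {v : V} (hv : {v} ∈ P) (hvT : v ∈ T) : IsFace {v} T := by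
  have := (hP.inter_face T hT {v} hv ⟨v, hvT, rfl⟩).1
  rwa [Set.inter_eq_self_of_subset_right (Set.singleton_subset_iff.2 hvT)] at this

/-- The ray over a vertex of a cell is a face of the cone over the cell. -/
theorem IsPolyhedralDecomposition.cone_singleton_isFace (hP : IsPolyhedralDecomposition P)
    {T : Set V} (hT : T ∈ P) {v : V} (hv : {v} ∈ P) (hvT : v ∈ T) :
    IsFace (coneOver {v}) (coneOver T) := by
  have hTp := hP.polyhedron T hT
  obtain ⟨-, m, c, hm, hvm⟩ := hP.singleton_isFace hT hv hvT
  have hmv : m v = c := by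
    have : v ∈ ({v} : Set V) := rfl
    rw [hvm] at this
    exact this.2
  have huniq : ∀ x ∈ T, m x = c → x = v := by
    intro x hx hxc
    have : x ∈ ({v} : Set V) := by rw [hvm]; exact ⟨hx, hxc⟩
    exact this
  refine ⟨⟨_, mem_coneOver rfl⟩, m ∘ₗ LinearMap.fst ℚ V ℚ - c • LinearMap.snd ℚ V ℚ, 0, ?_, ?_⟩
  · rw [nonneg_coneOver_iff]
    intro x hx
    simpa using hm x hx
  · refine Set.Subset.antisymm ?_ ?_
    · intro y hy
      refine ⟨coneOver_mono (Set.singleton_subset_iff.2 hvT) hy, ?_⟩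
      refine (eq_zero_coneOver_iff.2 ?_) y hy
      rintro x rfl
      simp [hmv]
    · rintro ⟨x, h⟩ ⟨hy, hy0⟩
      simp only [LinearMap.sub_apply, LinearMap.comp_apply, LinearMap.fst_apply,
        LinearMap.smul_apply, LinearMap.snd_apply, smul_eq_mul] at hy0
      have hh : 0 ≤ h := snd_nonneg_of_mem_coneOver hy
      rcases hh.eq_or_lt with rfl | hpos
      · have h1 : v + x ∈ T := hTp.mem_of_mem_coneOver (by
          have : ((v + x, 1) : V × ℚ) = (v, 1) + (x, 0) := by simp
          rw [this]
          exact coneOver_add (mem_coneOver hvT) hy)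
        have h2 := huniq _ h1 (by rw [map_add, hmv]; linarith)
        have h3 : x = 0 := by simpa using h2
        subst h3
        have : ((0 : V), (0 : ℚ)) = (0 : ℚ) • (v, (1 : ℚ)) := by simp
        rw [this]
        exact coneOver_smul (mem_coneOver (Set.mem_singleton v)) le_rfl
      · have hmem : ((h⁻¹ • x, 1) : V × ℚ) = h⁻¹ • (x, h) := by
          simp [inv_mul_cancel₀ hpos.ne']
        have h1 : h⁻¹ • x ∈ T := hTp.mem_of_mem_coneOver (by
          rw [hmem]; exact coneOver_smul hy (inv_nonneg.2 hh))
        have h2 := huniq _ h1 (by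
          rw [map_smul, smul_eq_mul, inv_mul_eq_iff_eq_mul₀ hpos.ne']; linarith)
        have : ((x, h) : V × ℚ) = h • (v, 1) := by
          rw [← h2]; simp [smul_smul, mul_inv_cancel₀ hpos.ne']
        rw [this]
        exact coneOver_smul (mem_coneOver (Set.mem_singleton v)) hh

theorem mem_of_isFace_cone {v : V} {σ : Set (V × ℚ)} (h : IsFace (coneOver {v}) σ) :
    (v, (1 : ℚ)) ∈ σ := h.subset (mem_coneOver rfl)

/-- A common step size that respects all strict inequalities among finitely many; it is used to move
away from a point without violating the constraints that are not active there. -/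
theorem exists_pos_forall_mul_le {ι : Type*} (F : Finset ι) (a b : ι → ℚ) :
    ∃ ε : ℚ, 0 < ε ∧ ∀ i ∈ F, 0 < b i → ε * a i ≤ b i := by
  classical
  induction F using Finset.induction_on with
  | empty => exact ⟨1, one_pos, by simp⟩
  | insert j F _ ih =>
    obtain ⟨ε, hε, h⟩ := ih
    by_cases hj : 0 < b j
    · have hpos : 0 < b j / (|a j| + 1) := div_pos hj (by positivity)
      refine ⟨min ε (b j / (|a j| + 1)), lt_min hε hpos, fun i hi hbi => ?_⟩
      have hle : ∀ η x y : ℚ, 0 < η → 0 < y → (η * |x| ≤ y) → η * x ≤ y := fun η x y h1 _ h3 =>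
        le_trans (mul_le_mul_of_nonneg_left (le_abs_self x) h1.le) h3
      rcases Finset.mem_insert.1 hi with rfl | hi
      · refine hle _ _ _ (lt_min hε hpos) hbi ?_
        calc min ε (b i / (|a i| + 1)) * |a i| ≤ b i / (|a i| + 1) * (|a i| + 1) := by
              apply mul_le_mul (min_le_right _ _) (by linarith) (abs_nonneg _) hpos.le
          _ = b i := by field_simp
      · by_cases hai : 0 ≤ a i
        · exact (mul_le_mul_of_nonneg_right (min_le_left _ _) hai).trans (h i hi hbi)
        · push Not at hai
          have : min ε (b j / (|a j| + 1)) * a i ≤ 0 :=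
            mul_nonpos_of_nonneg_of_nonpos (lt_min hε hpos).le hai.le
          linarith
    · refine ⟨ε, hε, fun i hi hbi => ?_⟩
      rcases Finset.mem_insert.1 hi with rfl | hi
      · exact absurd hbi hj
      · exact h i hi hbi

/-- Every monomial that is invertible along the ray over the vertex `v` is a quotient of two such
monomials that are regular on the chart of a cone containing this ray. -/
theorem IsPolyhedralDecomposition.exists_regular_quotient [N.IsLattice ℚ]
    (hP : IsPolyhedralDecomposition P) {v : V} (hv : {v} ∈ P) {τ : Set (V × ℚ)}
    (hτ : τ ∈ fanOver P) (hvτ : (v, (1 : ℚ)) ∈ τ) (m : dualLattice (extLattice N))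
    (hm : m.1 (v, 1) = 0) :
    ∃ m₂ : dualLattice (extLattice N), m₂.1 (v, 1) = 0 ∧ (∀ y ∈ τ, 0 ≤ m₂.1 y) ∧
      ∀ y ∈ τ, 0 ≤ (m + m₂).1 y := by
  classical
  obtain ⟨T, hT, hvT, rfl⟩ := hP.exists_cell hτ hvτ
  obtain ⟨-, g, c, hg, hvg⟩ := hP.singleton_isFace hT hv hvT
  have hgv : g v = c := by
    have : v ∈ ({v} : Set V) := rfl
    rw [hvg] at this
    exact this.2
  obtain ⟨F, hF⟩ := hP.polyhedron T hT
  let φ : Module.Dual ℚ V × ℚ → Module.Dual ℚ (V × ℚ) :=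
    fun t => t.1 ∘ₗ LinearMap.fst ℚ V ℚ - t.2 • LinearMap.snd ℚ V ℚ
  have hφ : ∀ t x h, φ t (x, h) = t.1 x - t.2 * h := fun t x h => by simp [φ]
  let Fa := F.filter fun t => t.1 v = t.2
  have hφnn : ∀ t ∈ Fa, ∀ y ∈ coneOver T, 0 ≤ φ t y := by
    intro t ht
    rw [nonneg_coneOver_iff]
    intro x hx
    rw [hφ]
    rw [hF] at hx
    have := hx t (Finset.mem_filter.1 ht).1
    linarith
  have hspan : m.1 ∈ Submodule.span ℚ (Set.range fun t : Fa => φ t) := by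
    refine mem_span_of_iInf_ker_le_ker ?_
    rintro ⟨x, h⟩ hy
    simp only [Submodule.mem_iInf, LinearMap.mem_ker] at hy ⊢
    have hz : ∀ t ∈ Fa, t.1 (x - h • v) = 0 := by
      intro t ht
      have h1 := hy ⟨t, ht⟩
      rw [hφ] at h1
      rw [map_sub, map_smul, (Finset.mem_filter.1 ht).2, smul_eq_mul]
      linarith
    have hz0 : x - h • v = 0 := by
      by_contra hne
      set z := x - h • v
      obtain ⟨ε, hε, hεF⟩ := exists_pos_forall_mul_le F (fun t => |t.1 z|) (fun t => t.1 v - t.2)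
      have hmem : ∀ s : ℚ, |s| = ε → v + s • z ∈ T := by
        intro s hs
        rw [hF]
        intro t ht
        rw [map_add, map_smul, smul_eq_mul]
        have hvt : t.2 ≤ t.1 v := by
          rw [hF] at hvT; exact hvT t ht
        rcases hvt.eq_or_lt with heq | hlt
        · rw [hz t (Finset.mem_filter.2 ⟨ht, heq.symm⟩)]; linarith
        · have h1 := hεF t ht (by linarith)
          have h2 : |s * t.1 z| = ε * |t.1 z| := by rw [abs_mul, hs]
          have h3 := neg_abs_le (s * t.1 z)
          linarith
      have h1 := hmem ε (abs_of_pos hε)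
      have h2 := hmem (-ε) (by rw [abs_neg, abs_of_pos hε])
      have h3 := hg _ h1
      have h4 := hg _ h2
      rw [map_add, map_smul, smul_eq_mul] at h3 h4
      have h5 : ε * g z = 0 := by linarith
      have h6 : v + ε • z ∈ ({v} : Set V) := by
        rw [hvg]; exact ⟨h1, by rw [map_add, map_smul, smul_eq_mul, h5, hgv, add_zero]⟩
      have h7 : ε • z = 0 := by simpa using h6
      exact hne ((smul_eq_zero.1 h7).resolve_left hε.ne')
    have hx : ((x, h) : V × ℚ) = h • (v, 1) := by
      rw [sub_eq_zero] at hz0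
      simp [hz0]
    rw [hx, map_smul, hm, smul_zero]
  obtain ⟨a, ha⟩ := (Submodule.mem_span_range_iff_exists_fun ℚ).1 hspan
  -- A large integral multiple of the sum of the active forms compensates the negative coefficients
  -- of `m`; this is the denominator `m₂`.
  obtain ⟨K, hK, hKm⟩ := exists_pos_smul_integral (extLattice_fg N) (∑ t : Fa, φ t)
  obtain ⟨n, hn⟩ := exists_nat_ge (∑ t : Fa, |a t|)
  have hnK : (n : ℚ) • (K : ℚ) • (∑ t : Fa, φ t) ∈ dualLattice (extLattice N) := by
    rw [Nat.cast_smul_eq_nsmul]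
    exact AddSubgroup.nsmul_mem _ hKm n
  refine ⟨⟨_, hnK⟩, ?_, ?_, ?_⟩
  · simp only [LinearMap.smul_apply, LinearMap.sum_apply, smul_eq_mul]
    rw [Finset.sum_eq_zero fun t _ => ?_]
    · simp
    · rw [hφ, (Finset.mem_filter.1 t.2).2]; ring
  · intro y hy
    simp only [LinearMap.smul_apply, LinearMap.sum_apply, smul_eq_mul]
    have := Finset.sum_nonneg fun (t : Fa) (_ : t ∈ Finset.univ) => hφnn t t.2 y hy
    positivity
  · intro y hy
    have h1 : (m.1 + (n : ℚ) • (K : ℚ) • ∑ t : Fa, φ t) y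
        = ∑ t : Fa, (a t + n * K) * φ t y := by
      rw [LinearMap.add_apply, ← ha]
      simp only [LinearMap.smul_apply, LinearMap.sum_apply, smul_eq_mul, Finset.mul_sum]
      rw [← Finset.sum_add_distrib]
      refine Finset.sum_congr rfl fun t _ => by ring
    change 0 ≤ (m.1 + (n : ℚ) • (K : ℚ) • ∑ t : Fa, φ t) y
    rw [h1]
    refine Finset.sum_nonneg fun t _ => mul_nonneg ?_ (hφnn t t.2 y hy)
    have h2 : |a t| ≤ n :=
      (Finset.single_le_sum (f := fun t : Fa => |a t|) (fun _ _ => abs_nonneg _)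
        (Finset.mem_univ t)).trans hn
    have h3 : (1 : ℚ) ≤ K := by exact_mod_cast hK
    have h4 := neg_abs_le (a t)
    have h5 : (n : ℚ) * 1 ≤ n * K := mul_le_mul_of_nonneg_left h3 (Nat.cast_nonneg n)
    linarith

end Cones

/-! ### Cells on a line -/

section Segments

variable {V : Type*} [AddCommGroup V] [Module ℚ V] {N : Submodule ℤ V} {P : Set (Set V)}

/-- A vertex of `P` lying in a cell is a face of that cell. A linear form whose minimum is attained
at an inner point of a segment is constant on the segment, so this face would contain the whole
segment. -/
theorem IsPolyhedralDecomposition.no_vertex_between (hP : IsPolyhedralDecomposition P) {S : Set V}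
    (hS : S ∈ P) {x₀ u : V} (hu : u ≠ 0) {r s t : ℚ} (hr : x₀ + r • u ∈ S) (ht : x₀ + t • u ∈ S)
    (hrs : r < s) (hst : s < t) (hs : {x₀ + s • u} ∈ P) : False := by
  have hsS : x₀ + s • u ∈ S := by
    obtain ⟨F, rfl⟩ := hP.polyhedron S hS
    intro f hf
    have h1 := hr f hf
    have h2 := ht f hf
    simp only [map_add, map_smul, smul_eq_mul] at h1 h2 ⊢
    rcases le_total 0 (f.1 u) with h | h <;> nlinarith
  obtain ⟨-, m, c, hm, hc⟩ := hP.singleton_isFace hS hs hsS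
  have h0 : m (x₀ + s • u) = c := by
    have : x₀ + s • u ∈ ({x₀ + s • u} : Set V) := rfl
    rw [hc] at this
    exact this.2
  have h1 := hm _ hr
  have h2 := hm _ ht
  rw [← h0] at h1 h2
  simp only [map_add, map_smul, smul_eq_mul] at h1 h2
  have hmu : m u = 0 := by nlinarith
  have h3 : x₀ + r • u ∈ ({x₀ + s • u} : Set V) := by
    rw [hc]
    refine ⟨hr, ?_⟩
    rw [← h0]; simp [hmu]
  have h4 : r • u = s • u := by simpa using h3
  have h5 : (s - r) • u = 0 := by rw [sub_smul, h4, sub_self]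
  exact hu ((smul_eq_zero.1 h5).resolve_left (by linarith))

/-- Only inequalities whose form increases along `u` bound the parameter from below, and there is
one of them since otherwise all smaller parameters would be allowed. The largest of these bounds is
attained. -/
theorem IsPolyhedron.exists_min_param {S : Set V} (hS : IsPolyhedron S) {x₀ u : V} {t₀ L : ℚ}
    (ht₀ : x₀ + t₀ • u ∈ S) (hL : ∀ t : ℚ, x₀ + t • u ∈ S → L ≤ t) :
    ∃ a : ℚ, x₀ + a • u ∈ S ∧ ∀ t : ℚ, x₀ + t • u ∈ S → a ≤ t := by
  classical
  obtain ⟨F, rfl⟩ := hS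
  let Fp := F.filter fun f => 0 < f.1 u
  have hne : Fp.Nonempty := by
    by_contra hempty
    rw [Finset.not_nonempty_iff_eq_empty, Finset.filter_eq_empty_iff] at hempty
    have : L ≤ min t₀ (L - 1) := by
      refine hL _ fun f hf => ?_
      have h1 := ht₀ f hf
      have h2 := not_lt.1 (hempty hf)
      simp only [map_add, map_smul, smul_eq_mul] at h1 ⊢
      nlinarith [min_le_left t₀ (L - 1)]
    linarith [min_le_right t₀ (L - 1)]
  obtain ⟨g, hg, hmax⟩ := Finset.exists_max_image Fp (fun f => (f.2 - f.1 x₀) / f.1 u) hne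
  have hlow : ∀ t : ℚ, x₀ + t • u ∈ {x | ∀ t ∈ F, t.2 ≤ t.1 x} → (g.2 - g.1 x₀) / g.1 u ≤ t := by
    intro t ht
    have h1 := ht g (Finset.mem_filter.1 hg).1
    simp only [map_add, map_smul, smul_eq_mul] at h1
    rw [div_le_iff₀ (Finset.mem_filter.1 hg).2]
    linarith
  refine ⟨(g.2 - g.1 x₀) / g.1 u, fun f hf => ?_, hlow⟩
  simp only [map_add, map_smul, smul_eq_mul]
  by_cases hfu : 0 < f.1 u
  · have := hmax f (Finset.mem_filter.2 ⟨hf, hfu⟩)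
    rw [div_le_iff₀ hfu] at this
    linarith
  · have h1 := ht₀ f hf
    have h2 := hlow t₀ ht₀
    simp only [map_add, map_smul, smul_eq_mul] at h1
    push Not at hfu
    nlinarith

/-- The least parameter is singled out by a linear form with value one on `u`, so it gives a face,
and `P` is closed under faces. -/
theorem IsPolyhedralDecomposition.exists_min_vertex (hP : IsPolyhedralDecomposition P) {S : Set V}
    (hS : S ∈ P) {x₀ u : V} (hu : u ≠ 0) (hline : ∀ x ∈ S, ∃ t : ℚ, x = x₀ + t • u) {t₀ L : ℚ}
    (ht₀ : x₀ + t₀ • u ∈ S) (hL : ∀ t : ℚ, x₀ + t • u ∈ S → L ≤ t) :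
    ∃ a : ℚ, x₀ + a • u ∈ S ∧ {x₀ + a • u} ∈ P ∧ ∀ t : ℚ, x₀ + t • u ∈ S → a ≤ t := by
  obtain ⟨a, haS, ha⟩ := (hP.polyhedron S hS).exists_min_param ht₀ hL
  refine ⟨a, haS, ?_, ha⟩
  obtain ⟨m, hm⟩ : ∃ m : Module.Dual ℚ V, m u ≠ 0 := by
    by_contra! hcon
    exact hu ((Module.forall_dual_apply_eq_zero_iff ℚ u).1 hcon)
  have hmu : ((m u)⁻¹ • m) u = 1 := by simp [hm]
  refine hP.face_mem S hS _ ⟨⟨_, rfl⟩, (m u)⁻¹ • m, ((m u)⁻¹ • m) (x₀ + a • u), ?_, ?_⟩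
  · intro x hx
    obtain ⟨t, rfl⟩ := hline x hx
    rw [map_add, map_add, map_smul, map_smul, hmu]
    simpa using ha t hx
  · ext x
    constructor
    · rintro rfl
      exact ⟨haS, rfl⟩
    · rintro ⟨hx, hxe⟩
      obtain ⟨t, rfl⟩ := hline x hx
      rw [map_add, map_add, map_smul, map_smul, hmu] at hxe
      have : t = a := by simpa using hxe
      rw [this]; rfl

theorem IsPolyhedron.eventually_notMem {S : Set V} (hS : IsPolyhedron S) {x₀ : V} (u : V)
    (hx : x₀ ∉ S) : ∀ᶠ δ in nhdsWithin (0 : ℚ) (Set.Ioi 0), x₀ + δ • u ∉ S := by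
  obtain ⟨F, rfl⟩ := hS
  have : ∃ f ∈ F, f.1 x₀ < f.2 := by
    by_contra! hcon
    exact hx hcon
  obtain ⟨f, hf, hlt⟩ := this
  have hcont : Filter.Tendsto (fun δ : ℚ => f.1 x₀ + δ * f.1 u) (nhdsWithin (0 : ℚ) (Set.Ioi 0))
      (nhds (f.1 x₀ + 0 * f.1 u)) :=
    Filter.Tendsto.mono_left (Continuous.tendsto (by fun_prop) 0) nhdsWithin_le_nhds
  rw [zero_mul, add_zero] at hcont
  filter_upwards [hcont.eventually (gt_mem_nhds hlt)] with δ hδ hmem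
  have := hmem f hf
  rw [map_add, map_smul, smul_eq_mul] at this
  linarith

/-- Each of the finitely many cells that miss `x₀` also misses `x₀ + δ • u` for all small positive
`δ`. Hence a one-dimensional cell containing such a point contains `x₀` as well. -/
theorem IsPolyhedralDecomposition.exists_cell_germ (hP : IsPolyhedralDecomposition P) {x₀ u : V}
    {δ₀ : ℚ} (hδ₀ : 0 < δ₀)
    (h : ∀ δ : ℚ, 0 ≤ δ → δ ≤ δ₀ → x₀ + δ • u ∈ ⋃₀ {S ∈ P | dimension S = 1}) :
    ∃ S ∈ P, dimension S = 1 ∧ x₀ ∈ S ∧ ∃ δ : ℚ, 0 < δ ∧ δ ≤ δ₀ ∧ x₀ + δ • u ∈ S := by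
  have h1 : ∀ᶠ δ in nhdsWithin (0 : ℚ) (Set.Ioi 0), ∀ S ∈ P, x₀ ∉ S → x₀ + δ • u ∉ S := by
    rw [Filter.eventually_all_finite hP.finite]
    intro S hS
    by_cases hx : x₀ ∈ S
    · exact Filter.Eventually.of_forall fun δ h => absurd hx h
    · filter_upwards [(hP.polyhedron S hS).eventually_notMem u hx] with δ hδ _ using hδ
  have h2 : ∀ᶠ δ in nhdsWithin (0 : ℚ) (Set.Ioi 0), δ ≤ δ₀ :=
    nhdsWithin_le_nhds (ge_mem_nhds hδ₀)
  have h3 : ∀ᶠ δ in nhdsWithin (0 : ℚ) (Set.Ioi 0), 0 < δ := eventually_mem_nhdsWithin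
  obtain ⟨δ, hδ1, hδ2, hδ3⟩ := (h1.and (h2.and h3)).exists
  obtain ⟨S, ⟨hS, hdim⟩, hmem⟩ := h δ hδ3.le hδ2
  refine ⟨S, hS, hdim, ?_, δ, hδ3, hδ2, hmem⟩
  by_contra hx
  exact hδ1 S hS hx hmem

theorem exists_smul_of_dimension_one {S : Set V} (hS : dimension S = 1) {x₀ u : V} {s t : ℚ}
    (hs : x₀ + s • u ∈ S) (ht : x₀ + t • u ∈ S) (hst : s ≠ t) (hu : u ≠ 0) {x : V} (hx : x ∈ S) :
    ∃ r : ℚ, x = x₀ + r • u := by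
  have h1 : (x₀ + t • u) - (x₀ + s • u) ∈ vectorSpan ℚ S := vsub_mem_vectorSpan ℚ ht hs
  have h2 : x - (x₀ + s • u) ∈ vectorSpan ℚ S := vsub_mem_vectorSpan ℚ hx hs
  have h3 : (x₀ + t • u) - (x₀ + s • u) = (t - s) • u := by rw [sub_smul]; abel
  have h4 : (t - s) • u ≠ 0 := smul_ne_zero (sub_ne_zero.2 hst.symm) hu
  rw [h3] at h1
  obtain ⟨c, hc⟩ := (finrank_eq_one_iff_of_nonzero' (⟨_, h1⟩ : vectorSpan ℚ S)
    (fun h => h4 (congrArg Subtype.val h))).1 hS ⟨_, h2⟩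
  have hc' : c • (t - s) • u = x - (x₀ + s • u) := congrArg Subtype.val hc
  refine ⟨s + c * (t - s), ?_⟩
  rw [add_smul, mul_smul, hc']; abel

end Segments

/-! ### Subdivision of the edges of a tropical curve into cells -/

namespace TropicalCurve

variable {V : Type*} [AddCommGroup V] [Module ℚ V] {N : Submodule ℤ V} (Γ : TropicalCurve N)
  {P : Set (Set V)}

/-- The length of a bounded edge, measured by its primitive direction vector. -/
def blen (b : Γ.BEdge) : ℚ := (Γ.length b).choose

theorem blen_pos (b : Γ.BEdge) : 0 < Γ.blen b := (Γ.length b).choose_spec.1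

theorem pos_tgt (b : Γ.BEdge) :
    Γ.pos (Γ.tgt b) = Γ.pos (Γ.src b) + Γ.blen b • (Γ.bdir b : V) := by
  rw [blen, ← (Γ.length b).choose_spec.2]; simp

/-- The value `⊤` for unbounded edges lets both kinds of edges be treated as intervals of parameters
starting at zero. -/
def edgeLen : Γ.Edge → WithTop ℚ
  | .inl b => (Γ.blen b : ℚ)
  | .inr _ => ⊤

theorem edgeLen_pos (E : Γ.Edge) : (0 : ℚ) < Γ.edgeLen E := by
  cases E with
  | inl b => exact WithTop.coe_lt_coe.2 (Γ.blen_pos b)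
  | inr e => exact WithTop.coe_lt_top 0

def edgePoint (E : Γ.Edge) (t : ℚ) : V := Γ.pos (Γ.tail E) + t • (Γ.dir E : V)

theorem dir_primitive (E : Γ.Edge) : IsPrimitive (Γ.dir E) := by
  cases E with
  | inl b => exact Γ.bdir_primitive b
  | inr e => exact Γ.udir_primitive e

theorem dir_ne_zero (E : Γ.Edge) : (Γ.dir E : V) ≠ 0 := (Γ.dir_primitive E).coe_ne_zero

theorem weight_pos (E : Γ.Edge) : 0 < Γ.weight E := by
  cases E with
  | inl b => exact Γ.bweight_pos b
  | inr e => exact Γ.uweight_pos e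

@[simp]
theorem edgePoint_zero (E : Γ.Edge) : Γ.edgePoint E 0 = Γ.pos (Γ.tail E) := by
  simp [edgePoint]

@[simp]
theorem edgePoint_blen (b : Γ.BEdge) : Γ.edgePoint (.inl b) (Γ.blen b) = Γ.pos (Γ.tgt b) :=
  (Γ.pos_tgt b).symm

theorem edgePoint_injective (E : Γ.Edge) : Function.Injective (Γ.edgePoint E) := by
  intro s t h
  have h1 : s • (Γ.dir E : V) = t • (Γ.dir E : V) := by simpa [edgePoint] using h
  have h5 : (s - t) • (Γ.dir E : V) = 0 := by rw [sub_smul, h1, sub_self]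
  have := (smul_eq_zero.1 h5).resolve_right (Γ.dir_ne_zero E)
  linarith

theorem edgePoint_add (E : Γ.Edge) (s t : ℚ) :
    Γ.edgePoint E (s + t) = Γ.edgePoint E s + t • (Γ.dir E : V) := by
  simp [edgePoint, add_smul, add_assoc]

theorem mem_edgeImage {E : Γ.Edge} {x : V} :
    x ∈ Γ.edgeImage E ↔ ∃ t : ℚ, 0 ≤ t ∧ t ≤ Γ.edgeLen E ∧ x = Γ.edgePoint E t := by
  cases E with
  | inl b =>
    simp only [edgeImage, edgeLen, edgePoint, tail, dir, WithTop.coe_le_coe]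
    rw [segment_eq_image', Γ.pos_tgt, add_sub_cancel_left]
    have hpos := Γ.blen_pos b
    constructor
    · rintro ⟨θ, ⟨h0, h1⟩, rfl⟩
      refine ⟨θ * Γ.blen b, by positivity, ?_, by rw [mul_smul]⟩
      nlinarith
    · rintro ⟨t, h0, h1, rfl⟩
      refine ⟨t / Γ.blen b, ⟨by positivity, (div_le_one hpos).2 h1⟩, ?_⟩
      simp only [smul_smul, div_mul_cancel₀ _ hpos.ne']
  | inr e => simp [edgeImage, edgeLen, edgePoint, tail, dir]

theorem mem_openCell {E : Γ.Edge} {x : V} :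
    x ∈ Γ.openCell (.inr E) ↔ ∃ t : ℚ, 0 < t ∧ t < Γ.edgeLen E ∧ x = Γ.edgePoint E t := by
  cases E with
  | inl b =>
    simp only [openCell, edgeLen, edgePoint, tail, dir, WithTop.coe_lt_coe]
    rw [openSegment_eq_image', Γ.pos_tgt, add_sub_cancel_left]
    have hpos := Γ.blen_pos b
    constructor
    · rintro ⟨θ, ⟨h0, h1⟩, rfl⟩
      refine ⟨θ * Γ.blen b, by positivity, ?_, by rw [mul_smul]⟩
      nlinarith
    · rintro ⟨t, h0, h1, rfl⟩
      refine ⟨t / Γ.blen b, ⟨by positivity, (div_lt_one hpos).2 h1⟩, ?_⟩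
      simp only [smul_smul, div_mul_cancel₀ _ hpos.ne']
  | inr e => simp [openCell, edgeLen, edgePoint, tail, dir]

/-- The image of the part of an edge between the parameters `a` and `b`. -/
def edgeInterval (E : Γ.Edge) (a : ℚ) (b : WithTop ℚ) : Set V :=
  {x | ∃ t : ℚ, a ≤ t ∧ t ≤ b ∧ x = Γ.edgePoint E t}

theorem mem_edgeInterval {E : Γ.Edge} {a : ℚ} {b : WithTop ℚ} {t : ℚ} :
    Γ.edgePoint E t ∈ Γ.edgeInterval E a b ↔ a ≤ t ∧ t ≤ b := by
  constructor
  · rintro ⟨s, h1, h2, h⟩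
    rw [Γ.edgePoint_injective E h]
    exact ⟨h1, h2⟩
  · rintro ⟨h1, h2⟩
    exact ⟨t, h1, h2, rfl⟩

/-- The part of the edge between the parameters `a` and `b` is a cell of the decomposition. -/
structure IsEdgeCell (P : Set (Set V)) (E : Γ.Edge) (a : ℚ) (b : WithTop ℚ) : Prop where
  nonneg : 0 ≤ a
  lt : a < b
  le : b ≤ Γ.edgeLen E
  mem : Γ.edgeInterval E a b ∈ P
  left : {Γ.edgePoint E a} ∈ P
  right : ∀ b' : ℚ, b = b' → {Γ.edgePoint E b'} ∈ P

variable {Γ}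

theorem vertex_tail {l : ℕ} {A : Fin l → AffineSubspace ℚ V} (hA : IsAdapted P Γ A) (E : Γ.Edge) :
    {Γ.edgePoint E 0} ∈ P := by
  rw [edgePoint_zero]; exact hA.vert _

theorem vertex_len {l : ℕ} {A : Fin l → AffineSubspace ℚ V} (hA : IsAdapted P Γ A) {E : Γ.Edge}
    {b : ℚ} (hb : Γ.edgeLen E = b) : {Γ.edgePoint E b} ∈ P := by
  cases E with
  | inl c =>
    have : b = Γ.blen c := (WithTop.coe_injective hb).symm
    rw [this, edgePoint_blen]; exact hA.vert _
  | inr e => exact absurd hb (by simp [edgeLen])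

/-- The ends of the edge are vertices of `P`, and no vertex lies strictly inside a cell. So a cell
on the line of `E` that shares two points with `E` cannot extend beyond it. Its own ends are found
by applying `exists_min_vertex` in both directions. -/
theorem exists_isEdgeCell_of_subset (hP : IsPolyhedralDecomposition P) {l : ℕ}
    {A : Fin l → AffineSubspace ℚ V} (hA : IsAdapted P Γ A) {E : Γ.Edge} {S : Set V} (hS : S ∈ P)
    (hline : ∀ x ∈ S, ∃ t : ℚ, x = Γ.edgePoint E t) {s t : ℚ} (hs0 : 0 ≤ s) (hst : s < t)
    (ht : t ≤ Γ.edgeLen E) (hsS : Γ.edgePoint E s ∈ S) (htS : Γ.edgePoint E t ∈ S) :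
    ∃ (a : ℚ) (b : WithTop ℚ), Γ.IsEdgeCell P E a b ∧ S = Γ.edgeInterval E a b ∧ a ≤ s ∧
      t ≤ b := by
  have hu := Γ.dir_ne_zero E
  have hconv : ∀ r₁ r r₂ : ℚ, r₁ ≤ r → r ≤ r₂ → Γ.edgePoint E r₁ ∈ S → Γ.edgePoint E r₂ ∈ S →
      Γ.edgePoint E r ∈ S := by
    intro r₁ r r₂ h1 h2 hr₁ hr₂
    obtain ⟨F, hF⟩ := hP.polyhedron S hS
    rw [hF] at hr₁ hr₂ ⊢
    intro f hf
    have h3 := hr₁ f hf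
    have h4 := hr₂ f hf
    simp only [edgePoint, map_add, map_smul, smul_eq_mul] at h3 h4 ⊢
    rcases le_total 0 (f.1 (Γ.dir E : V)) with h | h <;> nlinarith
  have hlow : ∀ r : ℚ, Γ.edgePoint E r ∈ S → 0 ≤ r := by
    intro r hr
    by_contra! hneg
    exact hP.no_vertex_between hS hu hr htS hneg (hs0.trans_lt hst) (vertex_tail hA E)
  obtain ⟨a, haS, haP, hamin⟩ := hP.exists_min_vertex hS hu hline hsS hlow
  have has := hamin s hsS
  by_cases hbdd : ∃ L : ℚ, ∀ r : ℚ, Γ.edgePoint E r ∈ S → r ≤ L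
  · obtain ⟨L, hL⟩ := hbdd
    have hneg : ∀ r : ℚ, Γ.pos (Γ.tail E) + r • (-(Γ.dir E : V)) = Γ.edgePoint E (-r) := by
      intro r; simp [edgePoint]
    obtain ⟨b, hbS, hbP, hbmax⟩ := hP.exists_min_vertex hS (neg_ne_zero.2 hu)
      (x₀ := Γ.pos (Γ.tail E)) (t₀ := -t) (L := -L)
      (by intro x hx
          obtain ⟨r, rfl⟩ := hline x hx
          exact ⟨-r, by rw [hneg, neg_neg]⟩)
      (by rw [hneg, neg_neg]; exact htS)
      (by intro r hr
          rw [hneg] at hr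
          linarith [hL _ hr])
    rw [hneg] at hbS hbP
    have htb : t ≤ -b := by
      have := hbmax (-t) (by rw [hneg, neg_neg]; exact htS)
      linarith
    refine ⟨a, ((-b : ℚ) : WithTop ℚ), ⟨hamin a haS |>.trans' (hlow a haS), ?_, ?_, ?_, haP, ?_⟩, ?_,
      has, WithTop.coe_le_coe.2 htb⟩
    · exact WithTop.coe_lt_coe.2 (by linarith)
    · by_contra! hlt
      cases hE : Γ.edgeLen E with
      | top => rw [hE] at hlt; exact absurd hlt (not_lt.2 le_top)
      | coe c =>
        rw [hE] at hlt ht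
        exact hP.no_vertex_between hS hu hsS hbS
          (hst.trans_le (WithTop.coe_le_coe.1 ht)) (WithTop.coe_lt_coe.1 hlt) (vertex_len hA hE)
    · convert hS using 1
      ext x
      constructor
      · rintro ⟨r, h1, h2, rfl⟩
        exact hconv a r (-b) h1 (WithTop.coe_le_coe.1 h2) haS hbS
      · intro hx
        obtain ⟨r, rfl⟩ := hline x hx
        refine ⟨r, hamin r hx, WithTop.coe_le_coe.2 ?_, rfl⟩
        have := hbmax (-r) (by rw [hneg, neg_neg]; exact hx)
        linarith
    · intro b' hb'
      rw [← WithTop.coe_injective hb']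
      exact hbP
    · ext x
      constructor
      · intro hx
        obtain ⟨r, rfl⟩ := hline x hx
        refine ⟨r, hamin r hx, WithTop.coe_le_coe.2 ?_, rfl⟩
        have := hbmax (-r) (by rw [hneg, neg_neg]; exact hx)
        linarith
      · rintro ⟨r, h1, h2, rfl⟩
        exact hconv a r (-b) h1 (WithTop.coe_le_coe.1 h2) haS hbS
  · push Not at hbdd
    have htop : Γ.edgeLen E = ⊤ := by
      cases hE : Γ.edgeLen E with
      | top => rfl
      | coe c =>
        exfalso
        obtain ⟨r, hr, hrc⟩ := hbdd c
        rw [hE] at ht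
        exact hP.no_vertex_between hS hu hsS hr
          (hst.trans_le (WithTop.coe_le_coe.1 ht)) hrc (vertex_len hA hE)
    have hset : S = Γ.edgeInterval E a ⊤ := by
      ext x
      constructor
      · intro hx
        obtain ⟨r, rfl⟩ := hline x hx
        exact ⟨r, hamin r hx, le_top, rfl⟩
      · rintro ⟨r, h1, -, rfl⟩
        obtain ⟨r', hr', hrr'⟩ := hbdd r
        exact hconv a r r' h1 hrr'.le haS hr'
    exact ⟨a, ⊤, ⟨hlow a haS, WithTop.coe_lt_top a, htop ▸ le_rfl, hset ▸ hS, haP,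
      fun b' hb' => absurd hb' (by simp)⟩, hset, has, le_top⟩

/-- The edge lies in the union of the one-dimensional cells, and `exists_cell_germ` selects one that
contains both the point `s` and a point shortly after it. -/
theorem exists_isEdgeCell_forward (hP : IsPolyhedralDecomposition P) {l : ℕ}
    {A : Fin l → AffineSubspace ℚ V} (hA : IsAdapted P Γ A) {E : Γ.Edge} {s : ℚ} (hs0 : 0 ≤ s)
    (hs : s < Γ.edgeLen E) :
    ∃ (a : ℚ) (b : WithTop ℚ), Γ.IsEdgeCell P E a b ∧ a ≤ s ∧ s < b := by
  obtain ⟨δ₀, hδ₀, hδ₀le⟩ : ∃ δ₀ : ℚ, 0 < δ₀ ∧ ((s + δ₀ : ℚ) : WithTop ℚ) ≤ Γ.edgeLen E := by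
    cases hE : Γ.edgeLen E with
    | top => exact ⟨1, one_pos, le_top⟩
    | coe c =>
      rw [hE] at hs
      have := WithTop.coe_lt_coe.1 hs
      exact ⟨c - s, by linarith, WithTop.coe_le_coe.2 (by linarith)⟩
  obtain ⟨S, hS, hdim, hsS, δ, hδ, hδle, hδS⟩ := hP.exists_cell_germ hδ₀ (x₀ := Γ.edgePoint E s)
    (u := Γ.dir E) (by
      intro δ h0 h1
      rw [← edgePoint_add]
      refine hA.edge E (Γ.mem_edgeImage.2 ⟨s + δ, by linarith, ?_, rfl⟩)
      exact (WithTop.coe_le_coe.2 (by linarith)).trans hδ₀le)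
  rw [← edgePoint_add] at hδS
  obtain ⟨a, b, hab, -, ha, hb⟩ := exists_isEdgeCell_of_subset hP hA hS (E := E) (s := s)
    (t := s + δ) (fun x hx => exists_smul_of_dimension_one hdim hsS hδS (by linarith)
      (Γ.dir_ne_zero E) hx) hs0 (by linarith)
      ((WithTop.coe_le_coe.2 (by linarith)).trans hδ₀le) hsS hδS
  exact ⟨a, b, hab, ha, lt_of_lt_of_le (WithTop.coe_lt_coe.2 (by linarith)) hb⟩

theorem exists_isEdgeCell_backward (hP : IsPolyhedralDecomposition P) {l : ℕ}
    {A : Fin l → AffineSubspace ℚ V} (hA : IsAdapted P Γ A) {E : Γ.Edge} {s : ℚ} (hs0 : 0 < s)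
    (hs : s ≤ Γ.edgeLen E) :
    ∃ (a : ℚ) (b : WithTop ℚ), Γ.IsEdgeCell P E a b ∧ a < s ∧ s ≤ b := by
  have hneg : ∀ δ : ℚ, Γ.edgePoint E s + δ • (-(Γ.dir E : V)) = Γ.edgePoint E (s - δ) := by
    intro δ
    rw [sub_eq_add_neg, edgePoint_add]; simp
  obtain ⟨S, hS, hdim, hsS, δ, hδ, hδle, hδS⟩ := hP.exists_cell_germ hs0 (x₀ := Γ.edgePoint E s)
    (u := -(Γ.dir E : V)) (by
      intro δ h0 h1
      rw [hneg]
      refine hA.edge E (Γ.mem_edgeImage.2 ⟨s - δ, by linarith, ?_, rfl⟩)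
      exact (WithTop.coe_le_coe.2 (by linarith)).trans hs)
  rw [hneg] at hδS
  obtain ⟨a, b, hab, -, ha, hb⟩ := exists_isEdgeCell_of_subset hP hA hS (E := E) (s := s - δ)
    (t := s) (fun x hx => exists_smul_of_dimension_one hdim hδS hsS (by linarith)
      (Γ.dir_ne_zero E) hx) (by linarith) (by linarith) hs hδS hsS
  exact ⟨a, b, hab, by linarith, hb⟩

theorem IsEdgeCell.not_between (hP : IsPolyhedralDecomposition P) {E : Γ.Edge} {a : ℚ}
    {b : WithTop ℚ} (h : Γ.IsEdgeCell P E a b) {t : ℚ} (hat : a < t) (htb : t < b)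
    (ht : {Γ.edgePoint E t} ∈ P) : False := by
  obtain ⟨r, htr, hrb⟩ : ∃ r : ℚ, t < r ∧ (r : WithTop ℚ) ≤ b := by
    cases b with
    | top => exact ⟨t + 1, by linarith, le_top⟩
    | coe c => exact ⟨c, WithTop.coe_lt_coe.1 htb, le_rfl⟩
  exact hP.no_vertex_between h.mem (Γ.dir_ne_zero E)
    (Γ.mem_edgeInterval.2 ⟨le_rfl, h.lt.le⟩)
    (Γ.mem_edgeInterval.2 ⟨by linarith, hrb⟩) hat htr ht

theorem IsEdgeCell.right_unique (hP : IsPolyhedralDecomposition P) {E : Γ.Edge} {a : ℚ}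
    {b b' : WithTop ℚ} (h : Γ.IsEdgeCell P E a b) (h' : Γ.IsEdgeCell P E a b') : b = b' := by
  by_contra hne
  wlog hlt : b < b' generalizing b b'
  · exact this h' h (Ne.symm hne) (lt_of_le_of_ne (not_lt.1 hlt) (Ne.symm hne))
  cases b with
  | top => exact absurd hlt (not_lt.2 le_top)
  | coe c => exact h'.not_between hP (WithTop.coe_lt_coe.1 h.lt) hlt (h.right c rfl)

theorem IsEdgeCell.left_unique (hP : IsPolyhedralDecomposition P) {E : Γ.Edge} {a a' : ℚ}
    {b : WithTop ℚ} (h : Γ.IsEdgeCell P E a b) (h' : Γ.IsEdgeCell P E a' b) : a = a' := by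
  by_contra hne
  wlog hlt : a < a' generalizing a a'
  · exact this h' h (Ne.symm hne) (lt_of_le_of_ne (not_lt.1 hlt) (Ne.symm hne))
  exact h.not_between hP hlt h'.lt h'.left

/-- At a vertex of the decomposition on an edge there is a cell in forward direction. -/
theorem exists_isEdgeCell_right (hP : IsPolyhedralDecomposition P) {l : ℕ}
    {A : Fin l → AffineSubspace ℚ V} (hA : IsAdapted P Γ A) {E : Γ.Edge} {s : ℚ} (hs0 : 0 ≤ s)
    (hs : s < Γ.edgeLen E) (hsP : {Γ.edgePoint E s} ∈ P) :
    ∃ b : WithTop ℚ, Γ.IsEdgeCell P E s b := by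
  obtain ⟨a, b, hab, ha, hb⟩ := exists_isEdgeCell_forward hP hA hs0 hs
  rcases ha.eq_or_lt with rfl | hlt
  · exact ⟨b, hab⟩
  · exact (hab.not_between hP hlt hb hsP).elim

/-- At a vertex of the decomposition on an edge there is a cell in backward direction. -/
theorem exists_isEdgeCell_left (hP : IsPolyhedralDecomposition P) {l : ℕ}
    {A : Fin l → AffineSubspace ℚ V} (hA : IsAdapted P Γ A) {E : Γ.Edge} {s : ℚ} (hs0 : 0 < s)
    (hs : s ≤ Γ.edgeLen E) (hsP : {Γ.edgePoint E s} ∈ P) :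
    ∃ a : ℚ, Γ.IsEdgeCell P E a s := by
  obtain ⟨a, b, hab, ha, hb⟩ := exists_isEdgeCell_backward hP hA hs0 hs
  rcases hb.eq_or_lt with rfl | hlt
  · exact ⟨a, hab⟩
  · exact (hab.not_between hP ha hlt hsP).elim

end TropicalCurve

/-! ### Trees: cochains and numbers of vertices and edges -/

namespace TropicalCurve

variable {V : Type*} [AddCommGroup V] [Module ℚ V] {N : Submodule ℤ V} (Γ : TropicalCurve N)

theorem eq_of_forall_edge {α : Type*} (f : Γ.Vert → α) (h : ∀ b, f (Γ.tgt b) = f (Γ.src b))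
    (x y : Γ.Vert) : f x = f y := by
  induction Γ.connected x y with
  | rel x y hxy =>
    obtain ⟨b, rfl, rfl⟩ := hxy
    exact (h b).symm
  | refl x => rfl
  | symm x y _ ih => exact ih.symm
  | trans x y z _ _ ih₁ ih₂ => exact ih₁.trans ih₂

/-- The differences of a function on the vertices along the bounded edges. -/
def coboundary : (Γ.Vert → ℚ) →ₗ[ℚ] (Γ.BEdge → ℚ) :=
  LinearMap.pi fun b =>
    (LinearMap.proj (Γ.tgt b) : (Γ.Vert → ℚ) →ₗ[ℚ] ℚ) - LinearMap.proj (Γ.src b)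

@[simp]
theorem coboundary_apply (f : Γ.Vert → ℚ) (b : Γ.BEdge) :
    Γ.coboundary f b = f (Γ.tgt b) - f (Γ.src b) := rfl

/-- By connectedness the kernel consists of the constants, and a rational curve has one bounded edge
less than vertices. This linear form of being a tree is inherited by subgraphs and contractions. -/
theorem coboundary_surjective (hrat : Γ.IsRational) : Function.Surjective Γ.coboundary := by
  obtain ⟨x₀⟩ := Γ.nonempty
  have hker : Module.finrank ℚ (LinearMap.ker Γ.coboundary) ≤ 1 := by
    refine finrank_le_one ⟨fun _ => 1, by rw [LinearMap.mem_ker]; ext b; simp⟩ ?_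
    rintro ⟨f, hf⟩
    refine ⟨f x₀, Subtype.ext (funext fun x => ?_)⟩
    have : f x₀ = f x := Γ.eq_of_forall_edge f (fun b => by
      have := congrFun (LinearMap.mem_ker.1 hf) b
      simp at this
      linarith) x₀ x
    simp [this]
  have h1 := LinearMap.finrank_range_add_finrank_ker Γ.coboundary
  rw [Module.finrank_fintype_fun_eq_card] at h1
  rw [← LinearMap.range_eq_top]
  refine Submodule.eq_top_of_finrank_eq (le_antisymm (Submodule.finrank_le _) ?_)
  rw [Module.finrank_fintype_fun_eq_card]
  unfold IsRational at hrat
  omega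

theorem sum_valency :
    ∑ x : Γ.Vert, ((Finset.univ.filter fun b => Γ.src b = x).card
      + (Finset.univ.filter fun b => Γ.tgt b = x).card
      + (Finset.univ.filter fun e => Γ.base e = x).card)
    = 2 * Fintype.card Γ.BEdge + Fintype.card Γ.UEdge := by
  rw [Finset.sum_add_distrib, Finset.sum_add_distrib,
    ← Finset.card_eq_sum_card_fiberwise (fun _ _ => Finset.mem_coe.2 (Finset.mem_univ _)),
    ← Finset.card_eq_sum_card_fiberwise (fun _ _ => Finset.mem_coe.2 (Finset.mem_univ _)),
    ← Finset.card_eq_sum_card_fiberwise (fun _ _ => Finset.mem_coe.2 (Finset.mem_univ _)),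
    Finset.card_univ, Finset.card_univ]
  ring

/-- Counting flags gives three times the number of vertices as twice the number of bounded edges
plus the number of unbounded ones; the tree relation eliminates the bounded edges. -/
theorem card_vert_of_isTrivalent (hrat : Γ.IsRational) (htri : Γ.IsTrivalent) :
    Fintype.card Γ.Vert + 2 = Fintype.card Γ.UEdge := by
  have h := Γ.sum_valency
  rw [Finset.sum_congr rfl fun x _ => htri x] at h
  simp only [Finset.sum_const, Finset.card_univ, smul_eq_mul] at h
  unfold IsRational at hrat
  omega

theorem card_uedge_of_hasDegree {Δ : N →₀ ℕ} (h : Γ.HasDegree Δ) :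
    Fintype.card Γ.UEdge = Δ.sum fun _ c => c := by
  classical
  have hmem : ∀ e : Γ.UEdge, Γ.uweight e • Γ.udir e ∈ Δ.support := fun e => by
    rw [Finsupp.mem_support_iff, ← h]
    have : Nonempty {e' : Γ.UEdge // Γ.uweight e' • Γ.udir e' = Γ.uweight e • Γ.udir e} :=
      ⟨⟨e, rfl⟩⟩
    exact Nat.card_ne_zero.2 ⟨inferInstance, inferInstance⟩
  rw [← Finset.card_univ, Finset.card_eq_sum_card_fiberwise (t := Δ.support)
    (f := fun e => Γ.uweight e • Γ.udir e) (fun e _ => hmem e), Finsupp.sum]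
  refine Finset.sum_congr rfl fun v _ => ?_
  rw [← h v, Nat.card_eq_fintype_card, Fintype.card_subtype]

end TropicalCurve

/-! ### Contracting the edges of length zero -/

section Contraction

variable {V : Type*} [AddCommGroup V] [Module ℚ V] {N : Submodule ℤ V}

theorem sum_filter_fiber {X Q B G : Type*} [Fintype X] [DecidableEq X] [DecidableEq Q] [Fintype B]
    [AddCommMonoid G] (π : X → Q)
    (s : B → X) (f : B → G) (q : Q) :
    ∑ x ∈ Finset.univ.filter (fun x => π x = q), ∑ b ∈ Finset.univ.filter (fun b => s b = x), f b
      = ∑ b ∈ Finset.univ.filter (fun b => π (s b) = q), f b := by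
  simp only [Finset.sum_filter]
  have : ∀ x, (if π x = q then ∑ b, if s b = x then f b else 0 else 0)
      = ∑ b, if s b = x then (if π x = q then f b else 0) else 0 := by
    intro x
    split_ifs with h <;> simp
  simp_rw [this]
  rw [Finset.sum_comm]
  refine Finset.sum_congr rfl fun b _ => ?_
  simp

theorem sum_filter_split {Q B G : Type*} [Fintype B] [DecidableEq Q] [AddCommMonoid G]
    (p : B → Prop) [DecidablePred p]
    (s : B → Q) (f : B → G) (q : Q) :
    ∑ b ∈ Finset.univ.filter (fun b => s b = q), f b
      = ∑ b ∈ Finset.univ.filter (fun b : {b // ¬ p b} => s b = q), f b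
        + ∑ b ∈ Finset.univ.filter (fun b : {b // p b} => s b = q), f b := by
  simp only [Finset.sum_filter]
  rw [add_comm]
  exact (Fintype.sum_subtype_add_sum_subtype p fun b => if s b = q then f b else 0).symm

namespace TropicalCurve

variable (Γ : TropicalCurve N) (ℓ : Γ.BEdge → ℚ)

/-- Two vertices are equivalent if they are connected by edges of length zero. -/
def zeroSetoid : Setoid Γ.Vert :=
  Relation.EqvGen.setoid fun x y => ∃ b, ℓ b = 0 ∧ Γ.src b = x ∧ Γ.tgt b = y

theorem zeroSetoid_src_tgt {b : Γ.BEdge} (hb : ℓ b = 0) :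
    (Quotient.mk (Γ.zeroSetoid ℓ) (Γ.src b)) = Quotient.mk (Γ.zeroSetoid ℓ) (Γ.tgt b) :=
  Quotient.sound (Relation.EqvGen.rel _ _ ⟨b, hb, rfl, rfl⟩)

theorem eq_of_zeroSetoid {α : Type*} (f : Γ.Vert → α)
    (hf : ∀ b, ℓ b = 0 → f (Γ.tgt b) = f (Γ.src b)) {x y : Γ.Vert} (h : (Γ.zeroSetoid ℓ) x y) :
    f x = f y := by
  change Relation.EqvGen _ x y at h
  induction h with
  | rel x y hxy =>
    obtain ⟨b, hb, rfl, rfl⟩ := hxy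
    exact (hf b hb).symm
  | refl x => rfl
  | symm x y _ ih => exact ih.symm
  | trans x y z _ _ ih₁ ih₂ => exact ih₁.trans ih₂

open scoped Classical in
-- The edges of length zero in one class form a forest: their coboundary is surjective because that
-- of `Γ` is, and its kernel contains the constants.
theorem card_zero_edges_lt (hrat : Γ.IsRational) (q : Quotient (Γ.zeroSetoid ℓ)) :
    (Finset.univ.filter fun b : {b // ℓ b = 0} =>
        (Quotient.mk (Γ.zeroSetoid ℓ) (Γ.src b)) = q).card + 1
      ≤ (Finset.univ.filter fun x => Quotient.mk (Γ.zeroSetoid ℓ) x = q).card := by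
  let X := {x // Quotient.mk (Γ.zeroSetoid ℓ) x = q}
  let Z := {b : {b // ℓ b = 0} // (Quotient.mk (Γ.zeroSetoid ℓ) (Γ.src b)) = q}
  let ψ : (X → ℚ) →ₗ[ℚ] (Z → ℚ) := LinearMap.pi fun z =>
    (LinearMap.proj (⟨Γ.tgt z.1, by rw [← Γ.zeroSetoid_src_tgt ℓ z.1.2]; exact z.2⟩ : X) :
      (X → ℚ) →ₗ[ℚ] ℚ) - LinearMap.proj (⟨Γ.src z.1, z.2⟩ : X)
  have hψ : Function.Surjective ψ := by
    intro c
    obtain ⟨f, hf⟩ := Γ.coboundary_surjective hrat fun b =>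
      if h : ∃ z : Z, z.1.1 = b then c h.choose else 0
    refine ⟨fun x => f x.1, funext fun z => ?_⟩
    have h1 := congrFun hf z.1.1
    have hex : ∃ z' : Z, z'.1.1 = z.1.1 := ⟨z, rfl⟩
    rw [dif_pos hex] at h1
    have h2 : hex.choose = z := Subtype.ext (Subtype.ext hex.choose_spec)
    rw [h2] at h1
    exact h1
  obtain ⟨x₀, hx₀⟩ := Quotient.exists_rep q
  have h1 := LinearMap.finrank_range_add_finrank_ker ψ
  rw [LinearMap.range_eq_top.2 hψ, finrank_top, Module.finrank_fintype_fun_eq_card,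
    Module.finrank_fintype_fun_eq_card] at h1
  have h2 : 0 < Module.finrank ℚ (LinearMap.ker ψ) := by
    have : Nontrivial (LinearMap.ker ψ) := by
      refine ⟨⟨⟨fun _ => 1, by rw [LinearMap.mem_ker]; ext z; simp [ψ]⟩, 0, fun h => ?_⟩⟩
      have := congrFun (congrArg Subtype.val h) ⟨x₀, hx₀⟩
      simp at this
    exact Module.finrank_pos
  rw [← Fintype.card_subtype, ← Fintype.card_subtype]
  change Fintype.card Z + 1 ≤ Fintype.card X
  omega

open scoped Classical in
-- Functions on the quotient are the functions on the vertices that are constant along the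
-- contracted edges. As the coboundary onto these edges is surjective, each contracted edge removes
-- exactly one vertex, so the Euler characteristic is preserved.
theorem card_zero_quotient (hrat : Γ.IsRational) :
    Fintype.card {b // ¬ ℓ b = 0} + 1 = Fintype.card (Quotient (Γ.zeroSetoid ℓ)) := by
  let ψ : (Γ.Vert → ℚ) →ₗ[ℚ] ({b // ℓ b = 0} → ℚ) := LinearMap.pi fun z =>
    (LinearMap.proj (Γ.tgt z.1) : (Γ.Vert → ℚ) →ₗ[ℚ] ℚ) - LinearMap.proj (Γ.src z.1)
  have hψ : Function.Surjective ψ := by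
    intro c
    obtain ⟨f, hf⟩ := Γ.coboundary_surjective hrat fun b => if h : ℓ b = 0 then c ⟨b, h⟩ else 0
    refine ⟨f, funext fun z => ?_⟩
    have h1 := congrFun hf z.1
    rw [dif_pos z.2] at h1
    exact h1
  let π : Γ.Vert → Quotient (Γ.zeroSetoid ℓ) := Quotient.mk _
  have hπ : LinearMap.range (LinearMap.funLeft ℚ ℚ π) = LinearMap.ker ψ := by
    refine le_antisymm ?_ ?_
    · rintro _ ⟨f, rfl⟩
      rw [LinearMap.mem_ker]
      ext z
      simp [ψ, π, LinearMap.funLeft, Γ.zeroSetoid_src_tgt ℓ z.2]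
    · intro f hf
      refine ⟨Quotient.lift f fun x y h => Γ.eq_of_zeroSetoid ℓ f (fun b hb => ?_) h, ?_⟩
      · have := congrFun (LinearMap.mem_ker.1 hf) ⟨b, hb⟩
        exact sub_eq_zero.1 this
      · ext x; rfl
  have h1 := LinearMap.finrank_range_add_finrank_ker ψ
  rw [LinearMap.range_eq_top.2 hψ, finrank_top, Module.finrank_fintype_fun_eq_card,
    Module.finrank_fintype_fun_eq_card, ← hπ, LinearMap.finrank_range_of_inj
      (LinearMap.funLeft_injective_of_surjective ℚ ℚ π Quotient.mk_surjective),
    Module.finrank_fintype_fun_eq_card] at h1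
  have h2 := Fintype.card_subtype_compl fun b => ℓ b = 0
  have h3 := Fintype.card_subtype_le fun b => ℓ b = 0
  unfold IsRational at hrat
  omega

variable {ℓ}

open scoped Classical in
-- A class with `r` vertices has `3 * r` flags, of which each contracted edge uses two. There are at
-- most `r - 1` such edges, which leaves at least `r + 2` flags.
theorem three_le_valency_quotient (hrat : Γ.IsRational) (htri : Γ.IsTrivalent)
    (q : Quotient (Γ.zeroSetoid ℓ)) :
    3 ≤ (Finset.univ.filter fun b : {b // ¬ ℓ b = 0} =>
          Quotient.mk (Γ.zeroSetoid ℓ) (Γ.src b) = q).card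
      + (Finset.univ.filter fun b : {b // ¬ ℓ b = 0} =>
          Quotient.mk (Γ.zeroSetoid ℓ) (Γ.tgt b) = q).card
      + (Finset.univ.filter fun e => Quotient.mk (Γ.zeroSetoid ℓ) (Γ.base e) = q).card := by
  have h1 : ∑ x ∈ Finset.univ.filter (fun x => Quotient.mk (Γ.zeroSetoid ℓ) x = q),
      (∑ b ∈ Finset.univ.filter (fun b => Γ.src b = x), 1
        + ∑ b ∈ Finset.univ.filter (fun b => Γ.tgt b = x), 1
        + ∑ e ∈ Finset.univ.filter (fun e => Γ.base e = x), 1)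
      = ∑ x ∈ Finset.univ.filter (fun x => Quotient.mk (Γ.zeroSetoid ℓ) x = q), 3 := by
    refine Finset.sum_congr rfl fun x _ => ?_
    rw [← Finset.card_eq_sum_ones, ← Finset.card_eq_sum_ones, ← Finset.card_eq_sum_ones]
    convert htri x
  rw [Finset.sum_add_distrib, Finset.sum_add_distrib, sum_filter_fiber, sum_filter_fiber,
    sum_filter_fiber, sum_filter_split (fun b => ℓ b = 0),
    sum_filter_split (fun b => ℓ b = 0)] at h1
  have h2 : (Finset.univ.filter fun b : {b // ℓ b = 0} =>
      Quotient.mk (Γ.zeroSetoid ℓ) (Γ.tgt b) = q) = Finset.univ.filter fun b : {b // ℓ b = 0} =>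
      Quotient.mk (Γ.zeroSetoid ℓ) (Γ.src b) = q :=
    Finset.filter_congr fun b _ => by rw [Γ.zeroSetoid_src_tgt ℓ b.2]
  rw [h2] at h1
  have h3 := Γ.card_zero_edges_lt ℓ hrat q
  simp only [Finset.sum_const, smul_eq_mul, mul_one] at h1
  omega

open scoped Classical in
/-- The tropical curve obtained from a deformation `p` of the positions of the vertices of a
trivalent rational curve by contracting all edges whose length `ℓ` has become zero. -/
def contract (hrat : Γ.IsRational) (htri : Γ.IsTrivalent) (hℓ : ∀ b, 0 ≤ ℓ b) (p : Γ.Vert → V)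
    (hp : ∀ b, p (Γ.tgt b) - p (Γ.src b) = ℓ b • (Γ.bdir b : V)) : TropicalCurve N where
  Vert := Quotient (Γ.zeroSetoid ℓ)
  BEdge := {b // ¬ ℓ b = 0}
  UEdge := Γ.UEdge
  src b := Quotient.mk _ (Γ.src b)
  tgt b := Quotient.mk _ (Γ.tgt b)
  base e := Quotient.mk _ (Γ.base e)
  bweight b := Γ.bweight b
  uweight := Γ.uweight
  pos := Quotient.lift p fun x y h => Γ.eq_of_zeroSetoid ℓ p (fun b hb => by
    have := hp b
    rwa [hb, zero_smul, sub_eq_zero] at this) h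
  bdir b := Γ.bdir b
  udir := Γ.udir
  bweight_pos b := Γ.bweight_pos b
  uweight_pos := Γ.uweight_pos
  bdir_primitive b := Γ.bdir_primitive b
  udir_primitive := Γ.udir_primitive
  length b := ⟨ℓ b, lt_of_le_of_ne (hℓ b) (Ne.symm b.2), hp b⟩
  nonempty := Γ.nonempty.map (Quotient.mk _)
  connected := by
    intro x y
    induction x using Quotient.inductionOn with | _ x
    induction y using Quotient.inductionOn with | _ y
    induction Γ.connected x y with
    | rel x y hxy =>
      obtain ⟨b, rfl, rfl⟩ := hxy
      by_cases hb : ℓ b = 0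
      · rw [Γ.zeroSetoid_src_tgt ℓ hb]
        exact Relation.EqvGen.refl _
      · exact Relation.EqvGen.rel _ _ ⟨⟨b, hb⟩, rfl, rfl⟩
    | refl x => exact Relation.EqvGen.refl _
    | symm x y _ ih => exact Relation.EqvGen.symm _ _ ih
    | trans x y z _ _ ih₁ ih₂ => exact Relation.EqvGen.trans _ _ _ ih₁ ih₂
  valency q := by
    have := Γ.three_le_valency_quotient (ℓ := ℓ) hrat htri q
    simp only [Set.mem_insert_iff, Set.mem_singleton_iff, not_or]
    omega
  balanced q := by
    -- Sum the balancing conditions over the class. A contracted edge has both ends in the same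
    -- class, so its two contributions cancel.
    have h1 : ∑ x ∈ Finset.univ.filter (fun x => Quotient.mk (Γ.zeroSetoid ℓ) x = q),
        ((∑ b ∈ Finset.univ.filter (fun b => Γ.src b = x), Γ.bweight b • Γ.bdir b)
          - (∑ b ∈ Finset.univ.filter (fun b => Γ.tgt b = x), Γ.bweight b • Γ.bdir b)
          + ∑ e ∈ Finset.univ.filter (fun e => Γ.base e = x), Γ.uweight e • Γ.udir e) = 0 := by
      refine Finset.sum_eq_zero fun x _ => ?_
      convert Γ.balanced x
    rw [Finset.sum_add_distrib, Finset.sum_sub_distrib, sum_filter_fiber, sum_filter_fiber,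
      sum_filter_fiber, sum_filter_split (fun b => ℓ b = 0),
      sum_filter_split (fun b => ℓ b = 0)] at h1
    have h2 : (Finset.univ.filter fun b : {b // ℓ b = 0} =>
        Quotient.mk (Γ.zeroSetoid ℓ) (Γ.tgt b) = q) = Finset.univ.filter fun b : {b // ℓ b = 0} =>
        Quotient.mk (Γ.zeroSetoid ℓ) (Γ.src b) = q :=
      Finset.filter_congr fun b _ => by rw [Γ.zeroSetoid_src_tgt ℓ b.2]
    rw [h2, add_sub_add_right_eq_sub] at h1
    exact h1

theorem contract_isRational (hrat : Γ.IsRational) (htri : Γ.IsTrivalent) (hℓ : ∀ b, 0 ≤ ℓ b)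
    (p : Γ.Vert → V) (hp : ∀ b, p (Γ.tgt b) - p (Γ.src b) = ℓ b • (Γ.bdir b : V)) :
    (Γ.contract hrat htri hℓ p hp).IsRational := by
  exact Γ.card_zero_quotient ℓ hrat

theorem exists_mem_edgeImage (x : Γ.Vert)
    (h : 0 < (Finset.univ.filter fun b => Γ.src b = x).card
      + (Finset.univ.filter fun b => Γ.tgt b = x).card
      + (Finset.univ.filter fun e => Γ.base e = x).card) :
    ∃ E : Γ.Edge, Γ.pos x ∈ Γ.edgeImage E := by
  by_contra! hcon
  rw [Finset.card_eq_zero.2, Finset.card_eq_zero.2, Finset.card_eq_zero.2] at h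
  · omega
  all_goals
    refine Finset.filter_eq_empty_iff.2 ?_
    rintro b - rfl
  · exact hcon (.inr b) (Γ.mem_edgeImage.2 ⟨0, le_rfl, (Γ.edgeLen_pos _).le, by simp [tail]⟩)
  · exact hcon (.inl b) (Γ.mem_edgeImage.2 ⟨Γ.blen b, (Γ.blen_pos b).le, le_rfl, by simp⟩)
  · exact hcon (.inl b) (Γ.mem_edgeImage.2 ⟨0, le_rfl, (Γ.edgeLen_pos _).le, by simp [tail]⟩)

end TropicalCurve

end Contraction

/-! ### The lattice map: injectivity and finite index -/

section LatticeMap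

variable {V : Type*} [AddCommGroup V] [Module ℚ V] {N : Submodule ℤ V}

/-- Moving along a line, finitely many positive affine functions that are not all constant stay
nonnegative until one of them vanishes. -/
theorem exists_first_zero {J : Type*} [Finite J] (α β : J → ℚ) (hα : ∀ j, 0 < α j)
    (hβ : ∃ j, β j ≠ 0) : ∃ t : ℚ, (∀ j, 0 ≤ α j + t * β j) ∧ ∃ j, α j + t * β j = 0 := by
  classical
  have := Fintype.ofFinite J
  wlog hneg : ∃ j, β j < 0 generalizing β
  · obtain ⟨j, hj⟩ := hβ
    obtain ⟨t, h1, h2⟩ := this (fun j => -β j) ⟨j, neg_ne_zero.2 hj⟩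
      ⟨j, neg_lt_zero.2 (lt_of_le_of_ne (not_lt.1 fun h => hneg ⟨j, h⟩) hj.symm)⟩
    exact ⟨-t, fun j => by have := h1 j; linarith, by
      obtain ⟨i, hi⟩ := h2; exact ⟨i, by linarith⟩⟩
  obtain ⟨j₀, hj₀⟩ := hneg
  obtain ⟨i, hi, hmin⟩ := Finset.exists_min_image (Finset.univ.filter fun j => β j < 0)
    (fun j => α j / (-β j)) ⟨j₀, by simpa using hj₀⟩
  have hi' : β i < 0 := by simpa using hi
  have hpos : 0 < α i / (-β i) := div_pos (hα i) (by linarith)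
  refine ⟨α i / (-β i), fun j => ?_, i, ?_⟩
  · rcases lt_or_ge (β j) 0 with h | h
    · have h1 := hmin j (by simpa using h)
      rw [le_div_iff₀ (by linarith)] at h1
      linarith
    · have := hα j
      positivity
  · rw [div_neg, neg_mul, div_mul_cancel₀ _ hi'.ne, add_neg_cancel]

theorem exists_marking {l : ℕ} {A : Fin l → AffineSubspace ℚ V} {Γ : TropicalCurve N}
    {E : Fin l → Γ.Edge} (hmatch : Γ.Matches E A) (hpos : ∀ (x : Γ.Vert) (i : Fin l), Γ.pos x ∉ A i)
    (i : Fin l) : ∃ s : ℚ, 0 < s ∧ s < Γ.edgeLen (E i) ∧ Γ.edgePoint (E i) s ∈ A i := by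
  obtain ⟨x, hx, hxA⟩ := hmatch i
  obtain ⟨s, h0, h1, rfl⟩ := Γ.mem_edgeImage.1 hx
  refine ⟨s, lt_of_le_of_ne h0 ?_, lt_of_le_of_ne h1 ?_, hxA⟩
  · rintro rfl
    rw [Γ.edgePoint_zero] at hxA
    exact hpos _ i hxA
  · intro hs
    cases hE : E i with
    | inl b =>
      rw [hE] at hs hxA
      rw [WithTop.coe_injective hs, Γ.edgePoint_blen] at hxA
      exact hpos _ i hxA
    | inr e =>
      rw [hE] at hs
      exact WithTop.coe_ne_top hs

/-- Otherwise the marked point could be slid along its edge inside `A i` until it reaches the tail,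
a vertex. -/
theorem dir_notMem_direction {l : ℕ} {A : Fin l → AffineSubspace ℚ V} {Γ : TropicalCurve N}
    {E : Fin l → Γ.Edge} (hmatch : Γ.Matches E A) (hpos : ∀ (x : Γ.Vert) (i : Fin l), Γ.pos x ∉ A i)
    (i : Fin l) : (Γ.dir (E i) : V) ∉ (A i).direction := by
  intro hmem
  obtain ⟨s, -, -, hs⟩ := exists_marking hmatch hpos i
  apply hpos (Γ.tail (E i)) i
  have := AffineSubspace.vadd_mem_of_mem_direction
    (Submodule.smul_mem _ (-s) hmem) hs
  simpa [TropicalCurve.edgePoint] using this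

/-- A kernel element deforms the curve while preserving directions and incidences. Following the
deformation to the first degeneration contradicts generality unless nothing changes, and then the
deformation is a translation preserving all `A i`. -/
theorem latticeMap_injective {Δ : N →₀ ℕ} {l : ℕ} {d : Fin l → ℕ}
    {A : Fin l → AffineSubspace ℚ V} (hgen : IsGeneral N Δ d A) (hdir : ⨅ i, (A i).direction = ⊥)
    (Γ : TropicalCurve N) (E : Fin l → Γ.Edge) (hrat : Γ.IsRational) (hdeg : Γ.HasDegree Δ)
    (hmatch : Γ.Matches E A) : Function.Injective (Γ.latticeMap E A) := by
  classical
  obtain ⟨htri, hpos, -, -⟩ := hgen.2 Γ E hrat hdeg hmatch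
  choose s hs0 hs1 hsA using exists_marking hmatch hpos
  rw [injective_iff_map_eq_zero]
  intro g hg
  have hb : ∀ b, ∃ c : ℤ, c • Γ.bdir b = g (Γ.tgt b) - g (Γ.src b) := fun b => by
    have := congrFun (congrArg Prod.fst hg) b
    exact Submodule.mem_span_singleton.1 ((Submodule.Quotient.mk_eq_zero _).1 this)
  choose lam hlam using hb
  have hi : ∀ i, ∃ c : ℚ, (g (Γ.tail (E i)) : V) + c • (Γ.dir (E i) : V) ∈ (A i).direction :=
    fun i => by
      have := congrFun (congrArg Prod.snd hg) i
      have h1 : g (Γ.tail (E i)) ∈ TropicalCurve.incidenceLattice (Γ.dir (E i)) (A i) :=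
        (Submodule.Quotient.mk_eq_zero _).1 this
      obtain ⟨y, hy, z, hz, hyz⟩ := Submodule.mem_sup.1 h1
      obtain ⟨c, rfl⟩ := Submodule.mem_span_singleton.1 hy
      refine ⟨-c, ?_⟩
      have h2 : (g (Γ.tail (E i)) : V) = c • (Γ.dir (E i) : V) + z := hyz.symm
      rw [h2]
      simpa using hz
  choose sig hsig using hi
  have hlamV : ∀ b, (g (Γ.tgt b) : V) - g (Γ.src b) = (lam b : ℚ) • (Γ.bdir b : V) := fun b => by
    have := congrArg (fun x : N => (x : V)) (hlam b)
    simp only [Submodule.coe_smul, Submodule.coe_sub] at this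
    rw [← this, Int.cast_smul_eq_zsmul]
  -- The quantities that have to stay positive: the lengths of the edges and the distances of each
  -- marked point from the tail and from the head of its edge. On an unbounded edge there is no
  -- head, and the last quantity is the constant one. The function `β` records their derivatives.
  let α : Γ.BEdge ⊕ Fin l ⊕ Fin l → ℚ
    | .inl b => Γ.blen b
    | .inr (.inl i) => s i
    | .inr (.inr i) => match E i with
      | .inl b => Γ.blen b - s i
      | .inr _ => 1
  let β : Γ.BEdge ⊕ Fin l ⊕ Fin l → ℚ
    | .inl b => lam b
    | .inr (.inl i) => sig i
    | .inr (.inr i) => match E i with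
      | .inl b => lam b - sig i
      | .inr _ => 0
  have hα : ∀ j, 0 < α j := by
    rintro (b | i | i)
    · exact Γ.blen_pos b
    · exact hs0 i
    · have := hs1 i
      simp only [α]
      cases hE : E i with
      | inl b =>
        rw [hE] at this
        exact sub_pos.2 (WithTop.coe_lt_coe.1 this)
      | inr e => exact one_pos
  by_cases hβ : ∃ j, β j ≠ 0
  · exfalso
    obtain ⟨t, htnn, j, hj⟩ := exists_first_zero α β hα hβ
    let ℓ : Γ.BEdge → ℚ := fun b => Γ.blen b + t * lam b
    let p : Γ.Vert → V := fun x => Γ.pos x + t • (g x : V)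
    have hp : ∀ b, p (Γ.tgt b) - p (Γ.src b) = ℓ b • (Γ.bdir b : V) := fun b => by
      simp only [p, ℓ, add_smul, mul_smul, ← hlamV b, Γ.pos_tgt b, smul_sub]
      abel
    have hℓ : ∀ b, 0 ≤ ℓ b := fun b => htnn (.inl b)
    let Γ' := Γ.contract hrat htri hℓ p hp
    have hmarkA : ∀ i, p (Γ.tail (E i)) + (s i + t * sig i) • (Γ.dir (E i) : V) ∈ A i := by
      intro i
      have h1 := AffineSubspace.vadd_mem_of_mem_direction
        (Submodule.smul_mem _ t (hsig i)) (hsA i)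
      convert h1 using 1
      simp only [p, TropicalCurve.edgePoint, vadd_eq_add, smul_add, add_smul, mul_smul]
      abel
    have hmark0 : ∀ i, 0 ≤ s i + t * sig i := fun i => htnn (.inr (.inl i))
    have hmark1 : ∀ i b, E i = .inl b → s i + t * sig i ≤ ℓ b := fun i b hE => by
      have := htnn (.inr (.inr i))
      simp only [α, β, hE] at this
      simp only [ℓ]
      linarith
    -- The degenerate curve still matches `A`. If the marked edge has been contracted, the marked
    -- point has become the image of a vertex, and any edge through that vertex serves.
    have hedge : ∀ i, ∃ E' : Γ'.Edge, (Γ'.edgeImage E' ∩ A i).Nonempty := by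
      intro i
      have hA := hmarkA i
      cases hE : E i with
      | inl b =>
        rw [hE] at hA
        by_cases hb : ℓ b = 0
        · have h0 : s i + t * sig i = 0 := le_antisymm (hb ▸ hmark1 i b hE) (hmark0 i)
          rw [h0, zero_smul, add_zero] at hA
          obtain ⟨E', hE'⟩ := Γ'.exists_mem_edgeImage (Quotient.mk _ (Γ.src b))
            (lt_of_lt_of_le (by norm_num)
              (Γ.three_le_valency_quotient (ℓ := ℓ) hrat htri (Quotient.mk _ (Γ.src b))))
          exact ⟨E', _, hE', hA⟩
        · refine ⟨.inl ⟨b, hb⟩, _, ?_, hA⟩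
          have hb0 : 0 < ℓ b := lt_of_le_of_ne (hℓ b) (Ne.symm hb)
          change _ ∈ segment ℚ (p (Γ.src b)) (p (Γ.tgt b))
          rw [segment_eq_image', hp]
          refine ⟨(s i + t * sig i) / ℓ b, ⟨div_nonneg (hmark0 i) hb0.le,
            (div_le_one hb0).2 (hmark1 i b hE)⟩, ?_⟩
          simp only [smul_smul, div_mul_cancel₀ _ hb0.ne']
          rfl
      | inr e =>
        rw [hE] at hA
        exact ⟨.inr e, _, ⟨_, hmark0 i, rfl⟩, hA⟩
    choose E' hE' using hedge
    obtain ⟨htri', hpos', -, -⟩ := hgen.2 Γ' E' (Γ.contract_isRational hrat htri hℓ p hp) hdeg hE'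
    -- The unbounded edges have not changed, and for trivalent trees they determine the number of
    -- vertices. So no edge can have been contracted.
    have hnz : ∀ b, ℓ b ≠ 0 := by
      have h1 := Γ.card_vert_of_isTrivalent hrat htri
      have h2 := Γ'.card_vert_of_isTrivalent (Γ.contract_isRational hrat htri hℓ p hp) htri'
      have h3 : Fintype.card Γ'.UEdge = Fintype.card Γ.UEdge := rfl
      have h4 : Fintype.card Γ'.BEdge + 1 = Fintype.card Γ'.Vert :=
        Γ.contract_isRational hrat htri hℓ p hp
      have h5 : Fintype.card Γ.BEdge + 1 = Fintype.card Γ.Vert := hrat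
      intro b hb
      have h6 : Fintype.card {b // ¬ ℓ b = 0} < Fintype.card Γ.BEdge :=
        Fintype.card_subtype_lt (x := b) (by simpa using hb)
      have h7 : Fintype.card Γ'.BEdge = Fintype.card {b // ¬ ℓ b = 0} := rfl
      omega
    -- Whichever quantity has vanished, it is not a length; then a marked point has reached an end
    -- of its edge, and this vertex lies in `A i`.
    rcases j with b | i | i
    · exact hnz b hj
    · have hA := hmarkA i
      have : s i + t * sig i = 0 := hj
      rw [this, zero_smul, add_zero] at hA
      exact hpos' (Quotient.mk _ (Γ.tail (E i))) i hA
    · have hA := hmarkA i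
      cases hE : E i with
      | inl b =>
        simp only [α, β, hE] at hj
        rw [hE] at hA
        have : s i + t * sig i = ℓ b := by simp only [ℓ]; linarith
        rw [this] at hA
        refine hpos' (Quotient.mk _ (Γ.tgt b)) i ?_
        change p (Γ.tgt b) ∈ A i
        have h2 := hp b
        rw [sub_eq_iff_eq_add'] at h2
        rw [h2]
        exact hA
      | inr e =>
        simp only [α, β, hE] at hj
        norm_num at hj
  -- No quantity changes, so `g` is constant along the edges, and its value is parallel to every `A
  -- i`.
  · push Not at hβ
    have hconst : ∀ x y, g x = g y := Γ.eq_of_forall_edge g fun b => by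
      have h1 : (lam b : ℚ) = 0 := hβ (.inl b)
      have h2 : lam b = 0 := by exact_mod_cast h1
      have := hlam b
      rw [h2, zero_smul] at this
      exact (sub_eq_zero.1 this.symm)
    ext x
    have hmem : (g x : V) ∈ ⨅ i, (A i).direction := by
      rw [Submodule.mem_iInf]
      intro i
      have h1 : sig i = 0 := hβ (.inr (.inl i))
      have h2 := hsig i
      rw [h1, zero_smul, add_zero] at h2
      rwa [hconst x (Γ.tail (E i))]
    rw [hdir, Submodule.mem_bot] at hmem
    exact hmem

/-- The lattice points of a rational subspace. -/
def subspaceLattice (N : Submodule ℤ V) (U : Submodule ℚ V) : Submodule ℤ N :=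
  (U.restrictScalars ℤ).comap N.subtype

theorem span_primitive_eq [N.IsLattice ℚ] {u : N} (hu : IsPrimitive u) :
    Submodule.span ℤ {u} = subspaceLattice N (Submodule.span ℚ {(u : V)}) := by
  refine le_antisymm ?_ ?_
  · rw [Submodule.span_singleton_le_iff_mem]
    exact Submodule.mem_span_singleton_self (R := ℚ) (u : V)
  · intro x hx
    obtain ⟨a, ha⟩ := Submodule.mem_span_singleton.1 (show (x : V) ∈ Submodule.span ℚ {(u : V)} from hx)
    obtain ⟨m, hm⟩ := hu.exists_dual_eq_one
    refine Submodule.mem_span_singleton.2 ⟨m x, Subtype.ext ?_⟩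
    have h1 : (m x : ℚ) = a := by
      rw [← extendQ_apply m x, ← ha, map_smul, extendQ_apply, hm]; simp
    rw [Submodule.coe_smul, ← Int.cast_smul_eq_zsmul ℚ, h1, ha]

/-- The quotient by the lattice points of a subspace `U` embeds into the quotient by `U`. -/
def quotientEmbedding (N : Submodule ℤ V) (U : Submodule ℚ V) :
    (N ⧸ subspaceLattice N U) →ₗ[ℤ] (V ⧸ U) :=
  Submodule.liftQ _ ((U.mkQ.restrictScalars ℤ) ∘ₗ N.subtype) fun x hx => by
    rw [LinearMap.mem_ker]
    exact (Submodule.Quotient.mk_eq_zero _).2 hx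

theorem quotientEmbedding_injective (U : Submodule ℚ V) :
    Function.Injective (quotientEmbedding N U) := by
  rw [injective_iff_map_eq_zero]
  intro x hx
  obtain ⟨x, rfl⟩ := Submodule.mkQ_surjective _ x
  have hx' : (Submodule.Quotient.mk (x : V) : V ⧸ U) = 0 := hx
  exact (Submodule.Quotient.mk_eq_zero _).2 ((Submodule.Quotient.mk_eq_zero U).1 hx')

/-- The quotient embeds into a rational vector space, so it is torsion free, and it is finitely
generated. -/
theorem free_quotient [N.IsLattice ℚ] (U : Submodule ℚ V) :
    Module.Free ℤ (N ⧸ subspaceLattice N U) := by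
  have : Module.IsTorsionFree ℤ (V ⧸ U) := Module.IsTorsionFree.trans_faithfulSMul ℤ ℚ _
  have : Module.IsTorsionFree ℤ (N ⧸ subspaceLattice N U) :=
    Function.Injective.moduleIsTorsionFree _ (quotientEmbedding_injective U) (by simp)
  infer_instance

/-- Integrally independent vectors of a rational vector space are rationally independent. The
inequality suffices, as the opposite bound on ranks will come from injectivity of the lattice map.
-/
theorem finrank_quotient_le [N.IsLattice ℚ] (U : Submodule ℚ V) :
    Module.finrank ℤ (N ⧸ subspaceLattice N U) + Module.finrank ℚ U ≤ Module.finrank ℚ V := by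
  have := finiteDimensional_of_lattice N
  have := free_quotient (N := N) U
  let b := Module.Free.chooseBasis ℤ (N ⧸ subspaceLattice N U)
  have h1 : LinearIndependent ℤ (quotientEmbedding N U ∘ b) :=
    b.linearIndependent.map' _ (LinearMap.ker_eq_bot.2 (quotientEmbedding_injective U))
  have h2 := (LinearIndependent.iff_fractionRing ℤ ℚ).1 h1
  have h3 := h2.fintype_card_le_finrank
  rw [Module.finrank_eq_card_chooseBasisIndex]
  have h4 := U.finrank_quotient_add_finrank
  omega

theorem finrank_lattice [N.IsLattice ℚ] : Module.finrank ℤ N = Module.finrank ℚ V := by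
  rw [Module.finrank_eq_card_basis (Module.Free.chooseBasis ℤ N),
    Module.finrank_eq_card_basis ((Module.Free.chooseBasis ℤ N).extendOfIsLattice ℚ)]

theorem free_latticeTarget [N.IsLattice ℚ] (Γ : TropicalCurve N) {l : ℕ} (E : Fin l → Γ.Edge)
    (A : Fin l → AffineSubspace ℚ V) : Module.Free ℤ (Γ.LatticeTarget E A) := by
  have h1 : ∀ b, Module.Free ℤ (N ⧸ Submodule.span ℤ {Γ.bdir b}) := fun b => by
    rw [span_primitive_eq (Γ.bdir_primitive b)]
    exact free_quotient _
  have h2 : ∀ i, Module.Free ℤ (N ⧸ TropicalCurve.incidenceLattice (Γ.dir (E i)) (A i)) :=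
    fun i => free_quotient _
  infer_instance

/-- The factors have rank at most `n - 1` for each of the `|Δ| - 3` bounded edges and at most `d i`
for each marking, because the direction of `E i` is not parallel to `A i`. With `∑ d i = |Δ| + n -
3` this adds up to `n * (|Δ| - 2)`, the rank of the source. -/
theorem finrank_latticeTarget_le [N.IsLattice ℚ] {Δ : N →₀ ℕ} {l : ℕ} {d : Fin l → ℕ}
    {A : Fin l → AffineSubspace ℚ V} (hA : IsAffineConstraint d A) (hgen : IsGeneral N Δ d A)
    (Γ : TropicalCurve N) (E : Fin l → Γ.Edge)
    (hrat : Γ.IsRational) (hdeg : Γ.HasDegree Δ) (hmatch : Γ.Matches E A) :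
    Module.finrank ℤ (Γ.LatticeTarget E A) ≤ Module.finrank ℤ (Γ.Vert → N) := by
  have := finiteDimensional_of_lattice N
  obtain ⟨htri, hpos, -, -⟩ := hgen.2 Γ E hrat hdeg hmatch
  have h1 : ∀ b, Module.Free ℤ (N ⧸ Submodule.span ℤ {Γ.bdir b}) := fun b => by
    rw [span_primitive_eq (Γ.bdir_primitive b)]
    exact free_quotient _
  have h2 : ∀ i, Module.Free ℤ (N ⧸ TropicalCurve.incidenceLattice (Γ.dir (E i)) (A i)) :=
    fun i => free_quotient _
  rw [Module.finrank_prod, Module.finrank_pi_fintype, Module.finrank_pi_fintype,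
    Module.finrank_pi_fintype]
  have h3 : ∀ b, Module.finrank ℤ (N ⧸ Submodule.span ℤ {Γ.bdir b}) + 1 ≤ Module.finrank ℚ V :=
    fun b => by
      rw [span_primitive_eq (Γ.bdir_primitive b)]
      have := finrank_quotient_le (N := N) (Submodule.span ℚ {(Γ.bdir b : V)})
      rwa [finrank_span_singleton (Γ.bdir_primitive b).coe_ne_zero] at this
  have h4 : ∀ i, Module.finrank ℤ (N ⧸ TropicalCurve.incidenceLattice (Γ.dir (E i)) (A i)) ≤ d i :=
    fun i => by
      have h5 := finrank_quotient_le (N := N)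
        (Submodule.span ℚ {(Γ.dir (E i) : V)} ⊔ (A i).direction)
      have h6 := Submodule.finrank_sup_add_finrank_inf_eq
        (Submodule.span ℚ {(Γ.dir (E i) : V)}) (A i).direction
      have h7 : Submodule.span ℚ {(Γ.dir (E i) : V)} ⊓ (A i).direction = ⊥ := by
        rw [← disjoint_iff, disjoint_comm, Submodule.disjoint_span_singleton' (Γ.dir_ne_zero (E i))]
        exact dir_notMem_direction hmatch hpos i
      rw [h7, finrank_bot, finrank_span_singleton (Γ.dir_ne_zero (E i))] at h6
      have h8 := (hA i).2
      have h9 : Module.finrank ℤ (N ⧸ subspaceLattice N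
          (Submodule.span ℚ {(Γ.dir (E i) : V)} ⊔ (A i).direction))
          = Module.finrank ℤ (N ⧸ TropicalCurve.incidenceLattice (Γ.dir (E i)) (A i)) := rfl
      omega
  have h5 : ∑ b, Module.finrank ℤ (N ⧸ Submodule.span ℤ {Γ.bdir b}) + Fintype.card Γ.BEdge
      ≤ Fintype.card Γ.BEdge * Module.finrank ℚ V := by
    have := Finset.sum_le_sum fun b (_ : b ∈ Finset.univ) => h3 b
    rw [Finset.sum_add_distrib] at this
    simpa using this
  have h6 := Finset.sum_le_sum fun i (_ : i ∈ Finset.univ) => h4 i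
  have h7 := Γ.card_vert_of_isTrivalent hrat htri
  have h8 := Γ.card_uedge_of_hasDegree hdeg
  have h9 := hgen.1
  have h10 : Fintype.card Γ.BEdge + 1 = Fintype.card Γ.Vert := hrat
  simp only [finrank_lattice, Finset.sum_const, Finset.card_univ, smul_eq_mul]
  rw [← h10, add_mul, one_mul]
  omega

theorem finiteIndex_range_latticeMap [N.IsLattice ℚ] {Δ : N →₀ ℕ} {l : ℕ} {d : Fin l → ℕ}
    {A : Fin l → AffineSubspace ℚ V} (hA : IsAffineConstraint d A) (hgen : IsGeneral N Δ d A)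
    (hdir : ⨅ i, (A i).direction = ⊥) (Γ : TropicalCurve N) (E : Fin l → Γ.Edge)
    (hrat : Γ.IsRational) (hdeg : Γ.HasDegree Δ) (hmatch : Γ.Matches E A) :
    Finite (Γ.LatticeTarget E A ⧸ LinearMap.range (Γ.latticeMap E A)) := by
  have := free_latticeTarget Γ E A
  refine Submodule.finiteQuotientOfFreeOfRankEq _ ?_
  rw [LinearMap.finrank_range_of_inj (latticeMap_injective hgen hdir Γ E hrat hdeg hmatch)]
  refine le_antisymm ?_ (finrank_latticeTarget_le hA hgen Γ E hrat hdeg hmatch)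
  exact LinearMap.finrank_le_finrank_of_injective
    (latticeMap_injective hgen hdir Γ E hrat hdeg hmatch)

end LatticeMap

/-! ### The index of a lattice map and of its transpose -/

section DualIndex

theorem card_quotient_range_eq_natAbs_det {M : Type*} [AddCommGroup M] [Module.Free ℤ M]
    [Module.Finite ℤ M] (f : M →ₗ[ℤ] M) (hf : Function.Injective f) :
    Nat.card (M ⧸ LinearMap.range f) = (LinearMap.det f).natAbs := by
  rw [← Submodule.natAbs_det_equiv (LinearMap.range f) (LinearEquiv.ofInjective f hf)]
  rfl

/-- A nonzero multiple of every element of `Q` lies in the image of `φ`, and `ℤ` has no torsion. -/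
theorem dualMap_injective_of_finite {F Q : Type*} [AddCommGroup F] [AddCommGroup Q]
    (φ : F →ₗ[ℤ] Q) [Finite (Q ⧸ LinearMap.range φ)] : Function.Injective φ.dualMap := by
  rw [injective_iff_map_eq_zero]
  intro η hη
  ext q
  have : Finite (Q ⧸ (LinearMap.range φ).toAddSubgroup) :=
    inferInstanceAs (Finite (Q ⧸ LinearMap.range φ))
  have hfin : (LinearMap.range φ).toAddSubgroup.FiniteIndex :=
    AddSubgroup.finiteIndex_of_finite_quotient
  obtain ⟨n, hn, hmem⟩ : ∃ n : ℕ, n ≠ 0 ∧ n • q ∈ LinearMap.range φ := by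
    refine ⟨(LinearMap.range φ).toAddSubgroup.index, hfin.index_ne_zero, ?_⟩
    exact (LinearMap.range φ).toAddSubgroup.nsmul_index_mem q
  obtain ⟨x, hx⟩ := hmem
  have h1 : η (φ x) = 0 := LinearMap.congr_fun hη x
  rw [hx, map_nsmul, smul_eq_zero] at h1
  simpa [hn] using h1

/-- An injection of lattices of finite index and its dual have the same index. -/
theorem card_quotient_dualMap {F Q : Type*} [AddCommGroup F] [Module.Free ℤ F] [Module.Finite ℤ F]
    [AddCommGroup Q] [Module.Free ℤ Q] [Module.Finite ℤ Q] (φ : F →ₗ[ℤ] Q)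
    (hφ : Function.Injective φ) [Finite (Q ⧸ LinearMap.range φ)] :
    Nat.card (Module.Dual ℤ F ⧸ LinearMap.range φ.dualMap) = Nat.card (Q ⧸ LinearMap.range φ) := by
  have hrank : Module.finrank ℤ Q = Module.finrank ℤ F := by
    rw [← LinearMap.finrank_range_of_inj hφ]
    exact ((Submodule.finiteQuotient_iff _).1 inferInstance).symm
  -- Identifying source and target turns `φ` into an endomorphism, whose index is the absolute value
  -- of its determinant; the transpose has the same determinant.
  let ψ : Q ≃ₗ[ℤ] F := LinearEquiv.ofFinrankEq Q F hrank
  let f : Q →ₗ[ℤ] Q := φ ∘ₗ ψ.toLinearMap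
  have hf : Function.Injective f := hφ.comp ψ.injective
  have hr : LinearMap.range f = LinearMap.range φ := LinearMap.range_comp_of_range_eq_top _ ψ.range
  have h1 := card_quotient_range_eq_natAbs_det f hf
  rw [hr] at h1
  have hfd : f.dualMap = ψ.dualMap.toLinearMap ∘ₗ φ.dualMap := rfl
  have hfinj : Function.Injective f.dualMap := by
    rw [hfd]
    exact ψ.dualMap.injective.comp (dualMap_injective_of_finite φ)
  have h2 := card_quotient_range_eq_natAbs_det f.dualMap hfinj
  rw [LinearMap.det_dualMap] at h2
  rw [h1, ← h2]
  refine Nat.card_congr (Submodule.Quotient.equiv _ _ ψ.dualMap ?_).toEquiv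
  rw [hfd, LinearMap.range_comp]

end DualIndex

/-! ### Extending characters -/

section Extension

variable {k : Type*} [Field k]

/-- Over an algebraically closed field the group `kˣ` is divisible, hence injective. -/
theorem exists_character_extension [IsAlgClosed k] {H G : Type*} [AddCommGroup H] [AddCommGroup G]
    (f : H →+ G) (hf : Function.Injective f) (χ : H →+ Additive kˣ) :
    ∃ χ' : G →+ Additive kˣ, χ'.comp f = χ := by
  have hdiv : ∀ {n : ℤ} (a : Additive kˣ), n ≠ 0 → ∃ y : Additive kˣ, n • y = a := by
    intro n a hn
    obtain ⟨t, ht⟩ := exists_pow_eq_unit (Additive.toMul a) (Int.natAbs_pos.2 hn)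
    rcases Int.natAbs_eq n with h | h
    · refine ⟨Additive.ofMul t, ?_⟩
      rw [h, natCast_zsmul, ← ofMul_pow, ht]; rfl
    · refine ⟨Additive.ofMul t⁻¹, ?_⟩
      rw [h, neg_smul, natCast_zsmul, ← ofMul_pow, inv_pow, ht, ofMul_inv, neg_neg]; rfl
  let _ : DivisibleBy (Additive kˣ) ℤ :=
    AddCommGroup.divisibleByIntOfSMulTopEqTop _ (by
      intro n hn
      refine top_unique fun a _ => ?_
      obtain ⟨y, hy⟩ := hdiv a hn
      exact ⟨y, trivial, hy⟩)
  obtain ⟨χ', h⟩ := (Module.Baer.of_divisible (Additive kˣ)).extension_property_addMonoidHom f hf χ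
  exact ⟨χ', h⟩

/-- The extensions are a torsor under the characters of the finite cokernel. In characteristic zero
`kˣ` has all roots of unity of every order, so a finite abelian group has as many characters as
elements. -/
theorem card_character_extensions [IsAlgClosed k] [CharZero k] {H G : Type*} [AddCommGroup H]
    [AddCommGroup G] (f : H →+ G) (hf : Function.Injective f) [Finite (G ⧸ f.range)]
    (χ : H →+ Additive kˣ) :
    Nat.card {χ' : G →+ Additive kˣ // χ'.comp f = χ} = Nat.card (G ⧸ f.range) := by
  obtain ⟨χ₀, hχ₀⟩ := exists_character_extension f hf χ
  let e : {χ' : G →+ Additive kˣ // χ'.comp f = χ} ≃ ((G ⧸ f.range) →+ Additive kˣ) :=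
    { toFun := fun χ' => QuotientAddGroup.lift _ (χ'.1 - χ₀) (by
        rintro _ ⟨h, rfl⟩
        have h1 := DFunLike.congr_fun χ'.2 h
        have h2 := DFunLike.congr_fun hχ₀ h
        simp only [AddMonoidHom.comp_apply] at h1 h2
        change χ'.1 (f h) - χ₀ (f h) = 0
        rw [h1, h2, sub_self])
      invFun := fun ψ => ⟨χ₀ + ψ.comp (QuotientAddGroup.mk' _), by
        ext h
        have h2 := DFunLike.congr_fun hχ₀ h
        simp only [AddMonoidHom.comp_apply] at h2
        have h3 : (QuotientAddGroup.mk' f.range) (f h) = 0 :=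
          (QuotientAddGroup.eq_zero_iff _).2 ⟨h, rfl⟩
        simp only [AddMonoidHom.comp_apply, AddMonoidHom.add_apply, h3, map_zero, add_zero, h2]⟩
      left_inv := fun χ' => by
        ext g
        simp
      right_inv := fun ψ => by
        ext g
        simp }
  rw [Nat.card_congr e, ← Nat.card_congr (AddMonoidHom.toMultiplicativeLeft
    (α := G ⧸ f.range) (β := kˣ)).symm]
  have hexp : NeZero (Monoid.exponent (Multiplicative (G ⧸ f.range))) := inferInstance
  rw [CommGroup.card_monoidHom_of_hasEnoughRootsOfUnity]
  rfl

end Extension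

/-! ### Counting families of characters at the vertices -/

section Count

variable {k : Type*} [Field k] {V : Type*} [AddCommGroup V] [Module ℚ V] {N : Submodule ℤ V}

/-- A family of characters of `N` is the same as a character of the dual of the lattice of functions
on the vertices. -/
def characterFamilyEquiv {X : Type*} [Fintype X] [DecidableEq X] {M : Type*} [AddCommGroup M]
    {C : Type*} [AddCommGroup C] :
    (X → (Module.Dual ℤ M →+ C)) ≃ (Module.Dual ℤ (X → M) →+ C) where
  toFun c := ∑ x, (c x).comp ((LinearMap.single ℤ (fun _ => M) x).dualMap).toAddMonoidHom
  invFun χ x := χ.comp ((LinearMap.proj x : (X → M) →ₗ[ℤ] M).dualMap).toAddMonoidHom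
  left_inv c := by
    funext x
    ext m
    simp only [AddMonoidHom.comp_apply, AddMonoidHom.finsetSum_apply]
    rw [Finset.sum_eq_single x]
    · simp only [LinearMap.toAddMonoidHom_coe]
      congr 1
      ext y
      simp
    · intro y _ hy
      have : (LinearMap.single ℤ (fun _ => M) y).dualMap
          ((LinearMap.proj x : (X → M) →ₗ[ℤ] M).dualMap m) = 0 := by
        ext z
        simp [Ne.symm hy]
      simp [this]
    · simp
  right_inv χ := by
    ext ξ
    simp only [AddMonoidHom.comp_apply, AddMonoidHom.finsetSum_apply]
    rw [← map_sum]
    congr 1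
    refine LinearMap.ext fun g => ?_
    simp only [LinearMap.toAddMonoidHom_coe, LinearMap.sum_apply, LinearMap.dualMap_apply,
      LinearMap.proj_apply, LinearMap.coe_single]
    rw [← map_sum, Finset.univ_sum_single]

/-- The number of families of characters with prescribed quotients along the bounded edges and
prescribed values at the markings is the lattice index. -/
theorem card_characterFamilies [IsAlgClosed k] [CharZero k] [N.IsLattice ℚ] (Γ : TropicalCurve N)
    {l : ℕ} (E : Fin l → Γ.Edge) (A : Fin l → AffineSubspace ℚ V)
    (hinj : Function.Injective (Γ.latticeMap E A))
    (hfin : Finite (Γ.LatticeTarget E A ⧸ LinearMap.range (Γ.latticeMap E A)))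
    (α : Γ.BEdge → CharTorus k N) (β : Fin l → CharTorus k N) :
    Nat.card {c : Γ.Vert → CharTorus k N //
      (∀ b (m : Module.Dual ℤ N), m (Γ.bdir b) = 0 →
        c (Γ.tgt b) (Multiplicative.ofAdd m)
          = c (Γ.src b) (Multiplicative.ofAdd m) * α b (Multiplicative.ofAdd m)) ∧
      ∀ i (m : Module.Dual ℤ N),
        (∀ y ∈ TropicalCurve.incidenceLattice (Γ.dir (E i)) (A i), m y = 0) →
        c (Γ.tail (E i)) (Multiplicative.ofAdd m) = β i (Multiplicative.ofAdd m)}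
      = Γ.latticeIndex E A := by
  classical
  have hfree := free_latticeTarget Γ E A
  let φ := Γ.latticeMap E A
  let πb : ∀ b, N →ₗ[ℤ] Γ.LatticeTarget E A := fun b =>
    LinearMap.inl ℤ _ _ ∘ₗ LinearMap.single ℤ (fun b => N ⧸ Submodule.span ℤ {Γ.bdir b}) b ∘ₗ
      (Submodule.span ℤ {Γ.bdir b}).mkQ
  let πi : ∀ i, N →ₗ[ℤ] Γ.LatticeTarget E A := fun i =>
    LinearMap.inr ℤ _ _ ∘ₗ LinearMap.single ℤ
      (fun i => N ⧸ TropicalCurve.incidenceLattice (Γ.dir (E i)) (A i)) i ∘ₗ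
      (TropicalCurve.incidenceLattice (Γ.dir (E i)) (A i)).mkQ
  let pr : Γ.Vert → (Γ.Vert → N) →ₗ[ℤ] N := fun x => LinearMap.proj x
  have hφ : ∀ g, φ g = ∑ b, πb b (g (Γ.tgt b) - g (Γ.src b)) + ∑ i, πi i (g (Γ.tail (E i))) := by
    intro g
    refine Prod.ext ?_ ?_
    · simp only [Prod.fst_add, Prod.fst_sum, πb, πi, LinearMap.comp_apply, LinearMap.inl_apply,
        LinearMap.inr_apply, Finset.sum_const_zero, add_zero, LinearMap.coe_single]
      rw [Finset.univ_sum_single (fun b => (Submodule.span ℤ {Γ.bdir b}).mkQ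
        (g (Γ.tgt b) - g (Γ.src b)))]
      rfl
    · simp only [Prod.snd_add, Prod.snd_sum, πb, πi, LinearMap.comp_apply, LinearMap.inl_apply,
        LinearMap.inr_apply, Finset.sum_const_zero, zero_add, LinearMap.coe_single]
      rw [Finset.univ_sum_single (fun i =>
        (TropicalCurve.incidenceLattice (Γ.dir (E i)) (A i)).mkQ (g (Γ.tail (E i))))]
      rfl
  have hdual : ∀ η : Module.Dual ℤ (Γ.LatticeTarget E A), φ.dualMap η
      = ∑ b, ((pr (Γ.tgt b)).dualMap ((πb b).dualMap η) - (pr (Γ.src b)).dualMap ((πb b).dualMap η))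
        + ∑ i, (pr (Γ.tail (E i))).dualMap ((πi i).dualMap η) := by
    intro η
    refine LinearMap.ext fun g => ?_
    rw [LinearMap.dualMap_apply, hφ, map_add, map_sum, map_sum]
    simp [pr, LinearMap.sum_apply]
  -- The prescribed data `α` and `β` are assembled into one character of the dual of the target. The
  -- conditions on a family say exactly that the corresponding character of the dual of `Map(Vert,
  -- N)` pulls back to it along the transpose of the lattice map.
  let χ₀ : Module.Dual ℤ (Γ.LatticeTarget E A) →+ Additive kˣ :=
    ∑ b, (MonoidHom.toAdditiveRight (α b)).comp (πb b).dualMap.toAddMonoidHom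
      + ∑ i, (MonoidHom.toAdditiveRight (β i)).comp (πi i).dualMap.toAddMonoidHom
  have hχ₀ : ∀ η, χ₀ η = ∑ b, MonoidHom.toAdditiveRight (α b) ((πb b).dualMap η)
      + ∑ i, MonoidHom.toAdditiveRight (β i) ((πi i).dualMap η) := by
    intro η
    simp [χ₀]
  -- To recover an individual condition from the assembled one, a form orthogonal to one edge is
  -- turned into a functional supported on the factor of this edge; likewise for the markings below.
  have hfb : ∀ b (m : Module.Dual ℤ N), m (Γ.bdir b) = 0 →
      ∃ η : Module.Dual ℤ (Γ.LatticeTarget E A), (∀ b', (πb b').dualMap η = if b' = b then m else 0) ∧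
        ∀ i, (πi i).dualMap η = 0 := by
    intro b m hm
    refine ⟨(Submodule.liftQ _ m (by
      rw [Submodule.span_singleton_le_iff_mem]; exact hm)) ∘ₗ LinearMap.proj b ∘ₗ
        LinearMap.fst ℤ _ _, fun b' => ?_, fun i => ?_⟩
    · ext y
      by_cases hbb : b' = b
      · subst hbb
        simp [πb]
      · simp [πb, hbb]
    · ext y
      simp [πi]
  have hfi : ∀ i (m : Module.Dual ℤ N),
      (∀ y ∈ TropicalCurve.incidenceLattice (Γ.dir (E i)) (A i), m y = 0) →
      ∃ η : Module.Dual ℤ (Γ.LatticeTarget E A), (∀ b, (πb b).dualMap η = 0) ∧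
        ∀ i', (πi i').dualMap η = if i' = i then m else 0 := by
    intro i m hm
    refine ⟨(Submodule.liftQ _ m fun y hy => hm y hy) ∘ₗ LinearMap.proj i ∘ₗ
        LinearMap.snd ℤ _ _, fun b' => ?_, fun i' => ?_⟩
    · ext y
      simp [πb]
    · ext y
      by_cases hbb : i' = i
      · subst hbb
        simp [πi]
        exact Submodule.liftQ_apply _ _ _
      · simp [πi, hbb]
  have hπb : ∀ b (η : Module.Dual ℤ (Γ.LatticeTarget E A)), (πb b).dualMap η (Γ.bdir b) = 0 := by
    intro b η
    have : (Submodule.span ℤ {Γ.bdir b}).mkQ (Γ.bdir b) = 0 :=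
      (Submodule.Quotient.mk_eq_zero _).2 (Submodule.mem_span_singleton_self _)
    simp only [LinearMap.dualMap_apply, πb, LinearMap.comp_apply, this, map_zero]
  have hπi : ∀ i (η : Module.Dual ℤ (Γ.LatticeTarget E A)),
      ∀ y ∈ TropicalCurve.incidenceLattice (Γ.dir (E i)) (A i), (πi i).dualMap η y = 0 := by
    intro i η y hy
    have : (TropicalCurve.incidenceLattice (Γ.dir (E i)) (A i)).mkQ y = 0 :=
      (Submodule.Quotient.mk_eq_zero _).2 hy
    simp only [LinearMap.dualMap_apply, πi, LinearMap.comp_apply, this, map_zero]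
  let e₁ : (Γ.Vert → CharTorus k N) ≃ (Module.Dual ℤ (Γ.Vert → N) →+ Additive kˣ) :=
    (Equiv.piCongrRight fun _ => MonoidHom.toAdditiveRight).trans characterFamilyEquiv
  have he₁ : ∀ c x m, e₁ c ((pr x).dualMap m) = Additive.ofMul (c x (Multiplicative.ofAdd m)) := by
    intro c x m
    have := congrFun (characterFamilyEquiv.symm_apply_apply
      (fun x => MonoidHom.toAdditiveRight (c x))) x
    exact DFunLike.congr_fun this m
  have key : ∀ c η, e₁ c (φ.dualMap η)
      = ∑ b, (MonoidHom.toAdditiveRight (c (Γ.tgt b)) ((πb b).dualMap η)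
          - MonoidHom.toAdditiveRight (c (Γ.src b)) ((πb b).dualMap η))
        + ∑ i, MonoidHom.toAdditiveRight (c (Γ.tail (E i))) ((πi i).dualMap η) := by
    intro c η
    rw [hdual, map_add, map_sum, map_sum]
    congr 1
    · exact Finset.sum_congr rfl fun b _ => by rw [map_sub, he₁, he₁]; rfl
    · exact Finset.sum_congr rfl fun i _ => by rw [he₁]; rfl
  have hcount := card_quotient_dualMap φ hinj
  have hfin' : Finite (Module.Dual ℤ (Γ.Vert → N) ⧸ φ.dualMap.toAddMonoidHom.range) := by
    refine Nat.finite_of_card_ne_zero ?_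
    change Nat.card (Module.Dual ℤ (Γ.Vert → N) ⧸ LinearMap.range φ.dualMap) ≠ 0
    rw [hcount]
    exact Nat.card_ne_zero.2 ⟨inferInstance, hfin⟩
  have hcard := card_character_extensions φ.dualMap.toAddMonoidHom
    (dualMap_injective_of_finite φ) χ₀
  have hidx : Γ.latticeIndex E A
      = Nat.card (Module.Dual ℤ (Γ.Vert → N) ⧸ φ.dualMap.toAddMonoidHom.range) := by
    change Nat.card (Γ.LatticeTarget E A ⧸ LinearMap.range φ)
      = Nat.card (Module.Dual ℤ (Γ.Vert → N) ⧸ LinearMap.range φ.dualMap)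
    rw [hcount]
  rw [hidx, ← hcard]
  refine Nat.card_congr (e₁.subtypeEquiv fun c => ?_)
  constructor
  · rintro ⟨hb, hi⟩
    refine AddMonoidHom.ext fun η => ?_
    change e₁ c (φ.dualMap η) = χ₀ η
    rw [key, hχ₀]
    congr 1
    · refine Finset.sum_congr rfl fun b _ => ?_
      rw [sub_eq_iff_eq_add, add_comm]
      exact congrArg Additive.ofMul (hb b _ (hπb b η))
    · exact Finset.sum_congr rfl fun i _ => congrArg Additive.ofMul (hi i _ (hπi i η))
  · intro h
    have h' : ∀ η, e₁ c (φ.dualMap η) = χ₀ η := fun η => DFunLike.congr_fun h η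
    refine ⟨fun b m hm => ?_, fun i m hm => ?_⟩
    · obtain ⟨η, h1, h2⟩ := hfb b m hm
      have h3 := h' η
      rw [key, hχ₀] at h3
      simp only [h1, h2, map_zero, Finset.sum_const_zero, add_zero] at h3
      rw [Finset.sum_eq_single b, Finset.sum_eq_single b, if_pos rfl, sub_eq_iff_eq_add,
        add_comm] at h3
      · exact congrArg Additive.toMul h3
      · intro b' _ hb'
        rw [if_neg hb', map_zero]
      · simp
      · intro b' _ hb'
        rw [if_neg hb', map_zero, map_zero, sub_zero]
      · simp
    · obtain ⟨η, h1, h2⟩ := hfi i m hm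
      have h3 := h' η
      rw [key, hχ₀] at h3
      simp only [h1, h2, map_zero, sub_zero, Finset.sum_const_zero, zero_add] at h3
      rw [Finset.sum_eq_single i, Finset.sum_eq_single i, if_pos rfl] at h3
      · exact congrArg Additive.toMul h3
      · intro b' _ hb'
        rw [if_neg hb', map_zero]
      · simp
      · intro b' _ hb'
        rw [if_neg hb', map_zero]
      · simp

end Count

/-! ### Standard lines on a component -/

section Lines

variable {V : Type*} [AddCommGroup V] [Module ℚ V] {N : Submodule ℤ V} {P : Set (Set V)}
  {k : Type*} [Field k]

theorem zpow_eq_pow_toNat_div (x : k) (n : ℤ) : x ^ n = x ^ n.toNat / x ^ (-n).toNat := by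
  rcases le_total 0 n with h | h
  · rw [Int.toNat_of_nonpos (by omega : -n ≤ 0), pow_zero, div_one]
    conv_lhs => rw [← Int.toNat_of_nonneg h, zpow_natCast]
  · rw [Int.toNat_of_nonpos h, pow_zero, one_div]
    have : n = -((-n).toNat : ℤ) := by omega
    conv_lhs => rw [this, zpow_neg, zpow_natCast]

theorem exists_rep_eq_smul {x : Fin 2 → k} (hx : x ≠ 0) :
    ∃ a : k, a ≠ 0 ∧ (Projectivization.mk k x hx).rep = a • x := by
  obtain ⟨a, ha⟩ := Projectivization.exists_smul_eq_mk_rep k x hx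
  exact ⟨a, a.ne_zero, ha.symm⟩

variable (N P) in
/-- The combinatorial type of a line on the component `X_v`: the toric divisors that it meets, given
by cells `T j` of dimension one with primitive direction vectors `u j`, and the intersection
indices `w j`. -/
structure LineFrame where
  v : N
  v_mem : {(v : V)} ∈ P
  J : Type
  [fintypeJ : Fintype J]
  w : J → ℕ
  w_pos : ∀ j, 0 < w j
  u : J → N
  u_primitive : ∀ j, IsPrimitive (u j)
  T : J → Set V
  T_mem : ∀ j, T j ∈ P
  T_subset : ∀ j, ∀ x ∈ T j, ∃ a : ℚ, 0 ≤ a ∧ x = v + a • (u j : V)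
  v_mem_T : ∀ j, (v : V) ∈ T j
  exists_mem_T : ∀ j, ∃ a : ℚ, 0 < a ∧ v + a • (u j : V) ∈ T j

attribute [instance] LineFrame.fintypeJ

namespace LineFrame

variable (L : LineFrame N P)

/-- The weighted direction vector. -/
def amp (j : L.J) : N := L.w j • L.u j

/-- This makes the product of powers of linear forms in `lineVal` homogeneous of degree zero, so
that it is a function on the projective line. -/
def IsBalanced : Prop := ∑ j, L.amp j = 0

theorem apply_amp (m : Module.Dual ℤ N) (j : L.J) : m (L.amp j) = L.w j * m (L.u j) := by
  simp [amp]

variable {L} in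
theorem IsBalanced.sum_apply (h : L.IsBalanced) (m : Module.Dual ℤ N) : ∑ j, m (L.amp j) = 0 := by
  rw [← map_sum, h, map_zero]

theorem nonneg_T_iff {m : dualLattice (extLattice N)} (hm : m.1 ((L.v : V), 1) = 0) (j : L.J) :
    (∀ y ∈ coneOver (L.T j), 0 ≤ m.1 y) ↔ 0 ≤ restr m (L.u j) := by
  rw [nonneg_coneOver_iff]
  constructor
  · intro h
    obtain ⟨a, ha, hT⟩ := L.exists_mem_T j
    have := h _ hT
    rw [apply_add_smul m hm] at this
    have h2 := nonneg_of_mul_nonneg_right this ha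
    exact_mod_cast h2
  · intro h x hx
    obtain ⟨a, ha, rfl⟩ := L.T_subset j x hx
    rw [apply_add_smul m hm]
    have : (0 : ℚ) ≤ restr m (L.u j) := by exact_mod_cast h
    positivity

theorem eq_zero_T_iff (m : dualLattice (extLattice N)) (j : L.J) :
    (∀ y ∈ coneOver (L.T j), m.1 y = 0) ↔ m.1 ((L.v : V), 1) = 0 ∧ restr m (L.u j) = 0 := by
  rw [eq_zero_coneOver_iff]
  constructor
  · intro h
    have hv := h _ (L.v_mem_T j)
    refine ⟨hv, ?_⟩
    obtain ⟨a, ha, hT⟩ := L.exists_mem_T j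
    have := h _ hT
    rw [apply_add_smul m hv] at this
    have h2 := (mul_eq_zero.1 this).resolve_left ha.ne'
    exact_mod_cast h2
  · rintro ⟨hv, h⟩ x hx
    obtain ⟨a, ha, rfl⟩ := L.T_subset j x hx
    rw [apply_add_smul m hv, h]
    simp

theorem T_ne_singleton (j : L.J) : L.T j ≠ {(L.v : V)} := by
  intro h
  obtain ⟨a, ha, hT⟩ := L.exists_mem_T j
  rw [h] at hT
  have h1 : a • (L.u j : V) = 0 := by simpa using hT
  exact (L.u_primitive j).coe_ne_zero ((smul_eq_zero.1 h1).resolve_left (ne_of_gt ha))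

/-- Distinct points of the projective line indexed by the toric divisors. -/
structure Points (k : Type*) [Field k] where
  pt : L.J → Fin 2 → k
  ne_zero : ∀ j, pt j ≠ 0
  cross_ne : ∀ i j, i ≠ j → cross (pt i) (pt j) ≠ 0

variable {L} (p : L.Points k)

def Points.point (j : L.J) : P1 k := Projectivization.mk k (p.pt j) (p.ne_zero j)

theorem Points.cross_eq_zero_iff {j : L.J} {q : P1 k} : cross (p.pt j) q.rep = 0 ↔ q = p.point j :=
  cross_mk_rep_eq_zero_iff (p.ne_zero j)

theorem Points.point_injective : Function.Injective p.point := by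
  intro i j h
  by_contra hij
  exact p.cross_ne i j hij ((ToricTropical.cross_eq_zero_iff (p.ne_zero i) (p.ne_zero j)).2 h)

theorem prod_zpow_const {ι : Type*} (s : Finset ι) {a : k} (ha : a ≠ 0) (f : ι → ℤ) :
    ∏ i ∈ s, a ^ f i = a ^ ∑ i ∈ s, f i := by
  classical
  induction s using Finset.induction_on with
  | empty => simp
  | insert i s his ih => rw [Finset.prod_insert his, Finset.sum_insert his, ih, zpow_add₀ ha]

theorem sum_toNat_neg_eq {ι : Type*} (s : Finset ι) (n : ι → ℤ) (a : ℕ)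
    (h : (a : ℤ) + ∑ i ∈ s, n i = 0) :
    ∑ i ∈ s, (-n i).toNat = ∑ i ∈ s, (n i).toNat + a := by
  have h3 : ∑ i ∈ s, n i = ∑ i ∈ s, ((n i).toNat : ℤ) - ∑ i ∈ s, ((-n i).toNat : ℤ) := by
    rw [← Finset.sum_sub_distrib]
    exact Finset.sum_congr rfl fun i _ => by omega
  rw [h3, ← Nat.cast_sum, ← Nat.cast_sum] at h
  omega

/-- The value of a monomial along a line, in homogeneous coordinates. -/
def lineVal (c : CharTorus k N) (x : Fin 2 → k) (m : Module.Dual ℤ N) : k :=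
  c (Multiplicative.ofAdd m) * ∏ j, cross (p.pt j) x ^ m (L.amp j)

theorem lineVal_smul (hL : L.IsBalanced) (c : CharTorus k N) {a : k} (ha : a ≠ 0) (x : Fin 2 → k)
    (m : Module.Dual ℤ N) : lineVal p c (a • x) m = lineVal p c x m := by
  simp only [lineVal, cross_smul_right, mul_zpow, Finset.prod_mul_distrib]
  rw [prod_zpow_const _ ha, hL.sum_apply, zpow_zero, one_mul]

theorem lineVal_ne_zero_iff {c : CharTorus k N} {x : Fin 2 → k} {m : Module.Dual ℤ N} :
    lineVal p c x m ≠ 0 ↔ ∀ j, cross (p.pt j) x = 0 → m (L.u j) = 0 := by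
  rw [lineVal, mul_ne_zero_iff, Finset.prod_ne_zero_iff]
  simp only [Units.ne_zero, ne_eq, not_false_eq_true, true_and, Finset.mem_univ, true_imp_iff]
  refine forall_congr' fun j => ?_
  have hw : (L.w j : ℤ) ≠ 0 := by exact_mod_cast (L.w_pos j).ne'
  rw [L.apply_amp]
  by_cases hm : m (L.u j) = 0
  · simp [hm]
  · rw [zpow_eq_zero_iff (mul_ne_zero hw hm)]
    simp [hm]

/-- Integral powers of zero are not multiplicative in the exponent. The assumptions ensure that a
linear form vanishing at `x` occurs only with nonnegative exponents. -/
theorem lineVal_add {c : CharTorus k N} {x : Fin 2 → k} {m m' : Module.Dual ℤ N}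
    (hm : ∀ j, cross (p.pt j) x = 0 → 0 ≤ m (L.u j))
    (hm' : ∀ j, cross (p.pt j) x = 0 → 0 ≤ m' (L.u j)) :
    lineVal p c x (m + m') = lineVal p c x m * lineVal p c x m' := by
  have key : ∀ j, cross (p.pt j) x ^ (m + m') (L.amp j)
      = cross (p.pt j) x ^ m (L.amp j) * cross (p.pt j) x ^ m' (L.amp j) := by
    intro j
    rw [LinearMap.add_apply]
    by_cases h : cross (p.pt j) x = 0
    · have h1 : 0 ≤ m (L.amp j) := by
        rw [L.apply_amp]; exact mul_nonneg (by positivity) (hm j h)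
      have h2 : 0 ≤ m' (L.amp j) := by
        rw [L.apply_amp]; exact mul_nonneg (by positivity) (hm' j h)
      obtain ⟨a, ha⟩ := Int.eq_ofNat_of_zero_le h1
      obtain ⟨b, hb⟩ := Int.eq_ofNat_of_zero_le h2
      rw [ha, hb, ← Int.natCast_add, zpow_natCast, zpow_natCast, zpow_natCast, pow_add]
    · rw [zpow_add₀ h]
  simp only [lineVal, key, Finset.prod_mul_distrib, ofAdd_add, map_mul, Units.val_mul]
  ring

open Classical in
/-- The cone whose orbit contains the image of the point `q`. -/
def lineCone (q : P1 k) : Set (V × ℚ) :=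
  if h : ∃ j, q = p.point j then coneOver (L.T h.choose) else coneOver {(L.v : V)}

theorem lineCone_point (j : L.J) : lineCone p (p.point j) = coneOver (L.T j) := by
  have h : ∃ i, p.point j = p.point i := ⟨j, rfl⟩
  rw [lineCone, dif_pos h, ← p.point_injective h.choose_spec]

theorem lineCone_of_forall_ne {q : P1 k} (h : ∀ j, q ≠ p.point j) :
    lineCone p q = coneOver {(L.v : V)} := by
  rw [lineCone, dif_neg (by push Not; exact h)]

theorem point_cases (q : P1 k) : (∃ j, q = p.point j) ∨ ∀ j, q ≠ p.point j := by
  by_cases h : ∃ j, q = p.point j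
  · exact Or.inl h
  · exact Or.inr (by push Not at h; exact h)

theorem mem_lineCone (q : P1 k) : ((L.v : V), (1 : ℚ)) ∈ lineCone p q := by
  rcases point_cases p q with ⟨j, rfl⟩ | h
  · rw [lineCone_point]; exact mem_coneOver (L.v_mem_T j)
  · rw [lineCone_of_forall_ne p h]; exact mem_coneOver rfl

theorem nonneg_lineCone_iff {m : dualLattice (extLattice N)} (hm : m.1 ((L.v : V), 1) = 0)
    (q : P1 k) :
    (∀ y ∈ lineCone p q, 0 ≤ m.1 y) ↔ ∀ j, cross (p.pt j) q.rep = 0 → 0 ≤ restr m (L.u j) := by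
  simp only [p.cross_eq_zero_iff]
  rcases point_cases p q with ⟨j, rfl⟩ | h
  · rw [lineCone_point, L.nonneg_T_iff hm]
    refine ⟨fun h i hi => ?_, fun h => h j rfl⟩
    rwa [← p.point_injective hi]
  · rw [lineCone_of_forall_ne p h, nonneg_coneOver_iff]
    simp [hm, h]

theorem eq_zero_lineCone_iff (m : dualLattice (extLattice N)) (q : P1 k) :
    (∀ y ∈ lineCone p q, m.1 y = 0) ↔
      m.1 ((L.v : V), 1) = 0 ∧ ∀ j, cross (p.pt j) q.rep = 0 → restr m (L.u j) = 0 := by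
  simp only [p.cross_eq_zero_iff]
  rcases point_cases p q with ⟨j, rfl⟩ | h
  · rw [lineCone_point, L.eq_zero_T_iff]
    refine and_congr_right fun _ => ⟨fun h i hi => ?_, fun h => h j rfl⟩
    rwa [← p.point_injective hi]
  · rw [lineCone_of_forall_ne p h, eq_zero_coneOver_iff]
    simp [h]

open Classical in
/-- The line on `X_v` with the given boundary points. -/
def lineMap (hP : IsPolyhedralDecomposition P) (c : CharTorus k N)
    (q : P1 k) : Degeneration k N P where
  cone := lineCone p q
  cone_mem := by
    rcases point_cases p q with ⟨j, rfl⟩ | h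
    · rw [lineCone_point]; exact hP.cone_mem_fan (L.T_mem j)
    · rw [lineCone_of_forall_ne p h]; exact hP.cone_mem_fan L.v_mem
  -- A monomial that is not of order zero along `X_v` either vanishes there or is not regular, and
  -- both get the value zero. If `m` has order zero along `X_v` but a pole at `q`, then `lineVal`
  -- contains a negative power of zero, which is again zero as the convention demands.
  val m := if m.1 ((L.v : V), 1) = 0 then lineVal p c q.rep (restr m) else 0
  val_zero := by simp [lineVal]
  val_add m m' hm hm' := by
    have h1 := hm _ (mem_lineCone p q)
    have h2 := hm' _ (mem_lineCone p q)
    have hadd : (m + m').1 ((L.v : V), 1) = m.1 ((L.v : V), 1) + m'.1 ((L.v : V), 1) := rfl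
    by_cases h3 : m.1 ((L.v : V), 1) = 0
    · by_cases h4 : m'.1 ((L.v : V), 1) = 0
      · rw [if_pos h3, if_pos h4, if_pos (by rw [hadd, h3, h4, add_zero]), map_add,
          lineVal_add p ((nonneg_lineCone_iff p h3 q).1 hm) ((nonneg_lineCone_iff p h4 q).1 hm')]
      · rw [if_neg h4, if_neg (by rw [hadd, h3, zero_add]; exact h4), mul_zero]
    · rw [if_neg h3, zero_mul, if_neg]
      rw [hadd]
      intro h
      exact h3 (le_antisymm (by linarith) h1)
  val_ne_zero m := by
    rw [eq_zero_lineCone_iff]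
    by_cases h : m.1 ((L.v : V), 1) = 0
    · rw [if_pos h, lineVal_ne_zero_iff]; simp [h]
    · simp [h]

section LineMap

variable (hP : IsPolyhedralDecomposition P) (c : CharTorus k N)

theorem lineMap_cone (q : P1 k) : (lineMap p hP c q).cone = lineCone p q := rfl

theorem lineMap_val {m : dualLattice (extLattice N)} (hm : m.1 ((L.v : V), 1) = 0) (q : P1 k) :
    (lineMap p hP c q).val m = lineVal p c q.rep (restr m) := if_pos hm

theorem lineMap_val_of_ne {m : dualLattice (extLattice N)} (hm : m.1 ((L.v : V), 1) ≠ 0)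
    (q : P1 k) : (lineMap p hP c q).val m = 0 := if_neg hm

theorem lineMap_val_mk (hL : L.IsBalanced) {m : dualLattice (extLattice N)} (hm : m.1 ((L.v : V), 1) = 0)
    {x : Fin 2 → k} (hx : x ≠ 0) :
    (lineMap p hP c (Projectivization.mk k x hx)).val m = lineVal p c x (restr m) := by
  obtain ⟨a, ha, h⟩ := exists_rep_eq_smul hx
  rw [lineMap_val p hP c hm, h, lineVal_smul p hL c ha]

theorem isFace_lineCone (hP : IsPolyhedralDecomposition P) (q : P1 k) : IsFace (coneOver {(L.v : V)}) (lineCone p q) := by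
  rcases point_cases p q with ⟨j, rfl⟩ | h
  · rw [lineCone_point]
    exact hP.cone_singleton_isFace (L.T_mem j) L.v_mem (L.v_mem_T j)
  · rw [lineCone_of_forall_ne p h]
    exact isFace_refl ⟨_, mem_coneOver rfl⟩

theorem lineCone_eq_singleton_iff (hP : IsPolyhedralDecomposition P) {q : P1 k} :
    lineCone p q = coneOver {(L.v : V)} ↔ ∀ j, q ≠ p.point j := by
  refine ⟨fun h j hj => ?_, lineCone_of_forall_ne p⟩
  rw [hj, lineCone_point] at h
  exact L.T_ne_singleton j
    ((hP.polyhedron _ (L.T_mem j)).coneOver_inj (hP.polyhedron _ L.v_mem) h)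

theorem boundaryPoints_lineMap :
    boundaryPoints (lineMap p hP c) L.v = Set.range p.point := by
  ext q
  change ¬ (lineCone p q = coneOver {(L.v : V)}) ↔ _
  rw [lineCone_eq_singleton_iff p hP]
  simp only [not_forall, not_not, Set.mem_range, eq_comm]

theorem finrank_span_cone_le (j : L.J) :
    Module.finrank ℚ (Submodule.span ℚ (coneOver (L.T j))) ≤ 2 := by
  classical
  set S : Finset (V × ℚ) := {((L.v : V), (1 : ℚ)), ((L.u j : V), (0 : ℚ))} with hS
  have hsub : Submodule.span ℚ (coneOver (L.T j)) ≤ Submodule.span ℚ (S : Set (V × ℚ)) := by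
    rw [Submodule.span_le]
    intro y hy
    by_contra hy'
    obtain ⟨f, hf, hf'⟩ := Submodule.exists_le_ker_of_notMem hy'
    refine hf ?_
    refine eq_zero_coneOver_iff.2 (fun x hx => ?_) y hy
    obtain ⟨a, -, rfl⟩ := L.T_subset j x hx
    have h1 : f ((L.v : V), 1) = 0 := hf' (Submodule.subset_span (by simp [hS]))
    have h2 : f ((L.u j : V), 0) = 0 := hf' (Submodule.subset_span (by simp [hS]))
    have : ((L.v : V) + a • (L.u j : V), (1 : ℚ))
        = ((L.v : V), (1 : ℚ)) + a • ((L.u j : V), (0 : ℚ)) := by simp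
    rw [this, map_add, map_smul, h1, h2, smul_zero, add_zero]
  calc _ ≤ Module.finrank ℚ (Submodule.span ℚ (S : Set (V × ℚ))) :=
        Submodule.finrank_mono hsub
    _ ≤ S.card := finrank_span_finset_le_card S
    _ ≤ 2 := Finset.card_le_two

theorem isTransverse_lineMap : IsTransverse (lineMap p hP c) L.v := by
  refine ⟨fun q => isFace_lineCone p hP q, ?_, fun q => ?_⟩
  · rw [boundaryPoints_lineMap]; exact Set.finite_range _
  · change Module.finrank ℚ (Submodule.span ℚ (lineCone p q)) ≤ 2
    rcases point_cases p q with ⟨j, rfl⟩ | h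
    · rw [lineCone_point]; exact finrank_span_cone_le j
    · rw [lineCone_of_forall_ne p h]
      have hsub : Submodule.span ℚ (coneOver {(L.v : V)})
          ≤ Submodule.span ℚ ({((L.v : V), (1 : ℚ))} : Set (V × ℚ)) := by
        rw [Submodule.span_le]
        intro y hy
        by_contra hy'
        obtain ⟨f, hf, hf'⟩ := Submodule.exists_le_ker_of_notMem hy'
        refine hf (eq_zero_coneOver_iff.2 (fun x hx => ?_) y hy)
        rw [Set.mem_singleton_iff.1 hx]
        exact hf' (Submodule.subset_span rfl)
      exact (Submodule.finrank_mono hsub).trans ((finrank_span_le_card _).trans (by simp))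

/-- Near `q₀` let `G` be the product of the linear forms that do not vanish at `q₀`. Monomials
regular on the chart have nonnegative exponents at the other forms, a power of `G` clears the
remaining denominators, and balancing makes the degrees match. -/
theorem isMorphism_lineMap (hL : L.IsBalanced) : IsMorphism (lineMap p hP c) := by
  classical
  intro q₀
  set S : Finset L.J := Finset.univ.filter fun j => cross (p.pt j) q₀.rep = 0 with hS
  have hmemS : ∀ j, j ∈ S ↔ cross (p.pt j) q₀.rep = 0 := fun j => by simp [hS]
  set G : MvPolynomial (Fin 2) k := ∏ j ∈ Sᶜ, crossForm (p.pt j) with hG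
  have hGq : ∀ q : P1 k, evalForm G q = ∏ j ∈ Sᶜ, cross (p.pt j) q.rep := fun q => by
    simp [hG, evalForm, map_prod]
  have hGq0 : ∀ q : P1 k, evalForm G q ≠ 0 → ∀ j, cross (p.pt j) q.rep = 0 →
      cross (p.pt j) q₀.rep = 0 := by
    intro q hq j hj
    rw [hGq, Finset.prod_ne_zero_iff] at hq
    by_contra h
    exact hq j (by rw [Finset.mem_compl, hmemS]; exact h) hj
  refine ⟨lineCone p q₀, (lineMap p hP c q₀).cone_mem, (Sᶜ).card, G, ?_, ?_, ?_, ?_⟩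
  · have := MvPolynomial.IsHomogeneous.prod Sᶜ (fun j => crossForm (p.pt j)) (fun _ => 1)
      fun j _ => isHomogeneous_crossForm _
    simpa using this
  · rw [hGq, Finset.prod_ne_zero_iff]
    intro j hj
    rwa [Finset.mem_compl, hmemS] at hj
  · intro q hq
    change IsFace (lineCone p q) (lineCone p q₀)
    rcases point_cases p q with ⟨j, rfl⟩ | h
    · have h1 := hGq0 _ hq j (p.cross_eq_zero_iff.2 rfl)
      rw [p.cross_eq_zero_iff.1 h1]
      exact isFace_refl ⟨_, mem_lineCone p _⟩
    · rw [lineCone_of_forall_ne p h]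
      exact isFace_lineCone p hP q₀
  · intro m hm
    have hmv := hm _ (mem_lineCone p q₀)
    by_cases hmv0 : m.1 ((L.v : V), 1) = 0
    swap
    · refine ⟨0, 0, MvPolynomial.isHomogeneous_zero _ _ _, fun q _ => ?_⟩
      rw [lineMap_val_of_ne p hP c hmv0]
      simp [evalForm]
    rw [nonneg_lineCone_iff p hmv0] at hm
    set n : L.J → ℤ := fun j => restr m (L.amp j) with hn
    have hnS : ∀ j ∈ S, 0 ≤ n j := fun j hj => by
      simp only [hn, L.apply_amp]
      exact mul_nonneg (by positivity) (hm j ((hmemS j).1 hj))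
    -- Any `r` exceeding all pole orders will do; the sum of the absolute values of the exponents is
    -- a convenient choice.
    obtain ⟨r, hr⟩ : ∃ r : ℕ, ∀ j, 0 ≤ n j + r := by
      refine ⟨∑ j, (n j).natAbs, fun j => ?_⟩
      have h1 : (n j).natAbs ≤ ∑ j, (n j).natAbs :=
        Finset.single_le_sum (f := fun j => (n j).natAbs) (fun _ _ => Nat.zero_le _)
          (Finset.mem_univ j)
      have h2 : -((n j).natAbs : ℤ) ≤ n j := by omega
      have h3 : ((n j).natAbs : ℤ) ≤ ((∑ j, (n j).natAbs : ℕ) : ℤ) := by exact_mod_cast h1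
      omega
    set ee : L.J → ℕ := fun j => (n j + if j ∈ S then 0 else (r : ℤ)).toNat with hee
    have hee' : ∀ j, (ee j : ℤ) = n j + if j ∈ S then 0 else (r : ℤ) := by
      intro j
      simp only [hee]
      rw [Int.toNat_of_nonneg]
      split_ifs with h
      · simpa using hnS j h
      · exact hr j
    refine ⟨r, MvPolynomial.C (c (Multiplicative.ofAdd (restr m)) : k)
      * ∏ j, crossForm (p.pt j) ^ ee j, ?_, ?_⟩
    · have h1 := (MvPolynomial.isHomogeneous_C (Fin 2)
        (c (Multiplicative.ofAdd (restr m)) : k)).mul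
        (MvPolynomial.IsHomogeneous.prod Finset.univ (fun j => crossForm (p.pt j) ^ ee j) ee
        fun j _ => by simpa using (isHomogeneous_crossForm (p.pt j)).pow (ee j))
      convert h1 using 1
      zify
      rw [zero_add, Finset.sum_congr rfl fun j _ => hee' j, Finset.sum_add_distrib,
        hL.sum_apply, zero_add]
      rw [Finset.sum_ite, Finset.sum_const_zero, zero_add, Finset.sum_const]
      have h3 : (Finset.univ.filter fun j => j ∉ S) = Sᶜ := by ext; simp
      rw [h3, nsmul_eq_mul, mul_comm]
    · intro q hq
      rw [eq_div_iff (pow_ne_zero _ hq), lineMap_val p hP c hmv0, lineVal, hGq,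
        ← Finset.prod_pow, mul_assoc]
      have h2 : evalForm (MvPolynomial.C (c (Multiplicative.ofAdd (restr m)) : k)
          * ∏ j, crossForm (p.pt j) ^ ee j) q
          = c (Multiplicative.ofAdd (restr m)) * ∏ j, cross (p.pt j) q.rep ^ ee j := by
        simp [evalForm, map_prod]
      rw [h2]
      congr 1
      rw [← Finset.prod_filter_mul_prod_filter_not Finset.univ (· ∈ S)]
      rw [← Finset.prod_filter_mul_prod_filter_not Finset.univ (· ∈ S)
        (fun j => cross (p.pt j) q.rep ^ ee j)]
      have h3 : (Finset.univ.filter fun j => j ∉ S) = Sᶜ := by ext; simp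
      rw [h3, mul_assoc, ← Finset.prod_mul_distrib]
      rw [hGq, Finset.prod_ne_zero_iff] at hq
      congr 1
      · refine Finset.prod_congr rfl fun j hj => ?_
        have hj' : j ∈ S := by simpa using hj
        rw [← zpow_natCast, hee', if_pos hj', add_zero]
      · refine Finset.prod_congr rfl fun j hj => ?_
        have hj' : j ∉ S := by simpa using hj
        rw [← zpow_natCast _ (ee j), hee', if_neg hj', zpow_add₀ (hq j hj), zpow_natCast]

/-- The linear form of `p j` enters `χ^m` with exponent `w j * m(u j)`, and the linear forms of the
other points do not vanish at `p j`. -/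
theorem hasIndex_lineMap (hL : L.IsBalanced) (j : L.J) : HasIndex (lineMap p hP c) L.v (p.point j) (L.w j) := by
  classical
  refine ⟨L.u j, L.u_primitive j, ?_, ?_⟩
  · intro x hx
    change (x, (1 : ℚ)) ∈ lineCone p (p.point j) at hx
    rw [lineCone_point] at hx
    exact L.T_subset j x ((hP.polyhedron _ (L.T_mem j)).mem_of_mem_coneOver hx)
  intro m hm hmv
  have hm : ∀ i, cross (p.pt i) (p.point j).rep = 0 → 0 ≤ restr m (L.u i) :=
    (nonneg_lineCone_iff p hmv _).1 hm
  have hj0 := hm j (p.cross_eq_zero_iff.2 rfl)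
  obtain ⟨a, ha⟩ := Int.eq_ofNat_of_zero_le hj0
  refine ⟨a, by rw [← restr_apply, ha]; simp, ?_⟩
  set n : L.J → ℤ := fun j => restr m (L.amp j) with hn
  have hnj : n j = ((L.w j * a : ℕ) : ℤ) := by simp only [hn, L.apply_amp, ha]; simp
  -- The order is measured by the linear form of the chosen representative of the point, which
  -- differs from that of `p.pt j` by the scalar `b`; a power of `b` is moved into the constant.
  obtain ⟨b, hb, hrep⟩ := exists_rep_eq_smul (p.ne_zero j)
  have hrep' : p.pt j = b⁻¹ • (p.point j).rep := by
    change _ = b⁻¹ • (Projectivization.mk k (p.pt j) (p.ne_zero j)).rep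
    rw [hrep, smul_smul, inv_mul_cancel₀ hb, one_smul]
  set pp : (L.J → ℕ) → MvPolynomial (Fin 2) k := fun e =>
    ∏ i ∈ Finset.univ.erase j, crossForm (p.pt i) ^ e i with hpp
  have hpph : ∀ e, (pp e).IsHomogeneous (∑ i ∈ Finset.univ.erase j, e i) := fun e =>
    MvPolynomial.IsHomogeneous.prod _ (fun j => crossForm (p.pt j) ^ e j) e
        fun j _ => by simpa using (isHomogeneous_crossForm (p.pt j)).pow (e j)
  have hppe : ∀ e (q : P1 k), evalForm (pp e) q
      = ∏ i ∈ Finset.univ.erase j, cross (p.pt i) q.rep ^ e i := fun e q => by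
    simp [hpp, evalForm, map_prod]
  have hpp0 : ∀ e, evalForm (pp e) (p.point j) ≠ 0 := fun e => by
    rw [hppe, Finset.prod_ne_zero_iff]
    intro i hi
    refine pow_ne_zero _ fun h => (Finset.mem_erase.1 hi).1 ?_
    exact (p.point_injective (p.cross_eq_zero_iff.1 h)).symm
  refine ⟨∑ i ∈ Finset.univ.erase j, (n i).toNat,
    MvPolynomial.C (c (Multiplicative.ofAdd (restr m)) * b⁻¹ ^ n j : k) * pp fun i => (n i).toNat,
    pp fun i => (-n i).toNat, ?_, ?_, ?_, hpp0 _, ?_⟩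
  · have := (MvPolynomial.isHomogeneous_C (Fin 2)
      (c (Multiplicative.ofAdd (restr m)) * b⁻¹ ^ n j : k)).mul (hpph fun i => (n i).toNat)
    rwa [zero_add] at this
  · convert hpph fun i => (-n i).toNat using 1
    have h1 := hL.sum_apply (restr m)
    rw [← Finset.add_sum_erase _ _ (Finset.mem_univ j)] at h1
    exact (sum_toNat_neg_eq _ n (L.w j * a) (by rw [← hnj]; exact h1)).symm
  · have : evalForm (MvPolynomial.C (c (Multiplicative.ofAdd (restr m)) * b⁻¹ ^ n j : k)
        * pp fun i => (n i).toNat) (p.point j) = (c (Multiplicative.ofAdd (restr m)) * b⁻¹ ^ n j)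
        * evalForm (pp fun i => (n i).toNat) (p.point j) := by
      rw [evalForm, map_mul, MvPolynomial.eval_C]; rfl
    rw [this]
    exact mul_ne_zero (mul_ne_zero (Units.ne_zero _) (zpow_ne_zero _ (inv_ne_zero hb))) (hpp0 _)
  · intro q _ _
    change (lineMap p hP c q).val m = cross (p.point j).rep q.rep ^ (L.w j * a) * _ / _
    have h1 : evalForm (MvPolynomial.C (c (Multiplicative.ofAdd (restr m)) * b⁻¹ ^ n j : k)
        * pp fun i => (n i).toNat) q = (c (Multiplicative.ofAdd (restr m)) * b⁻¹ ^ n j)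
        * evalForm (pp fun i => (n i).toNat) q := by
      rw [evalForm, map_mul, MvPolynomial.eval_C]; rfl
    rw [h1, lineMap_val p hP c hmv, lineVal, ← Finset.mul_prod_erase _ _ (Finset.mem_univ j)]
    have h2 : ∏ i ∈ Finset.univ.erase j, cross (p.pt i) q.rep ^ restr m (L.amp i)
        = evalForm (pp fun i => (n i).toNat) q / evalForm (pp fun i => (-n i).toNat) q := by
      rw [hppe, hppe, ← Finset.prod_div_distrib]
      exact Finset.prod_congr rfl fun i _ => zpow_eq_pow_toNat_div _ _
    rw [h2]
    have h3 : cross (p.pt j) q.rep ^ restr m (L.amp j)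
        = b⁻¹ ^ n j * cross (p.point j).rep q.rep ^ (L.w j * a) := by
      change cross (p.pt j) q.rep ^ n j = _
      conv_lhs => rw [hrep', cross_smul_left, mul_zpow]
      rw [hnj, zpow_natCast, zpow_natCast]
    rw [h3]
    ring

theorem lineMap_mem_centralFiber (q : P1 k) : lineMap p hP c q ∈ centralFiber k N P :=
  lineMap_val_of_ne p hP c (by simp [projMonomial]) q

theorem exists_forall_ne_point [Infinite k] : ∃ q : P1 k, ∀ j, q ≠ p.point j := by
  by_contra h
  push Not at h
  have hfin : (Set.univ : Set (P1 k)).Finite :=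
    (Set.finite_range p.point).subset fun q _ => by
      obtain ⟨j, hj⟩ := h q
      exact ⟨j, hj.symm⟩
  have hc : cross (k := k) ![1, 0] ![0, 1] ≠ 0 := by simp [cross]
  have := finite_line_preimage hc hfin
  exact Set.infinite_univ (this.subset fun t _ => by simp)

theorem lineMap_nonconstant [Infinite k] [Nonempty L.J] :
    ∃ q q', lineMap p hP c q ≠ lineMap p hP c q' := by
  obtain ⟨q, hq⟩ := exists_forall_ne_point p
  obtain ⟨j⟩ := ‹Nonempty L.J›
  refine ⟨q, p.point j, fun h => ?_⟩
  have h1 : lineCone p q = lineCone p (p.point j) := congrArg ToricPoint.cone h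
  rw [lineCone_of_forall_ne p hq] at h1
  exact (lineCone_eq_singleton_iff p hP).1 h1.symm j rfl

end LineMap

end LineFrame

end Lines

/-! ### Every map with the boundary behavior of a line is a standard line -/

section Classification

variable {V : Type*} [AddCommGroup V] [Module ℚ V] {N : Submodule ℤ V} {P : Set (Set V)}
  {k : Type*} [Field k]

theorem evalForm_ne_zero_iff {G : MvPolynomial (Fin 2) k} {e : ℕ} (hG : G.IsHomogeneous e)
    {y : Fin 2 → k} (hy : y ≠ 0) :
    evalForm G (Projectivization.mk k y hy) ≠ 0 ↔ MvPolynomial.eval y G ≠ 0 := by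
  obtain ⟨a, ha, h⟩ := exists_rep_eq_smul hy
  rw [evalForm, h, eval_smul_of_isHomogeneous hG, mul_ne_zero_iff]
  simp [ha]

/-- Numerator and denominator have the same degree, so the local formula does not depend on the
representative. It may therefore be evaluated on the punctured plane. -/
theorem HasOrder.exists_eval {g : P1 k → k} {q₀ : P1 k} {w : ℕ} (h : HasOrder g q₀ w) :
    ∃ (e : ℕ) (G H : MvPolynomial (Fin 2) k), G.IsHomogeneous e ∧ H.IsHomogeneous (e + w) ∧
      MvPolynomial.eval q₀.rep G ≠ 0 ∧ MvPolynomial.eval q₀.rep H ≠ 0 ∧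
      ∀ y (hy : y ≠ 0), MvPolynomial.eval y G ≠ 0 → MvPolynomial.eval y H ≠ 0 →
        g (Projectivization.mk k y hy)
          = cross q₀.rep y ^ w * MvPolynomial.eval y G / MvPolynomial.eval y H := by
  obtain ⟨e, G, H, hG, hH, hG0, hH0, hg⟩ := h
  refine ⟨e, G, H, hG, hH, hG0, hH0, fun y hy hyG hyH => ?_⟩
  rw [hg _ ((evalForm_ne_zero_iff hG hy).2 hyG) ((evalForm_ne_zero_iff hH hy).2 hyH)]
  change cross q₀.rep (Projectivization.mk k y hy).rep ^ w * _ / _ = _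
  obtain ⟨a, ha, h⟩ := exists_rep_eq_smul hy
  rw [evalForm, evalForm, h, eval_smul_of_isHomogeneous hG, eval_smul_of_isHomogeneous hH,
    cross_smul_right, mul_pow, pow_add]
  field_simp

variable {Λ : Submodule ℤ (V × ℚ)} {F : Set (Set (V × ℚ))} in
theorem IsMorphism.exists_eval {f : P1 k → ToricPoint k Λ F} (hf : IsMorphism f) {x : Fin 2 → k}
    (hx : x ≠ 0) :
    ∃ τ ∈ F, ∃ (e : ℕ) (G : MvPolynomial (Fin 2) k), G.IsHomogeneous e ∧
      MvPolynomial.eval x G ≠ 0 ∧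
      (∀ y (hy : y ≠ 0), MvPolynomial.eval y G ≠ 0 →
        f (Projectivization.mk k y hy) ∈ chart k Λ F τ) ∧
      ∀ m : dualLattice Λ, (∀ y ∈ τ, 0 ≤ m.1 y) →
        ∃ (r : ℕ) (H : MvPolynomial (Fin 2) k), H.IsHomogeneous (r * e) ∧
          ∀ y (hy : y ≠ 0), MvPolynomial.eval y G ≠ 0 →
            (f (Projectivization.mk k y hy)).val m
              = MvPolynomial.eval y H / MvPolynomial.eval y G ^ r := by
  obtain ⟨τ, hτ, e, G, hG, hG0, hch, hval⟩ := hf (Projectivization.mk k x hx)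
  refine ⟨τ, hτ, e, G, hG, (evalForm_ne_zero_iff hG hx).1 hG0,
    fun y hy hyG => hch _ ((evalForm_ne_zero_iff hG hy).2 hyG), fun m hm => ?_⟩
  obtain ⟨r, H, hH, hr⟩ := hval m hm
  refine ⟨r, H, hH, fun y hy hyG => ?_⟩
  rw [hr _ ((evalForm_ne_zero_iff hG hy).2 hyG)]
  obtain ⟨a, ha, h⟩ := exists_rep_eq_smul hy
  rw [evalForm, evalForm, h, eval_smul_of_isHomogeneous hG, eval_smul_of_isHomogeneous hH,
    mul_pow, ← pow_mul, mul_comm e r]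
  rw [mul_div_mul_left _ _ (pow_ne_zero _ ha)]

/-- Products of powers of the linear forms of a family of points. -/
def powForm {ι : Type*} (s : Finset ι) (p : ι → Fin 2 → k) (n : ι → ℕ) : MvPolynomial (Fin 2) k :=
  ∏ i ∈ s, crossForm (p i) ^ n i

theorem isHomogeneous_powForm {ι : Type*} (s : Finset ι) (p : ι → Fin 2 → k) (n : ι → ℕ) :
    (powForm s p n).IsHomogeneous (∑ i ∈ s, n i) :=
  MvPolynomial.IsHomogeneous.prod _ (fun j => crossForm (p j) ^ n j) n
    fun j _ => by simpa using (isHomogeneous_crossForm (p j)).pow (n j)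

theorem eval_powForm {ι : Type*} (s : Finset ι) (p : ι → Fin 2 → k) (n : ι → ℕ) (x : Fin 2 → k) :
    MvPolynomial.eval x (powForm s p n) = ∏ i ∈ s, cross (p i) x ^ n i := by
  simp [powForm, map_prod]

theorem eval_powForm_ne_zero {ι : Type*} {s : Finset ι} {p : ι → Fin 2 → k} {n : ι → ℕ}
    {x : Fin 2 → k} (h : ∀ i ∈ s, cross (p i) x ≠ 0) :
    MvPolynomial.eval x (powForm s p n) ≠ 0 := by
  rw [eval_powForm, Finset.prod_ne_zero_iff]
  exact fun i hi => pow_ne_zero _ (h i hi)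

theorem prod_zpow_eq_eval_powForm {ι : Type*} (s : Finset ι) (p : ι → Fin 2 → k) (n : ι → ℤ)
    (x : Fin 2 → k) :
    ∏ i ∈ s, cross (p i) x ^ n i
      = MvPolynomial.eval x (powForm s p fun i => (n i).toNat)
        / MvPolynomial.eval x (powForm s p fun i => (-n i).toNat) := by
  rw [eval_powForm, eval_powForm, ← Finset.prod_div_distrib]
  exact Finset.prod_congr rfl fun i _ => zpow_eq_pow_toNat_div _ _

theorem sum_toNat_sub {ι : Type*} (s : Finset ι) (n : ι → ℤ) :
    ((∑ i ∈ s, (n i).toNat : ℕ) : ℤ) - (∑ i ∈ s, (-n i).toNat : ℕ) = ∑ i ∈ s, n i := by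
  rw [Nat.cast_sum, Nat.cast_sum, ← Finset.sum_sub_distrib]
  exact Finset.sum_congr rfl fun i _ => by omega

namespace LineFrame

variable {L : LineFrame N P} (p : L.Points k)

/-- A map from the projective line to `X_v` of the combinatorial type `L` with boundary points
`p`. -/
structure IsOfType (f : P1 k → Degeneration k N P) : Prop where
  isMorphism : IsMorphism f
  cone_generic : ∀ q, (∀ j, q ≠ p.point j) → (f q).cone = coneOver {(L.v : V)}
  cone_point : ∀ j, (f (p.point j)).cone = coneOver (L.T j)
  hasOrder : ∀ j, ∀ m : dualLattice (extLattice N), m.1 ((L.v : V), 1) = 0 →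
    0 ≤ restr m (L.u j) →
      HasOrder (fun q => (f q).val m) (p.point j) (L.w j * (restr m (L.u j)).toNat)

variable {p} {f : P1 k → Degeneration k N P}

namespace IsOfType

theorem val_add_of_generic (hf : IsOfType p f) {q : P1 k} (hq : ∀ j, q ≠ p.point j)
    {m m' : dualLattice (extLattice N)} (hm : m.1 ((L.v : V), 1) = 0)
    (hm' : m'.1 ((L.v : V), 1) = 0) : (f q).val (m + m') = (f q).val m * (f q).val m' := by
  refine (f q).val_add m m' ?_ ?_ <;> rw [hf.cone_generic q hq, nonneg_coneOver_iff]
  · simp [hm]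
  · simp [hm']

theorem val_ne_zero_of_generic (hf : IsOfType p f) {q : P1 k} (hq : ∀ j, q ≠ p.point j)
    {m : dualLattice (extLattice N)} (hm : m.1 ((L.v : V), 1) = 0) : (f q).val m ≠ 0 := by
  rw [(f q).val_ne_zero, hf.cone_generic q hq, eq_zero_coneOver_iff]
  simp [hm]

theorem val_neg_of_generic (hf : IsOfType p f) {q : P1 k} (hq : ∀ j, q ≠ p.point j)
    {m : dualLattice (extLattice N)} (hm : m.1 ((L.v : V), 1) = 0) :
    (f q).val (-m) = ((f q).val m)⁻¹ := by
  have h := hf.val_add_of_generic hq (m := -m) (m' := m)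
    (by change - m.1 ((L.v : V), 1) = 0; rw [hm, neg_zero]) hm
  rw [neg_add_cancel, (f q).val_zero] at h
  exact eq_inv_of_mul_eq_one_left h.symm

/-- The function `χ^m` divided by the product of powers of linear forms with the same zeros and
poles. -/
def ratio (_ : IsOfType p f) (m : dualLattice (extLattice N)) (y : Fin 2 → k) : k :=
  open Classical in
  if hy : y ≠ 0 then (f (Projectivization.mk k y hy)).val m
    * ∏ j, cross (p.pt j) y ^ (-(restr m (L.amp j))) else 0

theorem ratio_apply (hf : IsOfType p f) (m : dualLattice (extLattice N)) {y : Fin 2 → k}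
    (hy : y ≠ 0) : hf.ratio m y = (f (Projectivization.mk k y hy)).val m
      * ∏ j, cross (p.pt j) y ^ (-(restr m (L.amp j))) := dif_pos hy

theorem notMem_range {q : P1 k} : q ∉ Set.range p.point ↔ ∀ j, q ≠ p.point j := by
  simp [Set.mem_range, eq_comm]

/-- The hypothesis of `eq_const_of_local_quotient_forms` at one point: `ratio` has neither zero nor
pole at `x`, and the difference of the degrees is the same number everywhere. -/
def IsLocalQuotient (hf : IsOfType p f) (m : dualLattice (extLattice N)) (x : Fin 2 → k) : Prop :=
  ∃ (e e' : ℕ) (G H : MvPolynomial (Fin 2) k),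
      G.IsHomogeneous e ∧ H.IsHomogeneous e' ∧ (e : ℤ) - e' = ∑ j, -(restr m (L.amp j)) ∧
      MvPolynomial.eval x G ≠ 0 ∧ MvPolynomial.eval x H ≠ 0 ∧
      ∀ y (hy : y ≠ 0), Projectivization.mk k y hy ∉ Set.range p.point →
        MvPolynomial.eval y G ≠ 0 → MvPolynomial.eval y H ≠ 0 →
        hf.ratio m y = MvPolynomial.eval y G / MvPolynomial.eval y H

/-- Away from the boundary points, passing to the inverse monomial inverts `ratio`. Thus at a
boundary point only monomials of nonnegative order have to be treated. -/
theorem isLocalQuotient_of_neg (hf : IsOfType p f) {m : dualLattice (extLattice N)}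
    (hm : m.1 ((L.v : V), 1) = 0) {x : Fin 2 → k} (h : hf.IsLocalQuotient (-m) x) :
    hf.IsLocalQuotient m x := by
  obtain ⟨e, e', G, H, hG, hH, hd, hG0, hH0, hr⟩ := h
  refine ⟨e', e, H, G, hH, hG, ?_, hH0, hG0, fun y hy hyB h1 h2 => ?_⟩
  · have : ∑ j, -(restr (-m) (L.amp j)) = - ∑ j, -(restr m (L.amp j)) := by
      rw [← Finset.sum_neg_distrib]
      simp [map_neg]
    rw [this] at hd
    linarith
  · have h3 := hr y hy hyB h2 h1
    rw [ratio_apply _ _ hy, hf.val_neg_of_generic (notMem_range.1 hyB) hm] at h3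
    rw [ratio_apply _ _ hy, ← inv_div, ← h3, mul_inv, inv_inv, ← Finset.prod_inv_distrib]
    congr 1
    refine Finset.prod_congr rfl fun j _ => ?_
    rw [← zpow_neg]
    simp [map_neg]

/-- The monomial need not be regular on the chart provided by the morphism. It is a quotient of two
regular ones by `exists_regular_quotient`, and both are nonzero at `x` because its image lies in the
big torus of `X_v`. -/
theorem isLocalQuotient_generic [N.IsLattice ℚ] (hf : IsOfType p f)
    (hP : IsPolyhedralDecomposition P) {m : dualLattice (extLattice N)}
    (hm : m.1 ((L.v : V), 1) = 0) {x : Fin 2 → k} (hx : x ≠ 0)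
    (hxB : ∀ j, Projectivization.mk k x hx ≠ p.point j) : hf.IsLocalQuotient m x := by
  obtain ⟨τ, hτ, e, G, hG, hG0, hch, hval⟩ := hf.isMorphism.exists_eval hx
  have hvτ : ((L.v : V), (1 : ℚ)) ∈ τ := by
    have h1 := hch x hx hG0
    refine IsFace.subset h1 ?_
    rw [hf.cone_generic _ hxB]
    exact mem_coneOver rfl
  obtain ⟨m₂, hm₂, hm₂τ, hm₁τ⟩ := hP.exists_regular_quotient L.v_mem hτ hvτ m hm
  obtain ⟨r₁, H₁, hH₁, h₁⟩ := hval _ hm₁τ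
  obtain ⟨r₂, H₂, hH₂, h₂⟩ := hval _ hm₂τ
  have hm₁ : (m + m₂).1 ((L.v : V), 1) = 0 := by
    change m.1 ((L.v : V), 1) + m₂.1 ((L.v : V), 1) = 0
    rw [hm, hm₂, add_zero]
  set n : L.J → ℤ := fun j => -(restr m (L.amp j)) with hn
  have hcr : ∀ i ∈ (Finset.univ : Finset L.J), cross (p.pt i) x ≠ 0 := fun i _ h =>
    hxB i ((ToricTropical.cross_eq_zero_iff (p.ne_zero i) hx).1 h).symm
  have hx1 : MvPolynomial.eval x H₁ ≠ 0 := fun h => by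
    have := hf.val_ne_zero_of_generic hxB hm₁
    rw [h₁ x hx hG0, h, zero_div] at this
    exact this rfl
  have hx2 : MvPolynomial.eval x H₂ ≠ 0 := fun h => by
    have := hf.val_ne_zero_of_generic hxB hm₂
    rw [h₂ x hx hG0, h, zero_div] at this
    exact this rfl
  -- The common factor `G` changes nothing in the quotient. It ensures that the chart formulas apply
  -- wherever the numerator is nonzero.
  refine ⟨e + (r₁ * e + e * r₂) + ∑ j, (n j).toNat, e + (r₂ * e + e * r₁) + ∑ j, (-n j).toNat,
    G * (H₁ * G ^ r₂) * powForm Finset.univ p.pt fun i => (n i).toNat,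
    G * (H₂ * G ^ r₁) * powForm Finset.univ p.pt fun i => (-n i).toNat, ?_, ?_, ?_, ?_, ?_, ?_⟩
  · exact (hG.mul (hH₁.mul (hG.pow _))).mul (isHomogeneous_powForm _ _ _)
  · exact (hG.mul (hH₂.mul (hG.pow _))).mul (isHomogeneous_powForm _ _ _)
  · rw [← sum_toNat_sub]
    push_cast
    ring
  · rw [map_mul, map_mul, map_mul, map_pow]
    exact mul_ne_zero (mul_ne_zero hG0 (mul_ne_zero hx1 (pow_ne_zero _ hG0)))
      (eval_powForm_ne_zero hcr)
  · rw [map_mul, map_mul, map_mul, map_pow]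
    exact mul_ne_zero (mul_ne_zero hG0 (mul_ne_zero hx2 (pow_ne_zero _ hG0)))
      (eval_powForm_ne_zero hcr)
  · intro y hy hyB hyG _
    rw [notMem_range] at hyB
    have hyG0 : MvPolynomial.eval y G ≠ 0 := fun h => hyG (by simp [h])
    have h3 := hf.val_add_of_generic hyB hm hm₂
    have h4 := hf.val_ne_zero_of_generic hyB hm₂
    rw [h₁ y hy hyG0] at h3
    have h5 : (f (Projectivization.mk k y hy)).val m = MvPolynomial.eval y H₁
        / MvPolynomial.eval y G ^ r₁ / (f (Projectivization.mk k y hy)).val m₂ := by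
      rw [h3, mul_div_cancel_right₀ _ h4]
    rw [ratio_apply _ _ hy, h5, h₂ y hy hyG0, prod_zpow_eq_eval_powForm]
    simp only [map_mul, map_pow]
    rw [mul_div_mul_comm, mul_div_mul_left _ _ hyG0]
    congr 1
    rw [div_div_div_eq]
    congr 1
    ring

/-- The prescribed order of vanishing of `χ^m` at `p j` is cancelled by the power of the linear form
of `p j` in `ratio`; the other linear forms are nonzero there. -/
theorem isLocalQuotient_point (hf : IsOfType p f) {m : dualLattice (extLattice N)}
    (hm : m.1 ((L.v : V), 1) = 0) {x : Fin 2 → k} (hx : x ≠ 0) {j : L.J}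
    (hxj : Projectivization.mk k x hx = p.point j) (hmj : 0 ≤ restr m (L.u j)) :
    hf.IsLocalQuotient m x := by
  classical
  obtain ⟨e, G, H, hG, hH, hG0, hH0, hval⟩ := (hf.hasOrder j m hm hmj).exists_eval
  set n : L.J → ℤ := fun j => -(restr m (L.amp j)) with hn
  set a : ℕ := L.w j * (restr m (L.u j)).toNat with ha
  have hnj : n j = -(a : ℤ) := by
    simp only [hn, ha, L.apply_amp]
    push_cast
    rw [Int.toNat_of_nonneg hmj]
  obtain ⟨b, hb, hrep⟩ := exists_rep_eq_smul (p.ne_zero j)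
  obtain ⟨b', hb', hrep'⟩ := exists_rep_eq_smul hx
  rw [← hxj, hrep', eval_smul_of_isHomogeneous hG] at hG0
  rw [← hxj, hrep', eval_smul_of_isHomogeneous hH] at hH0
  have hcr : ∀ i ∈ Finset.univ.erase j, cross (p.pt i) x ≠ 0 := fun i hi h => by
    have h1 := (ToricTropical.cross_eq_zero_iff (p.ne_zero i) hx).1 h
    rw [hxj] at h1
    exact (Finset.mem_erase.1 hi).1 (p.point_injective h1)
  have hba : b ^ a ≠ 0 := pow_ne_zero _ hb
  refine ⟨0 + e + ∑ j ∈ Finset.univ.erase j, (n j).toNat,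
    (e + a) + ∑ j ∈ Finset.univ.erase j, (-n j).toNat,
    MvPolynomial.C (b ^ a) * G * powForm (Finset.univ.erase j) p.pt fun i => (n i).toNat,
    H * powForm (Finset.univ.erase j) p.pt fun i => (-n i).toNat, ?_, ?_, ?_, ?_, ?_, ?_⟩
  · exact ((MvPolynomial.isHomogeneous_C _ _).mul hG).mul (isHomogeneous_powForm _ _ _)
  · exact hH.mul (isHomogeneous_powForm _ _ _)
  · rw [← Finset.add_sum_erase _ _ (Finset.mem_univ j)]
    change _ = n j + ∑ i ∈ Finset.univ.erase j, n i
    rw [← sum_toNat_sub, hnj]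
    push_cast
    ring
  · rw [map_mul, map_mul, MvPolynomial.eval_C]
    exact mul_ne_zero (mul_ne_zero hba (right_ne_zero_of_mul hG0)) (eval_powForm_ne_zero hcr)
  · rw [map_mul]
    exact mul_ne_zero (right_ne_zero_of_mul hH0) (eval_powForm_ne_zero hcr)
  · intro y hy hyB hyG hyH
    rw [map_mul, map_mul] at hyG
    rw [map_mul] at hyH
    have hyG0 := right_ne_zero_of_mul (left_ne_zero_of_mul hyG)
    have hyH0 := left_ne_zero_of_mul hyH
    have hcj : cross (p.pt j) y ≠ 0 := fun h => notMem_range.1 hyB j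
      ((ToricTropical.cross_eq_zero_iff (p.ne_zero j) hy).1 h).symm
    rw [ratio_apply _ _ hy, ← Finset.mul_prod_erase _ _ (Finset.mem_univ j),
      prod_zpow_eq_eval_powForm _ _ (fun i => -(restr m (L.amp i)))]
    have h1 : (f (Projectivization.mk k y hy)).val m * cross (p.pt j) y ^ (n j)
        = b ^ a * MvPolynomial.eval y G / MvPolynomial.eval y H := by
      have h2 := hval y hy hyG0 hyH0
      have h3 : (p.point j).rep = b • p.pt j := hrep
      rw [h3, cross_smul_left] at h2
      rw [h2, hnj, zpow_neg, zpow_natCast]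
      field_simp
      ring
    rw [← mul_assoc]
    change (f (Projectivization.mk k y hy)).val m * cross (p.pt j) y ^ (n j) * _ = _
    rw [h1, div_mul_div_comm]
    simp only [map_mul, MvPolynomial.eval_C]
    rfl

theorem isLocalQuotient [N.IsLattice ℚ] (hf : IsOfType p f) (hP : IsPolyhedralDecomposition P)
    {m : dualLattice (extLattice N)} (hm : m.1 ((L.v : V), 1) = 0) {x : Fin 2 → k} (hx : x ≠ 0) :
    hf.IsLocalQuotient m x := by
  rcases point_cases p (Projectivization.mk k x hx) with ⟨j, hj⟩ | h
  · rcases le_total 0 (restr m (L.u j)) with h0 | h0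
    · exact hf.isLocalQuotient_point hm hx hj h0
    · have hm' : (-m).1 ((L.v : V), 1) = 0 := by
        change - m.1 ((L.v : V), 1) = 0
        rw [hm, neg_zero]
      exact hf.isLocalQuotient_of_neg hm
        (hf.isLocalQuotient_point hm' hx hj (by rw [map_neg]; simpa using h0))
  · exact hf.isLocalQuotient_generic hP hm hx h

variable [N.IsLattice ℚ] [IsAlgClosed k]

theorem ratio_const (hf : IsOfType p f) (hP : IsPolyhedralDecomposition P)
    {m : dualLattice (extLattice N)} (hm : m.1 ((L.v : V), 1) = 0) :
    ∑ j, -(restr m (L.amp j)) = 0 ∧ ∃ c, c ≠ 0 ∧ ∀ y (hy : y ≠ 0),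
      Projectivization.mk k y hy ∉ Set.range p.point → hf.ratio m y = c :=
  eq_const_of_local_quotient_forms (Set.finite_range p.point) (hf.ratio m) _
    fun _ hx => hf.isLocalQuotient hP hm hx

/-- A quotient of forms without zeros and poles has degree zero, and the degree of `ratio` is `-∑
m(w j • u j)` for every form `m`. So balancing is a consequence of the existence of the map. -/
theorem isBalanced (hf : IsOfType p f) (hP : IsPolyhedralDecomposition P) : L.IsBalanced := by
  have hfree : Module.Free ℤ N := inferInstance
  rw [IsBalanced, ← Module.forall_dual_apply_eq_zero_iff ℤ]
  intro m
  have h := (hf.ratio_const hP (monomial_apply_self L.v m)).1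
  rw [restr_monomial, Finset.sum_neg_distrib, neg_eq_zero] at h
  rw [map_sum]
  exact h

/-- Every map of the given combinatorial type is a standard line. -/
theorem exists_eq_lineMap (hf : IsOfType p f) (hP : IsPolyhedralDecomposition P) :
    ∃ c : CharTorus k N, ∀ q, f q = lineMap p hP c q := by
  classical
  have hinf : Infinite k := IsAlgClosed.instInfinite
  have hL := hf.isBalanced hP
  obtain ⟨q₀, hq₀⟩ := exists_forall_ne_point p
  set x₀ := q₀.rep with hx₀
  have hx₀0 : x₀ ≠ 0 := q₀.rep_nonzero
  have hmk₀ : Projectivization.mk k x₀ hx₀0 = q₀ := q₀.mk_rep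
  have hrat0 : ∀ m : Module.Dual ℤ N, hf.ratio (monomial L.v m) x₀
      = (f q₀).val (monomial L.v m) * ∏ j, cross (p.pt j) x₀ ^ (-(m (L.amp j))) := fun m => by
    rw [ratio_apply _ _ hx₀0, hmk₀, restr_monomial]
  have hcr0 : ∀ j, cross (p.pt j) x₀ ≠ 0 := fun j h => hq₀ j (p.cross_eq_zero_iff.1 h)
  have hne : ∀ m : Module.Dual ℤ N, hf.ratio (monomial L.v m) x₀ ≠ 0 := fun m => by
    rw [hrat0]
    exact mul_ne_zero (hf.val_ne_zero_of_generic hq₀ (monomial_apply_self _ _))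
      (Finset.prod_ne_zero_iff.2 fun j _ => zpow_ne_zero _ (hcr0 j))
  -- The character is read off at one point of the big torus: it is the constant value of `ratio` as
  -- a function of the monomial.
  let c : CharTorus k N :=
    { toFun := fun m => Units.mk0 _ (hne (Multiplicative.toAdd m))
      map_one' := by
        ext
        rw [Units.val_mk0, hrat0]
        simp [(f q₀).val_zero]
      map_mul' := fun m m' => by
        ext
        rw [Units.val_mul, Units.val_mk0, Units.val_mk0, Units.val_mk0, hrat0, hrat0, hrat0,
          toAdd_mul, map_add, hf.val_add_of_generic hq₀ (monomial_apply_self _ _)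
          (monomial_apply_self _ _)]
        simp only [LinearMap.add_apply, neg_add, zpow_add₀ (hcr0 _), Finset.prod_mul_distrib]
        ring }
  have hc : ∀ m : Module.Dual ℤ N, (c (Multiplicative.ofAdd m) : k)
      = hf.ratio (monomial L.v m) x₀ := fun m => rfl
  have hgen : ∀ y (hy : y ≠ 0), (∀ j, Projectivization.mk k y hy ≠ p.point j) →
      ∀ m : dualLattice (extLattice N), m.1 ((L.v : V), 1) = 0 →
      (f (Projectivization.mk k y hy)).val m = lineVal p c y (restr m) := by
    intro y hy hyB m hm
    obtain ⟨-, c', -, hc'⟩ := hf.ratio_const hP hm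
    have h1 := hc' y hy (notMem_range.2 hyB)
    have h2 := hc' x₀ hx₀0 (notMem_range.2 (by rwa [hmk₀]))
    rw [lineVal, hc, monomial_restr L.v hm, h2, ← h1, ratio_apply _ _ hy, mul_assoc,
      ← Finset.prod_mul_distrib]
    rw [Finset.prod_eq_one, mul_one]
    intro j _
    have hcj : cross (p.pt j) y ≠ 0 := fun h =>
      hyB j ((ToricTropical.cross_eq_zero_iff (p.ne_zero j) hy).1 h).symm
    rw [← zpow_add₀ hcj, neg_add_cancel, zpow_zero]
  refine ⟨c, fun q => ?_⟩
  have hcone : (f q).cone = (lineMap p hP c q).cone := by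
    rw [lineMap_cone]
    rcases point_cases p q with ⟨j, rfl⟩ | h
    · rw [hf.cone_point, lineCone_point]
    · rw [hf.cone_generic q h, lineCone_of_forall_ne p h]
  refine ToricPoint.ext hcone (funext fun m => ?_)
  by_cases hz : ∀ y ∈ (lineMap p hP c q).cone, m.1 y = 0
  swap
  · have h1 := mt ((lineMap p hP c q).val_ne_zero m).1 hz
    have h2 := mt ((f q).val_ne_zero m).1 (hcone ▸ hz)
    rw [not_not.1 h1, not_not.1 h2]
  have hm : m.1 ((L.v : V), 1) = 0 := hz _ (mem_lineCone p q)
  rcases point_cases p q with ⟨j, rfl⟩ | h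
  swap
  · rw [lineMap_val p hP c hm]
    have := hgen q.rep q.rep_nonzero (by rwa [q.mk_rep]) m hm
    rwa [q.mk_rep] at this
  have hmj : restr m (L.u j) = 0 :=
    ((eq_zero_lineCone_iff p m (p.point j)).1 hz).2 j (p.cross_eq_zero_iff.2 rfl)
  -- At a boundary point the relevant monomials have order zero. Both maps are then given near it by
  -- quotients of nonvanishing forms, and these agree off the boundary points, hence also at the
  -- point itself.
  obtain ⟨e, G, H, hG, hH, hG0, hH0, hval⟩ := (hf.hasOrder j m hm hmj.ge).exists_eval
  rw [hmj, Int.toNat_zero, mul_zero] at hval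
  set y₁ := (p.point j).rep with hy₁
  have hy₁0 : y₁ ≠ 0 := (p.point j).rep_nonzero
  have hmk₁ : Projectivization.mk k y₁ hy₁0 = p.point j := (p.point j).mk_rep
  set n : L.J → ℤ := fun j => restr m (L.amp j) with hn
  have hnj : n j = 0 := by simp only [hn, L.apply_amp, hmj, mul_zero]
  set G' := powForm (Finset.univ.erase j) p.pt fun i => (n i).toNat with hG'
  set H' := powForm (Finset.univ.erase j) p.pt fun i => (-n i).toNat with hH'
  set κ : k := ((c (Multiplicative.ofAdd (restr m)) : kˣ) : k) with hκ
  have hline : ∀ y, lineVal p c y (restr m)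
      = κ * (MvPolynomial.eval y G' / MvPolynomial.eval y H') := by
    intro y
    rw [lineVal, ← Finset.mul_prod_erase _ _ (Finset.mem_univ j),
      prod_zpow_eq_eval_powForm _ _ (fun i => restr m (L.amp i))]
    change κ * (cross (p.pt j) y ^ n j * _) = _
    rw [hnj, zpow_zero, one_mul]
  have hcr : ∀ i ∈ Finset.univ.erase j, cross (p.pt i) y₁ ≠ 0 := fun i hi h =>
    (Finset.mem_erase.1 hi).1 (p.point_injective (p.cross_eq_zero_iff.1 h)).symm
  have hvan := eval_eq_zero_of_finite_compl (Set.finite_range p.point)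
    (F := (G * H' - MvPolynomial.C κ * G' * H) * (G * H) * H') (by
      intro y hy hyB
      rw [notMem_range] at hyB
      simp only [map_mul, map_sub, MvPolynomial.eval_C]
      by_cases h1 : MvPolynomial.eval y G = 0
      · simp [h1]
      by_cases h2 : MvPolynomial.eval y H = 0
      · simp [h2]
      by_cases h3 : MvPolynomial.eval y H' = 0
      · simp [h3]
      have h4 := hval y hy h1 h2
      rw [pow_zero, one_mul] at h4
      change (f (Projectivization.mk k y hy)).val m = _ at h4
      rw [hgen y hy hyB m hm, hline] at h4
      field_simp at h4
      have h5 : MvPolynomial.eval y G * MvPolynomial.eval y H'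
          - κ * MvPolynomial.eval y G' * MvPolynomial.eval y H = 0 := by
        rw [h4]; ring
      rw [h5]; ring) hy₁0
  have hH'0 : MvPolynomial.eval y₁ H' ≠ 0 := eval_powForm_ne_zero hcr
  simp only [map_mul, map_sub, MvPolynomial.eval_C] at hvan
  have h6 := (mul_eq_zero.1 ((mul_eq_zero.1 hvan).resolve_right hH'0)).resolve_right
    (mul_ne_zero hG0 hH0)
  have h7 := hval y₁ hy₁0 hG0 hH0
  rw [pow_zero, one_mul, hmk₁] at h7
  rw [h7, lineMap_val p hP c hm, hline, ← hy₁]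
  field_simp
  linear_combination h6

end IsOfType

end LineFrame

end Classification

/-! ### Coordinate changes on the projective line and values at the boundary -/

section Gauge

variable {V : Type*} [AddCommGroup V] [Module ℚ V] {N : Submodule ℤ V} {P : Set (Set V)}
  {k : Type*} [Field k]

theorem exists_cross_map (g : (Fin 2 → k) ≃ₗ[k] (Fin 2 → k)) :
    ∃ D : k, D ≠ 0 ∧ ∀ x y, cross (g x) (g y) = D * cross x y := by
  have hexp : ∀ x : Fin 2 → k, g x = x 0 • g ![1, 0] + x 1 • g ![0, 1] := fun x => by
    rw [← map_smul, ← map_smul, ← map_add]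
    congr 1
    ext i
    fin_cases i <;> simp
  have key : ∀ x y, cross (g x) (g y) = cross (g ![1, 0]) (g ![0, 1]) * cross x y := fun x y => by
    rw [hexp x, hexp y]
    simp only [cross, Pi.add_apply, Pi.smul_apply, smul_eq_mul]
    ring
  refine ⟨_, fun h => ?_, key⟩
  have h1 := key (g.symm ![1, 0]) (g.symm ![0, 1])
  rw [h, zero_mul, g.apply_symm_apply, g.apply_symm_apply] at h1
  simp [cross] at h1

/-- The coordinates with respect to two independent vectors. -/
def frameEquiv (x y : Fin 2 → k) (h : cross x y ≠ 0) : (Fin 2 → k) ≃ₗ[k] (Fin 2 → k) where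
  toFun z := z 0 • x + z 1 • y
  map_add' z z' := by simp only [Pi.add_apply, add_smul]; abel
  map_smul' a z := by simp only [Pi.smul_apply, smul_eq_mul, mul_smul, smul_add, RingHom.id_apply]
  invFun z := ![cross z y / cross x y, cross x z / cross x y]
  left_inv z := by
    ext i
    fin_cases i
    · change cross (z 0 • x + z 1 • y) y / cross x y = z 0
      rw [div_eq_iff h]; simp [cross]; ring
    · change cross x (z 0 • x + z 1 • y) / cross x y = z 1
      rw [div_eq_iff h]; simp [cross]; ring
  right_inv z := by
    have key : cross z y • x + cross x z • y = cross x y • z := by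
      ext i
      fin_cases i <;> simp [cross] <;> ring
    change (cross z y / cross x y) • x + (cross x z / cross x y) • y = z
    rw [div_eq_inv_mul, div_eq_inv_mul, mul_smul, mul_smul, ← smul_add, key, smul_smul,
      inv_mul_cancel₀ h, one_smul]

/-- Three points of the projective line can be moved to any three others. The scalars by which the
representing vectors are multiplied are kept, since they enter the change of the character. -/
theorem exists_equiv_of_triple {x₁ x₂ x₃ y₁ y₂ y₃ : Fin 2 → k} (hx₁₂ : cross x₁ x₂ ≠ 0)
    (hx₁₃ : cross x₁ x₃ ≠ 0) (hx₂₃ : cross x₂ x₃ ≠ 0) (hy₁₂ : cross y₁ y₂ ≠ 0)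
    (hy₁₃ : cross y₁ y₃ ≠ 0) (hy₂₃ : cross y₂ y₃ ≠ 0) :
    ∃ (g : (Fin 2 → k) ≃ₗ[k] (Fin 2 → k)) (a b c : kˣ),
      g x₁ = (a : k) • y₁ ∧ g x₂ = (b : k) • y₂ ∧ g x₃ = (c : k) • y₃ := by
  have hdec : ∀ x y z : Fin 2 → k, cross x y • z = cross z y • x + cross x z • y := by
    intro x y z
    ext i
    fin_cases i <;> simp [cross] <;> ring
  have hx₃₂ : cross x₃ x₂ ≠ 0 := by rw [cross_comm]; exact neg_ne_zero.2 hx₂₃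
  have hy₃₂ : cross y₃ y₂ ≠ 0 := by rw [cross_comm]; exact neg_ne_zero.2 hy₂₃
  -- With these factors the linear relation among `x₁`, `x₂`, `x₃` given by `hdec` is mapped to the
  -- corresponding relation among `y₁`, `y₂`, `y₃`.
  set a := cross y₃ y₂ / cross x₃ x₂ with ha
  set b := cross y₁ y₃ / cross x₁ x₃ with hb
  have ha0 : a ≠ 0 := div_ne_zero hy₃₂ hx₃₂
  have hb0 : b ≠ 0 := div_ne_zero hy₁₃ hx₁₃
  have hab : cross (a • y₁) (b • y₂) ≠ 0 := by
    rw [cross_smul_left, cross_smul_right]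
    exact mul_ne_zero ha0 (mul_ne_zero hb0 hy₁₂)
  set φ := frameEquiv x₁ x₂ hx₁₂
  set ψ := frameEquiv (a • y₁) (b • y₂) hab
  have h1 : φ.symm x₁ = ![1, 0] := by
    rw [LinearEquiv.symm_apply_eq]; simp [φ, frameEquiv]
  have h2 : φ.symm x₂ = ![0, 1] := by
    rw [LinearEquiv.symm_apply_eq]; simp [φ, frameEquiv]
  have hg1 : (φ.symm.trans ψ) x₁ = a • y₁ := by
    rw [LinearEquiv.trans_apply, h1]; simp [ψ, frameEquiv]
  have hg2 : (φ.symm.trans ψ) x₂ = b • y₂ := by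
    rw [LinearEquiv.trans_apply, h2]; simp [ψ, frameEquiv]
  refine ⟨φ.symm.trans ψ, Units.mk0 a ha0, Units.mk0 b hb0,
    Units.mk0 (cross y₁ y₂ / cross x₁ x₂) (div_ne_zero hy₁₂ hx₁₂), hg1, hg2, ?_⟩
  have h3 := congrArg (φ.symm.trans ψ) (hdec x₁ x₂ x₃)
  rw [map_smul, map_add, map_smul, map_smul, hg1, hg2, smul_smul, smul_smul, ha, hb,
    mul_div_cancel₀ _ hx₃₂, mul_div_cancel₀ _ hx₁₃, ← hdec] at h3
  rw [Units.val_mk0, div_eq_inv_mul, mul_smul, ← h3, smul_smul, inv_mul_cancel₀ hx₁₂, one_smul]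

namespace LineFrame

variable {L : LineFrame N P}

/-- Three points are handled by `exists_equiv_of_triple`. If there are only two, the sum of the two
vectors is used as a third point. -/
theorem Points.exists_equiv (p p' : L.Points k)
    (hcard : Fintype.card L.J = 2 ∨ Fintype.card L.J = 3) :
    ∃ (g : (Fin 2 → k) ≃ₗ[k] (Fin 2 → k)) (s : L.J → kˣ),
      ∀ j, g (p.pt j) = ((s j : kˣ) : k) • p'.pt j := by
  classical
  rcases hcard with h | h
  · rw [← Finset.card_univ, Finset.card_eq_two] at h
    obtain ⟨i, j, hij, huniv⟩ := h
    have hadd : ∀ x y : Fin 2 → k, cross x y ≠ 0 → cross x (x + y) ≠ 0 ∧ cross y (x + y) ≠ 0 := by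
      intro x y h
      have h1 : cross x (x + y) = cross x y := by simp [cross]; ring
      have h2 : cross y (x + y) = - cross x y := by simp [cross]; ring
      rw [h1, h2]
      exact ⟨h, neg_ne_zero.2 h⟩
    obtain ⟨g, a, b, -, h1, h2, -⟩ := exists_equiv_of_triple (p.cross_ne i j hij)
      (hadd _ _ (p.cross_ne i j hij)).1 (hadd _ _ (p.cross_ne i j hij)).2 (p'.cross_ne i j hij)
      (hadd _ _ (p'.cross_ne i j hij)).1 (hadd _ _ (p'.cross_ne i j hij)).2
    refine ⟨g, fun l => if l = i then a else b, fun l => ?_⟩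
    have hl : l = i ∨ l = j := by
      have := Finset.mem_univ l
      rw [huniv] at this
      simpa using this
    rcases hl with rfl | rfl
    · simp [h1]
    · simp [hij.symm, h2]
  · rw [← Finset.card_univ, Finset.card_eq_three] at h
    obtain ⟨i, j, m, hij, him, hjm, huniv⟩ := h
    obtain ⟨g, a, b, c, h1, h2, h3⟩ := exists_equiv_of_triple (p.cross_ne i j hij)
      (p.cross_ne i m him) (p.cross_ne j m hjm) (p'.cross_ne i j hij)
      (p'.cross_ne i m him) (p'.cross_ne j m hjm)
    refine ⟨g, fun l => if l = i then a else if l = j then b else c, fun l => ?_⟩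
    have hl : l = i ∨ l = j ∨ l = m := by
      have := Finset.mem_univ l
      rw [huniv] at this
      simpa using this
    rcases hl with rfl | rfl | rfl
    · simp [h1]
    · simp [hij.symm, h2]
    · simp [him.symm, hjm.symm, h3]

/-- The change of the character of a line under a coordinate change. -/
def gaugeChar (s : L.J → kˣ) : CharTorus k N := ∏ j, oneParam (L.amp j) (s j)

theorem gaugeChar_apply (s : L.J → kˣ) (m : Module.Dual ℤ N) :
    gaugeChar s (Multiplicative.ofAdd m) = ∏ j, s j ^ m (L.amp j) := by
  rw [gaugeChar, MonoidHom.finsetProd_apply]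
  rfl

theorem smul_point {p p' : L.Points k} {g : (Fin 2 → k) ≃ₗ[k] (Fin 2 → k)} {s : L.J → kˣ}
    (hg : ∀ j, g (p.pt j) = ((s j : kˣ) : k) • p'.pt j) (j : L.J) :
    g • p.point j = p'.point j := by
  rw [Points.point, Points.point, Projectivization.smul_mk, Projectivization.mk_eq_mk_iff']
  exact ⟨s j, (hg j).symm⟩

/-- A coordinate change multiplies all values of `cross` by its determinant, and by balancing the
powers of the determinant cancel. What remains are the scalars `s j`, which make up the gauge
character. -/
theorem lineMap_smul {p p' : L.Points k} {g : (Fin 2 → k) ≃ₗ[k] (Fin 2 → k)} {s : L.J → kˣ}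
    (hg : ∀ j, g (p.pt j) = ((s j : kˣ) : k) • p'.pt j) (hP : IsPolyhedralDecomposition P)
    (hL : L.IsBalanced) (c : CharTorus k N) (q : P1 k) :
    lineMap p' hP (c * gaugeChar s) (g • q) = lineMap p hP c q := by
  have hcone : lineCone p' (g • q) = lineCone p q := by
    rcases point_cases p q with ⟨j, rfl⟩ | h
    · rw [smul_point hg, lineCone_point, lineCone_point]
    · rw [lineCone_of_forall_ne p h, lineCone_of_forall_ne]
      intro j hj
      rw [← smul_point hg] at hj
      exact h j (MulAction.injective g hj)
  refine ToricPoint.ext hcone (funext fun m => ?_)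
  by_cases hm : m.1 ((L.v : V), 1) = 0
  swap
  · rw [lineMap_val_of_ne p hP c hm, lineMap_val_of_ne p' hP _ hm]
  obtain ⟨D, hD, hcr⟩ := exists_cross_map g
  have h1 : g • q = Projectivization.mk k (g q.rep)
      (fun h => q.rep_nonzero (g.map_eq_zero_iff.1 h)) := by
    conv_lhs => rw [← q.mk_rep]
    rw [Projectivization.smul_mk]
    rfl
  rw [lineMap_val p hP c hm, h1, lineMap_val_mk p' hP _ hL hm, lineVal, lineVal,
    MonoidHom.mul_apply, gaugeChar_apply, Units.val_mul, mul_assoc, Units.coe_prod,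
    ← Finset.prod_mul_distrib]
  congr 1
  have h2 : ∀ j, ((s j ^ restr m (L.amp j) : kˣ) : k)
      * cross (p'.pt j) (g q.rep) ^ restr m (L.amp j)
      = D ^ restr m (L.amp j) * cross (p.pt j) q.rep ^ restr m (L.amp j) := by
    intro j
    rw [Units.val_zpow_eq_zpow_val, ← mul_zpow, ← cross_smul_left, ← hg, hcr, mul_zpow]
  rw [Finset.prod_congr rfl fun j _ => h2 j, Finset.prod_mul_distrib, prod_zpow_const _ hD,
    hL.sum_apply, zpow_zero, one_mul]

theorem lineMap_injective [Infinite k] [N.IsLattice ℚ] (p : L.Points k)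
    (hP : IsPolyhedralDecomposition P) {c c' : CharTorus k N}
    (h : ∀ q, lineMap p hP c q = lineMap p hP c' q) : c = c' := by
  obtain ⟨q, hq⟩ := exists_forall_ne_point p
  refine MonoidHom.ext fun m => ?_
  obtain ⟨m, rfl⟩ := Multiplicative.ofAdd.surjective m
  have h1 := congrArg (fun x => x.val (monomial L.v m)) (h q)
  simp only [lineMap_val p hP _ (monomial_apply_self L.v m), lineVal, restr_monomial] at h1
  refine Units.ext (mul_right_cancel₀ (Finset.prod_ne_zero_iff.2 fun j _ => zpow_ne_zero _ ?_) h1)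
  exact fun h0 => hq j (p.cross_eq_zero_iff.1 h0)

theorem gaugeChar_eq_one_of_const (hL : L.IsBalanced) {s : L.J → kˣ} (hs : ∀ i j, s i = s j) :
    gaugeChar s = 1 := by
  refine MonoidHom.ext fun m => ?_
  obtain ⟨m, rfl⟩ := Multiplicative.ofAdd.surjective m
  rw [gaugeChar_apply]
  rcases isEmpty_or_nonempty L.J with h | ⟨⟨i⟩⟩
  · simp
  · refine Units.ext ?_
    rw [Units.coe_prod, Finset.prod_congr rfl fun j _ => by
      rw [hs j i, Units.val_zpow_eq_zpow_val], prod_zpow_const _ (Units.ne_zero _),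
      hL.sum_apply, zpow_zero]
    rfl

/-- The product of any two of the scalars `s i` with distinct indices is the determinant of `g`.
Comparing with a third index shows that they are all equal. -/
theorem const_of_fix_triple (p : L.Points k) (hcard : Fintype.card L.J = 3)
    {g : (Fin 2 → k) ≃ₗ[k] (Fin 2 → k)} {s : L.J → kˣ}
    (hg : ∀ j, g (p.pt j) = ((s j : kˣ) : k) • p.pt j) (i j : L.J) : s i = s j := by
  classical
  obtain ⟨D, hD, hcr⟩ := exists_cross_map g
  have hmul : ∀ i j, i ≠ j → ((s i : kˣ) : k) * s j = D := by
    intro i j hij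
    have h := hcr (p.pt i) (p.pt j)
    rw [hg, hg, cross_smul_left, cross_smul_right, ← mul_assoc] at h
    exact mul_right_cancel₀ (p.cross_ne i j hij) h
  by_cases hij : i = j
  · rw [hij]
  obtain ⟨l, hl⟩ : ∃ l, l ∉ ({i, j} : Finset L.J) := by
    by_contra h
    push Not at h
    have h1 : Fintype.card L.J ≤ ({i, j} : Finset L.J).card :=
      Finset.card_le_card fun x _ => h x
    have h2 : ({i, j} : Finset L.J).card ≤ 2 := Finset.card_le_two
    omega
  simp only [Finset.mem_insert, Finset.mem_singleton, not_or] at hl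
  have h1 := hmul i l (Ne.symm hl.1)
  have h2 := hmul j l (Ne.symm hl.2)
  exact Units.ext (mul_right_cancel₀ (Units.ne_zero (s l)) (h1.trans h2.symm))

/-- The character of a line with three boundary points is determined by the line up to coordinate
changes. -/
theorem char_unique [Infinite k] [N.IsLattice ℚ] (p : L.Points k) (hcard : Fintype.card L.J = 3)
    (hT : Function.Injective L.T) (hP : IsPolyhedralDecomposition P) (hL : L.IsBalanced)
    {c c' : CharTorus k N} {g : (Fin 2 → k) ≃ₗ[k] (Fin 2 → k)}
    (h : ∀ q, lineMap p hP c' (g • q) = lineMap p hP c q) : c = c' := by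
  -- The boundary points lie over pairwise different cells, so `g` cannot permute them.
  have hpt : ∀ j, g • p.point j = p.point j := by
    intro j
    have h1 : lineCone p (g • p.point j) = lineCone p (p.point j) :=
      congrArg ToricPoint.cone (h (p.point j))
    rcases point_cases p (g • p.point j) with ⟨i, hi⟩ | h2
    · rw [hi, lineCone_point, lineCone_point] at h1
      have := hT ((hP.polyhedron _ (L.T_mem i)).coneOver_inj (hP.polyhedron _ (L.T_mem j)) h1)
      rw [hi, this]
    · rw [lineCone_of_forall_ne p h2] at h1
      exact absurd rfl ((lineCone_eq_singleton_iff p hP).1 h1.symm j)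
  have hex : ∀ j, ∃ a : kˣ, g (p.pt j) = (a : k) • p.pt j := by
    intro j
    have h1 := hpt j
    rw [Points.point, Projectivization.smul_mk, Projectivization.mk_eq_mk_iff] at h1
    obtain ⟨a, ha⟩ := h1
    exact ⟨a, ha.symm⟩
  choose s hs using hex
  have h2 := fun q => lineMap_smul hs hP hL c q
  simp only [gaugeChar_eq_one_of_const hL (const_of_fix_triple p hcard hs), mul_one c] at h2
  refine lineMap_injective p hP fun q => ?_
  have h3 := h2 (g⁻¹ • q)
  have h4 := h (g⁻¹ • q)
  rw [smul_inv_smul] at h3 h4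
  rw [h3, h4]

/-- The character by which the value of a line at the boundary point `j` differs from the character
of the line. -/
def boundaryChar (p : L.Points k) (j : L.J) : CharTorus k N :=
  open Classical in
  -- The factor with `i = j` is irrelevant, as only monomials orthogonal to `u j` are evaluated at
  -- the point `j`; it is set to one.
  ∏ i, oneParam (L.amp i) (if h : i = j then 1 else Units.mk0 _ (p.cross_ne i j h))

theorem boundaryChar_apply (p : L.Points k) (j : L.J) (m : Module.Dual ℤ N) (hm : m (L.u j) = 0) :
    (boundaryChar p j (Multiplicative.ofAdd m) : k)
      = ∏ i, cross (p.pt i) (p.pt j) ^ m (L.amp i) := by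
  rw [boundaryChar, MonoidHom.finsetProd_apply, Units.coe_prod]
  refine Finset.prod_congr rfl fun i _ => ?_
  rw [oneParam_apply]
  by_cases h : i = j
  · rw [dif_pos h, one_zpow, h, L.apply_amp, hm, mul_zero, zpow_zero, Units.val_one]
  · rw [dif_neg h, Units.val_zpow_eq_zpow_val, Units.val_mk0]

theorem lineMap_val_point (p : L.Points k) (hP : IsPolyhedralDecomposition P) (hL : L.IsBalanced)
    (c : CharTorus k N) (j : L.J) {m : dualLattice (extLattice N)}
    (hm : m.1 ((L.v : V), 1) = 0) (hmj : restr m (L.u j) = 0) :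
    (lineMap p hP c (p.point j)).val m
      = ((c * boundaryChar p j) (Multiplicative.ofAdd (restr m)) : kˣ) := by
  rw [Points.point, lineMap_val_mk p hP c hL hm, lineVal, MonoidHom.mul_apply, Units.val_mul,
    boundaryChar_apply p j _ hmj]

/-- Points in the orbit of the cone over a cell of dimension one are determined by the values of the
monomials orthogonal to it. -/
theorem lineMap_point_eq [N.IsLattice ℚ] {L' : LineFrame N P} {p : L.Points k} {p' : L'.Points k}
    (hP : IsPolyhedralDecomposition P) (hL : L.IsBalanced) (hL' : L'.IsBalanced)
    {c c' : CharTorus k N} {j : L.J} {j' : L'.J} (hT : L.T j = L'.T j') :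
    lineMap p hP c (p.point j) = lineMap p' hP c' (p'.point j') ↔
      ∀ m : Module.Dual ℤ N, m (L.u j) = 0 →
        (c * boundaryChar p j) (Multiplicative.ofAdd m)
          = (c' * boundaryChar p' j') (Multiplicative.ofAdd m) := by
  have hcone : (lineMap p hP c (p.point j)).cone = (lineMap p' hP c' (p'.point j')).cone := by
    rw [lineMap_cone, lineMap_cone, lineCone_point, lineCone_point, hT]
  have hequiv : ∀ m : dualLattice (extLattice N),
      (m.1 ((L.v : V), 1) = 0 ∧ restr m (L.u j) = 0) ↔
        (m.1 ((L'.v : V), 1) = 0 ∧ restr m (L'.u j') = 0) := by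
    intro m
    rw [← L.eq_zero_T_iff, ← L'.eq_zero_T_iff, hT]
  constructor
  · intro h m hm
    have hm1 : (monomial L.v m).1 ((L.v : V), 1) = 0 := monomial_apply_self _ _
    have hm2 : restr (monomial L.v m) (L.u j) = 0 := by rwa [restr_monomial]
    have h1 := congrArg (fun x => x.val (monomial L.v m)) h
    obtain ⟨h2, h3⟩ := (hequiv _).1 ⟨hm1, hm2⟩
    simp only [lineMap_val_point p hP hL c j hm1 hm2,
      lineMap_val_point p' hP hL' c' j' h2 h3, restr_monomial] at h1
    exact Units.ext h1
  · intro h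
    refine ToricPoint.ext hcone (funext fun m => ?_)
    by_cases hz : ∀ y ∈ coneOver (L.T j), m.1 y = 0
    · obtain ⟨h1, h2⟩ := (L.eq_zero_T_iff m j).1 hz
      obtain ⟨h3, h4⟩ := (hequiv _).1 ⟨h1, h2⟩
      rw [lineMap_val_point p hP hL c j h1 h2, lineMap_val_point p' hP hL' c' j' h3 h4, h _ h2]
    · have h1 := mt ((lineMap p hP c (p.point j)).val_ne_zero m).1
        (by rw [lineMap_cone, lineCone_point]; exact hz)
      have h2 := mt ((lineMap p' hP c' (p'.point j')).val_ne_zero m).1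
        (by rw [lineMap_cone, lineCone_point, ← hT]; exact hz)
      rw [not_not.1 h1, not_not.1 h2]

/-- A torically transverse map with the boundary behavior prescribed by `L`. -/
theorem isOfType_of_hasIndex [N.IsLattice ℚ] {p : L.Points k}
    {f : P1 k → Degeneration k N P}
    (hf : IsMorphism f) (hB : boundaryPoints f L.v = Set.range p.point)
    (hcone : ∀ j, (f (p.point j)).cone = coneOver (L.T j))
    (hidx : ∀ j, HasIndex f L.v (p.point j) (L.w j)) : IsOfType p f where
  isMorphism := hf
  cone_generic q hq := by
    by_contra h
    have h1 : q ∈ boundaryPoints f L.v := h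
    rw [hB] at h1
    obtain ⟨j, rfl⟩ := h1
    exact hq j rfl
  cone_point := hcone
  hasOrder j m hm hmj := by
    -- The primitive vector in `HasIndex` is only known to generate a ray containing the cell. The
    -- cell has a point different from `v`, and so this vector equals `u j`.
    obtain ⟨u', hu', hcell, hord⟩ := hidx j
    obtain ⟨a, ha, hmem⟩ := L.exists_mem_T j
    have h1 : (L.v : V) + a • (L.u j : V) ∈ cell (f (p.point j)) := by
      change (_, (1 : ℚ)) ∈ (f (p.point j)).cone
      rw [hcone]
      exact mem_coneOver hmem
    obtain ⟨b, hb, hb'⟩ := hcell h1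
    have h2 : a • (L.u j : V) = b • (u' : V) := add_left_cancel hb'
    have hb0 : b ≠ 0 := by
      rintro rfl
      rw [zero_smul] at h2
      exact (L.u_primitive j).coe_ne_zero ((smul_eq_zero.1 h2).resolve_left ha.ne')
    have h3 : L.u j = u' := by
      refine hu'.eq_of_smul (L.u_primitive j) (a := b / a)
        (div_pos (lt_of_le_of_ne hb hb0.symm) ha) ?_
      rw [div_eq_inv_mul, mul_smul, ← h2, smul_smul, inv_mul_cancel₀ ha.ne', one_smul]
    subst h3
    obtain ⟨i, hi, hi'⟩ := hord m (by rw [hcone, L.nonneg_T_iff hm]; exact hmj) hm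
    rw [← restr_apply] at hi
    have h4 : restr m (L.u j) = (i : ℤ) := by exact_mod_cast hi
    rwa [h4, Int.toNat_natCast]

end LineFrame

end Gauge

/-! ### Closures of subtorus orbits in the central fiber -/

section OrbitClosure

variable {V : Type*} [AddCommGroup V] [Module ℚ V] {N : Submodule ℤ V} {P : Set (Set V)}
  {k : Type*} [Field k]

/-- Adding the height to a form that cuts out `C(v)` gives a form vanishing only at the origin. Thus
the charts in question contain the big torus. -/
theorem IsPolyhedralDecomposition.isFace_zero (hP : IsPolyhedralDecomposition P) {T : Set V}
    (hT : T ∈ P) {v : V} (hv : {v} ∈ P) (hvT : v ∈ T) : IsFace {0} (coneOver T) := by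
  obtain ⟨m, hm, hvm⟩ := (hP.cone_singleton_isFace hT hv hvT).exists_form
  refine ⟨⟨0, rfl⟩, m + LinearMap.snd ℚ V ℚ, 0, fun y hy => ?_, ?_⟩
  · exact add_nonneg (hm y hy) (snd_nonneg_of_mem_coneOver hy)
  · ext y
    constructor
    · intro hy
      rw [Set.mem_singleton_iff.1 hy]
      exact ⟨by simpa using coneOver_smul (mem_coneOver hvT) (le_refl (0 : ℚ)), map_zero _⟩
    · rintro ⟨hy, h0⟩
      have h1 := hm y hy
      have h2 := snd_nonneg_of_mem_coneOver hy
      have h3 : m y + y.2 = 0 := h0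
      have hyv : y ∈ coneOver {v} := by rw [hvm]; exact ⟨hy, by linarith⟩
      have hy2 : y.2 = 0 := by linarith
      refine Set.mem_singleton_iff.2 (Prod.ext ?_ hy2)
      by_contra hne
      obtain ⟨f, hf⟩ : ∃ f : Module.Dual ℚ V, f y.1 ≠ 0 := by
        by_contra h
        push Not at h
        exact hne ((Module.forall_dual_apply_eq_zero_iff ℚ _).1 h)
      have h4 := eq_zero_coneOver_iff (S := {v})
        (f := f ∘ₗ LinearMap.fst ℚ V ℚ - f v • LinearMap.snd ℚ V ℚ) |>.2 (by simp) y hyv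
      simp [hy2] at h4
      exact hf h4

theorem evalPoly_sub {W : Type*} [AddCommGroup W] [Module ℚ W] {Λ : Submodule ℤ W}
    {F : Set (Set W)} (f g : dualLattice Λ →₀ k) (x : ToricPoint k Λ F) :
    evalPoly (f - g) x = evalPoly f x - evalPoly g x :=
  Finsupp.sum_sub_index fun _ _ _ => sub_mul _ _ _

theorem evalPoly_single {W : Type*} [AddCommGroup W] [Module ℚ W] {Λ : Submodule ℤ W}
    {F : Set (Set W)} (m : dualLattice Λ) (a : k) (x : ToricPoint k Λ F) :
    evalPoly (Finsupp.single m a) x = a * x.val m :=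
  Finsupp.sum_single_index (zero_mul _)

variable {L : Submodule ℚ (V × ℚ)} {pt x : Degeneration k N P}

/-- Monomials orthogonal to `L` are constant on the closure of an orbit of the subtorus of `L`. -/
theorem val_eq_of_mem_orbitClosure (hx : x ∈ orbitClosure L pt) {m : dualLattice (extLattice N)}
    (hm : ∀ y ∈ L, m.1 y = 0) (hmx : ∀ y ∈ x.cone, 0 ≤ m.1 y) : x.val m = pt.val m := by
  classical
  have hne : x.cone.Nonempty := by
    obtain ⟨S, -, h⟩ := x.cone_mem
    exact h.1
  have h := hx x.cone x.cone_mem (isFace_refl hne)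
    (Finsupp.single m 1 - Finsupp.single 0 (pt.val m)) (by
      intro m' hm'
      have h1 := Finsupp.support_sub hm'
      rw [Finset.mem_union] at h1
      rcases h1 with h1 | h1
      · rw [Finset.mem_singleton.1 (Finsupp.support_single_subset h1)]; exact hmx
      · rw [Finset.mem_singleton.1 (Finsupp.support_single_subset h1)]
        intro y _
        exact le_of_eq rfl) (by
      rintro s ⟨t, ht, rfl⟩ -
      rw [evalPoly_sub, evalPoly_single, evalPoly_single, ToricPoint.val_zero, one_mul, mul_one]
      change (t (Multiplicative.ofAdd m) : k) * pt.val m - pt.val m = 0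
      rw [ht m hm, Units.val_one, one_mul, sub_self])
  rw [evalPoly_sub, evalPoly_single, evalPoly_single, ToricPoint.val_zero, one_mul, mul_one] at h
  exact sub_eq_zero.1 h

theorem val_ne_zero_of_cone_zero (hpt : pt.cone = {0}) (m : dualLattice (extLattice N)) :
    pt.val m ≠ 0 := by
  rw [pt.val_ne_zero, hpt]
  simp

theorem val_add_of_cone_zero (hpt : pt.cone = {0}) (m m' : dualLattice (extLattice N)) :
    pt.val (m + m') = pt.val m * pt.val m' :=
  pt.val_add m m' (by rw [hpt]; simp) (by rw [hpt]; simp)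

/-- A multiple of `f` is a monomial that is constant and nonzero on the orbit, hence nonzero at `x`,
and monomials nonzero at `x` are orthogonal to its cone. To exclude a point from the closure it
therefore suffices to find a form that vanishes on `L` and is nonnegative but not zero on the cone
of the point. -/
theorem eq_zero_of_mem_orbitClosure [N.IsLattice ℚ] (hpt : pt.cone = {0})
    (hx : x ∈ orbitClosure L pt) {f : Module.Dual ℚ (V × ℚ)} (hf : ∀ y ∈ L, f y = 0)
    (hfx : ∀ y ∈ x.cone, 0 ≤ f y) : ∀ y ∈ x.cone, f y = 0 := by
  obtain ⟨K, hK, hKf⟩ := exists_pos_smul_integral (extLattice_fg (N := N)) f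
  have hK' : (0 : ℚ) < K := by exact_mod_cast hK
  have h1 := val_eq_of_mem_orbitClosure hx (m := ⟨_, hKf⟩) (fun y hy => by simp [hf y hy])
    (fun y hy => mul_nonneg hK'.le (hfx y hy))
  have h2 := (x.val_ne_zero ⟨_, hKf⟩).1 (h1 ▸ val_ne_zero_of_cone_zero hpt _)
  intro y hy
  exact (mul_eq_zero.1 (h2 y hy)).resolve_left hK'.ne'

theorem mem_linCone_iff {A : AffineSubspace ℚ V} {v : V} {h : ℚ}
    {a : V} (ha : a ∈ A) : (v, h) ∈ linCone A ↔ v - h • a ∈ A.direction := by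
  constructor
  · intro hv
    have : linCone A ≤ (A.direction).comap
        (LinearMap.fst ℚ V ℚ - (LinearMap.snd ℚ V ℚ).smulRight a) := by
      rw [linCone, Submodule.span_le]
      rintro ⟨y, z⟩ ⟨hy, hz⟩
      change y - z • a ∈ A.direction
      change z = 1 at hz
      rw [hz, one_smul]
      exact AffineSubspace.vsub_mem_direction hy ha
    exact this hv
  · intro hv
    have h1 : (a, (1 : ℚ)) ∈ linCone A := Submodule.subset_span ⟨ha, rfl⟩
    have h2 : ((v - h • a) + a, (1 : ℚ)) ∈ linCone A :=
      Submodule.subset_span ⟨AffineSubspace.vadd_mem_of_mem_direction hv ha, rfl⟩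
    have h3 : (v, h) = ((v - h • a) + a, (1 : ℚ)) - (a, (1 : ℚ)) + h • (a, (1 : ℚ)) := by
      ext <;> simp
    rw [h3]
    exact add_mem (sub_mem h2 h1) (Submodule.smul_mem _ _ h1)

theorem mem_linCone_one {A : AffineSubspace ℚ V} (hA : (A : Set V).Nonempty) {v : V} :
    (v, (1 : ℚ)) ∈ linCone A ↔ v ∈ A := by
  obtain ⟨a, ha⟩ := hA
  rw [mem_linCone_iff ha, one_smul]
  exact AffineSubspace.vsub_right_mem_direction_iff_mem ha v

variable {A : AffineSubspace ℚ V}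

/-- If `v ∉ A`, some form vanishes on `LC(A)` and is positive at `(v, 1)`, which
`eq_zero_of_mem_orbitClosure` forbids. -/
theorem mem_of_mem_orbitClosure [N.IsLattice ℚ] (hA : (A : Set V).Nonempty) (hpt : pt.cone = {0})
    (hx : x ∈ orbitClosure (linCone A) pt) {v : V} (hv : x.cone = coneOver {v}) : v ∈ A := by
  rw [← mem_linCone_one hA]
  by_contra h
  obtain ⟨f, hf, hfL⟩ := Submodule.exists_le_ker_of_notMem h
  wlog hpos : 0 < f (v, 1) generalizing f
  · exact this (-f) (by simpa using hf) (fun y hy => by simpa using hfL hy)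
      (by simpa using lt_of_le_of_ne (not_lt.1 hpos) hf)
  refine hf (eq_zero_of_mem_orbitClosure hpt hx (fun y hy => hfL hy) ?_ _
    (by rw [hv]; exact mem_coneOver rfl))
  rw [hv, nonneg_coneOver_iff]
  simpa using hpos.le

/-- All points of the cell in `A` are vertices of `P`, so no inner point of the cell lies in `A`.
Then a form exists that vanishes on `LC(A)` and is nonnegative but not zero on the cell. -/
theorem notMem_orbitClosure_of_segment [N.IsLattice ℚ] (hP : IsPolyhedralDecomposition P)
    (hA : (A : Set V).Nonempty) (hpt : pt.cone = {0}) {F : LineFrame N P} {j : F.J}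
    (hTA : ∀ y ∈ F.T j, y ∈ A → {y} ∈ P) (hcone : x.cone = coneOver (F.T j)) :
    x ∉ orbitClosure (linCone A) pt := by
  intro hx
  set v : V := (F.v : V)
  set u : V := (F.u j : V)
  have hu : u ≠ 0 := (F.u_primitive j).coe_ne_zero
  obtain ⟨b, hb, hbT⟩ := F.exists_mem_T j
  have hvT : v + (0 : ℚ) • u ∈ F.T j := by rw [zero_smul, add_zero]; exact F.v_mem_T j
  have hconv : ∀ s t : ℚ, 0 < s → s < t → v + t • u ∈ F.T j → v + s • u ∉ A := by
    intro s t hs hst ht hsA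
    have hsT : v + s • u ∈ F.T j := by
      obtain ⟨G, hG⟩ := hP.polyhedron _ (F.T_mem j)
      rw [hG] at hvT ht ⊢
      intro f hf
      have h1 := hvT f hf
      have h2 := ht f hf
      simp only [map_add, map_smul, smul_eq_mul] at h1 h2 ⊢
      rcases le_total 0 (f.1 u) with h | h <;> nlinarith
    exact hP.no_vertex_between (F.T_mem j) hu hvT ht hs hst (hTA _ hsT hsA)
  have hzero : ∀ f : Module.Dual ℚ (V × ℚ), (∀ y ∈ linCone A, f y = 0) →
      (∀ y ∈ F.T j, 0 ≤ f (y, 1)) → ∀ y ∈ F.T j, f (y, 1) = 0 := by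
    intro f hf hf'
    have := eq_zero_of_mem_orbitClosure hpt hx hf (by rw [hcone, nonneg_coneOver_iff]; exact hf')
    rwa [hcone, eq_zero_coneOver_iff] at this
  have hexp : ∀ (f : Module.Dual ℚ (V × ℚ)) (a : ℚ),
      f (v + a • u, 1) = f (v, 1) + a * f (u, 0) := by
    intro f a
    have : (v + a • u, (1 : ℚ)) = (v, (1 : ℚ)) + a • (u, (0 : ℚ)) := by simp
    rw [this, map_add, map_smul, smul_eq_mul]
  -- If the line spanned by the cell does not meet `A`, a form vanishing on `LC(A)` and on the
  -- direction `u` is a nonzero constant on the cell.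
  by_cases h1 : (v, (1 : ℚ)) ∈ linCone A ⊔ Submodule.span ℚ {(u, (0 : ℚ))}
  swap
  · obtain ⟨f, hf, hfL⟩ := Submodule.exists_le_ker_of_notMem h1
    wlog hpos : 0 < f (v, 1) generalizing f
    · exact this (-f) (by simpa using hf) (fun y hy => by simpa using hfL hy)
        (by simpa using lt_of_le_of_ne (not_lt.1 hpos) hf)
    have hfu : f (u, 0) = 0 := hfL (Submodule.mem_sup_right (Submodule.mem_span_singleton_self _))
    refine hf (hzero f (fun y hy => hfL (Submodule.mem_sup_left hy)) ?_ v (F.v_mem_T j))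
    intro y hy
    obtain ⟨a, -, rfl⟩ := F.T_subset j y hy
    rw [hexp, hfu, mul_zero, add_zero]
    exact hpos.le
  obtain ⟨y₁, hy₁, y₂, hy₂, hsum⟩ := Submodule.mem_sup.1 h1
  obtain ⟨β, rfl⟩ := Submodule.mem_span_singleton.1 hy₂
  set α := -β with hα
  have hαL : (v + α • u, (1 : ℚ)) ∈ linCone A := by
    have : (v + α • u, (1 : ℚ)) = y₁ := by
      rw [eq_sub_of_add_eq hsum, hα]
      ext <;> simp [sub_eq_add_neg]
    rwa [this]
  have hαA := (mem_linCone_one hA).1 hαL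
  -- The line meets `A` at the parameter `α`. If it were parallel to `A`, it would be contained in
  -- `A`, and so would the inner points of the cell.
  by_cases h2 : (u, (0 : ℚ)) ∈ linCone A
  · refine hconv (b / 2) b (by positivity) (by linarith) hbT ((mem_linCone_one hA).1 ?_)
    have : (v + (b / 2) • u, (1 : ℚ)) = (v + α • u, (1 : ℚ)) + (b / 2 - α) • (u, (0 : ℚ)) := by
      ext
      · simp [sub_smul]
      · simp
    rw [this]
    exact add_mem hαL (Submodule.smul_mem _ _ h2)
  · obtain ⟨f, hf, hfL⟩ := Submodule.exists_le_ker_of_notMem h2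
    wlog hpos : 0 < f (u, 0) generalizing f
    · exact this (-f) (by simpa using hf) (fun y hy => by simpa using hfL hy)
        (by simpa using lt_of_le_of_ne (not_lt.1 hpos) hf)
    have hfα : f (v, 1) + α * f (u, 0) = 0 := by rw [← hexp]; exact hfL hαL
    have hfa : ∀ a : ℚ, f (v + a • u, 1) = (a - α) * f (u, 0) := fun a => by
      rw [hexp]; linear_combination hfα
    -- Now `α` is the only parameter at which the line meets `A`, and the cell lies on one side of
    -- it: after it if `α ≤ 0`, before it otherwise. The form `f` changes sign exactly there.
    rcases le_or_gt α 0 with hα0 | hα0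
    · have := hzero f (fun y hy => hfL hy) (by
        intro y hy
        obtain ⟨a, ha, rfl⟩ := F.T_subset j y hy
        rw [hfa]
        exact mul_nonneg (by linarith) hpos.le) _ hbT
      rw [hfa] at this
      rcases mul_eq_zero.1 this with h | h
      · linarith
      · exact hf h
    · have := hzero (-f) (fun y hy => by rw [LinearMap.neg_apply, neg_eq_zero]; exact hfL hy) (by
        intro y hy
        obtain ⟨a, ha, rfl⟩ := F.T_subset j y hy
        have hle : a ≤ α := by
          by_contra hlt
          exact hconv α a hα0 (not_le.1 hlt) hy hαA
        rw [LinearMap.neg_apply, hfa]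
        nlinarith) v (F.v_mem_T j)
      have h3 := hfa 0
      rw [zero_smul, add_zero] at h3
      rw [LinearMap.neg_apply, h3, neg_eq_zero] at this
      rcases mul_eq_zero.1 this with h | h
      · linarith
      · exact hf h

/-- The order of vanishing of a monomial along the component `X_v`. -/
def heightAt (v : N) : dualLattice (extLattice N) →+ ℤ where
  toFun m := (m.1 ((v : V), 1)).num
  map_zero' := by simp
  map_add' m m' := by
    obtain ⟨a, ha⟩ := m.2 ((v : V), ((1 : ℤ) : ℚ)) (mem_extLattice v.2)
    obtain ⟨b, hb⟩ := m'.2 ((v : V), ((1 : ℤ) : ℚ)) (mem_extLattice v.2)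
    rw [Int.cast_one] at ha hb
    change (m.1 ((v : V), 1) + m'.1 ((v : V), 1)).num = _
    rw [ha, hb, ← Int.cast_add, Rat.num_intCast, Rat.num_intCast, Rat.num_intCast]

theorem heightAt_apply (v : N) (m : dualLattice (extLattice N)) :
    (heightAt v m : ℚ) = m.1 ((v : V), 1) := by
  obtain ⟨a, ha⟩ := m.2 ((v : V), ((1 : ℤ) : ℚ)) (mem_extLattice v.2)
  rw [Int.cast_one] at ha
  change ((m.1 ((v : V), 1)).num : ℚ) = _
  rw [ha]; simp

theorem heightAt_eq_zero_iff (v : N) (m : dualLattice (extLattice N)) :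
    heightAt v m = 0 ↔ m.1 ((v : V), 1) = 0 := by
  rw [← heightAt_apply]; exact Int.cast_eq_zero.symm

/-- Over a vertex `v ∈ A`, the orbit closure consists of the points at which the monomials orthogonal
to `A` have the values prescribed by `pt`. -/
theorem mem_orbitClosure_of_val_eq [Infinite k] [N.IsLattice ℚ] (hP : IsPolyhedralDecomposition P)
    (hA : (A : Set V).Nonempty) (hpt : pt.cone = {0}) {v : N} (hvP : {(v : V)} ∈ P)
    (hvA : (v : V) ∈ A) (hcone : x.cone = coneOver {(v : V)})
    (hval : ∀ m : dualLattice (extLattice N), (∀ y ∈ linCone A, m.1 y = 0) →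
      x.val m = pt.val m) : x ∈ orbitClosure (linCone A) pt := by
  classical
  intro τ hτ hxτ f hfτ hf0
  have hvτ : ((v : V), (1 : ℚ)) ∈ τ := by
    refine IsFace.subset hxτ ?_
    rw [hcone]
    exact mem_coneOver rfl
  obtain ⟨T, hT, hvT, rfl⟩ := hP.exists_cell hτ hvτ
  have hptne := val_ne_zero_of_cone_zero hpt
  have hx0 : ∀ m : dualLattice (extLattice N), m.1 ((v : V), 1) = 0 → x.val m ≠ 0 := fun m hm => by
    rw [x.val_ne_zero, hcone, eq_zero_coneOver_iff]
    simp [hm]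
  have hxadd : ∀ m m' : dualLattice (extLattice N), m.1 ((v : V), 1) = 0 →
      m'.1 ((v : V), 1) = 0 → x.val (m + m') = x.val m * x.val m' := fun m m' hm hm' => by
    refine x.val_add m m' ?_ ?_ <;> rw [hcone, nonneg_coneOver_iff]
    · simp [hm]
    · simp [hm']
  -- A family of elements of the subtorus whose translates of `pt` tend to `x` as `a` tends to zero.
  -- The power of `a` kills the monomials of positive order along `X_v`; on monomials orthogonal to
  -- `LC(A)` the hypothesis `hval` makes the element trivial.
  let t : kˣ → Torus k (extLattice N) := fun a =>
    { toFun := fun m => Units.mk0 _ (hx0 (monomial v (restr (Multiplicative.toAdd m)))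
          (monomial_apply_self _ _)) / Units.mk0 _ (hptne (monomial v (restr (Multiplicative.toAdd m))))
          * a ^ heightAt v (Multiplicative.toAdd m)
      map_one' := by
        ext
        simp [x.val_zero, pt.val_zero]
      map_mul' := fun m m' => by
        ext
        simp only [toAdd_mul, map_add, Units.val_mul, Units.val_div_eq_div_val, Units.val_mk0,
          hxadd _ _ (monomial_apply_self _ _) (monomial_apply_self _ _),
          val_add_of_cone_zero hpt, zpow_add]
        rw [mul_div_mul_comm]
        ring }
  have ht : ∀ a (m : dualLattice (extLattice N)), (t a (Multiplicative.ofAdd m) : k)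
      = x.val (monomial v (restr m)) / pt.val (monomial v (restr m)) * (a : k) ^ heightAt v m := by
    intro a m
    simp [t]
  have htmem : ∀ a, t a ∈ subtorus k (extLattice N) (linCone A) := by
    intro a m hm
    have h1 : m.1 ((v : V), 1) = 0 := hm _ ((mem_linCone_one hA).2 hvA)
    refine Units.ext ?_
    rw [ht, monomial_restr v h1, (heightAt_eq_zero_iff v m).2 h1, hval m hm,
      div_self (hptne m), zpow_zero, one_mul, Units.val_one]
  -- The function `f` along the family is a polynomial in `a` vanishing for all `a ≠ 0`. So it
  -- vanishes at `a = 0`, where its value is that of `f` at `x`.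
  let Q : Polynomial k := f.sum fun m c => Polynomial.C (c * (x.val (monomial v (restr m))
    / pt.val (monomial v (restr m)) * pt.val m)) * Polynomial.X ^ (heightAt v m).toNat
  have hQeval : ∀ a : k, Q.eval a = f.sum fun m c => c * (x.val (monomial v (restr m))
    / pt.val (monomial v (restr m)) * pt.val m) * a ^ (heightAt v m).toNat := by
    intro a
    simp only [Q, Finsupp.sum, Polynomial.eval_finsetSum, Polynomial.eval_mul, Polynomial.eval_C,
      Polynomial.eval_pow, Polynomial.eval_X]
  have hh : ∀ m ∈ f.support, 0 ≤ heightAt v m := by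
    intro m hm
    have h1 := hfτ m hm _ hvτ
    rw [← heightAt_apply] at h1
    exact_mod_cast h1
  have hQ : Q = 0 := by
    refine Polynomial.eq_zero_of_infinite_isRoot Q (Set.Infinite.mono (s := {0}ᶜ) ?_
      (Set.finite_singleton (0 : k)).infinite_compl)
    intro a ha'
    have ha : a ≠ 0 := ha'
    change Q.eval a = 0
    rw [hQeval]
    have h1 := hf0 (translate (t (Units.mk0 a ha)) pt) ⟨_, htmem _, rfl⟩ (by
      change IsFace pt.cone _
      rw [hpt]
      exact hP.isFace_zero hT hvP hvT)
    rw [← h1, evalPoly]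
    refine Finsupp.sum_congr fun m hm => ?_
    change _ = f m * ((t (Units.mk0 a ha) (Multiplicative.ofAdd m) : k) * pt.val m)
    rw [ht, Units.val_mk0]
    have h2 : a ^ heightAt v m = a ^ (heightAt v m).toNat := by
      conv_lhs => rw [← Int.toNat_of_nonneg (hh m hm), zpow_natCast]
    rw [h2]
    ring
  have hQ0 := hQeval 0
  rw [hQ, Polynomial.eval_zero] at hQ0
  rw [hQ0, evalPoly]
  refine Finsupp.sum_congr fun m hm => ?_
  by_cases h0 : m.1 ((v : V), 1) = 0
  · rw [(heightAt_eq_zero_iff v m).2 h0, monomial_restr v h0, div_mul_cancel₀ _ (hptne m)]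
    simp
  · have h1 : x.val m = 0 := by
      by_contra h
      rw [← Ne, x.val_ne_zero, hcone, eq_zero_coneOver_iff] at h
      exact h0 (h v rfl)
    have h2 : (heightAt v m).toNat ≠ 0 := by
      have h3 : heightAt v m ≠ 0 := mt (heightAt_eq_zero_iff v m).1 h0
      have h4 := hh m hm
      omega
    rw [h1, zero_pow h2]
    ring

end OrbitClosure

/-! ### Flags of the subdivided curve and the frames of its components -/

section Flags

variable {V : Type*} [AddCommGroup V] [Module ℚ V] {N : Submodule ℤ V} {P : Set (Set V)}

/-- The tropical curve `Γ` is trivalent, has at worst transverse double points, and its image is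
contained in the one-skeleton of the integral polyhedral decomposition `P`. -/
structure IsSubdivided (P : Set (Set V)) (Γ : TropicalCurve N) : Prop where
  decomp : IsPolyhedralDecomposition P
  integral : IsIntegral N P
  -- With an empty family of constraints, only the conditions on vertices and edges remain.
  adapted : IsAdapted P Γ (Fin.elim0 : Fin 0 → AffineSubspace ℚ V)
  trivalent : Γ.IsTrivalent
  pos_injective : Function.Injective Γ.pos
  pos_ne : ∀ (x : Γ.Vert) (E : Γ.Edge) (s : ℚ), 0 < s → s < Γ.edgeLen E →
    Γ.pos x ≠ Γ.edgePoint E s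
  edge_inter : ∀ E E' : Γ.Edge, E ≠ E' → (Γ.edgeImage E ∩ Γ.edgeImage E').Finite
  fiber_le : ∀ x, (Γ.fiber x).encard ≤ 2
  fiber_subsingleton : Module.finrank ℚ V ≠ 2 → ∀ x, (Γ.fiber x).Subsingleton

namespace TropicalCurve

variable (Γ : TropicalCurve N)

theorem edgeInterval_subset {E : Γ.Edge} {a : ℚ} {b : WithTop ℚ} (ha : 0 ≤ a)
    (hb : b ≤ Γ.edgeLen E) : Γ.edgeInterval E a b ⊆ Γ.edgeImage E := by
  rintro x ⟨t, h1, h2, rfl⟩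
  exact Γ.mem_edgeImage.2 ⟨t, ha.trans h1, h2.trans hb, rfl⟩

theorem edgeInterval_infinite {E : Γ.Edge} {a : ℚ} {b : WithTop ℚ} (hab : a < b) :
    (Γ.edgeInterval E a b).Infinite := by
  obtain ⟨c, hac, hcb⟩ : ∃ c : ℚ, a < c ∧ (c : WithTop ℚ) ≤ b := by
    cases b with
    | top => exact ⟨a + 1, by linarith, le_top⟩
    | coe c => exact ⟨c, WithTop.coe_lt_coe.1 hab, le_rfl⟩
  refine Set.Infinite.mono (s := Γ.edgePoint E '' Set.Icc a c) ?_
    ((Set.Icc_infinite hac).image (Γ.edgePoint_injective E).injOn)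
  rintro _ ⟨t, ⟨h1, h2⟩, rfl⟩
  exact Γ.mem_edgeInterval.2 ⟨h1, (WithTop.coe_le_coe.2 h2).trans hcb⟩

theorem edgeInterval_inj {E : Γ.Edge} {a a' : ℚ} {b b' : WithTop ℚ} (hab : a < b) (hab' : a' < b')
    (h : Γ.edgeInterval E a b = Γ.edgeInterval E a' b') : a = a' ∧ b = b' := by
  have key : ∀ t : ℚ, (a ≤ t ∧ t ≤ b) ↔ (a' ≤ t ∧ t ≤ b') := fun t => by
    rw [← Γ.mem_edgeInterval (E := E), ← Γ.mem_edgeInterval (E := E), h]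
  have haa : a = a' := le_antisymm ((key a').2 ⟨le_rfl, hab'.le⟩).1 ((key a).1 ⟨le_rfl, hab.le⟩).1
  refine ⟨haa, ?_⟩
  subst haa
  have hle : ∀ b b' : WithTop ℚ, a < b → a < b' → (∀ t : ℚ, (a ≤ t ∧ t ≤ b) ↔ (a ≤ t ∧ t ≤ b')) →
      b ≤ b' := by
    intro b b' h1 h2 hk
    cases b' with
    | top => exact le_top
    | coe c' =>
      cases b with
      | top =>
        have := ((hk (c' + 1)).1 ⟨by have := WithTop.coe_lt_coe.1 h2; linarith, le_top⟩).2
        have := WithTop.coe_le_coe.1 this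
        linarith
      | coe c => exact ((hk c).1 ⟨(WithTop.coe_lt_coe.1 h1).le, le_rfl⟩).2
  exact le_antisymm (hle _ _ hab hab' key) (hle _ _ hab' hab fun t => (key t).symm)

/-- At the parameter `s` of the edge `E` there is a vertex of the decomposition from which the edge
goes on in the forward (`σ = true`) or backward direction. -/
structure IsFlag (P : Set (Set V)) (E : Γ.Edge) (s : ℚ) (σ : Bool) : Prop where
  mem : {Γ.edgePoint E s} ∈ P
  nonneg : 0 ≤ s
  le : s ≤ Γ.edgeLen E
  lt_len : σ = true → s < Γ.edgeLen E
  pos : σ = false → 0 < s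

def flagDir (E : Γ.Edge) (σ : Bool) : N := if σ then Γ.dir E else - Γ.dir E

theorem flagDir_primitive (E : Γ.Edge) (σ : Bool) : IsPrimitive (Γ.flagDir E σ) := by
  cases σ
  · exact (Γ.dir_primitive E).neg
  · exact Γ.dir_primitive E

theorem apply_flagDir_eq_zero {E : Γ.Edge} {σ : Bool} {m : Module.Dual ℤ N} :
    m (Γ.flagDir E σ) = 0 ↔ m (Γ.dir E) = 0 := by
  cases σ <;> simp [flagDir]

/-- The one-dimensional cell of a flag. -/
def flagCell (P : Set (Set V)) (E : Γ.Edge) (s : ℚ) (σ : Bool) : Set V :=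
  {x | ∃ (a : ℚ) (b : WithTop ℚ), Γ.IsEdgeCell P E a b ∧
    (if σ then a = s else b = s) ∧ x ∈ Γ.edgeInterval E a b}

variable {Γ}

theorem IsEdgeCell.flagCell_left (hP : IsPolyhedralDecomposition P) {E : Γ.Edge} {a : ℚ}
    {b : WithTop ℚ} (h : Γ.IsEdgeCell P E a b) :
    Γ.flagCell P E a true = Γ.edgeInterval E a b := by
  ext x
  constructor
  · rintro ⟨a', b', h', ha', hx⟩
    rw [if_pos rfl] at ha'
    subst ha'
    rwa [h.right_unique hP h']
  · exact fun hx => ⟨a, b, h, rfl, hx⟩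

theorem IsEdgeCell.flagCell_right (hP : IsPolyhedralDecomposition P) {E : Γ.Edge} {a : ℚ}
    {b : ℚ} (h : Γ.IsEdgeCell P E a b) :
    Γ.flagCell P E b false = Γ.edgeInterval E a b := by
  ext x
  constructor
  · rintro ⟨a', b', h', hb', hx⟩
    rw [if_neg (by simp)] at hb'
    subst hb'
    rwa [h.left_unique hP h']
  · exact fun hx => ⟨a, b, h, rfl, hx⟩

theorem IsEdgeCell.isFlag_left {E : Γ.Edge} {a : ℚ} {b : WithTop ℚ} (h : Γ.IsEdgeCell P E a b) :
    Γ.IsFlag P E a true where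
  mem := h.left
  nonneg := h.nonneg
  le := (h.lt.trans_le h.le).le
  lt_len _ := h.lt.trans_le h.le
  pos := by simp

theorem IsEdgeCell.isFlag_right {E : Γ.Edge} {a b : ℚ} (h : Γ.IsEdgeCell P E a b) :
    Γ.IsFlag P E b false where
  mem := h.right b rfl
  nonneg := h.nonneg.trans (WithTop.coe_lt_coe.1 h.lt).le
  le := h.le
  lt_len := by simp
  pos _ := lt_of_le_of_lt h.nonneg (WithTop.coe_lt_coe.1 h.lt)

theorem IsFlag.exists_isEdgeCell (hΓ : IsSubdivided P Γ) {E : Γ.Edge} {s : ℚ} {σ : Bool}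
    (h : Γ.IsFlag P E s σ) : ∃ (a : ℚ) (b : WithTop ℚ), Γ.IsEdgeCell P E a b ∧
      (if σ then a = s else b = s) ∧ Γ.flagCell P E s σ = Γ.edgeInterval E a b := by
  cases σ with
  | true =>
    obtain ⟨b, hb⟩ := exists_isEdgeCell_right hΓ.decomp hΓ.adapted h.nonneg (h.lt_len rfl) h.mem
    exact ⟨s, b, hb, rfl, hb.flagCell_left hΓ.decomp⟩
  | false =>
    obtain ⟨a, ha⟩ := exists_isEdgeCell_left hΓ.decomp hΓ.adapted (h.pos rfl) h.le h.mem
    exact ⟨a, s, ha, rfl, ha.flagCell_right hΓ.decomp⟩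

theorem IsFlag.flagCell_mem (hΓ : IsSubdivided P Γ) {E : Γ.Edge} {s : ℚ} {σ : Bool}
    (h : Γ.IsFlag P E s σ) : Γ.flagCell P E s σ ∈ P := by
  obtain ⟨a, b, hab, -, heq⟩ := h.exists_isEdgeCell hΓ
  rw [heq]; exact hab.mem

theorem IsFlag.flagCell_infinite (hΓ : IsSubdivided P Γ) {E : Γ.Edge} {s : ℚ} {σ : Bool}
    (h : Γ.IsFlag P E s σ) : (Γ.flagCell P E s σ).Infinite := by
  obtain ⟨a, b, hab, -, heq⟩ := h.exists_isEdgeCell hΓ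
  rw [heq]; exact Γ.edgeInterval_infinite hab.lt

theorem IsFlag.flagCell_subset_edgeImage (hΓ : IsSubdivided P Γ) {E : Γ.Edge} {s : ℚ} {σ : Bool}
    (h : Γ.IsFlag P E s σ) : Γ.flagCell P E s σ ⊆ Γ.edgeImage E := by
  obtain ⟨a, b, hab, -, heq⟩ := h.exists_isEdgeCell hΓ
  rw [heq]; exact Γ.edgeInterval_subset hab.nonneg hab.le

theorem IsFlag.point_mem_flagCell (hΓ : IsSubdivided P Γ) {E : Γ.Edge} {s : ℚ} {σ : Bool}
    (h : Γ.IsFlag P E s σ) : Γ.edgePoint E s ∈ Γ.flagCell P E s σ := by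
  obtain ⟨a, b, hab, hs, heq⟩ := h.exists_isEdgeCell hΓ
  rw [heq, Γ.mem_edgeInterval]
  cases σ
  · rw [if_neg (by simp)] at hs
    rw [← hs]; exact ⟨WithTop.coe_le_coe.1 (hs ▸ hab.lt.le), le_rfl⟩
  · rw [if_pos rfl] at hs
    rw [← hs]; exact ⟨le_rfl, hab.lt.le⟩

theorem IsFlag.flagCell_subset_ray (hΓ : IsSubdivided P Γ) {E : Γ.Edge} {s : ℚ} {σ : Bool}
    (h : Γ.IsFlag P E s σ) {x : V} (hx : x ∈ Γ.flagCell P E s σ) :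
    ∃ a : ℚ, 0 ≤ a ∧ x = Γ.edgePoint E s + a • (Γ.flagDir E σ : V) := by
  obtain ⟨a, b, hab, hs, heq⟩ := h.exists_isEdgeCell hΓ
  rw [heq] at hx
  obtain ⟨t, h1, h2, rfl⟩ := hx
  cases σ
  · rw [if_neg (by simp)] at hs
    rw [hs] at h2
    refine ⟨s - t, sub_nonneg.2 (WithTop.coe_le_coe.1 h2), ?_⟩
    simp only [edgePoint, flagDir, Bool.false_eq_true, if_false, NegMemClass.coe_neg, smul_neg,
      sub_smul]
    abel
  · rw [if_pos rfl] at hs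
    subst hs
    refine ⟨t - a, sub_nonneg.2 h1, ?_⟩
    simp only [edgePoint, flagDir, if_true, sub_smul]
    abel

theorem IsFlag.exists_mem_flagCell (hΓ : IsSubdivided P Γ) {E : Γ.Edge} {s : ℚ} {σ : Bool}
    (h : Γ.IsFlag P E s σ) :
    ∃ a : ℚ, 0 < a ∧ Γ.edgePoint E s + a • (Γ.flagDir E σ : V) ∈ Γ.flagCell P E s σ := by
  obtain ⟨x, hx, hne⟩ := (h.flagCell_infinite hΓ).exists_notMem_finite
    (Set.finite_singleton (Γ.edgePoint E s))
  obtain ⟨a, ha, rfl⟩ := h.flagCell_subset_ray hΓ hx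
  refine ⟨a, lt_of_le_of_ne ha fun h0 => hne ?_, hx⟩
  simp [← h0]

/-- Distinct edges have only finitely many image points in common, whereas a cell is infinite. -/
theorem IsFlag.edge_eq_of_flagCell_eq (hΓ : IsSubdivided P Γ) {E E' : Γ.Edge} {s s' : ℚ}
    {σ σ' : Bool} (h : Γ.IsFlag P E s σ) (h' : Γ.IsFlag P E' s' σ')
    (heq : Γ.flagCell P E s σ = Γ.flagCell P E' s' σ') : E = E' := by
  by_contra hne
  refine h.flagCell_infinite hΓ ((hΓ.edge_inter E E' hne).subset fun x hx => ⟨?_, ?_⟩)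
  · exact h.flagCell_subset_edgeImage hΓ hx
  · rw [heq] at hx
    exact h'.flagCell_subset_edgeImage hΓ hx

theorem IsFlag.eq_of_flagCell_eq (hΓ : IsSubdivided P Γ) {E : Γ.Edge} {s s' : ℚ} {σ : Bool}
    (h : Γ.IsFlag P E s σ) (h' : Γ.IsFlag P E s' σ)
    (heq : Γ.flagCell P E s σ = Γ.flagCell P E s' σ) : s = s' := by
  obtain ⟨a, b, hab, hs, h1⟩ := h.exists_isEdgeCell hΓ
  obtain ⟨a', b', hab', hs', h1'⟩ := h'.exists_isEdgeCell hΓ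
  rw [h1, h1'] at heq
  obtain ⟨haa, hbb⟩ := Γ.edgeInterval_inj hab.lt hab'.lt heq
  cases σ
  · rw [if_neg (by simp)] at hs hs'
    exact WithTop.coe_injective (hs.symm.trans (hbb.trans hs'))
  · rw [if_pos rfl] at hs hs'
    exact hs.symm.trans (haa.trans hs')

theorem IsFlag.flagCell_ne_of_param_eq (hΓ : IsSubdivided P Γ) {E : Γ.Edge} {s : ℚ}
    (h : Γ.IsFlag P E s true) (h' : Γ.IsFlag P E s false) :
    Γ.flagCell P E s true ≠ Γ.flagCell P E s false := by
  intro heq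
  obtain ⟨a, b, hab, hs, h1⟩ := h.exists_isEdgeCell hΓ
  obtain ⟨a', b', hab', hs', h1'⟩ := h'.exists_isEdgeCell hΓ
  rw [h1, h1'] at heq
  obtain ⟨haa, hbb⟩ := Γ.edgeInterval_inj hab.lt hab'.lt heq
  rw [if_pos rfl] at hs
  rw [if_neg (by simp)] at hs'
  have := hab.lt
  rw [hs, hbb, hs'] at this
  exact lt_irrefl _ this

/-! #### The components of the standard curves -/

variable (P Γ) in
/-- The vertices of the decomposition in the interiors of the edges. -/
abbrev DivPoint : Type :=
  {z : Γ.Edge × ℚ // 0 < z.2 ∧ (z.2 : WithTop ℚ) < Γ.edgeLen z.1 ∧ {Γ.edgePoint z.1 z.2} ∈ P}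

variable (P Γ) in
abbrev StdComp : Type := Γ.Vert ⊕ Γ.DivPoint P

def compPos : Γ.StdComp P → V
  | .inl x => Γ.pos x
  | .inr z => Γ.edgePoint z.1.1 z.1.2

variable (P Γ) in
/-- The flags at a component. -/
def FlagAt : Γ.StdComp P → Type
  | .inl x => {b // Γ.src b = x} ⊕ {b // Γ.tgt b = x} ⊕ {e // Γ.base e = x}
  | .inr _ => Bool

instance (y : Γ.StdComp P) : Fintype (Γ.FlagAt P y) := by
  cases y with
  | inl x => exact inferInstanceAs (Fintype ({b // Γ.src b = x} ⊕ {b // Γ.tgt b = x} ⊕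
      {e // Γ.base e = x}))
  | inr _ => exact inferInstanceAs (Fintype Bool)

def FlagAt.edge : {y : Γ.StdComp P} → Γ.FlagAt P y → Γ.Edge
  | .inl _, .inl b => .inl b.1
  | .inl _, .inr (.inl b) => .inl b.1
  | .inl _, .inr (.inr e) => .inr e.1
  | .inr z, _ => z.1.1

def FlagAt.param : {y : Γ.StdComp P} → Γ.FlagAt P y → ℚ
  | .inl _, .inl _ => 0
  | .inl _, .inr (.inl b) => Γ.blen b.1
  | .inl _, .inr (.inr _) => 0
  | .inr z, _ => z.1.2

def FlagAt.sign : {y : Γ.StdComp P} → Γ.FlagAt P y → Bool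
  | .inl _, .inl _ => true
  | .inl _, .inr (.inl _) => false
  | .inl _, .inr (.inr _) => true
  | .inr _, σ => σ

theorem FlagAt.edgePoint_eq {y : Γ.StdComp P} (j : Γ.FlagAt P y) :
    Γ.edgePoint j.edge j.param = compPos y := by
  match y, j with
  | .inl _, .inl ⟨_, h⟩ => subst h; exact Γ.edgePoint_zero _
  | .inl _, .inr (.inl ⟨_, h⟩) => subst h; exact Γ.edgePoint_blen _
  | .inl _, .inr (.inr ⟨_, h⟩) => subst h; exact Γ.edgePoint_zero _
  | .inr z, _ => rfl

theorem compPos_mem (hΓ : IsSubdivided P Γ) (y : Γ.StdComp P) : {compPos y} ∈ P := by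
  cases y with
  | inl x => exact hΓ.adapted.vert x
  | inr z => exact z.2.2.2

theorem FlagAt.isFlag (hΓ : IsSubdivided P Γ) {y : Γ.StdComp P} (j : Γ.FlagAt P y) :
    Γ.IsFlag P j.edge j.param j.sign := by
  have hmem : {Γ.edgePoint j.edge j.param} ∈ P := by
    rw [j.edgePoint_eq]; exact compPos_mem hΓ y
  match y, j with
  | .inl _, .inl b =>
    exact ⟨hmem, le_rfl, (Γ.edgeLen_pos _).le, fun _ => Γ.edgeLen_pos _, by simp [sign]⟩
  | .inl _, .inr (.inl b) =>
    exact ⟨hmem, (Γ.blen_pos _).le, le_rfl, by simp [sign], fun _ => Γ.blen_pos _⟩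
  | .inl _, .inr (.inr e) =>
    exact ⟨hmem, le_rfl, (Γ.edgeLen_pos _).le, fun _ => Γ.edgeLen_pos _, by simp [sign]⟩
  | .inr z, _ => exact ⟨hmem, z.2.1.le, z.2.2.1.le, fun _ => z.2.2.1, fun _ => z.2.1⟩

theorem FlagAt.ext {y : Γ.StdComp P} {j j' : Γ.FlagAt P y} (h : j.edge = j'.edge)
    (h' : j.sign = j'.sign) : j = j' := by
  match y, j, j' with
  | .inl _, .inl b, .inl b' =>
    have : b = b' := Subtype.ext (Sum.inl_injective h)
    rw [this]
  | .inl _, .inl b, .inr (.inl b') => simp [sign] at h'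
  | .inl _, .inl b, .inr (.inr b') => simp [edge] at h
  | .inl _, .inr (.inl b), .inl b' => simp [sign] at h'
  | .inl _, .inr (.inl b), .inr (.inl b') =>
    have : b = b' := Subtype.ext (Sum.inl_injective h)
    rw [this]
  | .inl _, .inr (.inl b), .inr (.inr b') => simp [edge] at h
  | .inl _, .inr (.inr b), .inl b' => simp [edge] at h
  | .inl _, .inr (.inr b), .inr (.inl b') => simp [edge] at h
  | .inl _, .inr (.inr b), .inr (.inr b') =>
    have : b = b' := Subtype.ext (Sum.inr_injective h)
    rw [this]
  | .inr z, σ, σ' => exact h'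

/-- Vertices have distinct images and are not mapped to inner points of edges, so the position on
one edge distinguishes all components on it. -/
theorem comp_ext (hΓ : IsSubdivided P Γ) {y y' : Γ.StdComp P} {j : Γ.FlagAt P y}
    {j' : Γ.FlagAt P y'} (h : j.edge = j'.edge) (h' : j.param = j'.param) : y = y' := by
  have hpos : compPos y = compPos y' := by rw [← j.edgePoint_eq, ← j'.edgePoint_eq, h, h']
  match y, y' with
  | .inl x, .inl x' => rw [hΓ.pos_injective hpos]
  | .inl x, .inr z => exact absurd hpos (hΓ.pos_ne x _ _ z.2.1 z.2.2.1)
  | .inr z, .inl x => exact absurd hpos.symm (hΓ.pos_ne x _ _ z.2.1 z.2.2.1)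
  | .inr z, .inr z' => exact congrArg Sum.inr (Subtype.ext (Prod.ext h h'))

theorem flagAt_ext (hΓ : IsSubdivided P Γ) {f f' : Σ y, Γ.FlagAt P y}
    (h : f.2.edge = f'.2.edge) (h' : f.2.param = f'.2.param) (h'' : f.2.sign = f'.2.sign) :
    f = f' := by
  obtain ⟨y, j⟩ := f
  obtain ⟨y', j'⟩ := f'
  have hy : y = y' := comp_ext hΓ (j := j) (j' := j') h h'
  subst hy
  exact congrArg (Sigma.mk y) (FlagAt.ext h h'')

theorem IsFlag.exists_flagAt {E : Γ.Edge} {s : ℚ} {σ : Bool} (h : Γ.IsFlag P E s σ) :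
    ∃ f : Σ y, Γ.FlagAt P y, f.2.edge = E ∧ f.2.param = s ∧ f.2.sign = σ := by
  rcases h.nonneg.eq_or_lt with h0 | h0
  · subst h0
    obtain rfl : σ = true := by
      cases σ
      · exact absurd (h.pos rfl) (lt_irrefl _)
      · rfl
    cases E with
    | inl b => exact ⟨⟨.inl (Γ.src b), .inl ⟨b, rfl⟩⟩, rfl, rfl, rfl⟩
    | inr e => exact ⟨⟨.inl (Γ.base e), .inr (.inr ⟨e, rfl⟩)⟩, rfl, rfl, rfl⟩
  rcases h.le.eq_or_lt with h1 | h1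
  · obtain rfl : σ = false := by
      cases σ
      · rfl
      · exact absurd h1 (h.lt_len rfl).ne
    cases E with
    | inl b => exact ⟨⟨.inl (Γ.tgt b), .inr (.inl ⟨b, rfl⟩)⟩, rfl, (WithTop.coe_injective h1).symm, rfl⟩
    | inr e => exact absurd h1 (by simp [edgeLen])
  · exact ⟨⟨.inr ⟨(E, s), h0, h1, h.mem⟩, σ⟩, rfl, rfl, rfl⟩

/-- The combinatorial type of the component of a standard curve. -/
def frame (hΓ : IsSubdivided P Γ) (y : Γ.StdComp P) : LineFrame N P where
  v := ⟨compPos y, hΓ.integral _ (compPos_mem hΓ y)⟩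
  v_mem := compPos_mem hΓ y
  J := Γ.FlagAt P y
  w j := Γ.weight j.edge
  w_pos j := Γ.weight_pos _
  u j := Γ.flagDir j.edge j.sign
  u_primitive j := Γ.flagDir_primitive _ _
  T j := Γ.flagCell P j.edge j.param j.sign
  T_mem j := (j.isFlag hΓ).flagCell_mem hΓ
  T_subset j x hx := by
    have := (j.isFlag hΓ).flagCell_subset_ray hΓ hx
    rwa [j.edgePoint_eq] at this
  v_mem_T j := by
    have := (j.isFlag hΓ).point_mem_flagCell hΓ
    rwa [j.edgePoint_eq] at this
  exists_mem_T j := by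
    have := (j.isFlag hΓ).exists_mem_flagCell hΓ
    rwa [j.edgePoint_eq] at this

theorem card_frame_inl (hΓ : IsSubdivided P Γ) (x : Γ.Vert) :
    Fintype.card (frame hΓ (.inl x)).J = 3 := by
  change Fintype.card ({b // Γ.src b = x} ⊕ {b // Γ.tgt b = x} ⊕ {e // Γ.base e = x}) = 3
  rw [Fintype.card_sum, Fintype.card_sum, Fintype.card_subtype, Fintype.card_subtype,
    Fintype.card_subtype, ← hΓ.trivalent x, add_assoc]

theorem card_frame_inr (hΓ : IsSubdivided P Γ) (z : Γ.DivPoint P) :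
    Fintype.card (frame hΓ (.inr z)).J = 2 := rfl

theorem card_frame (hΓ : IsSubdivided P Γ) (y : Γ.StdComp P) :
    Fintype.card (frame hΓ y).J = 2 ∨ Fintype.card (frame hΓ y).J = 3 := by
  cases y with
  | inl x => exact Or.inr (card_frame_inl hΓ x)
  | inr z => exact Or.inl (card_frame_inr hΓ z)

/-- At a vertex this is the balancing condition of `Γ`; at a point subdividing an edge the two
directions are opposite and carry the same weight. -/
theorem frame_isBalanced (hΓ : IsSubdivided P Γ) (y : Γ.StdComp P) : (frame hΓ y).IsBalanced := by
  cases y with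
  | inl x =>
    let F : {b // Γ.src b = x} ⊕ {b // Γ.tgt b = x} ⊕ {e // Γ.base e = x} → N :=
      Sum.elim (fun b => Γ.bweight b.1 • Γ.bdir b.1)
        (Sum.elim (fun b => Γ.bweight b.1 • (- Γ.bdir b.1)) fun e => Γ.uweight e.1 • Γ.udir e.1)
    have key : ∑ j, F j = 0 := by
      rw [Fintype.sum_sum_type, Fintype.sum_sum_type, ← Γ.balanced x, ← add_assoc,
        sub_eq_add_neg, ← Finset.sum_neg_distrib]
      congr 1
      · congr 1
        · rw [Finset.sum_subtype (p := fun b => Γ.src b = x) _ (by simp)]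
          rfl
        · rw [Finset.sum_subtype (p := fun b => Γ.tgt b = x) _ (by simp)]
          exact Finset.sum_congr rfl fun b _ => smul_neg _ _
      · rw [Finset.sum_subtype (p := fun e => Γ.base e = x) _ (by simp)]
        rfl
    exact (Fintype.sum_congr (α := {b // Γ.src b = x} ⊕ {b // Γ.tgt b = x} ⊕ {e // Γ.base e = x})
      _ F fun j => by rcases j with j | j | j <;> rfl).trans key
  | inr z =>
    let F : Bool → N := fun σ => Γ.weight z.1.1 • Γ.flagDir z.1.1 σ
    have key : ∑ j, F j = 0 := by
      rw [Fintype.sum_bool]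
      change Γ.weight z.1.1 • Γ.dir z.1.1 + Γ.weight z.1.1 • (- Γ.dir z.1.1) = 0
      rw [smul_neg, add_neg_cancel]
    exact key

/-- The two flags of a one-dimensional cell. -/
theorem flagCell_eq_cases (hΓ : IsSubdivided P Γ) {f f' : Σ y, Γ.FlagAt P y}
    (h : (frame hΓ f.1).T f.2 = (frame hΓ f'.1).T f'.2) :
    f.2.edge = f'.2.edge ∧ (f.2.sign = f'.2.sign → f = f') := by
  have he := (f.2.isFlag hΓ).edge_eq_of_flagCell_eq hΓ (f'.2.isFlag hΓ) h
  refine ⟨he, fun hs => flagAt_ext hΓ he ?_ hs⟩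
  have h1 := f.2.isFlag hΓ
  have h2 := f'.2.isFlag hΓ
  change Γ.flagCell P f.2.edge f.2.param f.2.sign = Γ.flagCell P f'.2.edge f'.2.param f'.2.sign at h
  rw [he, hs] at h h1
  exact h1.eq_of_flagCell_eq hΓ h2 h

theorem frame_T_injective (hΓ : IsSubdivided P Γ) (y : Γ.StdComp P) :
    Function.Injective (frame hΓ y).T := by
  intro j j' h
  obtain ⟨he, hs⟩ := flagCell_eq_cases hΓ (f := ⟨y, j⟩) (f' := ⟨y, j'⟩) h
  by_cases hss : FlagAt.sign j = FlagAt.sign j'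
  · exact FlagAt.ext he hss
  exfalso
  have hpar : FlagAt.param j = FlagAt.param j' := by
    refine Γ.edgePoint_injective (FlagAt.edge j) ?_
    have h1 := FlagAt.edgePoint_eq j
    have h2 := FlagAt.edgePoint_eq j'
    rw [← he] at h2
    exact h1.trans h2.symm
  have h1 := FlagAt.isFlag hΓ j
  have h2 := FlagAt.isFlag hΓ j'
  change Γ.flagCell P (FlagAt.edge j) (FlagAt.param j) (FlagAt.sign j)
    = Γ.flagCell P (FlagAt.edge j') (FlagAt.param j') (FlagAt.sign j') at h
  change FlagAt.edge j = FlagAt.edge j' at he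
  rw [he, hpar] at h h1
  rcases hj : FlagAt.sign j <;> rcases hj' : FlagAt.sign j'
  · exact hss (hj.trans hj'.symm)
  · rw [hj] at h h1; rw [hj'] at h h2
    exact h2.flagCell_ne_of_param_eq hΓ h1 h.symm
  · rw [hj] at h h1; rw [hj'] at h h2
    exact h1.flagCell_ne_of_param_eq hΓ h2 h
  · exact hss (hj.trans hj'.symm)

theorem finite_divPoint (hΓ : IsSubdivided P Γ) : Finite (Γ.DivPoint P) := by
  have hfin := hΓ.decomp.finite
  have : Finite P := hfin
  refine Finite.of_injective (fun z : Γ.DivPoint P =>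
    ((z.1.1, ⟨{Γ.edgePoint z.1.1 z.1.2}, z.2.2.2⟩) : Γ.Edge × P)) ?_
  rintro ⟨⟨E, s⟩, hz⟩ ⟨⟨E', s'⟩, hz'⟩ h
  simp only [Prod.mk.injEq, Subtype.mk.injEq] at h
  obtain ⟨rfl, h⟩ := h
  have := Γ.edgePoint_injective E (Set.singleton_injective h)
  subst this
  rfl

end TropicalCurve

end Flags

/-! ### Standard components and their gluing along the edges -/

section Standard

variable {V : Type*} [AddCommGroup V] [Module ℚ V] {N : Submodule ℤ V} {P : Set (Set V)}

theorem TropicalCurve.exists_pos_of_end {Γ : TropicalCurve N} {E : Γ.Edge} {t : ℚ}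
    (h : t = 0 ∨ (t : WithTop ℚ) = Γ.edgeLen E) : ∃ x, Γ.edgePoint E t = Γ.pos x := by
  rcases h with rfl | h
  · exact ⟨_, Γ.edgePoint_zero E⟩
  · cases E with
    | inl b => exact ⟨Γ.tgt b, by rw [← Γ.edgePoint_blen, WithTop.coe_injective h]⟩
    | inr e => exact absurd h (by simp [TropicalCurve.edgeLen])

/-- In dimension two all properties come from generality and simplicity. In higher dimension `h` is
injective, so two different edges can meet only in images of vertices. -/
theorem isSubdivided_of_isGeneral (hn : 2 ≤ Module.finrank ℚ V) {Δ : N →₀ ℕ} {l : ℕ}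
    {d : Fin l → ℕ} {A : Fin l → AffineSubspace ℚ V} (hgen : IsGeneral N Δ d A)
    {Γ : TropicalCurve N} {E : Fin l → Γ.Edge} (hrat : Γ.IsRational) (hdeg : Γ.HasDegree Δ)
    (hmatch : Γ.Matches E A) (hP : IsPolyhedralDecomposition P) (hint : IsIntegral N P)
    (hA : IsAdapted P Γ A) (hsimple : Module.finrank ℚ V = 2 → Γ.IsSimple) :
    IsSubdivided P Γ := by
  obtain ⟨htri, -, hbig, h2⟩ := hgen.2 Γ E hrat hdeg hmatch
  have hopen : ∀ {E : Γ.Edge} {s : ℚ}, 0 < s → s < Γ.edgeLen E →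
      (Sum.inr E : Γ.Vert ⊕ Γ.Edge) ∈ Γ.fiber (Γ.edgePoint E s) := fun h1 h2 =>
    Γ.mem_openCell.2 ⟨_, h1, h2, rfl⟩
  have hvert : ∀ x : Γ.Vert, (Sum.inl x : Γ.Vert ⊕ Γ.Edge) ∈ Γ.fiber (Γ.pos x) := fun x => rfl
  have hadapted : IsAdapted P Γ (Fin.elim0 : Fin 0 → AffineSubspace ℚ V) :=
    ⟨hA.vert, hA.edge, fun _ j => j.elim0⟩
  by_cases hd : Module.finrank ℚ V = 2
  · obtain ⟨hs1, hs2, hs3⟩ := hsimple hd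
    refine ⟨hP, hint, hadapted, htri, (h2 hd).1, ?_, hs1, hs2, fun h => absurd hd h⟩
    intro x E s h0 h1 heq
    have := hopen h0 h1
    rw [← heq, hs3] at this
    simp at this
  · have hsub := hbig (lt_of_le_of_ne hn (Ne.symm hd))
    have hne : ∀ (x : Γ.Vert) (E : Γ.Edge) (s : ℚ), 0 < s → s < Γ.edgeLen E →
        Γ.pos x ≠ Γ.edgePoint E s := by
      intro x E s h0 h1 heq
      have h3 := hopen h0 h1
      rw [← heq] at h3
      have := hsub _ h3 (hvert x)
      simp at this
    refine ⟨hP, hint, hadapted, htri, ?_, hne, ?_, ?_, fun _ => hsub⟩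
    · intro x x' h
      have h3 := hvert x'
      rw [← h] at h3
      exact Sum.inl_injective (hsub _ (hvert x) h3)
    · intro E E' hEE
      refine (Set.finite_range Γ.pos).subset ?_
      rintro p ⟨hp, hp'⟩
      obtain ⟨t, ht0, ht1, rfl⟩ := Γ.mem_edgeImage.1 hp
      obtain ⟨t', ht0', ht1', heq⟩ := Γ.mem_edgeImage.1 hp'
      rcases ht0.eq_or_lt with h | h
      · obtain ⟨x, hx⟩ := TropicalCurve.exists_pos_of_end (E := E) (Or.inl h.symm)
        exact ⟨x, hx.symm⟩
      rcases ht1.eq_or_lt with h3 | h3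
      · obtain ⟨x, hx⟩ := TropicalCurve.exists_pos_of_end (Or.inr h3)
        exact ⟨x, hx.symm⟩
      rcases ht0'.eq_or_lt with h' | h'
      · obtain ⟨x, hx⟩ := TropicalCurve.exists_pos_of_end (E := E') (Or.inl h'.symm)
        exact ⟨x, (heq.trans hx).symm⟩
      rcases ht1'.eq_or_lt with h3' | h3'
      · obtain ⟨x, hx⟩ := TropicalCurve.exists_pos_of_end (Or.inr h3')
        exact ⟨x, (heq.trans hx).symm⟩
      have h4 := hopen h' h3'
      rw [← heq] at h4
      exact absurd (Sum.inr_injective (hsub _ (hopen h h3) h4)) hEE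
    · intro x
      exact ((Set.encard_le_one_iff_subsingleton).2 (hsub x)).trans (by norm_num)

theorem eq_of_mem_coneOver_singleton {v y : V} (h : (y, (1 : ℚ)) ∈ coneOver {v}) : y = v := by
  by_contra hne
  have hne' : y - v ≠ 0 := sub_ne_zero.2 hne
  obtain ⟨f, hf⟩ : ∃ f : Module.Dual ℚ V, f (y - v) ≠ 0 := by
    by_contra h
    push Not at h
    exact hne' ((Module.forall_dual_apply_eq_zero_iff ℚ _).1 h)
  have h4 := eq_zero_coneOver_iff (S := {v})
    (f := f ∘ₗ LinearMap.fst ℚ V ℚ - f v • LinearMap.snd ℚ V ℚ) |>.2 (by simp) _ h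
  simp at h4
  exact hf (by rw [map_sub, h4])

theorem vertex_of_isFace (hP : IsPolyhedralDecomposition P) {v : V} {σ : Set (V × ℚ)} {S : Set V}
    (hS : S ∈ P) (hσ : σ = coneOver S) (h : IsFace (coneOver {v}) σ) : {v} ∈ P := by
  obtain ⟨T, hT, -, hvT⟩ := hP.exists_cell (σ := coneOver {v}) ⟨S, hS, hσ ▸ h⟩ (mem_coneOver (S := {v}) rfl)
  have : T = {v} := by
    refine Set.Subset.antisymm (fun y hy => ?_) ?_
    · exact eq_of_mem_coneOver_singleton (hvT ▸ mem_coneOver hy)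
    · rintro _ rfl
      exact (hP.polyhedron T hT).mem_of_mem_coneOver (hvT ▸ mem_coneOver rfl)
  rwa [← this]

variable {k : Type*} [Field k]

/-- Distinct points of the projective line for a combinatorial type. -/
def LineFrame.stdPoints (L : LineFrame N P) [Infinite k] : L.Points k where
  pt j := ![1, Infinite.natEmbedding k (Fintype.equivFin L.J j)]
  ne_zero j h := by simpa using congrFun h 0
  cross_ne i j hij h := by
    rw [cross] at h
    simp only [Matrix.cons_val_zero, Matrix.cons_val_one, one_mul, mul_one, sub_eq_zero] at h
    exact hij ((Fintype.equivFin L.J).injective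
      (Fin.val_injective ((Infinite.natEmbedding k).injective h))).symm

/-- The pairs of distinct points that are mapped to the orbit of the same cone other than the cone
over a vertex. -/
def boundaryNodes {Comp : Type} (map : Comp → P1 k → Degeneration k N P) :
    Set (Sym2 (Comp × P1 k)) :=
  {s | ∃ x y, s = s(x, y) ∧ x ≠ y ∧ (∀ v, (map x.1 x.2).cone ≠ coneOver {v}) ∧
    (map x.1 x.2).cone = (map y.1 y.2).cone}

theorem mem_boundaryNodes {Comp : Type} {map : Comp → P1 k → Degeneration k N P}
    {x y : Comp × P1 k} : s(x, y) ∈ boundaryNodes map ↔ x ≠ y ∧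
      (∀ v, (map x.1 x.2).cone ≠ coneOver {v}) ∧ (map x.1 x.2).cone = (map y.1 y.2).cone := by
  constructor
  · rintro ⟨x', y', h, hne, hv, hc⟩
    rcases Sym2.eq_iff.1 h with ⟨rfl, rfl⟩ | ⟨rfl, rfl⟩
    · exact ⟨hne, hv, hc⟩
    · exact ⟨hne.symm, fun v => hc ▸ hv v, hc.symm⟩
  · exact fun h => ⟨x, y, rfl, h⟩

namespace TropicalCurve

variable {Γ : TropicalCurve N}

/-- Only finitely many vertices of `P` lie on the edge. At the smallest one violating `Q` a cell
ends, and the beginning of this cell is a smaller violation. -/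
theorem edge_induction (hΓ : IsSubdivided P Γ) (E : Γ.Edge) {Q : ℚ → Prop} (h0 : Q 0)
    (hstep : ∀ a b : ℚ, Γ.IsEdgeCell P E a b → Q a → Q b) {s : ℚ} (hs : {Γ.edgePoint E s} ∈ P)
    (hs0 : 0 ≤ s) (hsl : s ≤ Γ.edgeLen E) : Q s := by
  by_contra hbad
  set B : Set ℚ := {s | {Γ.edgePoint E s} ∈ P ∧ 0 ≤ s ∧ (s : WithTop ℚ) ≤ Γ.edgeLen E ∧ ¬ Q s}
  have hfin : B.Finite := by
    refine Set.Finite.subset (hΓ.decomp.finite.preimage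
      (f := fun s : ℚ => ({Γ.edgePoint E s} : Set V)) ?_) fun s hs => hs.1
    exact fun a _ b _ h => Γ.edgePoint_injective E (Set.singleton_injective h)
  obtain ⟨t, ht, hmin⟩ := Set.exists_min_image B id hfin ⟨s, hs, hs0, hsl, hbad⟩
  obtain ⟨htP, ht0, htl, htQ⟩ := ht
  have hpos : 0 < t := lt_of_le_of_ne ht0 fun h => htQ (h ▸ h0)
  obtain ⟨a, ha⟩ := exists_isEdgeCell_left hΓ.decomp hΓ.adapted hpos htl htP
  refine htQ (hstep a t ha ?_)
  by_contra hQa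
  have hat : a < t := WithTop.coe_lt_coe.1 ha.lt
  have := hmin a ⟨ha.left, ha.nonneg, (WithTop.coe_le_coe.2 hat.le).trans htl, hQa⟩
  exact absurd hat (not_lt.2 this)

/-- The other end of a cell. -/
theorem exists_opposite_flag (hΓ : IsSubdivided P Γ) (f : Σ y, Γ.FlagAt P y) {v : V}
    (hv : {v} ∈ P) (hvT : v ∈ (frame hΓ f.1).T f.2) (hne : v ≠ compPos f.1) :
    ∃ f' : Σ y, Γ.FlagAt P y, (frame hΓ f'.1).T f'.2 = (frame hΓ f.1).T f.2 ∧
      f'.2.edge = f.2.edge ∧ f'.2.sign ≠ f.2.sign ∧ compPos f'.1 = v := by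
  have hf := f.2.isFlag hΓ
  obtain ⟨a, b, hab, hs, heq⟩ := hf.exists_isEdgeCell hΓ
  have hT : (frame hΓ f.1).T f.2 = Γ.edgeInterval f.2.edge a b := heq
  rw [hT] at hvT
  obtain ⟨t, h1, h2, rfl⟩ := hvT
  have hends : t = a ∨ (t : WithTop ℚ) = b := by
    by_contra h
    push Not at h
    exact hab.not_between hΓ.decomp (lt_of_le_of_ne h1 (Ne.symm h.1)) (lt_of_le_of_ne h2 h.2) hv
  have hparam : t ≠ f.2.param := fun h => hne (by rw [h, f.2.edgePoint_eq])
  cases hσ : f.2.sign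
  · rw [hσ, if_neg (by simp)] at hs
    have hta : t = a := hends.resolve_right fun h => hparam (WithTop.coe_injective (h.trans hs))
    subst hta
    obtain ⟨f', he, hp, hsg⟩ := hab.isFlag_left.exists_flagAt
    refine ⟨f', ?_, he, by rw [hsg]; simp, by rw [← f'.2.edgePoint_eq, he, hp]⟩
    change Γ.flagCell P f'.2.edge f'.2.param f'.2.sign = _
    rw [hT, he, hp, hsg, hab.flagCell_left hΓ.decomp]
  · rw [hσ, if_pos rfl] at hs
    have htb : (t : WithTop ℚ) = b := hends.resolve_left fun h => hparam (h.trans hs)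
    subst htb
    obtain ⟨f', he, hp, hsg⟩ := hab.isFlag_right.exists_flagAt
    refine ⟨f', ?_, he, by rw [hsg]; simp, by rw [← f'.2.edgePoint_eq, he, hp]⟩
    change Γ.flagCell P f'.2.edge f'.2.param f'.2.sign = _
    rw [hT, he, hp, hsg, hab.flagCell_right hΓ.decomp]

theorem compPos_ne_of_T_eq (hΓ : IsSubdivided P Γ) {f f' : Σ y, Γ.FlagAt P y}
    (h : (frame hΓ f.1).T f.2 = (frame hΓ f'.1).T f'.2) (hne : f ≠ f') :
    compPos f.1 ≠ compPos f'.1 := by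
  intro hpos
  obtain ⟨he, -⟩ := flagCell_eq_cases hΓ h
  have hparam : f.2.param = f'.2.param := by
    refine Γ.edgePoint_injective f.2.edge ?_
    rw [f.2.edgePoint_eq, hpos, ← f'.2.edgePoint_eq, he]
  obtain ⟨y, j⟩ := f
  obtain ⟨y', j'⟩ := f'
  have hy : y = y' := comp_ext hΓ (j := j) (j' := j') he hparam
  subst hy
  exact hne (congrArg (Sigma.mk y) (frame_T_injective hΓ y h))

/-! #### Maps of the components -/

variable [Infinite k]

variable (k) in
abbrev points (hΓ : IsSubdivided P Γ) (y : Γ.StdComp P) : (frame hΓ y).Points k :=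
  (frame hΓ y).stdPoints

variable (k) in
/-- The boundary point given by a flag. -/
def flagPoint (hΓ : IsSubdivided P Γ) (f : Σ y, Γ.FlagAt P y) : Γ.StdComp P × P1 k :=
  (f.1, (points k hΓ f.1).point f.2)

theorem flagPoint_injective (hΓ : IsSubdivided P Γ) : Function.Injective (flagPoint k hΓ) := by
  rintro ⟨y, j⟩ ⟨y', j'⟩ h
  obtain rfl : y = y' := congrArg Prod.fst h
  have : (points k hΓ y).point j = (points k hΓ y).point j' := congrArg Prod.snd h
  rw [(points k hΓ y).point_injective this]

/-- The map of the component `y` with the character `χ y`. -/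
def compMap (hΓ : IsSubdivided P Γ) (χ : Γ.StdComp P → CharTorus k N) (y : Γ.StdComp P) :
    P1 k → Degeneration k N P :=
  LineFrame.lineMap (points k hΓ y) hΓ.decomp (χ y)

theorem compMap_cone_flagPoint (hΓ : IsSubdivided P Γ) (χ : Γ.StdComp P → CharTorus k N)
    (f : Σ y, Γ.FlagAt P y) :
    (compMap hΓ χ (flagPoint k hΓ f).1 (flagPoint k hΓ f).2).cone
      = coneOver ((frame hΓ f.1).T f.2) :=
  LineFrame.lineCone_point _ _

theorem T_ne_singleton (hΓ : IsSubdivided P Γ) (f : Σ y, Γ.FlagAt P y) (v : V) :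
    coneOver ((frame hΓ f.1).T f.2) ≠ coneOver {v} := by
  intro h
  refine (f.2.isFlag hΓ).flagCell_infinite hΓ ((Set.finite_singleton v).subset fun y hy => ?_)
  exact eq_of_mem_coneOver_singleton (h ▸ mem_coneOver hy)

theorem exists_flag_of_cone_ne (hΓ : IsSubdivided P Γ) {χ : Γ.StdComp P → CharTorus k N}
    {x : Γ.StdComp P × P1 k} (h : ∀ v, (compMap hΓ χ x.1 x.2).cone ≠ coneOver {v}) :
    ∃ f, x = flagPoint k hΓ f := by
  rcases LineFrame.point_cases (points k hΓ x.1) x.2 with ⟨j, hj⟩ | h'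
  · exact ⟨⟨x.1, j⟩, Prod.ext rfl hj⟩
  · exact absurd (LineFrame.lineCone_of_forall_ne _ h') (h _)

theorem mem_boundaryNodes_compMap (hΓ : IsSubdivided P Γ) {χ : Γ.StdComp P → CharTorus k N}
    {x y : Γ.StdComp P × P1 k} : s(x, y) ∈ boundaryNodes (compMap hΓ χ) ↔
      ∃ f f', x = flagPoint k hΓ f ∧ y = flagPoint k hΓ f' ∧ f ≠ f' ∧
        (frame hΓ f.1).T f.2 = (frame hΓ f'.1).T f'.2 := by
  rw [mem_boundaryNodes]
  constructor
  · rintro ⟨hne, hv, hc⟩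
    obtain ⟨f, rfl⟩ := exists_flag_of_cone_ne hΓ hv
    obtain ⟨f', rfl⟩ := exists_flag_of_cone_ne hΓ (χ := χ) (x := y) (fun v => hc ▸ hv v)
    refine ⟨f, f', rfl, rfl, fun h => hne (by rw [h]), ?_⟩
    rw [compMap_cone_flagPoint, compMap_cone_flagPoint] at hc
    exact (hΓ.decomp.polyhedron _ (LineFrame.T_mem _ _)).coneOver_inj
      (hΓ.decomp.polyhedron _ (LineFrame.T_mem _ _)) hc
  · rintro ⟨f, f', rfl, rfl, hne, hT⟩
    refine ⟨fun h => hne (flagPoint_injective hΓ h), ?_, ?_⟩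
    · rw [compMap_cone_flagPoint]; exact T_ne_singleton hΓ f
    · rw [compMap_cone_flagPoint, compMap_cone_flagPoint, hT]

/-- The character giving the value of a component at the boundary point of a flag. -/
def flagChar (hΓ : IsSubdivided P Γ) (χ : Γ.StdComp P → CharTorus k N) (f : Σ y, Γ.FlagAt P y) :
    CharTorus k N := χ f.1 * LineFrame.boundaryChar (points k hΓ f.1) f.2

/-- Both directions at a divalent component are multiples of the direction of the edge. Hence all
exponents of a monomial orthogonal to it vanish, and the monomial is constant along the component.
-/
theorem boundaryChar_div (hΓ : IsSubdivided P Γ) {z : Γ.DivPoint P}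
    (j : (frame hΓ (.inr z)).J) {m : Module.Dual ℤ N} (hm : m (Γ.dir z.1.1) = 0) :
    LineFrame.boundaryChar (points k hΓ (.inr z)) j (Multiplicative.ofAdd m) = 1 := by
  refine Units.ext ?_
  rw [LineFrame.boundaryChar_apply _ j m (Γ.apply_flagDir_eq_zero.2 hm)]
  refine Finset.prod_eq_one fun i _ => ?_
  rw [LineFrame.apply_amp]
  have : m ((frame hΓ (.inr z)).u i) = 0 := Γ.apply_flagDir_eq_zero.2 hm
  rw [this, mul_zero, zpow_zero]

theorem flagChar_div (hΓ : IsSubdivided P Γ) (χ : Γ.StdComp P → CharTorus k N) {z : Γ.DivPoint P}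
    (j : Γ.FlagAt P (.inr z)) {m : Module.Dual ℤ N} (hm : m (Γ.dir z.1.1) = 0) :
    flagChar hΓ χ ⟨.inr z, j⟩ (Multiplicative.ofAdd m) = χ (.inr z) (Multiplicative.ofAdd m) := by
  rw [flagChar, MonoidHom.mul_apply, mul_eq_left]
  exact boundaryChar_div hΓ j hm

/-- The flag at the tail of an edge. -/
def tailFlag (P : Set (Set V)) : (E : Γ.Edge) → Γ.FlagAt P (.inl (Γ.tail E))
  | .inl b => .inl ⟨b, rfl⟩
  | .inr e => .inr (.inr ⟨e, rfl⟩)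

def headFlag (P : Set (Set V)) (b : Γ.BEdge) : Γ.FlagAt P (.inl (Γ.tgt b)) := .inr (.inl ⟨b, rfl⟩)

theorem tailFlag_edge (E : Γ.Edge) : (tailFlag P E).edge = E := by cases E <;> rfl

theorem tailFlag_param (E : Γ.Edge) : (tailFlag P E).param = 0 := by cases E <;> rfl

theorem tailFlag_sign (E : Γ.Edge) : (tailFlag P E).sign = true := by cases E <;> rfl

/-- The components are glued along the cells of dimension one. -/
def IsGlued (hΓ : IsSubdivided P Γ) (χ : Γ.StdComp P → CharTorus k N) : Prop :=
  ∀ f f' : Σ y, Γ.FlagAt P y, (frame hΓ f.1).T f.2 = (frame hΓ f'.1).T f'.2 →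
    ∀ m : Module.Dual ℤ N, m (Γ.dir f.2.edge) = 0 →
      flagChar hΓ χ f (Multiplicative.ofAdd m) = flagChar hΓ χ f' (Multiplicative.ofAdd m)

theorem compMap_flagPoint_eq_iff [N.IsLattice ℚ] (hΓ : IsSubdivided P Γ)
    {χ χ' : Γ.StdComp P → CharTorus k N} {f f' : Σ y, Γ.FlagAt P y}
    (hT : (frame hΓ f.1).T f.2 = (frame hΓ f'.1).T f'.2) :
    compMap hΓ χ (flagPoint k hΓ f).1 (flagPoint k hΓ f).2
        = compMap hΓ χ' (flagPoint k hΓ f').1 (flagPoint k hΓ f').2 ↔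
      ∀ m : Module.Dual ℤ N, m (Γ.dir f.2.edge) = 0 →
        flagChar hΓ χ f (Multiplicative.ofAdd m) = flagChar hΓ χ' f' (Multiplicative.ofAdd m) := by
  have h := LineFrame.lineMap_point_eq (p := points k hΓ f.1) (p' := points k hΓ f'.1) hΓ.decomp
    (frame_isBalanced hΓ f.1) (frame_isBalanced hΓ f'.1) (c := χ f.1) (c' := χ' f'.1) hT
  refine h.trans (forall_congr' fun m => ?_)
  have : m ((frame hΓ f.1).u f.2) = 0 ↔ m (Γ.dir f.2.edge) = 0 := Γ.apply_flagDir_eq_zero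
  rw [this]
  rfl

/-- Along an edge, the values at the boundary points do not change. -/
theorem IsGlued.flagChar_eq (hΓ : IsSubdivided P Γ) {χ : Γ.StdComp P → CharTorus k N}
    (hχ : IsGlued hΓ χ) (f : Σ y, Γ.FlagAt P y) {m : Module.Dual ℤ N}
    (hm : m (Γ.dir f.2.edge) = 0) :
    flagChar hΓ χ f (Multiplicative.ofAdd m)
      = flagChar hΓ χ ⟨_, tailFlag P f.2.edge⟩ (Multiplicative.ofAdd m) := by
  set E := f.2.edge with hE
  have key : ∀ s : ℚ, {Γ.edgePoint E s} ∈ P → 0 ≤ s → s ≤ Γ.edgeLen E →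
      ∀ f : Σ y, Γ.FlagAt P y, f.2.edge = E → f.2.param = s →
        flagChar hΓ χ f (Multiplicative.ofAdd m)
          = flagChar hΓ χ ⟨_, tailFlag P E⟩ (Multiplicative.ofAdd m) := by
    intro s hs hs0 hsl
    refine edge_induction hΓ E (Q := fun s => ∀ f : Σ y, Γ.FlagAt P y, f.2.edge = E →
      f.2.param = s → flagChar hΓ χ f (Multiplicative.ofAdd m)
          = flagChar hΓ χ ⟨_, tailFlag P E⟩ (Multiplicative.ofAdd m)) ?_ ?_ hs hs0 hsl
    · intro f hf hfs
      have hσ : f.2.sign = true := by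
        cases h : f.2.sign
        · have := (f.2.isFlag hΓ).pos h
          rw [hfs] at this
          exact absurd this (lt_irrefl _)
        · rfl
      have : f = ⟨_, tailFlag P E⟩ := flagAt_ext hΓ (by rw [hf]; exact (tailFlag_edge E).symm)
        (by rw [hfs]; exact (tailFlag_param E).symm) (by rw [hσ]; exact (tailFlag_sign E).symm)
      rw [this]
    · intro a b hab ih f hf hfb
      obtain ⟨fa, hae, hap, has⟩ := hab.isFlag_left.exists_flagAt
      obtain ⟨fb, hbe, hbp, hbs⟩ := hab.isFlag_right.exists_flagAt
      have hT : (frame hΓ fb.1).T fb.2 = (frame hΓ fa.1).T fa.2 := by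
        change Γ.flagCell P fb.2.edge fb.2.param fb.2.sign
          = Γ.flagCell P fa.2.edge fa.2.param fa.2.sign
        rw [hae, hap, has, hbe, hbp, hbs, hab.flagCell_left hΓ.decomp,
          hab.flagCell_right hΓ.decomp]
      have h1 := hχ fb fa hT m (by rw [hbe]; exact hm)
      rw [← ih fa hae hap, ← h1]
      -- At the end `b` of the cell there may also be the flag of the following cell. It belongs to
      -- a divalent component, since at a vertex a forward flag has parameter zero, and along a
      -- divalent component orthogonal monomials are constant.
      by_cases hσ : f.2.sign = false
      · rw [flagAt_ext hΓ (f := f) (f' := fb) (hf.trans hbe.symm) (hfb.trans hbp.symm)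
          (hσ.trans hbs.symm)]
      · obtain ⟨y, j⟩ := f
        obtain ⟨y', j'⟩ := fb
        have hy : y = y' := comp_ext hΓ (j := j) (j' := j') (hf.trans hbe.symm)
          (hfb.trans hbp.symm)
        subst hy
        match y, j, j' with
        | .inl x, j, j' =>
          exfalso
          have h2 : FlagAt.sign j = true := by simpa using hσ
          match j with
          | .inl b' => exact (lt_of_le_of_lt hab.nonneg (WithTop.coe_lt_coe.1 hab.lt)).ne hfb
          | .inr (.inl b') => exact absurd h2 (by simp [FlagAt.sign])
          | .inr (.inr b') => exact (lt_of_le_of_lt hab.nonneg (WithTop.coe_lt_coe.1 hab.lt)).ne hfb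
        | .inr z, j, j' =>
          have hz : m (Γ.dir z.1.1) = 0 := by
            have : z.1.1 = E := hf
            rw [this]; exact hm
          rw [flagChar_div hΓ χ j hz, flagChar_div hΓ χ j' hz]
  have hfl := f.2.isFlag hΓ
  exact key _ hfl.mem hfl.nonneg hfl.le f rfl rfl

end TropicalCurve

end Standard

/-! ### The standard curves are maximally degenerate with tropical curve `Γ` -/

section StandardCurve

variable {V : Type*} [AddCommGroup V] [Module ℚ V] {N : Submodule ℤ V} {P : Set (Set V)}
  {k : Type*} [Field k]

namespace TropicalCurve

variable {Γ : TropicalCurve N} [Infinite k] [N.IsLattice ℚ] (hΓ : IsSubdivided P Γ)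
  {χ : Γ.StdComp P → CharTorus k N}

theorem finite_sigma_flag (hΓ : IsSubdivided P Γ) : Finite (Σ y, Γ.FlagAt P y) := by
  have := finite_divPoint hΓ
  infer_instance

theorem nonempty_frame_J (y : Γ.StdComp P) : Nonempty (frame hΓ y).J := by
  rw [← Fintype.card_pos_iff]
  rcases card_frame hΓ y with h | h <;> omega

theorem node_of_isEdgeCell {E : Γ.Edge} {a b : ℚ} (hab : Γ.IsEdgeCell P E a b) :
    ∃ fa fb : Σ y, Γ.FlagAt P y, fa.2.edge = E ∧ fa.2.param = a ∧ fb.2.edge = E ∧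
      fb.2.param = b ∧ s(flagPoint k hΓ fa, flagPoint k hΓ fb) ∈ boundaryNodes (compMap hΓ χ) := by
  obtain ⟨fa, hae, hap, has⟩ := hab.isFlag_left.exists_flagAt
  obtain ⟨fb, hbe, hbp, hbs⟩ := hab.isFlag_right.exists_flagAt
  refine ⟨fa, fb, hae, hap, hbe, hbp, (mem_boundaryNodes_compMap hΓ).2
    ⟨fa, fb, rfl, rfl, ?_, ?_⟩⟩
  · rintro rfl
    rw [has] at hbs
    simp at hbs
  · change Γ.flagCell P fa.2.edge fa.2.param fa.2.sign
      = Γ.flagCell P fb.2.edge fb.2.param fb.2.sign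
    rw [hae, hap, has, hbe, hbp, hbs, hab.flagCell_left hΓ.decomp, hab.flagCell_right hΓ.decomp]

/-- Each edge of `Γ` is a chain of cells whose common ends give nodes, so every component is
connected to the tail of its edge. The rest follows from connectedness of `Γ`. -/
theorem connected_compMap (y y' : Γ.StdComp P) :
    Relation.EqvGen (fun a b => ∃ p q, s((a, p), (b, q)) ∈ boundaryNodes (compMap hΓ χ)) y y' := by
  set r : Γ.StdComp P → Γ.StdComp P → Prop :=
    fun a b => ∃ p q, s((a, p), (b, q)) ∈ boundaryNodes (compMap hΓ χ) with hr
  have hedge : ∀ (E : Γ.Edge) (s : ℚ), {Γ.edgePoint E s} ∈ P → 0 ≤ s → s ≤ Γ.edgeLen E →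
      ∀ f : Σ y, Γ.FlagAt P y, f.2.edge = E → f.2.param = s →
        Relation.EqvGen r (.inl (Γ.tail E)) f.1 := by
    intro E s hs hs0 hsl
    refine edge_induction hΓ E (Q := fun s => ∀ f : Σ y, Γ.FlagAt P y, f.2.edge = E →
      f.2.param = s → Relation.EqvGen r (.inl (Γ.tail E)) f.1) ?_ ?_ hs hs0 hsl
    · intro f hf hfs
      have : Sum.inl (Γ.tail E) = f.1 := comp_ext hΓ (j := tailFlag P E) (j' := f.2)
        (by rw [hf, tailFlag_edge]) (by rw [hfs, tailFlag_param])
      rw [← this]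
      exact Relation.EqvGen.refl _
    · intro a b hab ih f hf hfb
      obtain ⟨fa, fb, hae, hap, hbe, hbp, hnode⟩ := node_of_isEdgeCell (k := k) (χ := χ) hΓ hab
      have hfb' : fb.1 = f.1 := comp_ext hΓ (j := fb.2) (j' := f.2) (hbe.trans hf.symm)
        (hbp.trans hfb.symm)
      rw [← hfb']
      exact (ih fa hae hap).trans _ _ _ (Relation.EqvGen.rel _ _ ⟨_, _, hnode⟩)
  have hflag : ∀ f : Σ y, Γ.FlagAt P y,
      Relation.EqvGen r (.inl (Γ.tail f.2.edge)) f.1 := fun f =>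
    hedge _ _ (f.2.isFlag hΓ).mem (f.2.isFlag hΓ).nonneg (f.2.isFlag hΓ).le f rfl rfl
  have hvert : ∀ x x' : Γ.Vert, Relation.EqvGen r (.inl x) (.inl x') := by
    intro x x'
    have h := Γ.connected x x'
    induction h with
    | rel a c h =>
      obtain ⟨b, rfl, rfl⟩ := h
      exact hflag ⟨_, headFlag P b⟩
    | refl a => exact Relation.EqvGen.refl _
    | symm a b _ ih => exact ih.symm _ _
    | trans a b c _ _ ih ih' => exact ih.trans _ _ _ ih'
  have hany : ∀ y : Γ.StdComp P, ∃ x, Relation.EqvGen r (.inl x) y := by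
    intro y
    obtain ⟨j⟩ := nonempty_frame_J hΓ y
    exact ⟨_, hflag ⟨y, j⟩⟩
  obtain ⟨x, hx⟩ := hany y
  obtain ⟨z, hz⟩ := hany y'
  exact (hx.symm _ _).trans _ _ _ ((hvert x z).trans _ _ _ hz)

/-- The curve in the central fiber with components `compMap hΓ χ`. -/
def stdCurve (hχ : IsGlued hΓ χ) : StableMap k (extLattice N) (fanOver P) where
  Comp := Γ.StdComp P
  finite_comp := by
    have := finite_divPoint hΓ
    infer_instance
  nodes := boundaryNodes (compMap hΓ χ)
  finite_nodes := by
    have := finite_sigma_flag hΓ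
    refine (Set.finite_range fun z : (Σ y, Γ.FlagAt P y) × (Σ y, Γ.FlagAt P y) =>
      s(flagPoint k hΓ z.1, flagPoint k hΓ z.2)).subset ?_
    intro s
    refine Sym2.ind (fun x y h => ?_) s
    obtain ⟨f, f', rfl, rfl, -⟩ := (mem_boundaryNodes_compMap hΓ).1 h
    exact ⟨(f, f'), rfl⟩
  not_diag s := by
    refine Sym2.ind (fun x y h => ?_) s
    rw [Sym2.mk_isDiag_iff]
    exact (mem_boundaryNodes.1 h).1
  disjoint s hs t ht x hxs hxt := by
    obtain ⟨y, rfl⟩ := Sym2.mem_iff_exists.1 hxs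
    obtain ⟨y', rfl⟩ := Sym2.mem_iff_exists.1 hxt
    obtain ⟨f, f', rfl, rfl, hne, hT⟩ := (mem_boundaryNodes_compMap hΓ).1 hs
    obtain ⟨g, g', hg, rfl, hne', hT'⟩ := (mem_boundaryNodes_compMap hΓ).1 ht
    obtain rfl := flagPoint_injective hΓ hg
    -- The flags of one cell are determined by their sign. Two flags different from a third one over
    -- the same cell therefore coincide.
    have h1 := flagCell_eq_cases hΓ hT
    have h2 := flagCell_eq_cases hΓ hT'
    have h3 := flagCell_eq_cases hΓ (hT.symm.trans hT')
    have : f' = g' := by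
      refine h3.2 ?_
      have h4 := mt h1.2 hne
      have h5 := mt h2.2 hne'
      revert h4 h5
      cases f.2.sign <;> cases f'.2.sign <;> cases g'.2.sign <;> simp
    rw [this]
  map := compMap hΓ χ
  isMorphism y := LineFrame.isMorphism_lineMap _ _ _ (frame_isBalanced hΓ y)
  glue x y h := by
    obtain ⟨f, f', rfl, rfl, hne, hT⟩ := (mem_boundaryNodes_compMap hΓ).1 h
    exact (compMap_flagPoint_eq_iff hΓ hT).2 (hχ f f' hT)
  nonempty := by
    obtain ⟨x⟩ := Γ.nonempty
    exact ⟨.inl x⟩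
  connected := connected_compMap hΓ
  stable y := by
    have := nonempty_frame_J hΓ y
    exact Or.inl (LineFrame.lineMap_nonconstant _ _ _)

theorem boundaryPoints_compMap (y : Γ.StdComp P) :
    boundaryPoints (compMap hΓ χ y) (compPos y) = Set.range (points k hΓ y).point :=
  LineFrame.boundaryPoints_lineMap _ _ _

theorem isTransverse_compMap (y : Γ.StdComp P) : IsTransverse (compMap hΓ χ y) (compPos y) :=
  LineFrame.isTransverse_lineMap _ _ _

theorem exists_generic_compMap (y : Γ.StdComp P) :
    ∃ q, (compMap hΓ χ y q).cone = coneOver {compPos y} := by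
  obtain ⟨q, hq⟩ := LineFrame.exists_forall_ne_point (points k hΓ y)
  exact ⟨q, LineFrame.lineCone_of_forall_ne _ hq⟩

theorem compPos_eq_of_forall_mem {y : Γ.StdComp P} {v : V}
    (h : ∀ q, compMap hΓ χ y q ∈ component k N P v) : v = compPos y := by
  obtain ⟨q, hq⟩ := exists_generic_compMap (χ := χ) hΓ y
  have h1 := h q
  change IsFace _ _ at h1
  rw [hq] at h1
  exact eq_of_mem_coneOver_singleton (mem_of_isFace_cone h1)

theorem ncard_boundaryPoints_compMap (y : Γ.StdComp P) :
    (boundaryPoints (compMap hΓ χ y) (compPos y)).ncard = Fintype.card (frame hΓ y).J := by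
  rw [boundaryPoints_compMap, ← Set.image_univ,
    Set.ncard_image_of_injective _ (points k hΓ y).point_injective, Set.ncard_univ,
    Nat.card_eq_fintype_card]

theorem isLine_compMap (y : Γ.StdComp P) : IsLine (compMap hΓ χ y) (compPos y) := by
  have := nonempty_frame_J hΓ y
  refine ⟨isTransverse_compMap hΓ y, LineFrame.lineMap_nonconstant _ _ _, ?_⟩
  rw [ncard_boundaryPoints_compMap]
  rcases card_frame hΓ y with h | h <;> omega

/-- The open cell of `Γ` that contains a component. -/
def openCellOf : Γ.StdComp P → Γ.Vert ⊕ Γ.Edge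
  | .inl x => .inl x
  | .inr z => .inr z.1.1

theorem openCellOf_mem_fiber (y : Γ.StdComp P) : openCellOf y ∈ Γ.fiber (compPos y) := by
  match y with
  | .inl x => exact rfl
  | .inr z => exact Γ.mem_openCell.2 ⟨_, z.2.1, z.2.2.1, rfl⟩

theorem eq_of_openCellOf_eq {y y' : Γ.StdComp P} (h : openCellOf y = openCellOf y')
    (hpos : compPos y = compPos y') : y = y' := by
  match y, y' with
  | .inl x, .inl x' => exact congrArg Sum.inl (Sum.inl_injective h)
  | .inl x, .inr z => simp [openCellOf] at h
  | .inr z, .inl x => simp [openCellOf] at h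
  | .inr ⟨(E, s), hz⟩, .inr ⟨(E', s'), hz'⟩ =>
    obtain rfl : E = E' := Sum.inr_injective h
    obtain rfl : s = s' := Γ.edgePoint_injective E hpos
    rfl

theorem exists_inr_of_compPos_eq (hΓ : IsSubdivided P Γ) {y y' : Γ.StdComp P} (hne : y ≠ y')
    (hpos : compPos y = compPos y') : ∃ z, y = .inr z := by
  match y, y' with
  | .inl x, .inl x' => exact absurd (congrArg Sum.inl (hΓ.pos_injective hpos)) hne
  | .inl x, .inr z => exact absurd hpos (hΓ.pos_ne x _ _ z.2.1 z.2.2.1)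
  | .inr z, _ => exact ⟨z, rfl⟩

theorem mem_or_of_compPos_eq (hΓ : IsSubdivided P Γ) {y y' y'' : Γ.StdComp P} (hne : y ≠ y')
    (hpos : compPos y = compPos y') (hpos' : compPos y = compPos y'') : y'' = y ∨ y'' = y' := by
  by_contra h
  push Not at h
  have h1 := openCellOf_mem_fiber y
  have h2 := openCellOf_mem_fiber y'
  have h3 := openCellOf_mem_fiber y''
  rw [← hpos] at h2
  rw [← hpos'] at h3
  have hsub : ({openCellOf y, openCellOf y', openCellOf y''} : Set (Γ.Vert ⊕ Γ.Edge))
      ⊆ Γ.fiber (compPos y) := by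
    rintro a (rfl | rfl | rfl) <;> assumption
  have h4 := (Set.encard_le_encard hsub).trans (hΓ.fiber_le _)
  have h5 : ({openCellOf y, openCellOf y', openCellOf y''} : Set (Γ.Vert ⊕ Γ.Edge)).encard = 3 := by
    rw [Set.encard_eq_three]
    exact ⟨_, _, _, fun e => hne (eq_of_openCellOf_eq e hpos),
      fun e => h.1 (eq_of_openCellOf_eq e hpos').symm,
      fun e => h.2 (eq_of_openCellOf_eq e (hpos.symm.trans hpos')).symm, rfl⟩
  rw [h5] at h4
  exact absurd h4 (by norm_num)

theorem component_set_eq (v : V) :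
    {y | ∀ q, compMap hΓ χ y q ∈ component k N P v} = {y | compPos y = v} := by
  ext y
  refine ⟨fun h => (compPos_eq_of_forall_mem hΓ h).symm, ?_⟩
  rintro rfl
  exact (isTransverse_compMap hΓ y).1

/-- Components over the same vertex of `P` correspond to different open cells of `Γ` in one fiber of
`h`. There are at most two of them, two occur only in dimension two, and then both are divalent
because vertices of `Γ` share their image with nothing else. -/
theorem line_compMap (v : V) :
    ({c | ∀ p, compMap hΓ χ c p ∈ component k N P v} = ∅) ∨
    (∃ c, {c | ∀ p, compMap hΓ χ c p ∈ component k N P v} = {c} ∧ IsLine (compMap hΓ χ c) v) ∨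
    (Module.finrank ℚ V = 2 ∧ ∃ c c', c ≠ c' ∧
      {c | ∀ p, compMap hΓ χ c p ∈ component k N P v} = {c, c'} ∧
      IsDivalentLine (compMap hΓ χ c) v ∧ IsDivalentLine (compMap hΓ χ c') v ∧
      ∀ p ∈ boundaryPoints (compMap hΓ χ c) v, ∀ p' ∈ boundaryPoints (compMap hΓ χ c') v,
        (compMap hΓ χ c p).cone ≠ (compMap hΓ χ c' p').cone) := by
  simp only [component_set_eq]
  rcases Set.eq_empty_or_nonempty {y : Γ.StdComp P | compPos y = v} with h | ⟨y, rfl⟩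
  · exact Or.inl h
  right
  by_cases hsing : ∀ y' : Γ.StdComp P, compPos y' = compPos y → y' = y
  · refine Or.inl ⟨y, ?_, isLine_compMap hΓ y⟩
    ext y'
    exact ⟨fun h => hsing y' h, fun h => by rw [Set.mem_singleton_iff.1 h]; rfl⟩
  right
  push Not at hsing
  obtain ⟨y', hpos, hne⟩ := hsing
  have hdiv : ∀ z : Γ.StdComp P, ∀ z', z ≠ z' → compPos z = compPos z' →
      IsDivalentLine (compMap hΓ χ z) (compPos z) := by
    intro z z' hzz hzp
    refine ⟨isLine_compMap hΓ z, ?_⟩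
    rw [ncard_boundaryPoints_compMap]
    obtain ⟨w, rfl⟩ := exists_inr_of_compPos_eq hΓ hzz hzp
    exact card_frame_inr hΓ w
  refine ⟨?_, y, y', hne.symm, ?_, hdiv y y' hne.symm hpos.symm, ?_, ?_⟩
  · by_contra h2
    refine hne (eq_of_openCellOf_eq ?_ hpos)
    refine hΓ.fiber_subsingleton h2 _ (openCellOf_mem_fiber y') ?_
    rw [hpos]
    exact openCellOf_mem_fiber y
  · ext z
    constructor
    · intro hz
      exact mem_or_of_compPos_eq hΓ hne.symm hpos.symm (Eq.symm hz)
    · rintro (rfl | rfl)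
      · rfl
      · exact hpos
  · have := hdiv y' y hne hpos
    rwa [hpos] at this
  · intro p hp p' hp' hcone
    rw [← hpos, boundaryPoints_compMap] at hp'
    rw [boundaryPoints_compMap] at hp
    obtain ⟨j, rfl⟩ := hp
    obtain ⟨j', rfl⟩ := hp'
    have hnode : s(flagPoint k hΓ ⟨y, j⟩, flagPoint k hΓ ⟨y', j'⟩)
        ∈ boundaryNodes (compMap hΓ χ) := by
      rw [mem_boundaryNodes]
      refine ⟨fun h => hne (congrArg Prod.fst h).symm, ?_, hcone⟩
      rw [compMap_cone_flagPoint]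
      exact T_ne_singleton hΓ _
    obtain ⟨f, f', hf, hf', hff, hT⟩ := (mem_boundaryNodes_compMap hΓ).1 hnode
    obtain rfl := flagPoint_injective hΓ hf
    obtain rfl := flagPoint_injective hΓ hf'
    exact compPos_ne_of_T_eq hΓ hT hff hpos.symm

theorem eq_compPos_of_isTransverse {y : Γ.StdComp P} {v : V}
    (h : IsTransverse (compMap hΓ χ y) v) : v = compPos y :=
  compPos_eq_of_forall_mem hΓ h.1

theorem hasIndex_compMap (f : Σ y, Γ.FlagAt P y) :
    HasIndex (compMap hΓ χ (flagPoint k hΓ f).1) (compPos f.1) (flagPoint k hΓ f).2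
      (Γ.weight f.2.edge) :=
  LineFrame.hasIndex_lineMap _ hΓ.decomp (χ f.1) (frame_isBalanced hΓ f.1) f.2

theorem isMaximallyDegenerate_stdCurve (hχ : IsGlued hΓ χ) :
    IsMaximallyDegenerate (stdCurve hΓ hχ) where
  preLog :=
    { mem_fiber := fun y q => LineFrame.lineMap_mem_centralFiber (points k hΓ y) hΓ.decomp (χ y) q
      transverse := fun y => ⟨compPos y, compPos_mem hΓ y, isTransverse_compMap hΓ y⟩
      singular := by
        rintro y q ⟨v, v', hvv, hv, hv'⟩
        change IsFace _ (compMap hΓ χ y q).cone at hv hv'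
        rcases LineFrame.point_cases (points k hΓ y) q with ⟨j, rfl⟩ | h
        swap
        · have h1 : (compMap hΓ χ y q).cone = coneOver {compPos y} :=
            LineFrame.lineCone_of_forall_ne _ h
          rw [h1] at hv hv'
          exact absurd ((eq_of_mem_coneOver_singleton (mem_of_isFace_cone hv)).trans
            (eq_of_mem_coneOver_singleton (mem_of_isFace_cone hv')).symm) hvv
        have hc : (compMap hΓ χ y ((points k hΓ y).point j)).cone
          = coneOver ((frame hΓ y).T j) := LineFrame.lineCone_point _ _
        -- One of `v` and `v'` is not the position of the component `y`. It is the other end of the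
        -- cell, and the flag there is the second branch of the node.
        obtain ⟨w, hw, hwne⟩ : ∃ w, IsFace (coneOver {w}) (coneOver ((frame hΓ y).T j)) ∧
            w ≠ compPos y := by
          by_cases h : v = compPos y
          · exact ⟨v', hc ▸ hv', fun h' => hvv (h.trans h'.symm)⟩
          · exact ⟨v, hc ▸ hv, h⟩
        have hwP := vertex_of_isFace hΓ.decomp ((frame hΓ y).T_mem j) rfl hw
        have hwT := (hΓ.decomp.polyhedron _ ((frame hΓ y).T_mem j)).mem_of_mem_coneOver
          (mem_of_isFace_cone hw)
        obtain ⟨f', hT, he, hs, hpos⟩ := exists_opposite_flag hΓ ⟨y, j⟩ hwP hwT hwne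
        refine ⟨f'.1, (flagPoint k hΓ f').2, compPos y, compPos f'.1, Γ.weight (FlagAt.edge j),
          ?_, ?_, isTransverse_compMap hΓ y, isTransverse_compMap hΓ f'.1,
          hasIndex_compMap hΓ ⟨y, j⟩, ?_⟩
        · refine (mem_boundaryNodes_compMap hΓ).2 ⟨⟨y, j⟩, f', rfl, rfl, ?_, hT.symm⟩
          rintro rfl
          exact hs rfl
        · rw [hpos]; exact hwne.symm
        · have := hasIndex_compMap (χ := χ) hΓ f'
          rw [he] at this
          exact this }
  disjoint x y h v := by
    rintro ⟨h1, h2⟩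
    obtain ⟨f, f', rfl, rfl, hne, hT⟩ := (mem_boundaryNodes_compMap hΓ).1 h
    exact compPos_ne_of_T_eq hΓ hT hne
      ((eq_compPos_of_isTransverse hΓ h1).symm.trans (eq_compPos_of_isTransverse hΓ h2))
  line v _ := line_compMap hΓ v

open Classical in
/-- The edge of `Γ` containing the edge of the dual graph given by a boundary point. -/
def edgeOfPoint (y : Γ.StdComp P) (q : P1 k) : Γ.Edge :=
  -- Away from the boundary points the value is arbitrary.
  if h : ∃ j, q = (points k hΓ y).point j then FlagAt.edge h.choose
  else FlagAt.edge (nonempty_frame_J hΓ y).some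

theorem edgeOfPoint_flagPoint (f : Σ y, Γ.FlagAt P y) :
    edgeOfPoint hΓ (flagPoint k hΓ f).1 (flagPoint k hΓ f).2 = f.2.edge := by
  have h : ∃ j, (flagPoint k hΓ f).2 = (points k hΓ (flagPoint k hΓ f).1).point j := ⟨f.2, rfl⟩
  rw [edgeOfPoint, dif_pos h]
  exact congrArg FlagAt.edge ((points k hΓ f.1).point_injective h.choose_spec).symm

theorem FlagAt.incident {x : Γ.Vert} (j : Γ.FlagAt P (.inl x)) : Γ.Incident x j.edge := by
  match j with
  | .inl b => exact Or.inl b.2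
  | .inr (.inl b) => exact Or.inr b.2
  | .inr (.inr e) => exact e.2

theorem exists_flagAt_of_incident {x : Γ.Vert} {E : Γ.Edge} (h : Γ.Incident x E) :
    ∃ j : Γ.FlagAt P (.inl x), j.edge = E := by
  match E, h with
  | .inl b, .inl h => exact ⟨.inl ⟨b, h⟩, rfl⟩
  | .inl b, .inr h => exact ⟨.inr (.inl ⟨b, h⟩), rfl⟩
  | .inr e, h => exact ⟨.inr (.inr ⟨e, h⟩), rfl⟩

/-- An edge is embedded, so it does not return to the same vertex, and its two ends are never flags
at one vertex. -/
theorem FlagAt.edge_injective {x : Γ.Vert} :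
    Function.Injective (FlagAt.edge : Γ.FlagAt P (.inl x) → Γ.Edge) := by
  intro j j' h
  have hp : j.param = j'.param := by
    refine Γ.edgePoint_injective j.edge ?_
    rw [j.edgePoint_eq, h, j'.edgePoint_eq]
  match j, j' with
  | .inl b, .inl b' => exact FlagAt.ext h rfl
  | .inl b, .inr (.inl b') => exact absurd hp (Γ.blen_pos _).ne
  | .inl b, .inr (.inr b') => simp [edge] at h
  | .inr (.inl b), .inl b' => exact absurd hp (Γ.blen_pos _).ne'
  | .inr (.inl b), .inr (.inl b') => exact FlagAt.ext h rfl
  | .inr (.inl b), .inr (.inr b') => simp [edge] at h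
  | .inr (.inr b), .inl b' => simp [edge] at h
  | .inr (.inr b), .inr (.inl b') => simp [edge] at h
  | .inr (.inr b), .inr (.inr b') => exact FlagAt.ext h rfl

theorem cell_compMap_flagPoint (f : Σ y, Γ.FlagAt P y) :
    cell (compMap hΓ χ (flagPoint k hΓ f).1 (flagPoint k hΓ f).2) = (frame hΓ f.1).T f.2 := by
  ext x
  change (x, (1 : ℚ)) ∈ (compMap hΓ χ (flagPoint k hΓ f).1 (flagPoint k hΓ f).2).cone ↔ _
  rw [compMap_cone_flagPoint]
  exact ⟨fun h => (hΓ.decomp.polyhedron _ (LineFrame.T_mem _ _)).mem_of_mem_coneOver h,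
    fun h => mem_coneOver h⟩

theorem exists_flag_of_mem_edgeImage {E : Γ.Edge} {x : V} (hx : x ∈ Γ.edgeImage E) :
    ∃ f : Σ y, Γ.FlagAt P y, f.2.edge = E ∧ x ∈ (frame hΓ f.1).T f.2 := by
  obtain ⟨t, h0, h1, rfl⟩ := Γ.mem_edgeImage.1 hx
  obtain ⟨a, b, hab, ha, hb⟩ : ∃ (a : ℚ) (b : WithTop ℚ), Γ.IsEdgeCell P E a b ∧ a ≤ t ∧ t ≤ b := by
    rcases h1.eq_or_lt with h | h
    · have hpos : 0 < t := by
        have := Γ.edgeLen_pos E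
        rw [← h] at this
        exact WithTop.coe_lt_coe.1 this
      obtain ⟨a, b, hab, h2, h3⟩ := exists_isEdgeCell_backward hΓ.decomp hΓ.adapted hpos h1
      exact ⟨a, b, hab, h2.le, h3⟩
    · obtain ⟨a, b, hab, h2, h3⟩ := exists_isEdgeCell_forward hΓ.decomp hΓ.adapted h0 h
      exact ⟨a, b, hab, h2, h3.le⟩
  obtain ⟨f, he, hp, hs⟩ := hab.isFlag_left.exists_flagAt
  refine ⟨f, he, ?_⟩
  change _ ∈ Γ.flagCell P f.2.edge f.2.param f.2.sign
  rw [he, hp, hs, hab.flagCell_left hΓ.decomp, Γ.mem_edgeInterval]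
  exact ⟨ha, hb⟩

theorem hasTropicalCurve_stdCurve (hχ : IsGlued hΓ χ) : HasTropicalCurve (stdCurve hΓ hχ) Γ := by
  refine ⟨compPos, Sum.inl, edgeOfPoint hΓ, ?_, Sum.inl_injective, fun x => rfl, ?_, ?_, ?_, ?_, ?_⟩
  · exact fun y => ⟨compPos_mem hΓ y, isTransverse_compMap hΓ y⟩
  · intro x y h
    obtain ⟨f, f', rfl, rfl, -, hT⟩ := (mem_boundaryNodes_compMap hΓ).1 h
    exact (edgeOfPoint_flagPoint hΓ f).trans
      ((flagCell_eq_cases hΓ hT).1.trans (edgeOfPoint_flagPoint hΓ f').symm)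
  · intro y p hp
    obtain ⟨j, rfl⟩ := (boundaryPoints_compMap (χ := χ) hΓ y).subset hp
    have := edgeOfPoint_flagPoint (k := k) hΓ ⟨y, j⟩
    change edgeOfPoint hΓ y ((points k hΓ y).point j) = _ at this
    rw [this]
    exact hasIndex_compMap hΓ ⟨y, j⟩
  · intro x
    change Set.BijOn _ (boundaryPoints (compMap hΓ χ (.inl x)) (compPos (.inl x))) _
    rw [boundaryPoints_compMap]
    have hval : ∀ j : Γ.FlagAt P (.inl x),
        edgeOfPoint hΓ (.inl x) ((points k hΓ (.inl x)).point j) = j.edge :=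
      fun j => edgeOfPoint_flagPoint (k := k) hΓ ⟨.inl x, j⟩
    refine ⟨?_, ?_, ?_⟩
    · rintro _ ⟨j, rfl⟩
      exact (hval j).symm ▸ FlagAt.incident j
    · rintro _ ⟨j, rfl⟩ _ ⟨j', rfl⟩ h
      exact congrArg (points k hΓ (.inl x)).point
        (FlagAt.edge_injective ((hval j).symm.trans (h.trans (hval j'))))
    · intro E hE
      obtain ⟨j, hj⟩ := exists_flagAt_of_incident (P := P) hE
      exact ⟨_, ⟨j, rfl⟩, (hval j).trans hj⟩
  · intro y hy
    match y with
    | .inl x => exact absurd ⟨x, rfl⟩ hy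
    | .inr z =>
      refine ⟨(ncard_boundaryPoints_compMap hΓ _).trans (card_frame_inr hΓ z), ?_⟩
      change ∀ p ∈ boundaryPoints (compMap hΓ χ (.inr z)) (compPos (.inr z)),
        ∀ p' ∈ boundaryPoints (compMap hΓ χ (.inr z)) (compPos (.inr z)), _
      rw [boundaryPoints_compMap]
      rintro _ ⟨j, rfl⟩ _ ⟨j', rfl⟩
      exact (edgeOfPoint_flagPoint (k := k) hΓ ⟨.inr z, j⟩).trans
        (edgeOfPoint_flagPoint (k := k) hΓ ⟨.inr z, j'⟩).symm
  · intro E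
    ext x
    constructor
    · intro hx
      obtain ⟨f, he, hT⟩ := exists_flag_of_mem_edgeImage hΓ hx
      refine ⟨f.1, (flagPoint k hΓ f).2, ?_, (edgeOfPoint_flagPoint hΓ f).trans he, ?_⟩
      · change _ ∈ boundaryPoints (compMap hΓ χ f.1) _
        rw [boundaryPoints_compMap]
        exact ⟨f.2, rfl⟩
      · have := cell_compMap_flagPoint (χ := χ) hΓ f
        rw [← this] at hT
        exact hT
    · rintro ⟨y, p, hp, rfl, hx⟩
      obtain ⟨j, rfl⟩ := (boundaryPoints_compMap (χ := χ) hΓ y).subset hp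
      have h1 : x ∈ (frame hΓ y).T j := by
        rw [← cell_compMap_flagPoint (χ := χ) hΓ ⟨y, j⟩]
        exact hx
      have h2 := edgeOfPoint_flagPoint (k := k) hΓ ⟨y, j⟩
      change edgeOfPoint hΓ y ((points k hΓ y).point j) = _ at h2
      rw [h2]
      exact (FlagAt.isFlag hΓ j).flagCell_subset_edgeImage hΓ h1

end TropicalCurve

end StandardCurve

/-! ### Components of an arbitrary curve with tropical curve `Γ` -/

section Structure

variable {V : Type*} [AddCommGroup V] [Module ℚ V] {N : Submodule ℤ V} {P : Set (Set V)}
  {k : Type*} [Field k]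

theorem exists_notMem_of_finite [Infinite k] {B : Set (P1 k)} (hB : B.Finite) : ∃ q, q ∉ B := by
  by_contra h
  push Not at h
  have hc : cross (k := k) ![1, 0] ![0, 1] ≠ 0 := by simp [cross]
  exact Set.infinite_univ ((finite_line_preimage hc hB).subset fun t _ => h _)

/-- The data exhibiting `Γ` as the tropical curve associated to `C`. -/
structure TropicalMarking (C : StableMap k (extLattice N) (fanOver P)) (Γ : TropicalCurve N) where
  pos : C.Comp → V
  vert : Γ.Vert → C.Comp
  edge : C.Comp → P1 k → Γ.Edge
  pos_mem : ∀ c, {pos c} ∈ P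
  transverse : ∀ c, IsTransverse (C.map c) (pos c)
  vert_injective : Function.Injective vert
  pos_vert : ∀ x, pos (vert x) = Γ.pos x
  edge_node : ∀ x y, s(x, y) ∈ C.nodes → edge x.1 x.2 = edge y.1 y.2
  hasIndex : ∀ c, ∀ p ∈ boundaryPoints (C.map c) (pos c),
    HasIndex (C.map c) (pos c) p (Γ.weight (edge c p))
  bijOn : ∀ x, Set.BijOn (edge (vert x)) (boundaryPoints (C.map (vert x)) (pos (vert x)))
    {E | Γ.Incident x E}
  divalent : ∀ c, c ∉ Set.range vert → (boundaryPoints (C.map c) (pos c)).ncard = 2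
  edge_const : ∀ c, c ∉ Set.range vert → ∀ p ∈ boundaryPoints (C.map c) (pos c),
    ∀ p' ∈ boundaryPoints (C.map c) (pos c), edge c p = edge c p'
  image : ∀ E, Γ.edgeImage E =
      {x | ∃ c, ∃ p ∈ boundaryPoints (C.map c) (pos c), edge c p = E ∧ x ∈ cell (C.map c p)}

theorem HasTropicalCurve.nonempty_marking {C : StableMap k (extLattice N) (fanOver P)}
    {Γ : TropicalCurve N} (h : HasTropicalCurve C Γ) : Nonempty (TropicalMarking C Γ) := by
  obtain ⟨pos', ι, ε, h1, h2, h3, h4, h5, h6, h7, h8⟩ := h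
  exact ⟨⟨pos', ι, ε, fun c => (h1 c).1, fun c => (h1 c).2, h2, h3, h4, h5, h6,
    fun c hc => (h7 c hc).1, fun c hc => (h7 c hc).2, h8⟩⟩

namespace TropicalMarking

open TropicalCurve

variable {Γ : TropicalCurve N} {C : StableMap k (extLattice N) (fanOver P)}
  (D : TropicalMarking C Γ) [Infinite k] [N.IsLattice ℚ] (hΓ : IsSubdivided P Γ)

abbrev bdry (c : C.Comp) : Set (P1 k) := boundaryPoints (C.map c) (D.pos c)

theorem finite_bdry (c : C.Comp) : (D.bdry c).Finite := (D.transverse c).2.1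

theorem cone_of_notMem_bdry {c : C.Comp} {q : P1 k} (hq : q ∉ D.bdry c) :
    (C.map c q).cone = coneOver {D.pos c} := by
  by_contra h
  exact hq h

theorem eq_pos_of_forall_mem {c : C.Comp} {v : V} (h : ∀ q, C.map c q ∈ component k N P v) :
    v = D.pos c := by
  obtain ⟨q, hq⟩ := exists_notMem_of_finite (D.finite_bdry c)
  have h1 := h q
  change IsFace _ _ at h1
  rw [D.cone_of_notMem_bdry hq] at h1
  exact eq_of_mem_coneOver_singleton (mem_of_isFace_cone h1)

theorem mem_cone (c : C.Comp) (q : P1 k) : (D.pos c, (1 : ℚ)) ∈ (C.map c q).cone :=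
  mem_of_isFace_cone ((D.transverse c).1 q)

/-- The cell of the boundary point is contained in the image of its edge and has more than one
point, so it is a cell of the subdivided edge. The position of the component is a vertex of `P` in
this cell, hence one of its ends. -/
theorem exists_flag {c : C.Comp} {p : P1 k} (hp : p ∈ D.bdry c) :
    ∃ f : Σ y, Γ.FlagAt P y, f.2.edge = D.edge c p ∧ compPos f.1 = D.pos c ∧
      (C.map c p).cone = coneOver ((frame hΓ f.1).T f.2) := by
  obtain ⟨T, hT, hvT, hcone⟩ := hΓ.decomp.exists_cell (C.map c p).cone_mem (D.mem_cone c p)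
  set E := D.edge c p with hE
  have hsub : T ⊆ Γ.edgeImage E := by
    intro x hx
    rw [D.image]
    refine ⟨c, p, hp, rfl, ?_⟩
    change (x, (1 : ℚ)) ∈ (C.map c p).cone
    rw [hcone]
    exact mem_coneOver hx
  obtain ⟨y, hy, hyne⟩ : ∃ y ∈ T, y ≠ D.pos c := by
    by_contra h
    push Not at h
    have : T = {D.pos c} := Set.eq_singleton_iff_unique_mem.2 ⟨hvT, h⟩
    exact hp (by rw [this] at hcone; exact hcone)
  obtain ⟨s, hs0, hsl, hs⟩ := Γ.mem_edgeImage.1 (hsub hvT)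
  obtain ⟨t, ht0, htl, ht⟩ := Γ.mem_edgeImage.1 (hsub hy)
  have hst : s ≠ t := fun h => hyne (by rw [hs, ht, h])
  have hline : ∀ x ∈ T, ∃ t : ℚ, x = Γ.edgePoint E t := fun x hx => by
    obtain ⟨t, -, -, h⟩ := Γ.mem_edgeImage.1 (hsub hx)
    exact ⟨t, h⟩
  obtain ⟨a, b, hab, hTab⟩ : ∃ (a : ℚ) (b : WithTop ℚ), Γ.IsEdgeCell P E a b ∧
      T = Γ.edgeInterval E a b := by
    rcases lt_or_gt_of_ne hst with h | h
    · obtain ⟨a, b, hab, h1, -⟩ := exists_isEdgeCell_of_subset hΓ.decomp hΓ.adapted hT hline hs0 h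
        htl (hs ▸ hvT) (ht ▸ hy)
      exact ⟨a, b, hab, h1⟩
    · obtain ⟨a, b, hab, h1, -⟩ := exists_isEdgeCell_of_subset hΓ.decomp hΓ.adapted hT hline ht0 h
        hsl (ht ▸ hy) (hs ▸ hvT)
      exact ⟨a, b, hab, h1⟩
  have hsab : a ≤ s ∧ s ≤ b := by
    rw [← Γ.mem_edgeInterval (E := E), ← hTab, ← hs]; exact hvT
  have hends : s = a ∨ (s : WithTop ℚ) = b := by
    by_contra h
    push Not at h
    exact hab.not_between hΓ.decomp (lt_of_le_of_ne hsab.1 (Ne.symm h.1))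
      (lt_of_le_of_ne hsab.2 h.2) (hs ▸ D.pos_mem c)
  rcases hends with rfl | rfl
  · obtain ⟨f, he, hpp, hss⟩ := hab.isFlag_left.exists_flagAt
    refine ⟨f, he, ?_, ?_⟩
    · rw [← f.2.edgePoint_eq, he, hpp, hs]
    · change _ = coneOver (Γ.flagCell P f.2.edge f.2.param f.2.sign)
      rw [he, hpp, hss, hab.flagCell_left hΓ.decomp, ← hTab, hcone]
  · obtain ⟨f, he, hpp, hss⟩ := hab.isFlag_right.exists_flagAt
    refine ⟨f, he, ?_, ?_⟩
    · rw [← f.2.edgePoint_eq, he, hpp, hs]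
    · change _ = coneOver (Γ.flagCell P f.2.edge f.2.param f.2.sign)
      rw [he, hpp, hss, hab.flagCell_right hΓ.decomp, ← hTab, hcone]

/-- The flag of `Γ` given by a boundary point. -/
def flag {c : C.Comp} {p : P1 k} (hp : p ∈ D.bdry c) : Σ y, Γ.FlagAt P y :=
  (D.exists_flag hΓ hp).choose

theorem flag_edge {c : C.Comp} {p : P1 k} (hp : p ∈ D.bdry c) :
    (D.flag hΓ hp).2.edge = D.edge c p := (D.exists_flag hΓ hp).choose_spec.1

theorem compPos_flag {c : C.Comp} {p : P1 k} (hp : p ∈ D.bdry c) :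
    compPos (D.flag hΓ hp).1 = D.pos c := (D.exists_flag hΓ hp).choose_spec.2.1

theorem cone_eq {c : C.Comp} {p : P1 k} (hp : p ∈ D.bdry c) :
    (C.map c p).cone = coneOver ((frame hΓ (D.flag hΓ hp).1).T (D.flag hΓ hp).2) :=
  (D.exists_flag hΓ hp).choose_spec.2.2

theorem coneOver_T_inj {f f' : Σ y, Γ.FlagAt P y}
    (h : coneOver ((frame hΓ f.1).T f.2) = coneOver ((frame hΓ f'.1).T f'.2)) :
    (frame hΓ f.1).T f.2 = (frame hΓ f'.1).T f'.2 :=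
  (hΓ.decomp.polyhedron _ (LineFrame.T_mem _ _)).coneOver_inj
    (hΓ.decomp.polyhedron _ (LineFrame.T_mem _ _)) h

theorem ncard_bdry_vert (hΓ : IsSubdivided P Γ) (x : Γ.Vert) : (D.bdry (D.vert x)).ncard = 3 := by
  rw [← card_frame_inl hΓ x, ← Nat.card_eq_fintype_card]
  have h1 := (D.bijOn x).image_eq
  rw [← (D.bijOn x).injOn.ncard_image, h1]
  have h2 : {E | Γ.Incident x E}
      = Set.range (FlagAt.edge : Γ.FlagAt P (.inl x) → Γ.Edge) := by
    ext E
    exact ⟨fun h => exists_flagAt_of_incident h, by rintro ⟨j, rfl⟩; exact j.incident⟩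
  rw [h2, ← Set.image_univ, Set.ncard_image_of_injective _ FlagAt.edge_injective, Set.ncard_univ]
  rfl

theorem nonempty_bdry (hΓ : IsSubdivided P Γ) (c : C.Comp) : (D.bdry c).Nonempty := by
  by_cases hc : c ∈ Set.range D.vert
  · obtain ⟨x, rfl⟩ := hc
    exact Set.nonempty_of_ncard_ne_zero (by rw [D.ncard_bdry_vert hΓ x]; norm_num)
  · exact Set.nonempty_of_ncard_ne_zero (by rw [D.divalent c hc]; norm_num)

theorem flag_vert {x : Γ.Vert} {p : P1 k} (hp : p ∈ D.bdry (D.vert x)) :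
    (D.flag hΓ hp).1 = .inl x := by
  by_contra hne
  obtain ⟨z, hz⟩ := exists_inr_of_compPos_eq hΓ (Ne.symm hne)
    ((D.pos_vert x).symm.trans (D.compPos_flag hΓ hp).symm)
  simp at hz

theorem flag_comp_eq {c : C.Comp} {p p' : P1 k} (hp : p ∈ D.bdry c) (hp' : p' ∈ D.bdry c) :
    (D.flag hΓ hp).1 = (D.flag hΓ hp').1 := by
  by_cases hc : c ∈ Set.range D.vert
  · obtain ⟨x, rfl⟩ := hc
    rw [D.flag_vert hΓ hp, D.flag_vert hΓ hp']
  · have he : (D.flag hΓ hp).2.edge = (D.flag hΓ hp').2.edge := by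
      rw [D.flag_edge, D.flag_edge]
      exact D.edge_const c hc p hp p' hp'
    refine comp_ext hΓ (j := (D.flag hΓ hp).2) (j' := (D.flag hΓ hp').2) he ?_
    refine Γ.edgePoint_injective (D.flag hΓ hp).2.edge ?_
    rw [FlagAt.edgePoint_eq, he, FlagAt.edgePoint_eq, D.compPos_flag, D.compPos_flag]

/-- The standard component corresponding to a component. -/
def comp (c : C.Comp) : Γ.StdComp P := (D.flag hΓ (D.nonempty_bdry hΓ c).some_mem).1

theorem flag_comp {c : C.Comp} {p : P1 k} (hp : p ∈ D.bdry c) :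
    (D.flag hΓ hp).1 = D.comp hΓ c := D.flag_comp_eq hΓ hp _

theorem compPos_comp (c : C.Comp) : compPos (D.comp hΓ c) = D.pos c := D.compPos_flag hΓ _

theorem comp_vert (x : Γ.Vert) : D.comp hΓ (D.vert x) = .inl x := D.flag_vert hΓ _

theorem divalent_of_ne (hC : IsMaximallyDegenerate C) {c c' : C.Comp} (hne : c ≠ c') (hpos : D.pos c = D.pos c') :
    (D.bdry c).ncard = 2 ∧ ∀ p ∈ D.bdry c, ∀ p' ∈ D.bdry c',
      (C.map c p).cone ≠ (C.map c' p').cone := by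
  have hmem : c ∈ {a | ∀ p, C.map a p ∈ component k N P (D.pos c)} := (D.transverse c).1
  have hmem' : c' ∈ {a | ∀ p, C.map a p ∈ component k N P (D.pos c)} := by
    rw [hpos]; exact (D.transverse c').1
  rcases hC.line (D.pos c) (D.pos_mem c) with h | ⟨a, h, -⟩ | ⟨-, a, a', haa, h, h1, h2, h3⟩
  · rw [h] at hmem
    exact absurd hmem (Set.notMem_empty _)
  · rw [h] at hmem hmem'
    exact absurd (hmem.trans hmem'.symm) hne
  · rw [h] at hmem hmem'
    rcases hmem with rfl | rfl <;> rcases hmem' with rfl | rfl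
    · exact absurd rfl hne
    · refine ⟨h1.2, fun p hp p' hp' => h3 p hp p' ?_⟩
      rw [bdry, ← hpos] at hp'
      exact hp'
    · refine ⟨h2.2, fun p hp p' hp' => (h3 p' ?_ p hp).symm⟩
      rw [bdry, ← hpos] at hp'
      exact hp'
    · exact absurd rfl hne

/-- Two components over the same vertex of `P` are divalent, whereas the component of a vertex of
`Γ` has three boundary points. -/
theorem eq_vert_of_pos_eq (hΓ : IsSubdivided P Γ) (hC : IsMaximallyDegenerate C) {c : C.Comp} {x : Γ.Vert} (h : D.pos c = Γ.pos x) : c = D.vert x := by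
  by_contra hne
  have := (D.divalent_of_ne hC (Ne.symm hne) ((D.pos_vert x).trans h.symm)).1
  rw [D.ncard_bdry_vert hΓ x] at this
  omega

theorem comp_eq_inl (hC : IsMaximallyDegenerate C) {c : C.Comp} {x : Γ.Vert} (h : D.comp hΓ c = .inl x) : c = D.vert x := by
  refine D.eq_vert_of_pos_eq hΓ hC ?_
  rw [← D.compPos_comp hΓ c, h]
  rfl

/-- The flag of a boundary point as a flag at the corresponding standard component. -/
def flagAt {c : C.Comp} {p : P1 k} (hp : p ∈ D.bdry c) : Γ.FlagAt P (D.comp hΓ c) :=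
  D.flag_comp hΓ hp ▸ (D.flag hΓ hp).2

theorem sigma_flagAt {c : C.Comp} {p : P1 k} (hp : p ∈ D.bdry c) :
    (⟨D.comp hΓ c, D.flagAt hΓ hp⟩ : Σ y, Γ.FlagAt P y) = D.flag hΓ hp := by
  refine Sigma.ext (D.flag_comp hΓ hp).symm ?_
  rw [flagAt]
  exact eqRec_heq _ _

theorem flagAt_edge {c : C.Comp} {p : P1 k} (hp : p ∈ D.bdry c) :
    (D.flagAt hΓ hp).edge = D.edge c p := by
  have := D.flag_edge hΓ hp
  rw [← D.sigma_flagAt hΓ hp] at this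
  exact this

theorem cone_flagAt {c : C.Comp} {p : P1 k} (hp : p ∈ D.bdry c) :
    (C.map c p).cone = coneOver ((frame hΓ (D.comp hΓ c)).T (D.flagAt hΓ hp)) := by
  have := D.cone_eq hΓ hp
  rw [← D.sigma_flagAt hΓ hp] at this
  exact this

/-- Vectors representing points are pairwise independent. -/
theorem cross_rep_ne {p q : P1 k} (h : p ≠ q) : cross p.rep q.rep ≠ 0 :=
  mt cross_rep_eq_zero_iff.1 h

variable [IsAlgClosed k]

/-- The definition of the associated tropical curve does not state that the two boundary points of a
divalent component lie in opposite directions. Otherwise both would contribute the same vector `w •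
u`, and balancing would give `2 * w = 0`. -/
theorem sign_ne {c : C.Comp} (hc : c ∉ Set.range D.vert) {p p' : P1 k} (hp : p ∈ D.bdry c)
    (hp' : p' ∈ D.bdry c) (hne : p ≠ p') : (D.flagAt hΓ hp).sign ≠ (D.flagAt hΓ hp').sign := by
  intro hsign
  set E := D.edge c p with hE
  have hE' : D.edge c p' = E := D.edge_const c hc p' hp' p hp
  have hflag : D.flagAt hΓ hp = D.flagAt hΓ hp' := by
    refine FlagAt.ext ?_ hsign
    rw [flagAt_edge, flagAt_edge, hE']
  set j : (frame hΓ (D.comp hΓ c)).J := D.flagAt hΓ hp with hj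
  -- A frame with the same cell listed twice; the cells of a frame need not be distinct.
  let F : LineFrame N P :=
    { v := (frame hΓ (D.comp hΓ c)).v
      v_mem := (frame hΓ (D.comp hΓ c)).v_mem
      J := Bool
      w := fun _ => (frame hΓ (D.comp hΓ c)).w j
      w_pos := fun _ => (frame hΓ (D.comp hΓ c)).w_pos j
      u := fun _ => (frame hΓ (D.comp hΓ c)).u j
      u_primitive := fun _ => (frame hΓ (D.comp hΓ c)).u_primitive j
      T := fun _ => (frame hΓ (D.comp hΓ c)).T j
      T_mem := fun _ => (frame hΓ (D.comp hΓ c)).T_mem j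
      T_subset := fun _ => (frame hΓ (D.comp hΓ c)).T_subset j
      v_mem_T := fun _ => (frame hΓ (D.comp hΓ c)).v_mem_T j
      exists_mem_T := fun _ => (frame hΓ (D.comp hΓ c)).exists_mem_T j }
  let pts : F.Points k :=
    { pt := fun b => if b = true then p.rep else p'.rep
      ne_zero := fun b => by
        cases b
        · exact p'.rep_nonzero
        · exact p.rep_nonzero
      cross_ne := fun a b hab => by
        cases a <;> cases b
        · exact absurd rfl hab
        · exact cross_rep_ne (Ne.symm hne)
        · exact cross_rep_ne hne
        · exact absurd rfl hab }
  have hpt : pts.point true = p := p.mk_rep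
  have hpf : pts.point false = p' := p'.mk_rep
  have hFv : (F.v : V) = D.pos c := D.compPos_comp hΓ c
  have hw : F.w true = Γ.weight E := by
    change Γ.weight (D.flagAt hΓ hp).edge = _
    rw [flagAt_edge]
  have hbd : D.bdry c = {p, p'} := by
    refine (Set.eq_of_subset_of_ncard_le ?_ ?_ (D.finite_bdry c)).symm
    · rintro q (rfl | rfl) <;> assumption
    · rw [D.divalent c hc, Set.ncard_pair hne]
  have htype : LineFrame.IsOfType pts (C.map c) := by
    refine LineFrame.isOfType_of_hasIndex (C.isMorphism c) ?_ ?_ ?_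
    · rw [hFv]
      change D.bdry c = _
      rw [hbd]
      ext q
      constructor
      · rintro (rfl | rfl)
        · exact ⟨true, hpt⟩
        · exact ⟨false, hpf⟩
      · rintro ⟨b, rfl⟩
        cases b
        · exact Or.inr hpf
        · exact Or.inl hpt
    · intro b
      cases b
      · rw [hpf, D.cone_flagAt hΓ hp', ← hflag]
      · rw [hpt, D.cone_flagAt hΓ hp]
    · intro b
      have hwb : F.w b = Γ.weight E := hw
      rw [hFv, hwb]
      cases b
      · rw [hpf]
        have := D.hasIndex c p' hp'
        rwa [hE'] at this
      · rw [hpt]; exact D.hasIndex c p hp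
  have hbal := htype.isBalanced hΓ.decomp
  change ∑ b : Bool, F.w true • F.u true = 0 at hbal
  rw [Fintype.sum_bool, ← two_smul ℕ, smul_smul] at hbal
  have hw0 := F.w_pos true
  obtain ⟨m, hm⟩ := (F.u_primitive true).exists_dual_eq_one
  have h0 := congrArg m hbal
  rw [map_nsmul, hm, map_zero, nsmul_eq_mul, mul_one] at h0
  have h1 : 2 * F.w true = 0 := by exact_mod_cast h0
  omega

theorem flagAt_injective {c : C.Comp} {p p' : P1 k} (hp : p ∈ D.bdry c) (hp' : p' ∈ D.bdry c)
    (h : D.flagAt hΓ hp = D.flagAt hΓ hp') : p = p' := by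
  by_cases hc : c ∈ Set.range D.vert
  · obtain ⟨x, rfl⟩ := hc
    refine (D.bijOn x).injOn hp hp' ?_
    rw [← D.flagAt_edge hΓ hp, ← D.flagAt_edge hΓ hp', h]
  · by_contra hne
    exact D.sign_ne hΓ hc hp hp' hne (by rw [h])

/-- Boundary points inject into flags, and there are three or two of both, depending on whether the
component belongs to a vertex of `Γ`. -/
theorem flagAt_surjective (hC : IsMaximallyDegenerate C) {c : C.Comp} (j : Γ.FlagAt P (D.comp hΓ c)) :
    ∃ (p : P1 k) (hp : p ∈ D.bdry c), D.flagAt hΓ hp = j := by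
  have : Finite (D.bdry c) := D.finite_bdry c
  have hinj : Function.Injective fun q : D.bdry c => D.flagAt hΓ q.2 := fun q q' h =>
    Subtype.ext (D.flagAt_injective hΓ q.2 q'.2 h)
  have hcard : Nat.card (D.bdry c) = Nat.card (Γ.FlagAt P (D.comp hΓ c)) := by
    rw [Nat.card_coe_set_eq, Nat.card_eq_fintype_card]
    by_cases hc : c ∈ Set.range D.vert
    · obtain ⟨x, rfl⟩ := hc
      rw [D.ncard_bdry_vert hΓ x, D.comp_vert hΓ x]
      exact (card_frame_inl hΓ x).symm
    · rw [D.divalent c hc]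
      cases h : D.comp hΓ c with
      | inl x => exact absurd ⟨x, (D.comp_eq_inl hΓ hC h).symm⟩ hc
      | inr z => exact (card_frame_inr hΓ z).symm
  obtain ⟨q, hq⟩ := ((Nat.bijective_iff_injective_and_card _).2 ⟨hinj, hcard⟩).2 j
  exact ⟨q.1, q.2, hq⟩

/-- Two components with the same standard component would lie over one vertex and meet the same
toric divisors, which the definition of a maximally degenerate curve excludes. -/
theorem comp_injective (hC : IsMaximallyDegenerate C) : Function.Injective (D.comp hΓ) := by
  intro c c' h
  by_contra hne
  have hpos : D.pos c = D.pos c' := by rw [← D.compPos_comp hΓ, ← D.compPos_comp hΓ, h]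
  obtain ⟨p, hp⟩ := D.nonempty_bdry hΓ c
  have key : ∀ y, y = D.comp hΓ c' → ∀ j : Γ.FlagAt P y, ∃ p' ∈ D.bdry c',
      coneOver ((frame hΓ y).T j) = (C.map c' p').cone := by
    rintro _ rfl j
    obtain ⟨p', hp', rfl⟩ := D.flagAt_surjective hΓ hC j
    exact ⟨p', hp', (D.cone_flagAt hΓ hp').symm⟩
  obtain ⟨p', hp', h'⟩ := key _ h (D.flagAt hΓ hp)
  exact (D.divalent_of_ne hC hne hpos).2 p hp p' hp' ((D.cone_flagAt hΓ hp).trans h')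

end TropicalMarking

end Structure

/-! ### Every maximally degenerate curve is isomorphic to a standard one -/

section Standardization

variable {V : Type*} [AddCommGroup V] [Module ℚ V] {N : Submodule ℤ V} {P : Set (Set V)}
  {k : Type*} [Field k]

/-- Nodes of this kind are determined by the cones of the images, so an isomorphism of components
compatible with the maps respects them automatically. -/
theorem image_boundaryNodes {Comp Comp' : Type} {map : Comp → P1 k → Degeneration k N P}
    {map' : Comp' → P1 k → Degeneration k N P} (e : Comp ≃ Comp')
    (g : Comp → ((Fin 2 → k) ≃ₗ[k] (Fin 2 → k))) (h : ∀ c p, map' (e c) (g c • p) = map c p) :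
    Sym2.map (fun x : Comp × P1 k => (e x.1, g x.1 • x.2)) '' boundaryNodes map
      = boundaryNodes map' := by
  have hinj : Function.Injective fun x : Comp × P1 k => (e x.1, g x.1 • x.2) := by
    rintro ⟨c, p⟩ ⟨c', p'⟩ hx
    obtain rfl : c = c' := e.injective (congrArg Prod.fst hx)
    have h2 : g c • p = g c • p' := congrArg Prod.snd hx
    rw [MulAction.injective (g c) h2]
  have hsurj : Function.Surjective fun x : Comp × P1 k => (e x.1, g x.1 • x.2) := by
    rintro ⟨c, p⟩
    refine ⟨(e.symm c, (g (e.symm c))⁻¹ • p), ?_⟩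
    simp
  have key : ∀ x y : Comp × P1 k, s((e x.1, g x.1 • x.2), (e y.1, g y.1 • y.2)) ∈ boundaryNodes map'
      ↔ s(x, y) ∈ boundaryNodes map := by
    intro x y
    rw [mem_boundaryNodes, mem_boundaryNodes, h, h]
    exact and_congr_left' hinj.ne_iff
  ext s
  refine Sym2.ind (fun x' y' => ?_) s
  obtain ⟨x, rfl⟩ := hsurj x'
  obtain ⟨y, rfl⟩ := hsurj y'
  constructor
  · rintro ⟨t, ht, hst⟩
    have : t = s(x, y) := Sym2.map.injective hinj hst
    subst this
    exact (key x y).2 ht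
  · exact fun hs => ⟨s(x, y), (key x y).1 hs, Sym2.map_mk _ x y⟩

namespace TropicalMarking

open TropicalCurve

variable {Γ : TropicalCurve N} {C : StableMap k (extLattice N) (fanOver P)}
  (D : TropicalMarking C Γ) [Infinite k] [N.IsLattice ℚ] (hΓ : IsSubdivided P Γ)

theorem mem_bdry_of_cone_eq {c : C.Comp} {p : P1 k} {f : Σ y, Γ.FlagAt P y}
    (h : (C.map c p).cone = coneOver ((frame hΓ f.1).T f.2)) : p ∈ D.bdry c :=
  fun hv => T_ne_singleton hΓ f _ (h.symm.trans hv)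

/-- The node at a boundary point whose cell has another vertex. -/
theorem exists_node (hC : IsMaximallyDegenerate C) {c : C.Comp} {p : P1 k} (hp : p ∈ D.bdry c)
    {v : V} (hv : {v} ∈ P) (hvT : v ∈ (frame hΓ (D.flag hΓ hp).1).T (D.flag hΓ hp).2)
    (hne : v ≠ D.pos c) :
    ∃ (c' : C.Comp) (p' : P1 k) (hp' : p' ∈ D.bdry c'), s((c, p), (c', p')) ∈ C.nodes ∧
      (frame hΓ (D.flag hΓ hp').1).T (D.flag hΓ hp').2
        = (frame hΓ (D.flag hΓ hp).1).T (D.flag hΓ hp).2 ∧ D.pos c' = v := by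
  have hcomp : C.map c p ∈ component k N P v := by
    change IsFace _ (C.map c p).cone
    rw [D.cone_eq hΓ hp]
    exact hΓ.decomp.cone_singleton_isFace (LineFrame.T_mem _ _) hv hvT
  obtain ⟨c', p', v₁, v₂, w, hnode, hvv, h1, h2, -, -⟩ := hC.preLog.singular c p
    ⟨v, D.pos c, hne, hcomp, (D.transverse c).1 p⟩
  obtain rfl := D.eq_pos_of_forall_mem h1.1
  obtain rfl := D.eq_pos_of_forall_mem h2.1
  have hglue : C.map c p = C.map c' p' := C.glue (c, p) (c', p') hnode
  have hcone : (C.map c' p').cone = coneOver ((frame hΓ (D.flag hΓ hp).1).T (D.flag hΓ hp).2) := by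
    rw [← hglue, D.cone_eq hΓ hp]
  have hp' : p' ∈ D.bdry c' := D.mem_bdry_of_cone_eq hΓ hcone
  have hT : (frame hΓ (D.flag hΓ hp').1).T (D.flag hΓ hp').2
        = (frame hΓ (D.flag hΓ hp).1).T (D.flag hΓ hp).2 :=
    coneOver_T_inj hΓ ((D.cone_eq hΓ hp').symm.trans hcone)
  refine ⟨c', p', hp', hnode, hT, ?_⟩
  -- The two branches of the node have different positions, hence flags of different sign over the
  -- same cell. The flag opposite to the given one is unique, which places the second branch over
  -- `v`.
  obtain ⟨f, hfT, -, hfs, hfv⟩ := exists_opposite_flag hΓ (D.flag hΓ hp) hv hvT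
    (by rwa [D.compPos_flag hΓ hp])
  have hs : (D.flag hΓ hp').2.sign ≠ (D.flag hΓ hp).2.sign := fun h => by
    have h3 := congrArg (fun f : Σ y, Γ.FlagAt P y => compPos f.1) ((flagCell_eq_cases hΓ hT).2 h)
    simp only [D.compPos_flag] at h3
    exact hvv h3.symm
  have : f = D.flag hΓ hp' := by
    refine (flagCell_eq_cases hΓ (hfT.trans hT.symm)).2 ?_
    revert hs hfs
    cases f.2.sign <;> cases (D.flag hΓ hp').2.sign <;> cases (D.flag hΓ hp).2.sign <;> simp
  rw [← hfv, this, D.compPos_flag]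

variable [IsAlgClosed k]

theorem flag_injective (hC : IsMaximallyDegenerate C) {c c' : C.Comp} {p p' : P1 k}
    (hp : p ∈ D.bdry c) (hp' : p' ∈ D.bdry c') (h : D.flag hΓ hp = D.flag hΓ hp') :
    (c, p) = (c', p') := by
  obtain rfl : c = c' := D.comp_injective hΓ hC (by
    rw [← D.flag_comp hΓ hp, ← D.flag_comp hΓ hp', h])
  rw [← D.sigma_flagAt hΓ hp, ← D.sigma_flagAt hΓ hp'] at h
  rw [D.flagAt_injective hΓ hp hp' (eq_of_heq (Sigma.mk.inj h).2)]

/-- A node not on a boundary divisor would join two branches over the same `X_v`. Conversely, two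
boundary points over one cell have different positions, so the cell has a second vertex and its
stratum lies in two components of the central fiber. The pre-log condition then provides a node, and
injectivity of the flags identifies its second branch. -/
theorem nodes_eq (D : TropicalMarking C Γ) (hΓ : IsSubdivided P Γ) (hC : IsMaximallyDegenerate C) :
    C.nodes = boundaryNodes C.map := by
  ext s
  refine Sym2.ind (fun x y => ?_) s
  rw [mem_boundaryNodes]
  constructor
  · intro h
    have hcone := congrArg ToricPoint.cone (C.glue x y h)
    refine ⟨fun hxy => C.not_diag _ h (Sym2.mk_isDiag_iff.2 hxy), fun v hv => ?_, hcone⟩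
    have h1 := D.mem_cone x.1 x.2
    have h2 := D.mem_cone y.1 y.2
    rw [← hcone] at h2
    rw [hv] at h1 h2
    have h3 := eq_of_mem_coneOver_singleton h1
    have h4 := eq_of_mem_coneOver_singleton h2
    refine hC.disjoint x y h v ⟨?_, ?_⟩
    · rw [← h3]; exact D.transverse x.1
    · rw [← h4]; exact D.transverse y.1
  · rintro ⟨hne, hv, hcone⟩
    have hx : x.2 ∈ D.bdry x.1 := hv _
    have hy : y.2 ∈ D.bdry y.1 := fun h => hv _ (hcone.trans h)
    have hT : (frame hΓ (D.flag hΓ hx).1).T (D.flag hΓ hx).2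
        = (frame hΓ (D.flag hΓ hy).1).T (D.flag hΓ hy).2 :=
      coneOver_T_inj hΓ ((D.cone_eq hΓ hx).symm.trans (hcone.trans (D.cone_eq hΓ hy)))
    have hff : D.flag hΓ hx ≠ D.flag hΓ hy := fun h => hne (D.flag_injective hΓ hC hx hy h)
    have hpos := compPos_ne_of_T_eq hΓ hT hff
    rw [D.compPos_flag, D.compPos_flag] at hpos
    have hmem : D.pos y.1 ∈ (frame hΓ (D.flag hΓ hx).1).T (D.flag hΓ hx).2 := by
      rw [hT, ← D.compPos_flag hΓ hy]
      exact LineFrame.v_mem_T _ _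
    obtain ⟨c', p', hp', hnode, hT', hpos'⟩ :=
      D.exists_node hΓ hC hx (D.pos_mem y.1) hmem hpos.symm
    have : (c', p') = (y.1, y.2) := by
      refine D.flag_injective hΓ hC hp' hy ?_
      by_contra hne'
      refine compPos_ne_of_T_eq hΓ (hT'.trans hT) hne' ?_
      rw [D.compPos_flag, D.compPos_flag, hpos']
    rw [this] at hnode
    exact hnode

/-- A point subdividing an edge lies in the cell of some boundary point on this edge. It is a vertex
of that cell, so either the component itself or the one across the node lies over it. -/
theorem comp_surjective (hC : IsMaximallyDegenerate C) : Function.Surjective (D.comp hΓ) := by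
  rintro (x | z)
  · exact ⟨_, D.comp_vert hΓ x⟩
  have hmem : Γ.edgePoint z.1.1 z.1.2 ∈ Γ.edgeImage z.1.1 :=
    Γ.mem_edgeImage.2 ⟨_, z.2.1.le, z.2.2.1.le, rfl⟩
  have hend : ∀ (c : C.Comp) (p : P1 k) (hp : p ∈ D.bdry c), (D.flag hΓ hp).2.edge = z.1.1 →
      D.pos c = Γ.edgePoint z.1.1 z.1.2 → D.comp hΓ c = .inr z := by
    intro c p hp he hpos
    rw [← D.flag_comp hΓ hp]
    have hj : (FlagAt.edge (y := Sum.inr z) true : Γ.Edge) = z.1.1 := rfl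
    refine comp_ext hΓ (j := (D.flag hΓ hp).2) (j' := (true : Γ.FlagAt P (.inr z))) he ?_
    refine Γ.edgePoint_injective z.1.1 ?_
    rw [← he, FlagAt.edgePoint_eq, D.compPos_flag, hpos, he]
    rfl
  obtain ⟨c, p, hp, he, hcell⟩ := (D.image z.1.1).subset hmem
  have he' : (D.flag hΓ hp).2.edge = z.1.1 := (D.flag_edge hΓ hp).trans he
  by_cases hpos : Γ.edgePoint z.1.1 z.1.2 = D.pos c
  · exact ⟨c, hend c p hp he' hpos.symm⟩
  have hvT : Γ.edgePoint z.1.1 z.1.2 ∈ (frame hΓ (D.flag hΓ hp).1).T (D.flag hΓ hp).2 := by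
    have h1 : (Γ.edgePoint z.1.1 z.1.2, (1 : ℚ)) ∈ (C.map c p).cone := hcell
    rw [D.cone_eq hΓ hp] at h1
    exact (hΓ.decomp.polyhedron _ (LineFrame.T_mem _ _)).mem_of_mem_coneOver h1
  obtain ⟨c', p', hp', -, hT, hpos'⟩ := D.exists_node hΓ hC hp z.2.2.2 hvT hpos
  exact ⟨c', hend c' p' hp' ((flagCell_eq_cases hΓ hT).1.trans he') hpos'⟩

theorem exists_map_eq (hC : IsMaximallyDegenerate C) (c : C.Comp) :
    ∃ (χ : CharTorus k N) (g : (Fin 2 → k) ≃ₗ[k] (Fin 2 → k)), ∀ q,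
      C.map c (g • q) = LineFrame.lineMap (points k hΓ (D.comp hΓ c)) hΓ.decomp χ q := by
  choose q hq hflag using fun j : (frame hΓ (D.comp hΓ c)).J => D.flagAt_surjective hΓ hC j
  have hinj : Function.Injective q := by
    intro j j' h
    rw [← hflag j, ← hflag j']
    congr 1
  let pts : (frame hΓ (D.comp hΓ c)).Points k :=
    { pt := fun j => (q j).rep
      ne_zero := fun j => (q j).rep_nonzero
      cross_ne := fun i j hij => cross_rep_ne (hinj.ne hij) }
  have hpt : ∀ j, pts.point j = q j := fun j => (q j).mk_rep
  have hv : ((frame hΓ (D.comp hΓ c)).v : V) = D.pos c := D.compPos_comp hΓ c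
  have htype : LineFrame.IsOfType pts (C.map c) := by
    refine LineFrame.isOfType_of_hasIndex (C.isMorphism c) ?_ ?_ ?_
    · rw [hv]
      ext r
      constructor
      · intro hr
        refine ⟨D.flagAt hΓ (c := c) hr, ?_⟩
        exact (hpt _).trans (D.flagAt_injective hΓ (hq _) hr (hflag _))
      · rintro ⟨j, rfl⟩
        rw [hpt]
        exact hq j
    · intro j
      rw [hpt, D.cone_flagAt hΓ (hq j), hflag]
    · intro j
      rw [hv, hpt]
      have h1 := D.hasIndex c (q j) (hq j)
      rw [← D.flagAt_edge hΓ (hq j), hflag] at h1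
      exact h1
  obtain ⟨χ, hχ⟩ := htype.exists_eq_lineMap hΓ.decomp
  obtain ⟨g, s, hg⟩ := LineFrame.Points.exists_equiv (points k hΓ (D.comp hΓ c)) pts
    (card_frame hΓ _)
  -- Passing to the standard boundary points multiplies the character by the gauge character, which
  -- is compensated here.
  refine ⟨χ * (LineFrame.gaugeChar s)⁻¹, g, fun r => ?_⟩
  rw [← LineFrame.lineMap_smul hg hΓ.decomp (frame_isBalanced hΓ _),
    inv_mul_cancel_right χ (LineFrame.gaugeChar s)]
  exact hχ _

/-- Every maximally degenerate curve with tropical curve `Γ` is a standard one. -/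
theorem exists_iso_stdCurve (D : TropicalMarking C Γ) (hC : IsMaximallyDegenerate C) :
    ∃ (χ : Γ.StdComp P → CharTorus k N) (hχ : IsGlued hΓ χ), (stdCurve hΓ hχ).Iso C := by
  have hex : ∀ y : Γ.StdComp P, ∃ (χ : CharTorus k N) (g : (Fin 2 → k) ≃ₗ[k] (Fin 2 → k)), ∀ q,
      C.map ((Equiv.ofBijective _ ⟨D.comp_injective hΓ hC, D.comp_surjective hΓ hC⟩).symm y) (g • q)
        = LineFrame.lineMap (points k hΓ y) hΓ.decomp χ q := by
    intro y
    set e := Equiv.ofBijective _ ⟨D.comp_injective hΓ hC, D.comp_surjective hΓ hC⟩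
    obtain ⟨c, rfl⟩ := e.surjective y
    rw [e.symm_apply_apply]
    exact D.exists_map_eq hΓ hC c
  set e := (Equiv.ofBijective _ ⟨D.comp_injective hΓ hC, D.comp_surjective hΓ hC⟩).symm
  choose χ g hg using hex
  have himage := image_boundaryNodes (map := compMap hΓ χ) (map' := C.map) e g hg
  have hχ : IsGlued hΓ χ := by
    intro f f' hT
    by_cases hff : f = f'
    · rw [hff]; exact fun _ _ => rfl
    · rw [← compMap_flagPoint_eq_iff hΓ hT]
      have hnode : s(flagPoint k hΓ f, flagPoint k hΓ f') ∈ boundaryNodes (compMap hΓ χ) :=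
        (mem_boundaryNodes_compMap hΓ).2 ⟨f, f', rfl, rfl, hff, hT⟩
      have h1 := Set.mem_image_of_mem
        (Sym2.map (fun x : Γ.StdComp P × P1 k => (e x.1, g x.1 • x.2))) hnode
      rw [himage, ← D.nodes_eq hΓ hC, Sym2.map_mk] at h1
      have h2 := C.glue _ _ h1
      exact (hg _ _).symm.trans (h2.trans (hg _ _))
  exact ⟨χ, hχ, e, g, hg, himage.trans (D.nodes_eq hΓ hC).symm⟩

end TropicalMarking

end Standardization

/-! ### Isomorphism classes of standard curves -/

section Isomorphisms

theorem StableMap.Iso.refl {W : Type*} [AddCommGroup W] [Module ℚ W] {k : Type*} [Field k]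
    {Λ : Submodule ℤ W} {F : Set (Set W)} (C : StableMap k Λ F) : C.Iso C :=
  ⟨Equiv.refl _, fun _ => 1, fun c p => by rw [one_smul]; rfl, by
    have : (fun x : C.Comp × P1 k =>
        ((Equiv.refl C.Comp) x.1, (1 : (Fin 2 → k) ≃ₗ[k] (Fin 2 → k)) • x.2)) = id := by
      funext x
      rw [one_smul]; rfl
    rw [this, Sym2.map_id, Set.image_id]⟩

theorem StableMap.Iso.symm {W : Type*} [AddCommGroup W] [Module ℚ W] {k : Type*} [Field k]
    {Λ : Submodule ℤ W} {F : Set (Set W)} {C C' : StableMap k Λ F} (h : C.Iso C') : C'.Iso C := by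
  obtain ⟨e, g, hmap, hnodes⟩ := h
  refine ⟨e.symm, fun c => (g (e.symm c))⁻¹, fun c p => ?_, ?_⟩
  · rw [← hmap, smul_inv_smul, e.apply_symm_apply]
  · rw [← hnodes, ← Set.image_comp, ← Sym2.map_comp]
    have : ((fun x : C'.Comp × P1 k => (e.symm x.1, (g (e.symm x.1))⁻¹ • x.2)) ∘
        fun x : C.Comp × P1 k => (e x.1, g x.1 • x.2)) = id := by
      funext x
      simp
    rw [this, Sym2.map_id, Set.image_id]

theorem StableMap.Iso.trans {W : Type*} [AddCommGroup W] [Module ℚ W] {k : Type*} [Field k]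
    {Λ : Submodule ℤ W} {F : Set (Set W)} {C C' C'' : StableMap k Λ F} (h : C.Iso C')
    (h' : C'.Iso C'') : C.Iso C'' := by
  obtain ⟨e, g, hmap, hnodes⟩ := h
  obtain ⟨e', g', hmap', hnodes'⟩ := h'
  refine ⟨e.trans e', fun c => g' (e c) * g c, fun c p => ?_, ?_⟩
  · rw [mul_smul, Equiv.trans_apply, hmap', hmap]
  · rw [← hnodes', ← hnodes, ← Set.image_comp, ← Sym2.map_comp]
    congr 2
    funext x
    simp [mul_smul]

theorem StableMap.Iso.meets {W : Type*} [AddCommGroup W] [Module ℚ W] {k : Type*} [Field k]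
    {Λ : Submodule ℤ W} {F : Set (Set W)} {C C' : StableMap k Λ F} (h : C.Iso C')
    {Z : Set (ToricPoint k Λ F)} (hC : C.Meets Z) : C'.Meets Z := by
  obtain ⟨e, g, hmap, -⟩ := h
  obtain ⟨c, p, hp⟩ := hC
  exact ⟨e c, g c • p, by rw [hmap]; exact hp⟩

variable {V : Type*} [AddCommGroup V] [Module ℚ V] {N : Submodule ℤ V} {P : Set (Set V)}
  {k : Type*} [Field k]

theorem exists_equiv_scale {x y : Fin 2 → k} (h : cross x y ≠ 0) (t : kˣ) :
    ∃ g : (Fin 2 → k) ≃ₗ[k] (Fin 2 → k), g x = (t : k) • x ∧ g y = y := by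
  have h' : cross ((t : k) • x) y ≠ 0 := by
    rw [cross_smul_left]
    exact mul_ne_zero t.ne_zero h
  have h1 : (frameEquiv x y h).symm x = ![1, 0] := by
    rw [LinearEquiv.symm_apply_eq]; simp [frameEquiv]
  have h2 : (frameEquiv x y h).symm y = ![0, 1] := by
    rw [LinearEquiv.symm_apply_eq]; simp [frameEquiv]
  refine ⟨(frameEquiv x y h).symm.trans (frameEquiv _ y h'), ?_, ?_⟩
  · rw [LinearEquiv.trans_apply, h1]; simp [frameEquiv]
  · rw [LinearEquiv.trans_apply, h2]; simp [frameEquiv]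

namespace TropicalCurve

variable {Γ : TropicalCurve N} [Infinite k] [N.IsLattice ℚ] (hΓ : IsSubdivided P Γ)
  {χ χ' : Γ.StdComp P → CharTorus k N}

theorem amp_div_true (z : Γ.DivPoint P) :
    (frame hΓ (.inr z)).amp true = Γ.weight z.1.1 • Γ.dir z.1.1 := rfl

theorem amp_div_false (z : Γ.DivPoint P) :
    (frame hΓ (.inr z)).amp false = Γ.weight z.1.1 • - Γ.dir z.1.1 := rfl

/-- The characters of divalent components matter only on the monomials orthogonal to the edge. -/
theorem exists_smul_compMap_div [IsAlgClosed k] {z : Γ.DivPoint P}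
    (h : ∀ m : Module.Dual ℤ N, m (Γ.dir z.1.1) = 0 →
      χ (.inr z) (Multiplicative.ofAdd m) = χ' (.inr z) (Multiplicative.ofAdd m)) :
    ∃ g : (Fin 2 → k) ≃ₗ[k] (Fin 2 → k),
      ∀ q, compMap hΓ χ' (.inr z) (g • q) = compMap hΓ χ (.inr z) q := by
  -- The two characters differ by the one-parameter subgroup of the edge direction. Scaling one
  -- boundary vector by `t` changes the character by the parameter `t ^ w`, with `w` the weight of
  -- the edge, so a `w`-th root of `s` is taken.
  obtain ⟨s, hs⟩ := (Γ.dir_primitive z.1.1).exists_zpow ((χ (.inr z))⁻¹ * χ' (.inr z))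
    (fun m hm => by
      rw [MonoidHom.mul_apply, MonoidHom.inv_apply, h m hm, inv_mul_cancel])
  obtain ⟨t, ht⟩ := exists_pow_eq_unit s (Γ.weight_pos z.1.1)
  let p := points k hΓ (.inr z)
  obtain ⟨g, hg1, hg2⟩ := exists_equiv_scale (p.cross_ne true false Bool.noConfusion) t
  let σ : (frame hΓ (.inr z)).J → kˣ := fun j : Bool => if j = true then t else 1
  have hg : ∀ j, g (p.pt j) = ((σ j : kˣ) : k) • p.pt j := by
    rintro (_ | _)
    · change g (p.pt false) = ((1 : kˣ) : k) • p.pt false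
      rw [hg2, Units.val_one, one_smul]
    · exact hg1
  have hgauge : χ (.inr z) * LineFrame.gaugeChar σ = χ' (.inr z) := by
    have h1 : LineFrame.gaugeChar σ = (χ (.inr z))⁻¹ * χ' (.inr z) := by
      rw [hs]
      refine MonoidHom.ext fun m => ?_
      obtain ⟨m, rfl⟩ := Multiplicative.ofAdd.surjective m
      rw [LineFrame.gaugeChar_apply, oneParam_apply]
      refine (Fintype.prod_bool (fun j : Bool => σ j ^ m ((frame hΓ (.inr z)).amp j))).trans ?_
      have h2 : σ true = t := rfl
      have h3 : σ false = 1 := rfl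
      rw [h2, h3, one_zpow, mul_one, amp_div_true, map_nsmul, nsmul_eq_mul, zpow_mul,
        zpow_natCast, ht]
    rw [h1]
    exact mul_inv_cancel_left (χ (.inr z)) (χ' (.inr z))
  refine ⟨g, fun q => ?_⟩
  have := LineFrame.lineMap_smul hg hΓ.decomp (frame_isBalanced hΓ (.inr z)) (χ (.inr z)) q
  rw [hgauge] at this
  exact this

/-- The character at the tail of an edge. -/
def tailChar (c : Γ.Vert → CharTorus k N) (E : Γ.Edge) : CharTorus k N :=
  c (Γ.tail E) * LineFrame.boundaryChar (points k hΓ (.inl (Γ.tail E))) (tailFlag P E)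

theorem IsGlued.char_div_eq (hχ : IsGlued hΓ χ) (z : Γ.DivPoint P) {m : Module.Dual ℤ N}
    (hm : m (Γ.dir z.1.1) = 0) : χ (.inr z) (Multiplicative.ofAdd m)
      = tailChar hΓ (fun x => χ (.inl x)) z.1.1 (Multiplicative.ofAdd m) :=
  (flagChar_div hΓ χ (true : Bool) hm).symm.trans (hχ.flagChar_eq hΓ ⟨.inr z, (true : Bool)⟩ hm)

/-- Gluing determines the characters of the divalent components on the monomials orthogonal to the
edges, and the rest is absorbed by coordinate changes of these components. -/
theorem iso_stdCurve_of_eq [IsAlgClosed k] (hχ : IsGlued hΓ χ) (hχ' : IsGlued hΓ χ')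
    (h : ∀ x, χ (.inl x) = χ' (.inl x)) : (stdCurve hΓ hχ).Iso (stdCurve hΓ hχ') := by
  have hex : ∀ y : Γ.StdComp P, ∃ g : (Fin 2 → k) ≃ₗ[k] (Fin 2 → k),
      ∀ q, compMap hΓ χ' y (g • q) = compMap hΓ χ y q := by
    rintro (x | z)
    · refine ⟨1, fun q => ?_⟩
      rw [one_smul, compMap, compMap, h]
    · refine exists_smul_compMap_div hΓ fun m hm => ?_
      rw [hχ.char_div_eq hΓ z hm, hχ'.char_div_eq hΓ z hm, funext h]
  choose g hg using hex
  exact ⟨Equiv.refl _, g, hg, image_boundaryNodes (Equiv.refl _) g hg⟩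

/-- An isomorphism fixes the component of a vertex of `Γ`, the only one over its position. A
coordinate change that respects three boundary points over distinct cells fixes the character. -/
theorem eq_of_iso_stdCurve (hχ : IsGlued hΓ χ) (hχ' : IsGlued hΓ χ')
    (h : (stdCurve hΓ hχ).Iso (stdCurve hΓ hχ')) (x : Γ.Vert) : χ (.inl x) = χ' (.inl x) := by
  obtain ⟨e, g, hmap, -⟩ := h
  have hmap' : ∀ (y : Γ.StdComp P) q, compMap hΓ χ' (e y) (g y • q) = compMap hΓ χ y q := hmap
  have hpos : Γ.pos x = compPos (P := P) (e (.inl x)) := by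
    refine compPos_eq_of_forall_mem (χ := χ') hΓ fun q => ?_
    have h1 := hmap' (.inl x) ((g (.inl x))⁻¹ • q)
    rw [smul_inv_smul] at h1
    rw [h1]
    exact (isTransverse_compMap hΓ (.inl x)).1 _
  have he : e (.inl x) = (.inl x : Γ.StdComp P) := by
    by_contra hne
    obtain ⟨z, hz⟩ := exists_inr_of_compPos_eq hΓ (y := .inl x) (Ne.symm hne) hpos
    simp at hz
  refine LineFrame.char_unique (points k hΓ (.inl x)) (card_frame_inl hΓ x)
    (frame_T_injective hΓ _) hΓ.decomp (frame_isBalanced hΓ _) (g := g (.inl x)) fun q => ?_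
  have h1 := hmap' (.inl x) q
  rw [he] at h1
  exact h1

/-! #### Extending characters from the vertices -/

/-- The family of characters on all components given by characters at the vertices. -/
def stdChar (c : Γ.Vert → CharTorus k N) : Γ.StdComp P → CharTorus k N
  | .inl x => c x
  | .inr z => tailChar hΓ c z.1.1

/-- The difference of the boundary characters at the ends of a bounded edge. -/
def bedgeChar (b : Γ.BEdge) : CharTorus k N :=
  LineFrame.boundaryChar (points k hΓ (.inl (Γ.src b))) (tailFlag P (.inl b))
    * (LineFrame.boundaryChar (points k hΓ (.inl (Γ.tgt b))) (headFlag P b))⁻¹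

theorem bedgeChar_iff {c : Γ.Vert → CharTorus k N} {b : Γ.BEdge} {m : Module.Dual ℤ N} :
    c (Γ.tgt b) (Multiplicative.ofAdd m)
        = c (Γ.src b) (Multiplicative.ofAdd m) * bedgeChar hΓ b (Multiplicative.ofAdd m) ↔
      (c (Γ.tgt b) * LineFrame.boundaryChar (points k hΓ (.inl (Γ.tgt b))) (headFlag P b))
          (Multiplicative.ofAdd m) = tailChar hΓ c (.inl b) (Multiplicative.ofAdd m) := by
  rw [bedgeChar, tailChar, MonoidHom.mul_apply, MonoidHom.mul_apply, MonoidHom.mul_apply,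
    MonoidHom.inv_apply, ← mul_assoc, eq_mul_inv_iff_mul_eq]
  rfl

/-- Every divalent component takes over the boundary value at the tail of its edge. So only the
heads of the bounded edges impose conditions, and these are the ones in `hc`. -/
theorem isGlued_stdChar {c : Γ.Vert → CharTorus k N}
    (hc : ∀ b (m : Module.Dual ℤ N), m (Γ.bdir b) = 0 → c (Γ.tgt b) (Multiplicative.ofAdd m)
      = c (Γ.src b) (Multiplicative.ofAdd m) * bedgeChar hΓ b (Multiplicative.ofAdd m)) :
    IsGlued hΓ (stdChar hΓ c) := by
  have key : ∀ (f : Σ y, Γ.FlagAt P y) (m : Module.Dual ℤ N), m (Γ.dir f.2.edge) = 0 →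
      flagChar hΓ (stdChar hΓ c) f (Multiplicative.ofAdd m)
        = tailChar hΓ c f.2.edge (Multiplicative.ofAdd m) := by
    intro f m hm
    match f, hm with
    | ⟨.inr z, j⟩, hm => exact flagChar_div hΓ _ j hm
    | ⟨.inl _, .inl ⟨b, rfl⟩⟩, hm => rfl
    | ⟨.inl _, .inr (.inl ⟨b, rfl⟩)⟩, hm => exact (bedgeChar_iff hΓ).1 (hc b m hm)
    | ⟨.inl _, .inr (.inr ⟨e, rfl⟩)⟩, hm => rfl
  intro f f' hT m hm
  obtain ⟨he, -⟩ := flagCell_eq_cases hΓ hT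
  rw [key f m hm, key f' m (he ▸ hm), he]

theorem IsGlued.bedgeChar_eq (hχ : IsGlued hΓ χ) (b : Γ.BEdge) (m : Module.Dual ℤ N)
    (hm : m (Γ.bdir b) = 0) : χ (.inl (Γ.tgt b)) (Multiplicative.ofAdd m)
      = χ (.inl (Γ.src b)) (Multiplicative.ofAdd m) * bedgeChar hΓ b (Multiplicative.ofAdd m) :=
  (bedgeChar_iff hΓ (c := fun x => χ (.inl x))).2
    (hχ.flagChar_eq hΓ ⟨.inl (Γ.tgt b), headFlag P b⟩ hm)

end TropicalCurve

end Isomorphisms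

/-! ### Incidence with the orbit closures -/

section Markings

variable {V : Type*} [AddCommGroup V] [Module ℚ V] {N : Submodule ℤ V} {P : Set (Set V)}
  {k : Type*} [Field k]

theorem exists_pos_smul_mem [N.IsLattice ℚ] (x : V) : ∃ K : ℕ, 0 < K ∧ (K : ℚ) • x ∈ N := by
  have hx : x ∈ Submodule.span ℚ (N : Set V) := by
    rw [Submodule.IsLattice.span_eq_top]; trivial
  induction hx using Submodule.span_induction with
  | mem x h => exact ⟨1, one_pos, by simpa using h⟩
  | zero => exact ⟨1, one_pos, by simp⟩
  | add x y _ _ hx hy =>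
    obtain ⟨K, hK, h⟩ := hx
    obtain ⟨K', hK', h'⟩ := hy
    refine ⟨K * K', Nat.mul_pos hK hK', ?_⟩
    have h1 := N.smul_mem (K' : ℤ) h
    have h2 := N.smul_mem (K : ℤ) h'
    rw [← Int.cast_smul_eq_zsmul ℚ, smul_smul] at h1 h2
    have : ((K * K' : ℕ) : ℚ) • (x + y)
        = (((K' : ℤ) : ℚ) * (K : ℚ)) • x + (((K : ℤ) : ℚ) * (K' : ℚ)) • y := by
      rw [smul_add]
      push_cast
      rw [mul_comm (K' : ℚ)]
    rw [this]
    exact N.add_mem h1 h2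
  | smul a x _ hx =>
    obtain ⟨K, hK, h⟩ := hx
    refine ⟨a.den * K, Nat.mul_pos a.den_pos hK, ?_⟩
    have h1 := N.smul_mem a.num h
    rw [← Int.cast_smul_eq_zsmul ℚ, smul_smul] at h1
    rw [smul_smul]
    have : ((a.den * K : ℕ) : ℚ) * a = (a.num : ℚ) * (K : ℚ) := by
      have h2 : a * (a.den : ℚ) = a.num := Rat.mul_den_eq_num a
      push_cast
      rw [← h2]; ring
    rwa [this]

theorem extendQ_eq_zero_of_incidenceLattice [N.IsLattice ℚ] {u : N} {A : AffineSubspace ℚ V}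
    {m : Module.Dual ℤ N} (hm : ∀ y ∈ TropicalCurve.incidenceLattice u A, m y = 0) {b : V}
    (hb : b ∈ A.direction) : extendQ m b = 0 := by
  obtain ⟨K, hK, h⟩ := exists_pos_smul_mem (N := N) b
  have h1 := hm ⟨_, h⟩ (Submodule.mem_sup_right (A.direction.smul_mem _ hb))
  have h2 := extendQ_apply m ⟨_, h⟩
  rw [h1, Int.cast_zero] at h2
  change extendQ m ((K : ℚ) • b) = 0 at h2
  rw [map_smul, smul_eq_mul] at h2
  exact (mul_eq_zero.1 h2).resolve_left (by exact_mod_cast hK.ne')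

theorem eq_zero_of_mem_incidenceLattice [N.IsLattice ℚ] {u : N} {A : AffineSubspace ℚ V}
    {m : Module.Dual ℤ N} (hm : ∀ b ∈ A.direction, extendQ m b = 0) (hu : m u = 0) {y : N}
    (hy : y ∈ TropicalCurve.incidenceLattice u A) : m y = 0 := by
  obtain ⟨a, ha, b, hb, hab⟩ := Submodule.mem_sup.1 hy
  obtain ⟨t, rfl⟩ := Submodule.mem_span_singleton.1 ha
  have h1 := extendQ_apply m y
  have h2 : (y : V) = t • (u : V) + b := hab.symm
  rw [h2, map_add, map_smul, extendQ_apply, hu, hm b hb, Int.cast_zero, smul_zero, add_zero] at h1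
  exact_mod_cast h1.symm

theorem mem_incidenceLattice_self (u : N) (A : AffineSubspace ℚ V) :
    u ∈ TropicalCurve.incidenceLattice u A :=
  Submodule.mem_sup_left (Submodule.mem_span_singleton_self _)

/-- The values at a point of the big torus of the monomials of order zero along `X_v`. -/
def pointChar [N.IsLattice ℚ] {pt : Degeneration k N P} (hpt : pt.cone = {0}) (v : N) :
    CharTorus k N where
  toFun m := Units.mk0 _ (val_ne_zero_of_cone_zero hpt (monomial v (Multiplicative.toAdd m)))
  map_one' := Units.ext (by simp [pt.val_zero])
  map_mul' m m' := Units.ext (by simp [val_add_of_cone_zero hpt])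

theorem pointChar_apply [N.IsLattice ℚ] {pt : Degeneration k N P} (hpt : pt.cone = {0}) (v : N)
    (m : Module.Dual ℤ N) :
    (pointChar hpt v (Multiplicative.ofAdd m) : k) = pt.val (monomial v m) := rfl

namespace TropicalCurve

variable {Γ : TropicalCurve N} [Infinite k] [N.IsLattice ℚ] (hΓ : IsSubdivided P Γ)
  {χ : Γ.StdComp P → CharTorus k N}

theorem compMap_div_val (z : Γ.DivPoint P) {x : Fin 2 → k} (hx : x ≠ 0)
    {n : dualLattice (extLattice N)} (hn : n.1 (compPos (P := P) (.inr z : Γ.StdComp P), 1) = 0) :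
    (compMap hΓ χ (.inr z) (Projectivization.mk k x hx)).val n
      = (χ (.inr z) (Multiplicative.ofAdd (restr n)) : k) *
        (cross ((points k hΓ (.inr z)).pt true) x / cross ((points k hΓ (.inr z)).pt false) x)
          ^ ((Γ.weight z.1.1 : ℤ) * restr n (Γ.dir z.1.1)) := by
  have h1 := LineFrame.lineMap_val_mk (points k hΓ (.inr z)) hΓ.decomp (χ (.inr z))
    (frame_isBalanced hΓ (.inr z)) hn hx
  refine h1.trans ?_
  rw [LineFrame.lineVal]
  congr 1
  refine (Fintype.prod_bool (fun j : Bool => cross ((points k hΓ (.inr z)).pt j) x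
    ^ restr n ((frame hΓ (.inr z)).amp j))).trans ?_
  rw [amp_div_true, amp_div_false, map_nsmul, map_nsmul, map_neg, nsmul_eq_mul, nsmul_eq_mul,
    mul_neg, zpow_neg, div_zpow, div_eq_mul_inv]

variable {A : AffineSubspace ℚ V} {pt : Degeneration k N P}

theorem exists_vec {x y : Fin 2 → k} (h : cross x y ≠ 0) (t : k) :
    ∃ z : Fin 2 → k, cross x z = t ∧ cross y z = 1 := by
  refine ⟨(t / cross x y) • y - (1 / cross x y) • x, ?_, ?_⟩
  · have : cross x ((t / cross x y) • y - (1 / cross x y) • x) = t / cross x y * cross x y := by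
      simp only [cross, Pi.sub_apply, Pi.smul_apply, smul_eq_mul]; ring
    rw [this, div_mul_cancel₀ _ h]
  · have : cross y ((t / cross x y) • y - (1 / cross x y) • x) = 1 / cross x y * cross x y := by
      simp only [cross, Pi.sub_apply, Pi.smul_apply, smul_eq_mul]; ring
    rw [this, div_mul_cancel₀ _ h]

/-- The component over the vertex `z` in `A` can be moved along the edge to meet the orbit closure. -/
theorem meets_of_char_eq [IsAlgClosed k] (hχ : IsGlued hΓ χ) (hpt : pt.cone = {0})
    (z : Γ.DivPoint P) (hzA : Γ.edgePoint z.1.1 z.1.2 ∈ A)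
    (h : ∀ m : Module.Dual ℤ N, (∀ y ∈ incidenceLattice (Γ.dir z.1.1) A, m y = 0) →
      χ (.inr z) (Multiplicative.ofAdd m)
        = pointChar hpt (frame hΓ (.inr z)).v (Multiplicative.ofAdd m)) :
    (stdCurve hΓ hχ).Meets (orbitClosure (linCone A) pt) := by
  set v := (frame hΓ (.inr z)).v with hv
  -- The monomials to be matched for membership in the orbit closure: those vanishing on `L(A)`. The
  -- hypothesis covers only those that also vanish on the direction of the edge; on `K` the
  -- remaining discrepancy is therefore a one-parameter subgroup in that direction.
  let K : AddSubgroup (Module.Dual ℤ N) :=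
    { carrier := {m | ∀ b ∈ A.direction, extendQ m b = 0}
      zero_mem' := fun b _ => by
        have := extendQ_add (0 : Module.Dual ℤ N) 0
        rw [add_zero, left_eq_add] at this
        rw [this]; rfl
      add_mem' := fun {m m'} hm hm' b hb => by
        rw [extendQ_add, LinearMap.add_apply, hm b hb, hm' b hb, add_zero]
      neg_mem' := fun {m} hm b hb => by
        have h1 := extendQ_add m (-m)
        have h2 := extendQ_add (0 : Module.Dual ℤ N) 0
        rw [add_zero, left_eq_add] at h2
        rw [add_neg_cancel, h2] at h1
        have h3 := LinearMap.congr_fun h1 b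
        rw [LinearMap.add_apply, hm b hb, zero_add] at h3
        exact h3.symm }
  obtain ⟨t, ht⟩ := exists_zpow_of_trivial K (Γ.dir z.1.1) (Γ.weight_pos z.1.1)
    ((pointChar hpt v * (χ (.inr z))⁻¹).comp (AddMonoidHom.toMultiplicative K.subtype)) (by
      intro m hm
      change pointChar hpt v (Multiplicative.ofAdd m.1) * (χ (.inr z) (Multiplicative.ofAdd m.1))⁻¹
        = 1
      rw [h m.1 fun y hy => eq_zero_of_mem_incidenceLattice m.2 hm hy, mul_inv_cancel])
  have ht' : ∀ m ∈ K, (χ (.inr z) (Multiplicative.ofAdd m) : k)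
      * (t : k) ^ ((Γ.weight z.1.1 : ℤ) * m (Γ.dir z.1.1)) = pt.val (monomial v m) := by
    intro m hm
    have h1 := ht ⟨m, hm⟩
    change pointChar hpt v (Multiplicative.ofAdd m) * (χ (.inr z) (Multiplicative.ofAdd m))⁻¹
        = _ at h1
    rw [mul_inv_eq_iff_eq_mul, mul_comm] at h1
    have h2 := congrArg Units.val h1
    rw [pointChar_apply, Units.val_mul, Units.val_zpow_eq_zpow_val] at h2
    exact h2.symm
  -- The quotient of the two linear forms is a coordinate on the divalent line away from its two
  -- boundary points. Where it takes the value `t`, the discrepancy is compensated.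
  obtain ⟨x, hx1, hx2⟩ := exists_vec
    ((points k hΓ (.inr z)).cross_ne true false Bool.noConfusion) (t : k)
  have hx : x ≠ 0 := by
    rintro rfl
    simp [cross] at hx2
  have hcone : (compMap hΓ χ (.inr z) (Projectivization.mk k x hx)).cone = coneOver {(v : V)} := by
    refine LineFrame.lineCone_of_forall_ne (points k hΓ (.inr z)) fun j hj => ?_
    have h1 := (points k hΓ (.inr z)).cross_eq_zero_iff.2 hj
    obtain ⟨a, ha, hrep⟩ := exists_rep_eq_smul hx
    rw [hrep, cross_smul_right] at h1
    have h2 := (mul_eq_zero.1 h1).resolve_left ha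
    match j with
    | true => exact t.ne_zero (hx1.symm.trans h2)
    | false => exact one_ne_zero (hx2.symm.trans h2)
  refine ⟨.inr z, Projectivization.mk k x hx, ?_⟩
  refine mem_orbitClosure_of_val_eq hΓ.decomp ⟨_, hzA⟩ hpt (compPos_mem hΓ (.inr z)) (v := v) hzA
    hcone fun n hn => ?_
  have hnv : n.1 ((v : V), 1) = 0 := hn _ ((mem_linCone_one ⟨_, hzA⟩).2 hzA)
  refine (compMap_div_val hΓ z hx hnv).trans ?_
  rw [hx1, hx2, div_one, ht', monomial_restr v hnv]
  intro b hb
  have h1 := hn (b, 0) ((mem_linCone_iff hzA).2 (by rwa [zero_smul, sub_zero]))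
  rw [← monomial_restr v hnv, monomial_apply, mul_zero, sub_zero] at h1
  exact h1

/-- A curve meeting the orbit closure does so on the component over the vertex `z`. -/
theorem char_eq_of_meets (hχ : IsGlued hΓ χ) (hpt : pt.cone = {0})
    (z : Γ.DivPoint P) (hzA : Γ.edgePoint z.1.1 z.1.2 ∈ A)
    (hdir : (Γ.dir z.1.1 : V) ∉ A.direction)
    (hcon : ∀ E : Γ.Edge, ∀ x ∈ Γ.edgeImage E, x ∈ A → {x} ∈ P)
    (hE : ∀ E : Γ.Edge, (Γ.edgeImage E ∩ A).Nonempty → E = z.1.1)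
    (h : (stdCurve hΓ hχ).Meets (orbitClosure (linCone A) pt)) (m : Module.Dual ℤ N)
    (hm : ∀ y ∈ incidenceLattice (Γ.dir z.1.1) A, m y = 0) :
    χ (.inr z) (Multiplicative.ofAdd m)
      = pointChar hpt (frame hΓ (.inr z)).v (Multiplicative.ofAdd m) := by
  obtain ⟨y, q, hyq⟩ := h
  change compMap hΓ χ y q ∈ _ at hyq
  -- The closure does not pass through boundary points of the curve, because the points of their
  -- cells in `A` are vertices of `P`.
  rcases LineFrame.point_cases (points k hΓ y) q with ⟨j, rfl⟩ | hq
  · refine absurd hyq (notMem_orbitClosure_of_segment hΓ.decomp ⟨_, hzA⟩ hpt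
      (F := frame hΓ y) (j := j) ?_ (LineFrame.lineCone_point _ _))
    intro x hx hxA
    exact hcon _ x ((FlagAt.isFlag hΓ j).flagCell_subset_edgeImage hΓ hx) hxA
  have hcone : (compMap hΓ χ y q).cone = coneOver {compPos y} :=
    LineFrame.lineCone_of_forall_ne _ hq
  have hyA : compPos y ∈ A := mem_of_mem_orbitClosure ⟨_, hzA⟩ hpt hyq hcone
  -- The only edge whose image meets `A` is that of `z`, and it is transverse to `A`, so it meets
  -- `A` in a single point.
  have hy : y = .inr z := by
    obtain ⟨j⟩ := nonempty_frame_J hΓ y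
    have hj := FlagAt.isFlag hΓ j
    have hje := FlagAt.edgePoint_eq j
    have he : FlagAt.edge j = z.1.1 := hE _
      ⟨compPos y, Γ.mem_edgeImage.2 ⟨_, hj.nonneg, hj.le, hje.symm⟩, hyA⟩
    refine comp_ext hΓ (j := j) (j' := (true : Bool)) he ?_
    change FlagAt.param j = z.1.2
    rw [← hje, he] at hyA
    by_contra hne
    have h1 := AffineSubspace.vsub_mem_direction hyA hzA
    have h2 : Γ.edgePoint z.1.1 (FlagAt.param j) -ᵥ Γ.edgePoint z.1.1 z.1.2
        = (FlagAt.param j - z.1.2) • (Γ.dir z.1.1 : V) := by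
      rw [vsub_eq_sub, edgePoint, edgePoint, sub_smul]; abel
    rw [h2] at h1
    exact hdir ((Submodule.smul_mem_iff _ (sub_ne_zero.2 hne)).1 h1)
  subst hy
  set v := (frame hΓ (.inr z)).v with hv
  have hmdir : m (Γ.dir z.1.1) = 0 := hm _ (mem_incidenceLattice_self _ _)
  have hmv : (monomial v m).1 ((v : V), 1) = 0 := monomial_apply_self v m
  have h1 := val_eq_of_mem_orbitClosure hyq (m := monomial v m) (by
      rintro ⟨x, a⟩ hx
      have h2 := extendQ_eq_zero_of_incidenceLattice hm
        ((mem_linCone_iff (a := (v : V)) hzA).1 hx)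
      rw [map_sub, map_smul, smul_eq_mul, extendQ_apply] at h2
      rw [monomial_apply, ← h2]; ring) (by
      rw [hcone, nonneg_coneOver_iff]
      rintro x rfl
      exact hmv.ge)
  refine Units.ext ?_
  rw [pointChar_apply, ← h1]
  have h3 := compMap_div_val (χ := χ) hΓ z q.rep_nonzero hmv
  rw [q.mk_rep, restr_monomial, hmdir, mul_zero, zpow_zero, mul_one] at h3
  exact h3.symm

/-- A hyperplane direction together with a transverse vector spans everything. Hence a marking with
`d i = 0` imposes no condition. -/
theorem incidenceLattice_eq_top {u : N} (hu : (u : V) ∉ A.direction)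
    (hA : Module.finrank ℚ A.direction + 1 = Module.finrank ℚ V) : incidenceLattice u A = ⊤ := by
  have := finiteDimensional_of_lattice (N := N)
  have hlt : A.direction < Submodule.span ℚ {(u : V)} ⊔ A.direction :=
    lt_of_le_of_ne le_sup_right fun h => hu (h ▸ Submodule.mem_sup_left
      (Submodule.mem_span_singleton_self _))
  have h1 := Submodule.finrank_lt_finrank_of_lt hlt
  have h2 : Submodule.span ℚ {(u : V)} ⊔ A.direction = ⊤ :=
    Submodule.eq_top_of_finrank_eq (le_antisymm (Submodule.finrank_le _) (by omega))
  rw [eq_top_iff]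
  intro y _
  change (y : V) ∈ Submodule.span ℚ {(u : V)} ⊔ A.direction
  rw [h2]
  trivial

end TropicalCurve

end Markings

/-! ### The number of maximally degenerate curves -/

section Count

variable {V : Type*} [AddCommGroup V] [Module ℚ V] {N : Submodule ℤ V} {P : Set (Set V)}
  {k : Type*} [Field k]

theorem iso_of_quot_mk_eq {Γ : TropicalCurve N} {l : ℕ} {Z : Fin l → Set (Degeneration k N P)}
    {C C' : DegenerateCurve Γ Z}
    (h : Quot.mk (fun C C' : DegenerateCurve Γ Z => C.1.Iso C'.1) C = Quot.mk _ C') :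
    C.1.Iso C'.1 := by
  have heq : Equivalence fun C C' : DegenerateCurve Γ Z => C.1.Iso C'.1 :=
    ⟨fun C => StableMap.Iso.refl C.1, fun h => h.symm, fun h h' => h.trans h'⟩
  exact heq.eqvGen_iff.1 (Quot.eqvGen_exact h)

namespace TropicalCurve

variable {Γ : TropicalCurve N} [IsAlgClosed k] [N.IsLattice ℚ]

theorem card_degenerateCurve [CharZero k] (hΓ : IsSubdivided P Γ) {l : ℕ} {d : Fin l → ℕ}
    {A : Fin l → AffineSubspace ℚ V} (hA : IsAffineConstraint d A) {E : Fin l → Γ.Edge}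
    (hmatch : Γ.Matches E A) (hpos : ∀ (x : Γ.Vert) (i : Fin l), Γ.pos x ∉ A i)
    (hadapted : IsAdapted P Γ A)
    (hE : ∀ i, d i ≠ 0 → ∀ E' : Γ.Edge, (Γ.edgeImage E' ∩ A i).Nonempty → E' = E i)
    (hinj : Function.Injective (Γ.latticeMap E A))
    (hfin : Finite (Γ.LatticeTarget E A ⧸ LinearMap.range (Γ.latticeMap E A)))
    {pt : Fin l → Degeneration k N P} (hpt : ∀ i, (pt i).cone = {0}) :
    Nat.card (Quot fun C C' : DegenerateCurve Γ fun i => orbitClosure (linCone (A i)) (pt i) =>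
      C.1.Iso C'.1) = Γ.latticeIndex E A := by
  have hinfinite : Infinite k := inferInstance
  have hz : ∀ i, ∃ z : Γ.DivPoint P, z.1.1 = E i ∧ Γ.edgePoint z.1.1 z.1.2 ∈ A i := by
    intro i
    obtain ⟨s, hs0, hsl, hsA⟩ := exists_marking hmatch hpos i
    exact ⟨⟨(E i, s), hs0, hsl, hadapted.constraint (E i) i _
      (Γ.mem_edgeImage.2 ⟨s, hs0.le, hsl.le, rfl⟩) hsA⟩, rfl, hsA⟩
  choose z hzE hzA using hz
  have hdir : ∀ i, (Γ.dir (E i) : V) ∉ (A i).direction := dir_notMem_direction hmatch hpos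
  let ψ : Fin l → CharTorus k N := fun i => pointChar (hpt i) (frame hΓ (.inr (z i))).v
  let β : Fin l → CharTorus k N := fun i =>
    ψ i * (LineFrame.boundaryChar (points k hΓ (.inl (Γ.tail (E i)))) (tailFlag P (E i)))⁻¹
  have hβ : ∀ (c : Γ.Vert → CharTorus k N) i (m : Module.Dual ℤ N),
      c (Γ.tail (E i)) (Multiplicative.ofAdd m) = β i (Multiplicative.ofAdd m) ↔
        tailChar hΓ c (E i) (Multiplicative.ofAdd m) = ψ i (Multiplicative.ofAdd m) := by
    intro c i m
    simp only [β, tailChar]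
    rw [MonoidHom.mul_apply, MonoidHom.mul_apply, MonoidHom.inv_apply, eq_mul_inv_iff_mul_eq]
  have hmeets : ∀ (χ : Γ.StdComp P → CharTorus k N) (hχ : IsGlued hΓ χ) i,
      (stdCurve hΓ hχ).Meets (orbitClosure (linCone (A i)) (pt i)) ↔
        ∀ m : Module.Dual ℤ N, (∀ y ∈ incidenceLattice (Γ.dir (E i)) (A i), m y = 0) →
          χ (.inl (Γ.tail (E i))) (Multiplicative.ofAdd m) = β i (Multiplicative.ofAdd m) := by
    intro χ hχ i
    have hdiv : ∀ m : Module.Dual ℤ N,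
        (∀ y ∈ incidenceLattice (Γ.dir (E i)) (A i), m y = 0) →
        (χ (.inl (Γ.tail (E i))) (Multiplicative.ofAdd m) = β i (Multiplicative.ofAdd m) ↔
          χ (.inr (z i)) (Multiplicative.ofAdd m) = ψ i (Multiplicative.ofAdd m)) := by
      intro m hm
      have h1 : m (Γ.dir (z i).1.1) = 0 := by
        rw [hzE]; exact hm _ (mem_incidenceLattice_self _ _)
      rw [hβ (fun x => χ (.inl x)) i m, hχ.char_div_eq hΓ (z i) h1, hzE]
    constructor
    · intro h m hm
      -- For `d i = 0` other edges may meet `A i` as well, so the component meeting the closure is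
      -- unknown; but then only the form `m = 0` is to be checked.
      by_cases hd : d i = 0
      · have htop := incidenceLattice_eq_top (hdir i) (by
          have := (hA i).2
          rwa [hd, add_zero] at this)
        have hm0 : m = 0 := LinearMap.ext fun y => hm y (by rw [htop]; trivial)
        rw [hm0, ofAdd_zero, map_one, map_one]
      · rw [hdiv m hm]
        refine char_eq_of_meets hΓ hχ (hpt i) (z i) (hzA i) (by rw [hzE]; exact hdir i)
          (fun E' => hadapted.constraint E' i) (by rw [hzE]; exact hE i hd) h m ?_
        rw [hzE]; exact hm
    · intro h
      refine meets_of_char_eq hΓ hχ (hpt i) (z i) (hzA i) fun m hm => ?_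
      rw [hzE] at hm
      exact (hdiv m hm).1 (h m hm)
  -- The boundary characters at the ends of the edges and the values of the points `pt i` are the
  -- constants that the families of characters have to satisfy.
  rw [← card_characterFamilies Γ E A hinj hfin (bedgeChar hΓ) β]
  refine (Nat.card_congr (Equiv.ofBijective (fun c => Quot.mk _ ⟨stdCurve hΓ
    (isGlued_stdChar hΓ c.2.1), isMaximallyDegenerate_stdCurve hΓ _,
    hasTropicalCurve_stdCurve hΓ _, fun i => (hmeets _ _ i).2 (c.2.2 i)⟩) ⟨?_, ?_⟩)).symm
  · intro c c' h
    refine Subtype.ext (funext fun x => ?_)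
    exact eq_of_iso_stdCurve hΓ (isGlued_stdChar hΓ c.2.1) (isGlued_stdChar hΓ c'.2.1)
      (iso_of_quot_mk_eq h) x
  · intro q
    obtain ⟨⟨C, hC, htrop, hCZ⟩, rfl⟩ := Quot.exists_rep q
    obtain ⟨D⟩ := htrop.nonempty_marking
    obtain ⟨χ, hχ, hiso⟩ := D.exists_iso_stdCurve hΓ hC
    have hglued := isGlued_stdChar hΓ (c := fun x => χ (.inl x)) (hχ.bedgeChar_eq hΓ)
    refine ⟨⟨fun x => χ (.inl x), hχ.bedgeChar_eq hΓ,
      fun i => (hmeets χ hχ i).1 (hiso.symm.meets (hCZ i))⟩, Quot.sound ?_⟩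
    exact (iso_stdCurve_of_eq hΓ hglued hχ fun x => rfl).trans hiso

end TropicalCurve

end Count

end ToricTropical

end

/-! ### The proposition -/

open ToricTropical in
theorem mainTheorem5 {k : Type*} [Field k] [IsAlgClosed k] [CharZero k]
    {V : Type*} [AddCommGroup V] [Module ℚ V] (N : Submodule ℤ V) [N.IsLattice ℚ]
    (hn : 2 ≤ Module.finrank ℚ V)
    (Δ : N →₀ ℕ) {l : ℕ} (d : Fin l → ℕ) (A : Fin l → AffineSubspace ℚ V)
    (hA : IsAffineConstraint d A) (hgen : IsGeneral N Δ d A)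
    (hdir : ⨅ i, (A i).direction = ⊥)
    (Γ : TropicalCurve N) (E : Fin l → Γ.Edge)
    (hrat : Γ.IsRational) (hdeg : Γ.HasDegree Δ) (hmatch : Γ.Matches E A) :
    (Module.Free ℤ (Γ.LatticeTarget E A) ∧
      Function.Injective (Γ.latticeMap E A) ∧
      (LinearMap.range (Γ.latticeMap E A)).toAddSubgroup.FiniteIndex) ∧
    ∀ P : Set (Set V), IsPolyhedralDecomposition P → IsIntegral N P → IsAdapted P Γ A →
      (Module.finrank ℚ V = 2 → Γ.IsSimple) →
      (∀ i, d i ≠ 0 → ∀ E' : Γ.Edge, (Γ.edgeImage E' ∩ A i).Nonempty → E' = E i) →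
      ∀ pt : Fin l → Degeneration k N P, (∀ i, (pt i).cone = {0}) →
        Nat.card (Quot fun C C' : DegenerateCurve Γ fun i => orbitClosure (linCone (A i)) (pt i) =>
          C.1.Iso C'.1) = Γ.latticeIndex E A := by
  have hinj := latticeMap_injective hgen hdir Γ E hrat hdeg hmatch
  have hfin := finiteIndex_range_latticeMap hA hgen hdir Γ E hrat hdeg hmatch
  have hfin' : Finite (Γ.LatticeTarget E A ⧸
      (LinearMap.range (Γ.latticeMap E A)).toAddSubgroup) := hfin
  refine ⟨⟨free_latticeTarget Γ E A, hinj, ?_⟩, ?_⟩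
  · exact AddSubgroup.finiteIndex_of_finite_quotient
      (H := (LinearMap.range (Γ.latticeMap E A)).toAddSubgroup)
  · intro P hP hint hadapted hsimple hE pt hpt
    exact TropicalCurve.card_degenerateCurve
      (isSubdivided_of_isGeneral hn hgen hrat hdeg hmatch hP hint hadapted hsimple) hA hmatch
      (hgen.2 Γ E hrat hdeg hmatch).2.1 hadapted hE hinj hfin hpt
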